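/- **Theorem 2.1.** *Setting.* Let $\Omega=(a,b)$, $T>0$, $\alpha,\beta\ge 0$, $\alpha^*=\min\{\alpha,1\}$, and let $E_0:\bar\Omega\to\mathbb C$, $\omega_0,\omega_1:\bar\Omega\to\mathbb R$. Let $G_1,G_2\in C^2(\bar\Omega\times[0,\infty))$ solve $\partial_{ss}G_j=\partial_{xx}G_j$ with $G_1(\cdot,0)=\omega_0$, $\partial_sG_1(\cdot,0)=0$, $G_2(\cdot,0)=0$, $\partial_sG_2(\cdot,0)=\omega_1$ and $G_j=0$ at $x=a,b$. For $0<\varepsilon\le1$ put $G^\varepsilon(x,s)=\varepsilon^\alpha G_1(x,s)+\varepsilon^{1+\beta}G_2(x,s)$. Let $(E^\varepsilon,F^\varepsilon)$, with $E^\varepsilon$ of class $C^7$ and $F^\varepsilon$ real of class $C^6$ on $\bar\Omega\times[0,T]$, solve the reformulated Zakharov system $$i\partial_tE^\varepsilon+\partial_{xx}E^\varepsilon+\big[|E^\varepsilon|^2-F^\varepsilon-G^\varepsilon(x,t/\varepsilon)\big]E^\varepsilon=0,\qquad \varepsilon^2\partial_{tt}F^\varepsilon-\partial_{xx}F^\varepsilon-\varepsilon^2\partial_{tt}|E^\varepsilon|^2=0,$$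 $E^\varepsilon(\cdot,0)=E_0$, $F^\varepsilon(\cdot,0)=\partial_tF^\varepsilon(\cdot,0)=0$, $E^\varepsilon=F^\varepsilon=0$ at $x=a,b$, and let $\widetilde E^\varepsilon$, of class $C^6$ on $\bar\Omega\times[0,T]$, solve the NLSE-OP $$i\partial_t\widetilde E^\varepsilon+\partial_{xx}\widetilde E^\varepsilon+\big[|\widetilde E^\varepsilon|^2-G^\varepsilon(x,t/\varepsilon)\big]\widetilde E^\varepsilon=0,\qquad \widetilde E^\varepsilon(\cdot,0)=E_0,\qquad \widetilde E^\varepsilon=0\ \text{at }x=a,b.$$ *Scheme.* For $M\ge1$ and $\tau>0$ let $h=(b-a)/M$, $x_j=a+jh$, $t_k=k\tau$, let $\delta_x^+,\delta_x^2$ be the forward and the second difference in $x$, $\delta_t,\delta_t^2$ the centred first and second differences in $t$, and $H_j^{\varepsilon,k}=\frac1{2\tau}\int_{t_{k-1}}^{t_{k+1}}G^\varepsilon(x_j,s/\varepsilon)\,ds$. The scheme for $E_j^{\varepsilon,k}\in\mathbb C$, $F_j^{\varepsilon,k}\in\mathbb R$ is, for $1\le j\le M-1$, $k\ge1$, $t_{k+1}\le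 T$, $$i\delta_tE_j^{\varepsilon,k}=\Big(-\delta_x^2-|E_j^{\varepsilon,k}|^2+H_j^{\varepsilon,k}+\tfrac{F_j^{\varepsilon,k+1}+F_j^{\varepsilon,k-1}}2\Big)\tfrac{E_j^{\varepsilon,k+1}+E_j^{\varepsilon,k-1}}2,\qquad \varepsilon^2\delta_t^2F_j^{\varepsilon,k}=\tfrac12\delta_x^2(F_j^{\varepsilon,k+1}+F_j^{\varepsilon,k-1})+\varepsilon^2\delta_t^2|E_j^{\varepsilon,k}|^2,$$ with zero values at $j=0,M$, with $E_j^{\varepsilon,0}=E_0(x_j)$, $F_j^{\varepsilon,0}=0$, and with the first step $E_j^{\varepsilon,1}=E_0(x_j)+\tau\phi_2(x_j)+\frac{\tau^2}2\phi_3(x_j)$, $F_j^{\varepsilon,1}=\frac{\tau^2}2\phi_4(x_j)$ for $1\le j\le M-1$, where, with $N_0=-|E_0|^2+\varepsilon^\alpha\omega_0$ and $N_1=2\,\mathrm{Im}(E_0''\overline{E_0})+\varepsilon^\beta\omega_1$, $$\phi_2=i[E_0''-N_0E_0],\quad \phi_3=i[\phi_2''-N_1E_0-N_0\phi_2],\quad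 \phi_4=2\,\mathrm{Im}[\phi_2\overline{E_0''}+E_0\overline{\phi_2''}].$$ *Assumptions.* Let $K$ be a constant; $\|u\|_{W^{m,\infty}}$ denotes $\sup_{t\in[0,T]}\|u(\cdot,t)\|_{W^{m,\infty}(\Omega)}$. (A) $\|E^\varepsilon\|_{W^{5,\infty}}$, $\|\partial_tE^\varepsilon\|_{W^{1,\infty}}$, $\|\partial_{tt}F^\varepsilon\|_{W^{2,\infty}}$, $\|\widetilde E^\varepsilon\|_{W^{5,\infty}}$, $\|\partial_t\widetilde E^\varepsilon\|_{W^{1,\infty}}$ are at most $K$; $\|F^\varepsilon\|_{W^{4,\infty}}\le K\varepsilon^2$; $\|\partial_tF^\varepsilon\|_{W^{4,\infty}}\le K\varepsilon$; $\|\partial_{tt}\widetilde E^\varepsilon\|_{W^{4,\infty}}\le K\varepsilon^{\alpha^*-1}$; $\|\partial_{tt}E^\varepsilon\|_{W^{4,\infty}}$, $\|\partial_t^3F^\varepsilon\|_{W^{2,\infty}}$ are at most $K/\varepsilon$; $\|\partial_t^3E^\varepsilon\|_{W^{4,\infty}}$, $\|\partial_t^4F^\varepsilon\|_{W^{2,\infty}}$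 are at most $K/\varepsilon^2$. (B) $\|E_0\|_{W^{5,\infty}(\Omega)},\|\omega_0\|_{W^{3,\infty}(\Omega)},\|\omega_1\|_{W^{3,\infty}(\Omega)}\le K$. (C) $\|E^\varepsilon-\widetilde E^\varepsilon\|_{L^\infty([0,T];H^1(\Omega))}\le K\varepsilon^2$. (S) If $0<\alpha<1$: $\|\partial_t\widetilde E^\varepsilon\|_{W^{5,\infty}}\le K$. *Conclusion.* There are $h_0>0$, $\tau_0>0$ and $C$, depending only on $a,b,T,\alpha,\beta,K$ (in particular not on $\varepsilon,h,\tau$), such that, whenever $0<\varepsilon\le1$, (A), (B), (C) hold, $0<h\le h_0$ and $0<\tau\le\tau_0$, the scheme has a solution, and for every solution of it the errors $e_j^{\varepsilon,k}=E^\varepsilon(x_j,t_k)-E_j^{\varepsilon,k}$, $f_j^{\varepsilon,k}=F^\varepsilon(x_j,t_k)-F_j^{\varepsilon,k}$ satisfy, for all $0\le k\le T/\tau$, $$\|e^{\varepsilon,k}\|+\|\delta_x^+e^{\varepsilon,k}\|+\|f^{\varepsilon,k}\|\le C\Big(h^2+\frac{\tau^2}\varepsilon\Big),$$ and, if (S)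 also holds, $$\|e^{\varepsilon,k}\|+\|\delta_x^+e^{\varepsilon,k}\|+\|f^{\varepsilon,k}\|\le C\big(h^2+\tau^2+\tau\varepsilon^{\alpha^*}+\varepsilon^{1+\alpha^*}\big),$$ and therefore, uniformly in $\varepsilon$, the same quantity is at most $C(h^2+\tau^{4/3})$ if $\alpha\ge1$ and at most $C\big(h^2+\tau^{1+\frac{\alpha}{2+\alpha}}\big)$ if $0\le\alpha<1$. Here $\|u\|^2=h\sum_{j=1}^{M-1}|u_j|^2$ and $\|\delta_x^+u\|^2=h\sum_{j=0}^{M-1}|\delta_x^+u_j|^2$. -/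

import Mathlib

open Set MeasureTheory
open scoped ContDiff

noncomputable section

namespace Zakharov

/-! ## Function spaces -/

section Spaces

variable {V : Type*} [NormedAddCommGroup V] [NormedSpace ℝ V]

/-- The mixed partial derivative `∂_x^m ∂_t^n u (x, t)` of a function on the closed rectangle
`[a, b] × [0, T]` (one-sided on the boundary). -/
def pd (a b T : ℝ) (u : ℝ → ℝ → V) (m n : ℕ) (x t : ℝ) : V :=
  iteratedDerivWithin m (fun y => iteratedDerivWithin n (fun s => u y s) (Icc 0 T) t) (Icc a b) x

/-- `u` is `r` times continuously differentiable on `[a, b] × [0, T]`. -/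
def IsSmoothOn (a b T : ℝ) (r : ℕ) (u : ℝ → ℝ → V) : Prop :=
  ContDiffOn ℝ r (fun p : ℝ × ℝ => u p.1 p.2) (Icc a b ×ˢ Icc 0 T)

/-- `‖∂_t^n u‖_{W^{m,∞}} ≤ B`, that is `‖∂_t^n u(·, t)‖_{W^{m,∞}(a,b)} ≤ B` for all `t ∈ [0, T]`,
for a function `u` that is smooth on `[a, b] × [0, T]`; the norm is the maximum of the sup norms of
the derivatives of order at most `m` in `x`. -/
def WNormLE (a b T : ℝ) (m n : ℕ) (u : ℝ → ℝ → V) (B : ℝ) : Prop :=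
  ∀ t ∈ Icc (0 : ℝ) T, ∀ x ∈ Icc a b, ∀ j ≤ m, ‖pd a b T u j n x t‖ ≤ B

/-- `g` is the weak derivative of `f` on the open interval `(a, b)`. -/
def HasWeakDeriv (a b : ℝ) (f g : ℝ → V) : Prop :=
  LocallyIntegrableOn f (Ioo a b) ∧ LocallyIntegrableOn g (Ioo a b) ∧
    ∀ φ : ℝ → ℝ, ContDiff ℝ ∞ φ → HasCompactSupport φ → tsupport φ ⊆ Ioo a b →
      ∫ x in Ioo a b, deriv φ x • f x = - ∫ x in Ioo a b, φ x • g x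

/-- `f ∈ W^{m,∞}(a, b)` with `‖f‖_{W^{m,∞}(a,b)} ≤ B`, for `m ≥ 1`. -/
def SobolevNormLE (a b : ℝ) (m : ℕ) (f : ℝ → V) (B : ℝ) : Prop :=
  ∃ g : ℕ → ℝ → V, g 0 = f ∧ (∀ j < m, HasWeakDeriv a b (g j) (g (j + 1))) ∧
    ∀ j ≤ m, ∀ᵐ x ∂(volume.restrict (Ioo a b)), ‖g j x‖ ≤ B

end Spaces

/-! ## The differential equations -/

/-- `G` is the classical solution of `∂_ss G - ∂_xx G = 0` on `(a, b) × (0, ∞)` with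
`G(x, 0) = g₀(x)`, `∂_s G(x, 0) = g₁(x)` and homogeneous Dirichlet boundary conditions. -/
structure IsWaveSolution (a b : ℝ) (g₀ g₁ : ℝ → ℝ) (G : ℝ → ℝ → ℝ) : Prop where
  smooth : ContDiffOn ℝ 2 (fun p : ℝ × ℝ => G p.1 p.2) (Icc a b ×ˢ Ici 0)
  eqn : ∀ x ∈ Ioo a b, ∀ s > 0,
    iteratedDeriv 2 (fun r => G x r) s - iteratedDeriv 2 (fun y => G y s) x = 0
  init : ∀ x ∈ Icc a b, G x 0 = g₀ x
  init_deriv : ∀ x ∈ Icc a b, derivWithin (fun r => G x r) (Ici 0) 0 = g₁ x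
  left : ∀ s ≥ 0, G a s = 0
  right : ∀ s ≥ 0, G b s = 0

/-- `G^ε(x, s) = ε^α G₁(x, s) + ε^{1+β} G₂(x, s)`. -/
def oscG (α β ε : ℝ) (G₁ G₂ : ℝ → ℝ → ℝ) (x s : ℝ) : ℝ :=
  ε ^ α * G₁ x s + ε ^ (1 + β) * G₂ x s

/-- `(E, F)` is a smooth solution on `[a, b] × [0, T]` of the reformulated Zakharov system with
oscillatory potential `G(x, t/ε)`; the orders of smoothness are the total orders of the derivatives
of `E` and `F` that occur in the bounds below. -/
structure IsZSSolution (a b T ε : ℝ) (G : ℝ → ℝ → ℝ) (E₀ : ℝ → ℂ)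
    (E : ℝ → ℝ → ℂ) (F : ℝ → ℝ → ℝ) : Prop where
  smooth_E : IsSmoothOn a b T 7 E
  smooth_F : IsSmoothOn a b T 6 F
  eqn_E : ∀ x ∈ Ioo a b, ∀ t ∈ Ioc 0 T,
    Complex.I * pd a b T E 0 1 x t + pd a b T E 2 0 x t
      + ((‖E x t‖ ^ 2 - F x t - G x (t / ε) : ℝ) : ℂ) * E x t = 0
  eqn_F : ∀ x ∈ Ioo a b, ∀ t ∈ Ioc 0 T,
    ε ^ 2 * pd a b T F 0 2 x t - pd a b T F 2 0 x t
      - ε ^ 2 * pd a b T (fun y s => ‖E y s‖ ^ 2) 0 2 x t = 0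
  init_E : ∀ x ∈ Icc a b, E x 0 = E₀ x
  init_F : ∀ x ∈ Icc a b, F x 0 = 0
  init_Ft : ∀ x ∈ Icc a b, pd a b T F 0 1 x 0 = 0
  bdry_E : ∀ t ∈ Icc 0 T, E a t = 0 ∧ E b t = 0
  bdry_F : ∀ t ∈ Icc 0 T, F a t = 0 ∧ F b t = 0

/-- `E'` is a smooth solution on `[a, b] × [0, T]` of the nonlinear Schrödinger equation with
oscillatory potential `G(x, t/ε)` (NLSE-OP). -/
structure IsNLSEOPSolution (a b T ε : ℝ) (G : ℝ → ℝ → ℝ) (E₀ : ℝ → ℂ)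
    (E' : ℝ → ℝ → ℂ) : Prop where
  smooth : IsSmoothOn a b T 6 E'
  eqn : ∀ x ∈ Ioo a b, ∀ t ∈ Ioc 0 T,
    Complex.I * pd a b T E' 0 1 x t + pd a b T E' 2 0 x t
      + ((‖E' x t‖ ^ 2 - G x (t / ε) : ℝ) : ℂ) * E' x t = 0
  init : ∀ x ∈ Icc a b, E' x 0 = E₀ x
  bdry : ∀ t ∈ Icc 0 T, E' a t = 0 ∧ E' b t = 0

/-! ## The assumptions -/

/-- Assumption (A) at the parameter `ε`, with the constant `K`. -/
structure AssumptionA (a b T α ε K : ℝ) (E : ℝ → ℝ → ℂ) (F : ℝ → ℝ → ℝ) (E' : ℝ → ℝ → ℂ) :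
    Prop where
  E_bound : WNormLE a b T 5 0 E K
  Et_bound : WNormLE a b T 1 1 E K
  Ftt_bound : WNormLE a b T 2 2 F K
  E'_bound : WNormLE a b T 5 0 E' K
  E't_bound : WNormLE a b T 1 1 E' K
  F_bound : WNormLE a b T 4 0 F (K * ε ^ 2)
  Ft_bound : WNormLE a b T 4 1 F (K * ε)
  E'tt_bound : WNormLE a b T 4 2 E' (K / ε ^ (1 - min α 1))
  Ett_bound : WNormLE a b T 4 2 E (K / ε)
  Fttt_bound : WNormLE a b T 2 3 F (K / ε)
  Ettt_bound : WNormLE a b T 4 3 E (K / ε ^ 2)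
  Ftttt_bound : WNormLE a b T 2 4 F (K / ε ^ 2)

/-- The ε-uniform smoothness of the solution of the NLSE-OP beyond the list (A),
`‖∂_t E'‖_{W^{5,∞}} ≤ K`; it enters only for `0 < α < 1`. -/
def SmoothEnough (a b T K : ℝ) (E' : ℝ → ℝ → ℂ) : Prop :=
  WNormLE a b T 5 1 E' K

/-- Assumption (B), with the constant `K`. -/
structure AssumptionB (a b K : ℝ) (E₀ : ℝ → ℂ) (ω₀ ω₁ : ℝ → ℝ) : Prop where
  E₀_bound : SobolevNormLE a b 5 E₀ K
  ω₀_bound : SobolevNormLE a b 3 ω₀ K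
  ω₁_bound : SobolevNormLE a b 3 ω₁ K

/-- Assumption (C): `‖E - E'‖_{L^∞([0,T]; H^1(a,b))} ≤ K ε²`. -/
def AssumptionC (a b T ε K : ℝ) (E E' : ℝ → ℝ → ℂ) : Prop :=
  ∀ t ∈ Icc 0 T,
    Real.sqrt ((∫ x in a..b, ‖E x t - E' x t‖ ^ 2)
      + ∫ x in a..b, ‖pd a b T (fun y s => E y s - E' y s) 1 0 x t‖ ^ 2) ≤ K * ε ^ 2

/-! ## The finite difference scheme -/

section Differences

variable {V : Type*} [NormedAddCommGroup V] [NormedSpace ℝ V]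

/-- `δ_t u_j^k`, the central difference in time (`k ≥ 1`). -/
def dt (τ : ℝ) (u : ℕ → ℕ → V) (k j : ℕ) : V :=
  (2 * τ)⁻¹ • (u (k + 1) j - u (k - 1) j)

/-- `δ_t² u_j^k` (`k ≥ 1`). -/
def dt2 (τ : ℝ) (u : ℕ → ℕ → V) (k j : ℕ) : V :=
  (τ ^ 2)⁻¹ • (u (k + 1) j - (2 : ℝ) • u k j + u (k - 1) j)

/-- `(u_j^{k+1} + u_j^{k-1}) / 2` (`k ≥ 1`). -/
def avg (u : ℕ → ℕ → V) (k j : ℕ) : V :=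
  (2 : ℝ)⁻¹ • (u (k + 1) j + u (k - 1) j)

/-- `δ_x^+ v_j`. -/
def dxp (h : ℝ) (v : ℕ → V) (j : ℕ) : V :=
  h⁻¹ • (v (j + 1) - v j)

/-- `δ_x² v_j` (`j ≥ 1`). -/
def dx2 (h : ℝ) (v : ℕ → V) (j : ℕ) : V :=
  (h ^ 2)⁻¹ • (v (j + 1) - (2 : ℝ) • v j + v (j - 1))

/-- `‖v‖`, where `‖v‖² = h ∑_{j=1}^{M-1} |v_j|²`. -/
def l2 (h : ℝ) (M : ℕ) (v : ℕ → V) : ℝ :=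
  Real.sqrt (h * ∑ j ∈ Finset.Ico 1 M, ‖v j‖ ^ 2)

/-- `‖δ_x^+ v‖`, where `‖δ_x^+ v‖² = h ∑_{j=0}^{M-1} |δ_x^+ v_j|²`. -/
def l2dx (h : ℝ) (M : ℕ) (v : ℕ → V) : ℝ :=
  Real.sqrt (h * ∑ j ∈ Finset.range M, ‖dxp h v j‖ ^ 2)

end Differences

/-- The mesh size `h = (b - a) / M`. -/
def mesh (a b : ℝ) (M : ℕ) : ℝ := (b - a) / M

/-- The grid point `x_j = a + j h`. -/
def node (a b : ℝ) (M j : ℕ) : ℝ := a + j * mesh a b M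

/-- `H_j^k`, the average of `s ↦ G(x_j, s/ε)` over `[t_{k-1}, t_{k+1}]` (`k ≥ 1`). -/
def avgPotential (a b ε : ℝ) (G : ℝ → ℝ → ℝ) (M : ℕ) (τ : ℝ) (k j : ℕ) : ℝ :=
  (2 * τ)⁻¹ * ∫ s in (((k : ℝ) - 1) * τ)..(((k : ℝ) + 1) * τ), G (node a b M j) (s / ε)

/-- Second derivative on `[a, b]`. -/
def dd (a b : ℝ) (f : ℝ → ℂ) (x : ℝ) : ℂ := iteratedDerivWithin 2 f (Icc a b) x

section Initial

variable (a b α β ε : ℝ) (E₀ : ℝ → ℂ) (ω₀ ω₁ : ℝ → ℝ)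

/-- `φ₁ = 2 Im(E₀'' conj E₀)`. -/
def phi1 (x : ℝ) : ℝ := 2 * (dd a b E₀ x * starRingEnd ℂ (E₀ x)).im

/-- `N₀^ε = -|E₀|² + ε^α ω₀`. -/
def N0 (x : ℝ) : ℝ := -‖E₀ x‖ ^ 2 + ε ^ α * ω₀ x

/-- `N₁^ε = φ₁ + ε^β ω₁`. -/
def N1 (x : ℝ) : ℝ := phi1 a b E₀ x + ε ^ β * ω₁ x

/-- `φ₂ = i [E₀'' - N₀^ε E₀]`. -/
def phi2 (x : ℝ) : ℂ := Complex.I * (dd a b E₀ x - (N0 α ε E₀ ω₀ x : ℂ) * E₀ x)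

/-- `φ₃ = i [φ₂'' - N₁^ε E₀ - N₀^ε φ₂]`. -/
def phi3 (x : ℝ) : ℂ :=
  Complex.I * (dd a b (phi2 a b α ε E₀ ω₀) x - (N1 a b β ε E₀ ω₁ x : ℂ) * E₀ x
    - (N0 α ε E₀ ω₀ x : ℂ) * phi2 a b α ε E₀ ω₀ x)

/-- `φ₄ = 2 Im[φ₂ conj E₀'' + E₀ conj φ₂'']`. -/
def phi4 (x : ℝ) : ℝ :=
  2 * (phi2 a b α ε E₀ ω₀ x * starRingEnd ℂ (dd a b E₀ x)
    + E₀ x * starRingEnd ℂ (dd a b (phi2 a b α ε E₀ ω₀) x)).im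

end Initial

/-- The grid functions `U_j^k ≈ E(x_j, t_k)` and `P_j^k ≈ F(x_j, t_k)` (`0 ≤ j ≤ M`, `t_k ≤ T`) form
a solution of the implicit finite difference scheme up to time `T`. -/
structure IsSchemeSolution (a b T α β ε : ℝ) (E₀ : ℝ → ℂ) (ω₀ ω₁ : ℝ → ℝ) (G : ℝ → ℝ → ℝ)
    (M : ℕ) (τ : ℝ) (U : ℕ → ℕ → ℂ) (P : ℕ → ℕ → ℝ) : Prop where
  step_E : ∀ k : ℕ, 1 ≤ k → ((k : ℝ) + 1) * τ ≤ T → ∀ j ∈ Finset.Ico 1 M,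
    Complex.I * dt τ U k j
      = -dx2 (mesh a b M) (avg U k) j
        + ((-‖U k j‖ ^ 2 + avgPotential a b ε G M τ k j + avg P k j : ℝ) : ℂ) * avg U k j
  step_F : ∀ k : ℕ, 1 ≤ k → ((k : ℝ) + 1) * τ ≤ T → ∀ j ∈ Finset.Ico 1 M,
    ε ^ 2 * dt2 τ P k j
      = 1 / 2 * dx2 (mesh a b M) (fun i => P (k + 1) i + P (k - 1) i) j
        + ε ^ 2 * dt2 τ (fun l i => ‖U l i‖ ^ 2) k j
  bdry : ∀ k : ℕ, U k 0 = 0 ∧ U k M = 0 ∧ P k 0 = 0 ∧ P k M = 0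
  init : ∀ j ≤ M, U 0 j = E₀ (node a b M j) ∧ P 0 j = 0
  first_E : ∀ j ∈ Finset.Ico 1 M, U 1 j = E₀ (node a b M j)
    + (τ : ℂ) * phi2 a b α ε E₀ ω₀ (node a b M j)
    + ((τ ^ 2 / 2 : ℝ) : ℂ) * phi3 a b α β ε E₀ ω₀ ω₁ (node a b M j)
  first_F : ∀ j ∈ Finset.Ico 1 M, P 1 j = τ ^ 2 / 2 * phi4 a b α ε E₀ ω₀ (node a b M j)

/-- The error `‖e^k‖ + ‖δ_x^+ e^k‖ + ‖f^k‖`, with `e_j^k = E(x_j, t_k) - U_j^k` and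
`f_j^k = F(x_j, t_k) - P_j^k`. -/
def totalError (a b : ℝ) (M : ℕ) (τ : ℝ) (E : ℝ → ℝ → ℂ) (F : ℝ → ℝ → ℝ)
    (U : ℕ → ℕ → ℂ) (P : ℕ → ℕ → ℝ) (k : ℕ) : ℝ :=
  l2 (mesh a b M) M (fun j => E (node a b M j) (k * τ) - U k j)
    + l2dx (mesh a b M) M (fun j => E (node a b M j) (k * τ) - U k j)
    + l2 (mesh a b M) M (fun j => F (node a b M j) (k * τ) - P k j)

end Zakharov

end

namespace Zakharov

section DiscreteCalculus

set_option linter.unusedSectionVars false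

variable {V : Type*} [NormedAddCommGroup V] [InnerProductSpace ℝ V]

/-- The discrete real `L²` inner product over the interior grid points. -/
noncomputable def ip (h : ℝ) (M : ℕ) (u v : ℕ → V) : ℝ :=
  h * ∑ j ∈ Finset.Ico 1 M, inner ℝ (u j) (v j)

/-- The discrete real `L²` inner product of the forward differences. -/
noncomputable def ipd (h : ℝ) (M : ℕ) (u v : ℕ → V) : ℝ :=
  h * ∑ j ∈ Finset.range M, inner ℝ (dxp h u j) (dxp h v j)

lemma l2_nonneg (h : ℝ) (M : ℕ) (u : ℕ → V) : 0 ≤ l2 h M u := Real.sqrt_nonneg _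

lemma l2dx_nonneg (h : ℝ) (M : ℕ) (u : ℕ → V) : 0 ≤ l2dx h M u := Real.sqrt_nonneg _

lemma l2_sq {h : ℝ} (hh : 0 < h) (M : ℕ) (u : ℕ → V) :
    l2 h M u ^ 2 = h * ∑ j ∈ Finset.Ico 1 M, ‖u j‖ ^ 2 :=
  Real.sq_sqrt (mul_nonneg hh.le (Finset.sum_nonneg fun _ _ => by positivity))

lemma l2dx_sq {h : ℝ} (hh : 0 < h) (M : ℕ) (u : ℕ → V) :
    l2dx h M u ^ 2 = h * ∑ j ∈ Finset.range M, ‖dxp h u j‖ ^ 2 :=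
  Real.sq_sqrt (mul_nonneg hh.le (Finset.sum_nonneg fun _ _ => by positivity))

lemma ip_self {h : ℝ} (hh : 0 < h) (M : ℕ) (u : ℕ → V) : ip h M u u = l2 h M u ^ 2 := by
  rw [l2_sq hh, ip]; simp only [real_inner_self_eq_norm_sq]

lemma ipd_self {h : ℝ} (hh : 0 < h) (M : ℕ) (u : ℕ → V) : ipd h M u u = l2dx h M u ^ 2 := by
  rw [l2dx_sq hh, ipd]; simp only [real_inner_self_eq_norm_sq]

lemma ip_comm (h : ℝ) (M : ℕ) (u v : ℕ → V) : ip h M u v = ip h M v u := by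
  unfold ip; simp only [real_inner_comm]

lemma ipd_comm (h : ℝ) (M : ℕ) (u v : ℕ → V) : ipd h M u v = ipd h M v u := by
  unfold ipd; congr 1; exact Finset.sum_congr rfl fun j _ => real_inner_comm _ _

lemma ip_add_left (h : ℝ) (M : ℕ) (u u' v : ℕ → V) :
    ip h M (fun j => u j + u' j) v = ip h M u v + ip h M u' v := by
  unfold ip; simp only [inner_add_left, Finset.sum_add_distrib]; ring

lemma ip_sub_left (h : ℝ) (M : ℕ) (u u' v : ℕ → V) :
    ip h M (fun j => u j - u' j) v = ip h M u v - ip h M u' v := by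
  unfold ip; simp only [inner_sub_left, Finset.sum_sub_distrib]; ring

lemma ip_add_right (h : ℝ) (M : ℕ) (u v v' : ℕ → V) :
    ip h M u (fun j => v j + v' j) = ip h M u v + ip h M u v' := by
  unfold ip; simp only [inner_add_right, Finset.sum_add_distrib]; ring

lemma ip_sub_right (h : ℝ) (M : ℕ) (u v v' : ℕ → V) :
    ip h M u (fun j => v j - v' j) = ip h M u v - ip h M u v' := by
  unfold ip; simp only [inner_sub_right, Finset.sum_sub_distrib]; ring

lemma ip_smul_left (h : ℝ) (M : ℕ) (c : ℝ) (u v : ℕ → V) :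
    ip h M (fun j => c • u j) v = c * ip h M u v := by
  unfold ip; simp only [inner_smul_left, ← Finset.mul_sum]; simp; ring

lemma ip_smul_right (h : ℝ) (M : ℕ) (c : ℝ) (u v : ℕ → V) :
    ip h M u (fun j => c • v j) = c * ip h M u v := by
  unfold ip; simp only [inner_smul_right, ← Finset.mul_sum]; ring

lemma ip_neg_left (h : ℝ) (M : ℕ) (u v : ℕ → V) :
    ip h M (fun j => - u j) v = - ip h M u v := by
  unfold ip; simp only [inner_neg_left, Finset.sum_neg_distrib]; ring

lemma ip_neg_right (h : ℝ) (M : ℕ) (u v : ℕ → V) :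
    ip h M u (fun j => - v j) = - ip h M u v := by
  unfold ip; simp only [inner_neg_right, Finset.sum_neg_distrib]; ring

lemma ip_congr {h : ℝ} {M : ℕ} {u u' v v' : ℕ → V} (hu : ∀ j ∈ Finset.Ico 1 M, u j = u' j)
    (hv : ∀ j ∈ Finset.Ico 1 M, v j = v' j) : ip h M u v = ip h M u' v' := by
  unfold ip; congr 1
  exact Finset.sum_congr rfl fun j hj => by rw [hu j hj, hv j hj]

lemma l2_congr {h : ℝ} {M : ℕ} {u u' : ℕ → V} (hu : ∀ j ∈ Finset.Ico 1 M, u j = u' j) :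
    l2 h M u = l2 h M u' := by
  unfold l2; congr 2
  exact Finset.sum_congr rfl fun j hj => by rw [hu j hj]

lemma dxp_add (h : ℝ) (u v : ℕ → V) (j : ℕ) :
    dxp h (fun i => u i + v i) j = dxp h u j + dxp h v j := by
  unfold dxp; rw [← smul_add]; congr 1; module

lemma dxp_sub (h : ℝ) (u v : ℕ → V) (j : ℕ) :
    dxp h (fun i => u i - v i) j = dxp h u j - dxp h v j := by
  unfold dxp; rw [← smul_sub]; congr 1; module

lemma dxp_smul (h c : ℝ) (u : ℕ → V) (j : ℕ) :
    dxp h (fun i => c • u i) j = c • dxp h u j := by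
  unfold dxp; rw [← smul_sub, smul_comm]

lemma dx2_sub (h : ℝ) (u v : ℕ → V) (j : ℕ) :
    dx2 h (fun i => u i - v i) j = dx2 h u j - dx2 h v j := by
  unfold dx2; rw [← smul_sub]; congr 1; module

lemma ipd_add_left (h : ℝ) (M : ℕ) (u u' v : ℕ → V) :
    ipd h M (fun j => u j + u' j) v = ipd h M u v + ipd h M u' v := by
  unfold ipd; simp only [dxp_add, inner_add_left, Finset.sum_add_distrib]; ring

lemma ipd_sub_left (h : ℝ) (M : ℕ) (u u' v : ℕ → V) :
    ipd h M (fun j => u j - u' j) v = ipd h M u v - ipd h M u' v := by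
  unfold ipd; simp only [dxp_sub, inner_sub_left, Finset.sum_sub_distrib]; ring

lemma ipd_smul_left (h : ℝ) (M : ℕ) (c : ℝ) (u v : ℕ → V) :
    ipd h M (fun j => c • u j) v = c * ipd h M u v := by
  unfold ipd; simp only [dxp_smul, inner_smul_left, ← Finset.mul_sum]; simp; ring

lemma ipd_add_right (h : ℝ) (M : ℕ) (u v v' : ℕ → V) :
    ipd h M u (fun j => v j + v' j) = ipd h M u v + ipd h M u v' := by
  rw [ipd_comm, ipd_add_left, ipd_comm h M v, ipd_comm h M v']

lemma ipd_sub_right (h : ℝ) (M : ℕ) (u v v' : ℕ → V) :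
    ipd h M u (fun j => v j - v' j) = ipd h M u v - ipd h M u v' := by
  rw [ipd_comm, ipd_sub_left, ipd_comm h M v, ipd_comm h M v']

lemma ipd_smul_right (h : ℝ) (M : ℕ) (c : ℝ) (u v : ℕ → V) :
    ipd h M u (fun j => c • v j) = c * ipd h M u v := by
  rw [ipd_comm, ipd_smul_left, ipd_comm]

lemma abs_sum_inner_le (s : Finset ℕ) (u v : ℕ → V) :
    |∑ j ∈ s, inner ℝ (u j) (v j)| ≤ √(∑ j ∈ s, ‖u j‖ ^ 2) * √(∑ j ∈ s, ‖v j‖ ^ 2) := by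
  refine (Finset.abs_sum_le_sum_abs _ _).trans ?_
  refine (Finset.sum_le_sum fun j _ => abs_real_inner_le_norm (u j) (v j)).trans ?_
  exact Real.sum_mul_le_sqrt_mul_sqrt s _ _

lemma abs_ip_le {h : ℝ} (hh : 0 < h) (M : ℕ) (u v : ℕ → V) :
    |ip h M u v| ≤ l2 h M u * l2 h M v := by
  unfold ip l2
  rw [abs_mul, abs_of_pos hh, Real.sqrt_mul hh.le, Real.sqrt_mul hh.le]
  have := abs_sum_inner_le (Finset.Ico 1 M) u v
  calc _ ≤ h * _ := mul_le_mul_of_nonneg_left this hh.le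
    _ = (√h * √h) * (√(∑ j ∈ Finset.Ico 1 M, ‖u j‖ ^ 2) * √(∑ j ∈ Finset.Ico 1 M, ‖v j‖ ^ 2)) := by
      rw [Real.mul_self_sqrt hh.le]
    _ = _ := by ring

lemma abs_ipd_le {h : ℝ} (hh : 0 < h) (M : ℕ) (u v : ℕ → V) :
    |ipd h M u v| ≤ l2dx h M u * l2dx h M v := by
  unfold ipd l2dx
  rw [abs_mul, abs_of_pos hh, Real.sqrt_mul hh.le, Real.sqrt_mul hh.le]
  have := abs_sum_inner_le (Finset.range M) (dxp h u) (dxp h v)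
  calc _ ≤ h * _ := mul_le_mul_of_nonneg_left this hh.le
    _ = (√h * √h) * (√(∑ j ∈ Finset.range M, ‖dxp h u j‖ ^ 2) *
          √(∑ j ∈ Finset.range M, ‖dxp h v j‖ ^ 2)) := by
      rw [Real.mul_self_sqrt hh.le]
    _ = _ := by ring

lemma l2_add_le {h : ℝ} (hh : 0 < h) (M : ℕ) (u v : ℕ → V) :
    l2 h M (fun j => u j + v j) ≤ l2 h M u + l2 h M v := by
  refine abs_le_of_sq_le_sq' ?_ (add_nonneg (l2_nonneg _ _ _) (l2_nonneg _ _ _)) |>.2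
  rw [← ip_self hh, ip_add_left, ip_add_right, ip_add_right, ip_self hh, ip_self hh,
    ip_comm h M v u]
  have := (abs_le.1 (abs_ip_le hh M u v)).2
  nlinarith

lemma l2dx_add_le {h : ℝ} (hh : 0 < h) (M : ℕ) (u v : ℕ → V) :
    l2dx h M (fun j => u j + v j) ≤ l2dx h M u + l2dx h M v := by
  refine abs_le_of_sq_le_sq' ?_ (add_nonneg (l2dx_nonneg _ _ _) (l2dx_nonneg _ _ _)) |>.2
  rw [← ipd_self hh, ipd_add_left, ipd_add_right, ipd_add_right, ipd_self hh, ipd_self hh,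
    ipd_comm h M v u]
  have := (abs_le.1 (abs_ipd_le hh M u v)).2
  nlinarith

lemma l2_smul {h : ℝ} (M : ℕ) (c : ℝ) (u : ℕ → V) :
    l2 h M (fun j => c • u j) = |c| * l2 h M u := by
  unfold l2
  simp only [norm_smul, mul_pow, ← Finset.mul_sum, Real.norm_eq_abs, sq_abs]
  rw [← mul_assoc, mul_comm h, mul_assoc, Real.sqrt_mul (sq_nonneg c), Real.sqrt_sq_eq_abs]

lemma l2dx_smul {h : ℝ} (M : ℕ) (c : ℝ) (u : ℕ → V) :
    l2dx h M (fun j => c • u j) = |c| * l2dx h M u := by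
  unfold l2dx
  simp only [dxp_smul, norm_smul, mul_pow, ← Finset.mul_sum, Real.norm_eq_abs, sq_abs]
  rw [← mul_assoc, mul_comm h, mul_assoc, Real.sqrt_mul (sq_nonneg c), Real.sqrt_sq_eq_abs]

lemma l2_sub_le {h : ℝ} (hh : 0 < h) (M : ℕ) (u v : ℕ → V) :
    l2 h M (fun j => u j - v j) ≤ l2 h M u + l2 h M v := by
  have := l2_add_le hh M u (fun j => (-1 : ℝ) • v j)
  rw [l2_smul] at this
  simpa [sub_eq_add_neg] using this

lemma l2dx_sub_le {h : ℝ} (hh : 0 < h) (M : ℕ) (u v : ℕ → V) :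
    l2dx h M (fun j => u j - v j) ≤ l2dx h M u + l2dx h M v := by
  have := l2dx_add_le hh M u (fun j => (-1 : ℝ) • v j)
  rw [l2dx_smul] at this
  simpa [sub_eq_add_neg] using this

lemma l2_mono {W : Type*} [NormedAddCommGroup W] [NormedSpace ℝ W] {h : ℝ} (hh : 0 < h) {M : ℕ}
    {u : ℕ → V} {v : ℕ → W} (huv : ∀ j ∈ Finset.Ico 1 M, ‖u j‖ ≤ ‖v j‖) : l2 h M u ≤ l2 h M v := by
  unfold l2
  refine Real.sqrt_le_sqrt (mul_le_mul_of_nonneg_left (Finset.sum_le_sum fun j hj => ?_) hh.le)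
  exact pow_le_pow_left₀ (norm_nonneg _) (huv j hj) 2

lemma l2_le_of_forall {h L : ℝ} (hh : 0 < h) {M : ℕ} (hL : h * M = L) {u : ℕ → V} {B : ℝ}
    (hB : 0 ≤ B) (hu : ∀ j ∈ Finset.Ico 1 M, ‖u j‖ ≤ B) : l2 h M u ≤ √L * B := by
  unfold l2
  rw [Real.sqrt_le_left (by positivity), mul_pow, Real.sq_sqrt (by rw [← hL]; positivity), ← hL,
    mul_assoc]
  refine mul_le_mul_of_nonneg_left ?_ hh.le
  calc _ ≤ ∑ j ∈ Finset.Ico 1 M, B ^ 2 :=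
        Finset.sum_le_sum fun j hj => pow_le_pow_left₀ (norm_nonneg _) (hu j hj) 2
    _ = ((M - 1 : ℕ) : ℝ) * B ^ 2 := by simp
    _ ≤ _ := by gcongr; omega

lemma l2dx_le_of_forall {h L : ℝ} (hh : 0 < h) {M : ℕ} (hL : h * M = L) {u : ℕ → V} {B : ℝ}
    (hB : 0 ≤ B) (hu : ∀ j < M, ‖dxp h u j‖ ≤ B) : l2dx h M u ≤ √L * B := by
  unfold l2dx
  rw [Real.sqrt_le_left (by positivity), mul_pow, Real.sq_sqrt (by rw [← hL]; positivity), ← hL,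
    mul_assoc]
  refine mul_le_mul_of_nonneg_left ?_ hh.le
  calc _ ≤ ∑ j ∈ Finset.range M, B ^ 2 :=
        Finset.sum_le_sum fun j hj => pow_le_pow_left₀ (norm_nonneg _)
          (hu j (Finset.mem_range.1 hj)) 2
    _ = _ := by simp

lemma sum_by_parts (d v : ℕ → V) (m : ℕ) :
    ∑ j ∈ Finset.range m, inner ℝ (d (j + 1) - d j) (v (j + 1))
      + ∑ j ∈ Finset.range (m + 1), inner ℝ (d j) (v (j + 1) - v j)
      = inner ℝ (d m) (v (m + 1)) - inner ℝ (d 0) (v 0) := by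
  induction m with
  | zero => simp [inner_sub_right]
  | succ m ih =>
    rw [Finset.sum_range_succ, Finset.sum_range_succ _ (m + 1)]
    simp only [inner_sub_right, inner_sub_left] at ih ⊢
    linarith

lemma sum_Ico_one (f : ℕ → ℝ) (m : ℕ) :
    ∑ j ∈ Finset.Ico 1 (m + 1), f j = ∑ j ∈ Finset.range m, f (j + 1) := by
  rw [Finset.sum_Ico_eq_sum_range]
  simp [add_comm]

lemma dx2_succ (h : ℝ) (u : ℕ → V) (j : ℕ) :
    dx2 h u (j + 1) = h⁻¹ • (dxp h u (j + 1) - dxp h u j) := by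
  unfold dx2 dxp
  rw [← smul_sub, smul_smul, ← sq, ← inv_pow]
  simp only [Nat.add_sub_cancel]; congr 1; module

/-- Summation by parts. -/
lemma ip_dx2 {h : ℝ} (hh : 0 < h) {M : ℕ} (hM : 1 ≤ M) (u v : ℕ → V) (h0 : v 0 = 0)
    (h1 : v M = 0) : ip h M (dx2 h u) v = - ipd h M u v := by
  obtain ⟨m, rfl⟩ := Nat.exists_eq_add_of_le' hM
  unfold ip ipd
  rw [sum_Ico_one]
  have := sum_by_parts (dxp h u) v m
  rw [h0, h1] at this
  simp only [inner_zero_right, sub_zero] at this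
  simp only [dx2_succ, inner_smul_left]
  have h2 : ∀ j, inner ℝ (dxp h u j) (dxp h v j) = h⁻¹ * inner ℝ (dxp h u j) (v (j + 1) - v j) :=
    fun j => by rw [show dxp h v j = h⁻¹ • (v (j + 1) - v j) from rfl, inner_smul_right]
  simp only [h2, ← Finset.mul_sum]
  simp
  field_simp
  linear_combination this

/-- Summation by parts without boundary condition on the second differences' weight. -/
lemma ip_dx2_of_interior {h : ℝ} (hh : 0 < h) {m : ℕ} (r u : ℕ → V) :
    ip h (m + 2) r (dx2 h u) = - (h * ∑ j ∈ Finset.range m,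
        inner ℝ (dxp h r (j + 1)) (dxp h u (j + 1)))
      + inner ℝ (r (m + 1)) (dxp h u (m + 1)) - inner ℝ (r 1) (dxp h u 0) := by
  unfold ip
  rw [sum_Ico_one]
  simp only [dx2_succ, inner_smul_right, ← Finset.mul_sum]
  have h2 : ∀ j, inner ℝ (dxp h r (j+1)) (dxp h u (j+1))
      = h⁻¹ * inner ℝ (r (j + 2) - r (j+1)) (dxp h u (j+1)) :=
    fun j => by rw [show dxp h r (j+1) = h⁻¹ • (r (j + 2) - r (j+1)) from rfl, inner_smul_left]; simp
  simp only [h2, ← Finset.mul_sum]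
  have := sum_by_parts (dxp h u) r m
  have e1 : ∀ x y : V, inner ℝ x y = inner ℝ y x := fun x y => real_inner_comm _ _
  rw [Finset.sum_range_succ]
  rw [Finset.sum_range_succ'] at this
  have h3 : ∀ j, inner ℝ (r (j + 1)) (dxp h u (j + 1) - dxp h u j)
     = inner ℝ (dxp h u (j + 1) - dxp h u j) (r (j + 1)) := fun j => e1 _ _
  have h4 : ∀ j, inner ℝ (r (j + 2) - r (j+1)) (dxp h u (j+1))
     = inner ℝ (dxp h u (j + 1)) (r (j + 2) - r (j+1)) := fun j => e1 _ _
  simp only [h3, h4]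
  rw [e1 (r (m+1)), e1 (r 1)]
  have h5 : inner ℝ (dxp h u (m + 1) - dxp h u m) (r (m + 1))
    = inner ℝ (dxp h u (m + 1)) (r (m + 1)) - inner ℝ (dxp h u m) (r (m + 1)) := inner_sub_left _ _ _
  have h6 : inner ℝ (dxp h u 0) (r (0 + 1) - r 0)
    = inner ℝ (dxp h u 0) (r 1) - inner ℝ (dxp h u 0) (r 0) := inner_sub_right _ _ _
  rw [h5]
  rw [h6] at this
  field_simp
  simp only [add_assoc, Nat.reduceAdd] at this ⊢
  linarith

lemma norm_le_sum_dxp {h : ℝ} (hh : 0 < h) (u : ℕ → V) (h0 : u 0 = 0) (j : ℕ) :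
    ‖u j‖ ≤ h * ∑ i ∈ Finset.range j, ‖dxp h u i‖ := by
  have e : ∀ i, ‖dxp h u i‖ = h⁻¹ * ‖u (i + 1) - u i‖ := fun i => by
    rw [dxp, norm_smul, norm_inv, Real.norm_eq_abs, abs_of_pos hh]
  simp only [e, ← Finset.mul_sum]
  rw [mul_inv_cancel_left₀ hh.ne']
  have : u j = ∑ i ∈ Finset.range j, (u (i + 1) - u i) := by
    rw [Finset.sum_range_sub, h0, sub_zero]
  rw [this]; exact norm_sum_le _ _

lemma norm_sq_le_l2dx {h L : ℝ} (hh : 0 < h) {M : ℕ} (hL : h * M = L) (u : ℕ → V) (h0 : u 0 = 0)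
    {j : ℕ} (hj : j ≤ M) : ‖u j‖ ^ 2 ≤ L * l2dx h M u ^ 2 := by
  have h1 := norm_le_sum_dxp hh u h0 j
  have h2 : ∑ i ∈ Finset.range j, ‖dxp h u i‖ ≤ ∑ i ∈ Finset.range M, ‖dxp h u i‖ :=
    Finset.sum_le_sum_of_subset_of_nonneg (Finset.range_mono hj) fun _ _ _ => norm_nonneg _
  have h3 := sq_sum_le_card_mul_sum_sq (s := Finset.range M) (f := fun i => ‖dxp h u i‖)
  rw [l2dx_sq hh, ← hL]
  have h4 : ‖u j‖ ≤ h * ∑ i ∈ Finset.range M, ‖dxp h u i‖ :=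
    h1.trans (mul_le_mul_of_nonneg_left h2 hh.le)
  calc ‖u j‖ ^ 2 ≤ (h * ∑ i ∈ Finset.range M, ‖dxp h u i‖) ^ 2 :=
        pow_le_pow_left₀ (norm_nonneg _) h4 2
    _ = h ^ 2 * (∑ i ∈ Finset.range M, ‖dxp h u i‖) ^ 2 := by ring
    _ ≤ h ^ 2 * (M * ∑ i ∈ Finset.range M, ‖dxp h u i‖ ^ 2) := by
      refine mul_le_mul_of_nonneg_left ?_ (by positivity)
      simpa using h3
    _ = _ := by ring

lemma norm_le_l2dx {h L : ℝ} (hh : 0 < h) {M : ℕ} (hL : h * M = L) (u : ℕ → V) (h0 : u 0 = 0)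
    {j : ℕ} (hj : j ≤ M) : ‖u j‖ ≤ √L * l2dx h M u := by
  have hL0 : 0 ≤ L := by rw [← hL]; positivity
  refine abs_le_of_sq_le_sq' ?_ (mul_nonneg (Real.sqrt_nonneg _) (l2dx_nonneg _ _ _)) |>.2
  rw [mul_pow, Real.sq_sqrt hL0]
  exact norm_sq_le_l2dx hh hL u h0 hj

lemma l2_le_l2dx {h L : ℝ} (hh : 0 < h) {M : ℕ} (hL : h * M = L) (u : ℕ → V) (h0 : u 0 = 0) :
    l2 h M u ≤ L * l2dx h M u := by
  have hL0 : 0 ≤ L := by rw [← hL]; positivity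
  refine (l2_le_of_forall hh hL (B := √L * l2dx h M u)
    (mul_nonneg (Real.sqrt_nonneg _) (l2dx_nonneg _ _ _)) fun j hj =>
      norm_le_l2dx hh hL u h0 (Finset.mem_Ico.1 hj).2.le).trans ?_
  rw [← mul_assoc, Real.mul_self_sqrt hL0]

lemma norm_sq_le_l2_mul {h : ℝ} (hh : 0 < h) {M : ℕ} (u : ℕ → V) (h0 : u 0 = 0)
    {j : ℕ} (hj : j ≤ M) (h1 : u M = 0) : ‖u j‖ ^ 2 ≤ 2 * (l2 h M u * l2dx h M u) := by
  rcases Nat.eq_zero_or_pos M with rfl | hM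
  · obtain rfl : j = 0 := by omega
    rw [h0]; simp; exact mul_nonneg (l2_nonneg _ _ _) (l2dx_nonneg _ _ _)
  obtain ⟨m, rfl⟩ := Nat.exists_eq_add_of_le' hM
  have key : ∀ j, ‖u j‖ ^ 2 ≤ ∑ i ∈ Finset.range j,
      h * ‖dxp h u i‖ * (‖u (i + 1)‖ + ‖u i‖) := by
    intro j
    induction j with
    | zero => simp [h0]
    | succ j ih =>
      rw [Finset.sum_range_succ]
      have e : h * ‖dxp h u j‖ = ‖u (j + 1) - u j‖ := by
        rw [dxp, norm_smul, norm_inv, Real.norm_eq_abs, abs_of_pos hh, mul_inv_cancel_left₀ hh.ne']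
      rw [e]
      have := norm_sub_norm_le (u (j + 1)) (u j)
      nlinarith [norm_nonneg (u (j + 1)), norm_nonneg (u j)]
  refine (key j).trans ?_
  refine (Finset.sum_le_sum_of_subset_of_nonneg (Finset.range_mono hj)
    fun _ _ _ => by positivity).trans ?_
  have e2 : ∑ i ∈ Finset.range (m + 1), ‖u (i + 1)‖ ^ 2 = ∑ j ∈ Finset.Ico 1 (m + 1), ‖u j‖ ^ 2 := by
    rw [sum_Ico_one, Finset.sum_range_succ, h1]; simp
  have e3 : ∑ i ∈ Finset.range (m + 1), ‖u i‖ ^ 2 = ∑ j ∈ Finset.Ico 1 (m + 1), ‖u j‖ ^ 2 := by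
    rw [sum_Ico_one, Finset.sum_range_succ', h0]; simp
  have c1 := Real.sum_mul_le_sqrt_mul_sqrt (Finset.range (m + 1)) (fun i => ‖dxp h u i‖)
    (fun i => ‖u (i + 1)‖)
  have c2 := Real.sum_mul_le_sqrt_mul_sqrt (Finset.range (m + 1)) (fun i => ‖dxp h u i‖)
    (fun i => ‖u i‖)
  rw [e2] at c1
  rw [e3] at c2
  have e4 : l2 h (m+1) u * l2dx h (m+1) u = h * (√(∑ i ∈ Finset.range (m+1), ‖dxp h u i‖ ^ 2) *
      √(∑ j ∈ Finset.Ico 1 (m + 1), ‖u j‖ ^ 2)) := by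
    unfold l2 l2dx
    rw [Real.sqrt_mul hh.le, Real.sqrt_mul hh.le]
    linear_combination (√(∑ i ∈ Finset.range (m+1), ‖dxp h u i‖ ^ 2) *
      √(∑ j ∈ Finset.Ico 1 (m + 1), ‖u j‖ ^ 2)) * (Real.mul_self_sqrt hh.le)
  rw [e4]
  have : ∑ i ∈ Finset.range (m + 1), h * ‖dxp h u i‖ * (‖u (i + 1)‖ + ‖u i‖)
     = h * (∑ i ∈ Finset.range (m + 1), ‖dxp h u i‖ * ‖u (i + 1)‖
       + ∑ i ∈ Finset.range (m + 1), ‖dxp h u i‖ * ‖u i‖) := by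
    rw [← Finset.sum_add_distrib, Finset.mul_sum]
    exact Finset.sum_congr rfl fun i _ => by ring
  rw [this]
  nlinarith

lemma sum_range_le_sum_range_succ (f : ℕ → ℝ) (hf : ∀ j, 0 ≤ f j) (m : ℕ) :
    ∑ j ∈ Finset.range m, f (j + 1) ≤ ∑ j ∈ Finset.range (m + 1), f j ∧
    ∑ j ∈ Finset.range m, f j ≤ ∑ j ∈ Finset.range (m + 1), f j := by
  rw [Finset.sum_range_succ']
  refine ⟨le_add_of_nonneg_right (hf 0), ?_⟩
  rw [← Finset.sum_range_succ', Finset.sum_range_succ]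
  exact le_add_of_nonneg_right (hf m)

lemma l2_dx2_le {h : ℝ} (hh : 0 < h) (M : ℕ) (u : ℕ → V) :
    h * l2 h M (dx2 h u) ≤ 2 * l2dx h M u := by
  rcases Nat.eq_zero_or_pos M with rfl | hM
  · simp [l2, l2dx]
  obtain ⟨m, rfl⟩ := Nat.exists_eq_add_of_le' hM
  refine abs_le_of_sq_le_sq' ?_ (mul_nonneg (by norm_num) (l2dx_nonneg _ _ _)) |>.2
  rw [mul_pow, mul_pow, l2_sq hh, l2dx_sq hh, sum_Ico_one]
  have e : ∀ j, h ^ 2 * ‖dx2 h u (j + 1)‖ ^ 2 ≤ 2 * ‖dxp h u (j + 1)‖ ^ 2 + 2 * ‖dxp h u j‖ ^ 2 := by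
    intro j
    rw [dx2_succ, norm_smul, mul_pow, norm_inv, Real.norm_eq_abs, abs_of_pos hh, inv_pow,
      mul_inv_cancel_left₀ (by positivity)]
    have := norm_sub_le (dxp h u (j + 1)) (dxp h u j)
    have h2 := pow_le_pow_left₀ (norm_nonneg _) this 2
    nlinarith [sq_nonneg (‖dxp h u (j + 1)‖ - ‖dxp h u j‖)]
  have h1 : h ^ 2 * ∑ j ∈ Finset.range m, ‖dx2 h u (j + 1)‖ ^ 2 ≤
      2 * ∑ j ∈ Finset.range m, ‖dxp h u (j + 1)‖ ^ 2 + 2 * ∑ j ∈ Finset.range m, ‖dxp h u j‖ ^ 2 := by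
    rw [Finset.mul_sum, Finset.mul_sum, Finset.mul_sum, ← Finset.sum_add_distrib]
    exact Finset.sum_le_sum fun j _ => e j
  obtain ⟨h2, h3⟩ := sum_range_le_sum_range_succ (fun j => ‖dxp h u j‖ ^ 2) (fun _ => by positivity) m
  nlinarith

/-- Solvability of the discrete Dirichlet problem. -/
lemma exists_dx2_eq {h : ℝ} (hh : 0 < h) {M : ℕ} (hM : 1 ≤ M) (v : ℕ → V) :
    ∃ w : ℕ → V, w 0 = 0 ∧ w M = 0 ∧ ∀ j ∈ Finset.Ico 1 M, - dx2 h w j = v j := by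
  let y : ℕ → V := fun n => - (h ^ 2) • ∑ i ∈ Finset.range n, ∑ l ∈ Finset.range i, v (l + 1)
  have hM' : (M : ℝ) ≠ 0 := by positivity
  have hyd : ∀ j, dx2 h (fun n => y (n + 0)) (j + 1) = - v (j + 1) := by
    intro j
    have e1 : y (j + 2) = y (j + 1) + - (h ^ 2) • (∑ l ∈ Finset.range j, v (l + 1) + v (j + 1)) := by
      simp only [y]; rw [Finset.sum_range_succ _ (j + 1), ← Finset.sum_range_succ (fun l => v (l + 1)) j, smul_add]
    have e2 : y (j + 1) = y j + - (h ^ 2) • ∑ l ∈ Finset.range j, v (l + 1) := by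
      simp only [y]; rw [Finset.sum_range_succ, smul_add]
    simp only [dx2, Nat.add_sub_cancel, add_zero]
    rw [show j + 1 + 1 = j + 2 from rfl, e1, e2]
    have : y j + -h ^ 2 • ∑ l ∈ Finset.range j, v (l + 1) + -h ^ 2 • (∑ l ∈ Finset.range j, v (l + 1) + v (j + 1)) - (2 : ℝ) • (y j + -h ^ 2 • ∑ l ∈ Finset.range j, v (l + 1)) + y j = - h ^ 2 • v (j + 1) := by module
    rw [this, smul_smul]
    have : (h ^ 2)⁻¹ * - h ^ 2 = -1 := by field_simp
    rw [this]; simp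
  refine ⟨fun j => y j - ((j : ℝ) / M) • y M, by simp [y], by simp [hM'], fun j hj => ?_⟩
  obtain ⟨i, rfl⟩ := Nat.exists_eq_add_of_le' (Finset.mem_Ico.1 hj).1
  rw [dx2_sub, show dx2 h (fun i => y i) (i + 1) = - v (i + 1) from hyd i]
  have : dx2 h (fun i => ((i : ℝ) / M) • y M) (i + 1) = 0 := by
    simp only [dx2, Nat.add_sub_cancel]
    push_cast
    have : (((i:ℝ) + 1 + 1) / M) • y M - (2 : ℝ) • (((i:ℝ) + 1) / M) • y M + ((i:ℝ) / M) • y M = 0 := by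
      module
    rw [this, smul_zero]
  rw [this]; simp

end DiscreteCalculus

section HiddenRegularity

/-- `Im (x * conj y)`. -/
def wedge (x y : ℂ) : ℝ := x.im * y.re - x.re * y.im

/-- The central difference in space. -/
noncomputable def cdx (h : ℝ) (u : ℕ → ℂ) (j : ℕ) : ℂ := (2 * h)⁻¹ • (u (j + 1) - u (j - 1))

/-- The quadratic form of the multiplier `(x - (a + b) / 2) ∂_x`. -/
noncomputable def mform (h L : ℝ) (M : ℕ) (u v : ℕ → ℂ) : ℝ :=
  h * ∑ j ∈ Finset.Ico 1 M, (j * h - L / 2) * wedge (u j) (cdx h v j)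

lemma wedge_eq_inner (x y : ℂ) : wedge x y = inner ℝ (-(Complex.I * x)) y := by
  simp [wedge, Complex.inner]; ring

lemma norm_sq_eq (x : ℂ) : ‖x‖ ^ 2 = x.re ^ 2 + x.im ^ 2 := by
  rw [← Complex.normSq_eq_norm_sq, Complex.normSq_apply]; ring

lemma weighted_sum_by_parts (h L : ℝ) (A : ℕ → ℝ) (m : ℕ) :
    ∑ j ∈ Finset.range m, (((j + 1 : ℕ) : ℝ) * h - L / 2) * (A (j + 1) - A j)
      = (((m + 1 : ℕ) : ℝ) * h - L / 2) * A m + L / 2 * A 0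
        - h * ∑ j ∈ Finset.range (m + 1), A j := by
  induction m with
  | zero => simp; ring
  | succ m ih =>
    rw [Finset.sum_range_succ, ih, Finset.sum_range_succ _ (m + 1)]
    push_cast; ring

lemma cdx_succ {h : ℝ} (u : ℕ → ℂ) (j : ℕ) :
    cdx h u (j + 1) = (2 : ℝ)⁻¹ • (dxp h u (j + 1) + dxp h u j) := by
  unfold cdx dxp
  rw [← smul_add, smul_smul, ← mul_inv]
  simp only [Nat.add_sub_cancel]; congr 1; ring

lemma multiplier_dx2 {h L : ℝ} (hh : 0 < h) {m : ℕ} (hL : h * ((m + 1 : ℕ) : ℝ) = L) (w : ℕ → ℂ) :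
    h * ∑ j ∈ Finset.Ico 1 (m + 1), (j * h - L / 2) * inner ℝ (dx2 h w j) (cdx h w j)
      = L / 4 * (‖dxp h w 0‖ ^ 2 + ‖dxp h w m‖ ^ 2) - l2dx h (m + 1) w ^ 2 / 2 := by
  rw [sum_Ico_one, l2dx_sq hh]
  have e : ∀ j, inner ℝ (dx2 h w (j + 1)) (cdx h w (j + 1))
      = (2 * h)⁻¹ * (‖dxp h w (j + 1)‖ ^ 2 - ‖dxp h w j‖ ^ 2) := by
    intro j
    rw [cdx_succ, dx2_succ, inner_smul_left, inner_smul_right]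
    simp only [inner_add_right, inner_sub_left, real_inner_self_eq_norm_sq]
    rw [real_inner_comm (dxp h w j) (dxp h w (j + 1)), mul_inv]
    simp; ring
  simp only [e]
  have := weighted_sum_by_parts h L (fun j => ‖dxp h w j‖ ^ 2) m
  have e2 : ∀ j : ℕ, (((j + 1 : ℕ) : ℝ) * h - L / 2) * ((2 * h)⁻¹ * (‖dxp h w (j + 1)‖ ^ 2 - ‖dxp h w j‖ ^ 2)) = (2 * h)⁻¹ * ((((j + 1 : ℕ) : ℝ) * h - L / 2) * (‖dxp h w (j + 1)‖ ^ 2 - ‖dxp h w j‖ ^ 2)) := fun j => by ring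
  simp only [e2, ← Finset.mul_sum, this]
  rw [mul_comm ((m + 1 : ℕ) : ℝ) h, hL]
  field_simp; ring

lemma mform_sub_add {h L : ℝ} (hh : 0 < h) {m : ℕ} (p q : ℕ → ℂ)
    (p0 : p 0 = 0) (p1 : p (m + 1) = 0) (q0 : q 0 = 0) (q1 : q (m + 1) = 0) :
    mform h L (m + 1) (fun j => p j - q j) (fun j => p j + q j)
      = mform h L (m + 1) p p - mform h L (m + 1) q q
        - h / 2 * ∑ j ∈ Finset.Ico 1 (m + 1), wedge (p j - q j) (q (j + 1) + q (j - 1)) := by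
  have key : ∀ n : ℕ, ∑ j ∈ Finset.range n,
      ((((j + 1 : ℕ) : ℝ) * h - L / 2) / 2 *
        (wedge (p (j + 1) - q (j + 1)) (p (j + 2) + q (j + 2) - (p j + q j))
          - wedge (p (j + 1)) (p (j + 2) - p j) + wedge (q (j + 1)) (q (j + 2) - q j))
        + h / 2 * wedge (p (j + 1) - q (j + 1)) (q (j + 2) + q j))
      = (((n + 1 : ℕ) : ℝ) * h - L / 2) / 2 * (wedge (p n) (q (n + 1)) + wedge (p (n + 1)) (q n))
        + L / 4 * (wedge (p 0) (q 1) + wedge (p 1) (q 0))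
        - h / 2 * (wedge (p 0) (q 1) + wedge (p (n + 1)) (q n))
        - h / 2 * (wedge (q n) (q (n + 1)) - wedge (q 0) (q 1)) := by
    intro n
    induction n with
    | zero => simp; ring
    | succ n ih =>
      rw [Finset.sum_range_succ, ih]
      simp only [wedge, Complex.add_re, Complex.sub_re, Complex.add_im, Complex.sub_im]
      push_cast; ring
  have := key m
  rw [p0, p1, q0, q1] at this
  unfold mform
  rw [sum_Ico_one, sum_Ico_one, sum_Ico_one, sum_Ico_one]
  have e : ∀ (u v : ℕ → ℂ) (j : ℕ), wedge (u (j + 1)) (cdx h v (j + 1))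
      = (2 * h)⁻¹ * wedge (u (j + 1)) (v (j + 2) - v j) := by
    intro u v j
    simp only [cdx, wedge, Complex.real_smul, Complex.re_ofReal_mul, Complex.im_ofReal_mul,
      Nat.add_sub_cancel]
    ring
  have e' := e (fun j => p j - q j) (fun j => p j + q j)
  simp only [e, e', Nat.add_sub_cancel]
  have z : wedge 0 0 = 0 := by simp [wedge]
  have z1 : ∀ x, wedge 0 x = 0 := by simp [wedge]
  have z2 : ∀ x, wedge x 0 = 0 := by simp [wedge]
  simp only [z1, z2, add_zero, mul_zero, sub_zero] at this
  rw [← sub_eq_zero]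
  rw [← this]
  simp only [Finset.mul_sum, ← Finset.sum_sub_distrib]
  refine Finset.sum_congr rfl fun j _ => ?_
  field_simp; ring

lemma l2_cdx_le {h : ℝ} (hh : 0 < h) (M : ℕ) (u : ℕ → ℂ) : l2 h M (cdx h u) ≤ l2dx h M u := by
  rcases Nat.eq_zero_or_pos M with rfl | hM
  · simp [l2, l2dx]
  obtain ⟨m, rfl⟩ := Nat.exists_eq_add_of_le' hM
  refine Real.sqrt_le_sqrt (mul_le_mul_of_nonneg_left ?_ hh.le)
  rw [sum_Ico_one]
  have e : ∀ j, ‖cdx h u (j + 1)‖ ^ 2 ≤ ‖dxp h u (j + 1)‖ ^ 2 / 2 + ‖dxp h u j‖ ^ 2 / 2 := by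
    intro j
    rw [cdx_succ, norm_smul, mul_pow]
    have := pow_le_pow_left₀ (norm_nonneg _) (norm_add_le (dxp h u (j + 1)) (dxp h u j)) 2
    norm_num
    nlinarith [sq_nonneg (‖dxp h u (j + 1)‖ - ‖dxp h u j‖)]
  obtain ⟨h2, h3⟩ := sum_range_le_sum_range_succ (fun j => ‖dxp h u j‖ ^ 2) (fun _ => by positivity) m
  have := Finset.sum_le_sum fun j (_ : j ∈ Finset.range m) => e j
  rw [Finset.sum_add_distrib, ← Finset.sum_div, ← Finset.sum_div] at this
  linarith

lemma abs_weighted_ip_le {h L : ℝ} (hh : 0 < h) {M : ℕ} (hL : h * M = L) (u v : ℕ → ℂ) :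
    |h * ∑ j ∈ Finset.Ico 1 M, (j * h - L / 2) * inner ℝ (u j) (v j)|
      ≤ L / 2 * (l2 h M u * l2 h M v) := by
  have hL0 : 0 ≤ L := by rw [← hL]; positivity
  have e : h * ∑ j ∈ Finset.Ico 1 M, (j * h - L / 2) * inner ℝ (u j) (v j)
      = ip h M (fun j => ((j : ℝ) * h - L / 2) • u j) v := by
    unfold ip; congr 1; refine Finset.sum_congr rfl fun j _ => ?_
    rw [inner_smul_left]; simp
  rw [e, ← mul_assoc]
  refine (abs_ip_le hh M _ _).trans (mul_le_mul_of_nonneg_right ?_ (l2_nonneg _ _ _))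
  have : L / 2 * l2 h M u = l2 h M (fun j => (L / 2) • u j) := by
    rw [l2_smul, abs_of_nonneg (by positivity)]
  rw [this]
  refine l2_mono hh fun j hj => ?_
  rw [norm_smul, norm_smul]
  refine mul_le_mul_of_nonneg_right ?_ (norm_nonneg _)
  rw [Real.norm_eq_abs, Real.norm_eq_abs, abs_of_nonneg (a := L / 2) (by positivity), abs_le]
  have hj1 : (j : ℝ) ≤ M := by exact_mod_cast (Finset.mem_Ico.1 hj).2.le
  have : (j : ℝ) * h ≤ L := by rw [← hL]; nlinarith
  have : 0 ≤ (j : ℝ) * h := by positivity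
  constructor <;> linarith

lemma abs_mform_le {h L : ℝ} (hh : 0 < h) {M : ℕ} (hL : h * M = L) (u : ℕ → ℂ) (u0 : u 0 = 0) :
    |mform h L M u u| ≤ L ^ 2 / 2 * l2dx h M u ^ 2 := by
  have hL0 : 0 ≤ L := by rw [← hL]; positivity
  have := abs_weighted_ip_le hh hL (fun j => -(Complex.I * u j)) (cdx h u)
  simp only [← wedge_eq_inner] at this
  refine this.trans ?_
  have h1 : l2 h M (fun j => -(Complex.I * u j)) = l2 h M u := by simp [l2]
  rw [h1]
  have h2 := l2_cdx_le hh M u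
  have h3 := l2_le_l2dx hh hL u u0
  have h4 := l2dx_nonneg h M u
  have h5 : l2 h M u * l2 h M (cdx h u) ≤ (L * l2dx h M u) * l2dx h M u :=
    mul_le_mul h3 h2 (l2_nonneg _ _ _) (by positivity)
  nlinarith

/-- Control of the boundary values of the discrete derivative of a solution of one step of a
Crank–Nicolson scheme for the Schrödinger equation with a right-hand side `R`. -/
theorem boundary_derivative_le {h L τ : ℝ} (hh : 0 < h) (hτ : 0 < τ) {m : ℕ}
    (hL : h * ((m + 1 : ℕ) : ℝ) = L) (p q R : ℕ → ℂ)
    (p0 : p 0 = 0) (p1 : p (m + 1) = 0) (q0 : q 0 = 0) (q1 : q (m + 1) = 0)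
    (w : ℕ → ℂ) (hw : ∀ j, w j = (2 : ℝ)⁻¹ • (p j + q j))
    (heq : ∀ j ∈ Finset.Ico 1 (m + 1),
      Complex.I * ((2 * τ)⁻¹ • (p j - q j)) = - dx2 h w j + R j) :
    τ * (L * (‖dxp h w 0‖ ^ 2 + ‖dxp h w m‖ ^ 2))
      ≤ (mform h L (m + 1) p p - mform h L (m + 1) q q)
        + τ * (2 * l2dx h (m + 1) w ^ 2 + 6 * (l2dx h (m + 1) w * l2dx h (m + 1) q)
          + 4 * L * (l2 h (m + 1) R * l2dx h (m + 1) q)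
          + 2 * L * (l2 h (m + 1) R * l2dx h (m + 1) w)) := by
  have hL0 : 0 < L := by rw [← hL]; positivity
  have hhL : h ≤ L := by
    rw [← hL]; push_cast; nlinarith [mul_nonneg hh.le (Nat.cast_nonneg (α := ℝ) m)]
  set d : ℕ → ℂ := fun j => (2 * τ)⁻¹ • (p j - q j) with hd
  have hdx : ∀ j ∈ Finset.Ico 1 (m + 1), dx2 h w j = -(Complex.I * d j) + R j := by
    intro j hj; rw [hd]; simp only; rw [heq j hj]; ring
  have h1 := multiplier_dx2 hh hL w
  have h2 : h * ∑ j ∈ Finset.Ico 1 (m + 1), (j * h - L / 2) * inner ℝ (dx2 h w j) (cdx h w j)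
      = mform h L (m + 1) d w
        + h * ∑ j ∈ Finset.Ico 1 (m + 1), (j * h - L / 2) * inner ℝ (R j) (cdx h w j) := by
    unfold mform
    rw [← mul_add, ← Finset.sum_add_distrib]
    congr 1
    refine Finset.sum_congr rfl fun j hj => ?_
    rw [hdx j hj, inner_add_left, wedge_eq_inner]; ring
  have h3 : 4 * τ * mform h L (m + 1) d w
      = mform h L (m + 1) (fun j => p j - q j) (fun j => p j + q j) := by
    unfold mform
    rw [mul_left_comm]; congr 1
    rw [Finset.mul_sum]
    refine Finset.sum_congr rfl fun j hj => ?_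
    have : cdx h w j = (2 : ℝ)⁻¹ • cdx h (fun j => p j + q j) j := by
      simp only [cdx, hw]; rw [smul_comm, ← smul_sub]
    rw [this, hd]
    simp only [wedge, Complex.real_smul, Complex.re_ofReal_mul, Complex.im_ofReal_mul]
    field_simp; ring
  have h4 := mform_sub_add (L := L) hh p q p0 p1 q0 q1
  have h5 : h / 2 * ∑ j ∈ Finset.Ico 1 (m + 1), wedge (p j - q j) (q (j + 1) + q (j - 1))
      = τ * (ip h (m + 1) (dx2 h w) (fun j => (2 : ℝ) • q j + h ^ 2 • dx2 h q j)
        - ip h (m + 1) R (fun j => (2 : ℝ) • q j + h ^ 2 • dx2 h q j)) := by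
    rw [← ip_sub_left]
    unfold ip
    rw [mul_left_comm, div_mul_eq_mul_div, mul_div_assoc]; congr 1
    rw [Finset.mul_sum, Finset.sum_div]
    refine Finset.sum_congr rfl fun j hj => ?_
    simp only
    rw [hdx j hj, add_sub_cancel_right, ← wedge_eq_inner]
    have : (2 : ℝ) • q j + h ^ 2 • dx2 h q j = q (j + 1) + q (j - 1) := by
      rw [dx2, smul_smul, mul_inv_cancel₀ (by positivity)]; module
    rw [this, hd]
    simp only [wedge, Complex.real_smul, Complex.re_ofReal_mul, Complex.im_ofReal_mul]
    field_simp
  have h6 : |ip h (m + 1) (dx2 h w) (fun j => (2 : ℝ) • q j + h ^ 2 • dx2 h q j)|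
      ≤ 6 * (l2dx h (m + 1) w * l2dx h (m + 1) q) := by
    rw [ip_add_right, ip_smul_right, ip_smul_right, ip_dx2 hh (by omega) w q q0 q1]
    have a1 := abs_ipd_le hh (m + 1) w q
    have a2 := abs_ip_le hh (m + 1) (dx2 h w) (dx2 h q)
    have a3 := l2_dx2_le hh (m + 1) w
    have a4 := l2_dx2_le hh (m + 1) q
    have a5 : (h * l2 h (m + 1) (dx2 h w)) * (h * l2 h (m + 1) (dx2 h q))
        ≤ (2 * l2dx h (m + 1) w) * (2 * l2dx h (m + 1) q) :=
      mul_le_mul a3 a4 (mul_nonneg hh.le (l2_nonneg _ _ _))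
        (mul_nonneg (by norm_num) (l2dx_nonneg _ _ _))
    have a6 : |h ^ 2 * ip h (m + 1) (dx2 h w) (dx2 h q)| ≤ 4 * (l2dx h (m + 1) w * l2dx h (m + 1) q) := by
      rw [abs_mul, abs_of_pos (a := h ^ 2) (by positivity)]
      calc _ ≤ h ^ 2 * (l2 h (m + 1) (dx2 h w) * l2 h (m + 1) (dx2 h q)) := by gcongr
        _ ≤ _ := by nlinarith
    rw [abs_le] at a1 a6 ⊢
    constructor <;> linarith [a1.1, a1.2, a6.1, a6.2]
  have h7 : |ip h (m + 1) R (fun j => (2 : ℝ) • q j + h ^ 2 • dx2 h q j)|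
      ≤ 4 * L * (l2 h (m + 1) R * l2dx h (m + 1) q) := by
    refine (abs_ip_le hh _ _ _).trans ?_
    have a1 := l2_add_le hh (m + 1) (fun j => (2 : ℝ) • q j) (fun j => h ^ 2 • dx2 h q j)
    rw [l2_smul, l2_smul, abs_of_pos (a := h ^ 2) (by positivity)] at a1
    have a2 := l2_dx2_le hh (m + 1) q
    have a3 := l2_le_l2dx hh hL q q0
    have a4 : h ^ 2 * l2 h (m + 1) (dx2 h q) ≤ 2 * L * l2dx h (m + 1) q := by
      calc h ^ 2 * l2 h (m + 1) (dx2 h q) = h * (h * l2 h (m + 1) (dx2 h q)) := by ring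
        _ ≤ L * (2 * l2dx h (m + 1) q) :=
          mul_le_mul hhL a2 (mul_nonneg hh.le (l2_nonneg _ _ _)) hL0.le
        _ = _ := by ring
    norm_num at a1
    calc _ ≤ l2 h (m + 1) R * (4 * L * l2dx h (m + 1) q) := by
          refine mul_le_mul_of_nonneg_left ?_ (l2_nonneg _ _ _)
          simp only [Complex.real_smul] at a1 ⊢
          push_cast at a1 ⊢
          linarith
      _ = _ := by ring
  have h8 := abs_weighted_ip_le hh hL R (cdx h w)
  have h9 : l2 h (m + 1) R * l2 h (m + 1) (cdx h w) ≤ l2 h (m + 1) R * l2dx h (m + 1) w :=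
    mul_le_mul_of_nonneg_left (l2_cdx_le hh _ _) (l2_nonneg _ _ _)
  have h10 := (abs_le.1 h8).2
  have h11 := (abs_le.1 h6).1
  have h12 := (abs_le.1 h7).2
  have h13 := (abs_le.1 h7).1
  have h14 := (abs_le.1 h6).2
  have h15 : L / 2 * (l2 h (m + 1) R * l2 h (m + 1) (cdx h w)) ≤ L / 2 * (l2 h (m + 1) R * l2dx h (m + 1) w) :=
    mul_le_mul_of_nonneg_left h9 (by positivity)
  have e0 : τ * (L * (‖dxp h w 0‖ ^ 2 + ‖dxp h w m‖ ^ 2))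
     = 4 * τ * mform h L (m + 1) d w
        + 4 * τ * (h * ∑ j ∈ Finset.Ico 1 (m + 1), (j * h - L / 2) * inner ℝ (R j) (cdx h w j))
        + 2 * τ * l2dx h (m + 1) w ^ 2 := by
    have := h1.symm.trans h2
    linear_combination 4 * τ * this
  rw [e0, h3, h4, h5]
  have e1 : 4 * τ * (h * ∑ j ∈ Finset.Ico 1 (m + 1), (j * h - L / 2) * inner ℝ (R j) (cdx h w j))
    ≤ 4 * τ * (L / 2 * (l2 h (m + 1) R * l2dx h (m + 1) w)) :=
    mul_le_mul_of_nonneg_left (h10.trans h15) (by positivity)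
  have e2 : -(τ * (ip h (m + 1) (dx2 h w) (fun j => (2 : ℝ) • q j + h ^ 2 • dx2 h q j)
        - ip h (m + 1) R (fun j => (2 : ℝ) • q j + h ^ 2 • dx2 h q j)))
     ≤ τ * (6 * (l2dx h (m + 1) w * l2dx h (m + 1) q) + 4 * L * (l2 h (m + 1) R * l2dx h (m + 1) q)) := by
    rw [← mul_neg]
    refine mul_le_mul_of_nonneg_left ?_ hτ.le
    linarith
  linarith

end HiddenRegularity

section EnergyIdentities

lemma norm_diff_eq {V : Type*} [NormedAddCommGroup V] [NormedSpace ℝ V] {h : ℝ} (hh : 0 < h)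
    (u : ℕ → V) (j : ℕ) : ‖u (j + 1) - u j‖ = h * ‖dxp h u j‖ := by
  rw [dxp, norm_smul, norm_inv, Real.norm_eq_abs, abs_of_pos hh, mul_inv_cancel_left₀ hh.ne']

lemma l2dx_le_of_diff {V W Z : Type*} [NormedAddCommGroup V] [InnerProductSpace ℝ V]
    [NormedAddCommGroup W] [InnerProductSpace ℝ W] [NormedAddCommGroup Z] [InnerProductSpace ℝ Z]
    {h : ℝ} (hh : 0 < h) {M : ℕ} {A B : ℝ} (hA : 0 ≤ A) (hB : 0 ≤ B)
    {z : ℕ → Z} {v : ℕ → V} {u : ℕ → W}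
    (H : ∀ j < M, ‖z (j + 1) - z j‖ ≤ A * ‖v (j + 1) - v j‖ + B * ‖u (j + 1) - u j‖) :
    l2dx h M z ≤ A * l2dx h M v + B * l2dx h M u := by
  have h1 : ∀ j < M, ‖dxp h z j‖ ≤ A * ‖dxp h v j‖ + B * ‖dxp h u j‖ := by
    intro j hj
    have := H j hj
    rw [norm_diff_eq hh, norm_diff_eq hh, norm_diff_eq hh] at this
    have h2 : h * ‖dxp h z j‖ ≤ h * (A * ‖dxp h v j‖ + B * ‖dxp h u j‖) := by linarith
    exact le_of_mul_le_mul_left h2 hh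
  have h2 : l2dx h M z ≤ √(h * ∑ j ∈ Finset.range M,
      ‖(A * ‖dxp h v j‖ + B * ‖dxp h u j‖ : ℝ)‖ ^ 2) := by
    refine Real.sqrt_le_sqrt (mul_le_mul_of_nonneg_left (Finset.sum_le_sum fun j hj => ?_) hh.le)
    refine pow_le_pow_left₀ (norm_nonneg _) ((h1 j (Finset.mem_range.1 hj)).trans (le_abs_self _)) 2
  refine h2.trans ?_
  have e : ∀ c : ℕ → ℝ, √(h * ∑ j ∈ Finset.range M, ‖c j‖ ^ 2)
      = l2 h (M + 1) (fun j => c (j - 1)) := by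
    intro c; unfold l2; rw [sum_Ico_one]; simp
  rw [e]
  refine (l2_add_le hh _ (fun j => A * ‖dxp h v (j - 1)‖) (fun j => B * ‖dxp h u (j - 1)‖)).trans ?_
  have e1 := l2_smul (h := h) (M + 1) A (fun j => ‖dxp h v (j - 1)‖)
  have e2 := l2_smul (h := h) (M + 1) B (fun j => ‖dxp h u (j - 1)‖)
  simp only [smul_eq_mul] at e1 e2
  rw [e1, e2, ← e (fun j => ‖dxp h v j‖), ← e (fun j => ‖dxp h u j‖), abs_of_nonneg hA, abs_of_nonneg hB]
  simp [l2dx]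

lemma l2dx_congr {V : Type*} [NormedAddCommGroup V] [NormedSpace ℝ V] {h : ℝ} {M : ℕ}
    {u v : ℕ → V} (H : ∀ j ≤ M, u j = v j) : l2dx h M u = l2dx h M v := by
  unfold l2dx; congr 2
  refine Finset.sum_congr rfl fun j hj => ?_
  have := Finset.mem_range.1 hj
  rw [dxp, dxp, H j (by omega), H (j + 1) (by omega)]

/-- The identity behind the `H¹` estimate of one Crank–Nicolson step. -/
lemma crank_nicolson_identity {h τ : ℝ} (hh : 0 < h) (hτ : 0 < τ) {M : ℕ} (hM : 1 ≤ M)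
    {p q S : ℕ → ℂ} (p0 : p 0 = 0) (p1 : p M = 0) (q0 : q 0 = 0) (q1 : q M = 0)
    (heq : ∀ j ∈ Finset.Ico 1 M, Complex.I * ((2 * τ)⁻¹ • (p j - q j))
      = - dx2 h (fun j => (2 : ℝ)⁻¹ • (p j + q j)) j + S j) :
    l2dx h M p ^ 2 - l2dx h M q ^ 2
      = - (4 * τ) * ip h M S (fun j => (2 * τ)⁻¹ • (p j - q j)) := by
  have h1 : ip h M (fun j => Complex.I * ((2 * τ)⁻¹ • (p j - q j)))
      (fun j => (2 * τ)⁻¹ • (p j - q j)) = 0 := by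
    unfold ip
    rw [Finset.sum_eq_zero, mul_zero]
    intro j _
    simp [Complex.inner]; ring
  have h2 : ip h M (fun j => Complex.I * ((2 * τ)⁻¹ • (p j - q j)))
      (fun j => (2 * τ)⁻¹ • (p j - q j))
      = ip h M (fun j => - dx2 h (fun j => (2 : ℝ)⁻¹ • (p j + q j)) j + S j)
        (fun j => (2 * τ)⁻¹ • (p j - q j)) := ip_congr heq fun _ _ => rfl
  rw [h1, ip_add_left, ip_neg_left, ip_dx2 hh hM _ _ (by simp [p0, q0]) (by simp [p1, q1]),
    ipd_smul_left, ipd_smul_right, ipd_add_left, ipd_sub_right, ipd_sub_right, ipd_self hh,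
    ipd_self hh, ipd_comm h M q p] at h2
  field_simp at h2 ⊢
  linarith

lemma inner_dt_substitution {B N D d : ℂ} (hd : Complex.I * d = - D + (B + N)) :
    inner ℝ N d = - inner ℝ (Complex.I * N) D + inner ℝ (Complex.I * N) B := by
  have : d = -Complex.I * (- D + (B + N)) := by
    rw [← hd, ← mul_assoc, neg_mul, Complex.I_mul_I]; simp
  rw [this]
  simp [Complex.inner]; ring

lemma crank_nicolson_identity' {h τ : ℝ} (hh : 0 < h) (hτ : 0 < τ) {M : ℕ} (hM : 1 ≤ M)
    {p q B N : ℕ → ℂ} (p0 : p 0 = 0) (p1 : p M = 0) (q0 : q 0 = 0) (q1 : q M = 0)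
    (heq : ∀ j ∈ Finset.Ico 1 M, Complex.I * ((2 * τ)⁻¹ • (p j - q j))
      = - dx2 h (fun j => (2 : ℝ)⁻¹ • (p j + q j)) j + (B j + N j)) :
    l2dx h M p ^ 2 - l2dx h M q ^ 2
      = - (4 * τ) * ip h M B (fun j => (2 * τ)⁻¹ • (p j - q j))
        + 4 * τ * ip h M (fun j => Complex.I * N j) (dx2 h (fun j => (2 : ℝ)⁻¹ • (p j + q j)))
        - 4 * τ * ip h M (fun j => Complex.I * N j) B := by
  rw [crank_nicolson_identity hh hτ hM p0 p1 q0 q1 heq, ip_add_left]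
  have : ip h M N (fun j => (2 * τ)⁻¹ • (p j - q j))
      = - ip h M (fun j => Complex.I * N j) (dx2 h (fun j => (2 : ℝ)⁻¹ • (p j + q j)))
        + ip h M (fun j => Complex.I * N j) B := by
    unfold ip
    rw [← mul_neg, ← mul_add, ← Finset.sum_neg_distrib, ← Finset.sum_add_distrib]
    congr 1
    exact Finset.sum_congr rfl fun j hj => inner_dt_substitution (heq j hj)
  rw [this]; ring

/-- The identity behind the estimate of one step for the wave equation in a negative norm. -/
lemma wave_identity {h τ ε : ℝ} (hh : 0 < h) {M : ℕ} (hM : 1 ≤ M)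
    {W0 W1 W2 g0 g1 g2 φ η : ℕ → ℝ}
    (b0 : W0 0 = 0 ∧ W0 M = 0) (b1 : W1 0 = 0 ∧ W1 M = 0) (b2 : W2 0 = 0 ∧ W2 M = 0)
    (bφ : φ 0 = 0 ∧ φ M = 0)
    (h0 : ∀ j ∈ Finset.Ico 1 M, - dx2 h W0 j = g0 j)
    (h1 : ∀ j ∈ Finset.Ico 1 M, - dx2 h W1 j = g1 j)
    (h2 : ∀ j ∈ Finset.Ico 1 M, - dx2 h W2 j = g2 j)
    (heq : ∀ j ∈ Finset.Ico 1 M, ε ^ 2 * ((τ ^ 2)⁻¹ * (g2 j - 2 * g1 j + g0 j))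
      = dx2 h φ j + η j) :
    (ε / τ) ^ 2 * (l2dx h M (fun j => W2 j - W1 j) ^ 2 - l2dx h M (fun j => W1 j - W0 j) ^ 2)
      = - ip h M φ (fun j => g2 j - g0 j) + ip h M η (fun j => W2 j - W0 j) := by
  have e1 : ip h M (fun j => (ε / τ) ^ 2 * (g2 j - 2 * g1 j + g0 j)) (fun j => W2 j - W0 j)
      = ip h M (fun j => dx2 h φ j + η j) (fun j => W2 j - W0 j) := by
    refine ip_congr (fun j hj => ?_) fun _ _ => rfl
    rw [← heq j hj, div_pow]; ring
  have e2 : ip h M (fun j => (ε / τ) ^ 2 * (g2 j - 2 * g1 j + g0 j)) (fun j => W2 j - W0 j)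
      = (ε / τ) ^ 2 * (l2dx h M (fun j => W2 j - W1 j) ^ 2
          - l2dx h M (fun j => W1 j - W0 j) ^ 2) := by
    have := ip_smul_left h M ((ε / τ) ^ 2) (fun j => g2 j - 2 * g1 j + g0 j) (fun j => W2 j - W0 j)
    simp only [smul_eq_mul] at this
    rw [this]; congr 1
    have e3 : ip h M (fun j => g2 j - 2 * g1 j + g0 j) (fun j => W2 j - W0 j)
        = ip h M (fun j => - dx2 h (fun j => (W2 j - W1 j) - (W1 j - W0 j)) j)
          (fun j => (W2 j - W1 j) + (W1 j - W0 j)) := by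
      refine ip_congr (fun j hj => ?_) fun _ _ => by ring
      rw [dx2_sub h (fun j => W2 j - W1 j) (fun j => W1 j - W0 j), dx2_sub h W2 W1,
        dx2_sub h W1 W0, ← h0 j hj, ← h1 j hj, ← h2 j hj]; ring
    rw [e3, ip_neg_left, ip_dx2 hh hM _ _ (by simp [b0, b1, b2]) (by simp [b0, b1, b2]), neg_neg,
      ipd_add_right, ipd_sub_left h M (fun j => W2 j - W1 j) (fun j => W1 j - W0 j),
      ipd_sub_left h M (fun j => W2 j - W1 j) (fun j => W1 j - W0 j), ipd_self hh, ipd_self hh,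
      ipd_comm h M (fun j => W1 j - W0 j) (fun j => W2 j - W1 j)]
    ring
  have e3 : ip h M (dx2 h φ) (fun j => W2 j - W0 j) = - ip h M φ (fun j => g2 j - g0 j) := by
    rw [ip_dx2 hh hM _ _ (by simp [b0, b2]) (by simp [b0, b2]), ipd_comm,
      ← ip_dx2 hh hM _ _ bφ.1 bφ.2, ip_comm, ← ip_neg_right]
    refine ip_congr (fun _ _ => rfl) fun j hj => ?_
    rw [dx2_sub h W2 W0, ← h0 j hj, ← h2 j hj]; ring
  rw [← e2, e1, ip_add_left, e3]

lemma inner_density_identity {τ : ℝ} (hτ : 0 < τ) (xp xm up um : ℂ) :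
    4 * τ * inner ℝ ((2 : ℝ)⁻¹ • (up + um)) ((2 * τ)⁻¹ • ((xp - up) - (xm - um)))
      = ((‖xp‖ ^ 2 - ‖up‖ ^ 2) - (‖xm‖ ^ 2 - ‖um‖ ^ 2))
        - 4 * τ * inner ℝ ((2 : ℝ)⁻¹ • ((xp - up) + (xm - um))) ((2 * τ)⁻¹ • (xp - xm)) := by
  simp only [inner_smul_left, inner_smul_right, norm_sq_eq, Complex.inner]
  simp
  field_simp
  ring

end EnergyIdentities

section StabilityStep

lemma sqrt_le_of_le {L Λ : ℝ} (hΛ : 1 ≤ Λ) (hLΛ : L ≤ Λ) : √L ≤ Λ := by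
  refine (Real.sqrt_le_sqrt hLΛ).trans ?_
  rw [Real.sqrt_le_left (by linarith)]; nlinarith

lemma norm_smul_diff_le {V : Type*} [NormedAddCommGroup V] [NormedSpace ℝ V] (a a' : ℝ) (v v' : V) :
    ‖a' • v' - a • v‖ ≤ |a'| * ‖v' - v‖ + ‖v‖ * |a' - a| := by
  have : a' • v' - a • v = a' • (v' - v) + (a' - a) • v := by module
  rw [this]
  refine (norm_add_le _ _).trans ?_
  rw [norm_smul, norm_smul, Real.norm_eq_abs, Real.norm_eq_abs, mul_comm |a' - a|]

lemma l2dx_smul_le {V : Type*} [NormedAddCommGroup V] [InnerProductSpace ℝ V] {h : ℝ} (hh : 0 < h)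
    {M : ℕ} {a : ℕ → ℝ} {v : ℕ → V} {A B : ℝ} (hA : 0 ≤ A) (hB : 0 ≤ B) (ha : ∀ j ≤ M, |a j| ≤ A)
    (hv : ∀ j ≤ M, ‖v j‖ ≤ B) :
    l2dx h M (fun j => a j • v j) ≤ A * l2dx h M v + B * l2dx h M a := by
  refine l2dx_le_of_diff hh hA hB fun j hj => ?_
  refine (norm_smul_diff_le _ _ _ _).trans ?_
  rw [Real.norm_eq_abs]
  gcongr
  · exact ha _ hj
  · exact hv _ hj.le

lemma l2dx_normSq_le {h : ℝ} (hh : 0 < h) {M : ℕ} {u : ℕ → ℂ} {A : ℝ} (hA : 0 ≤ A)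
    (hu : ∀ j ≤ M, ‖u j‖ ≤ A) : l2dx h M (fun j => ‖u j‖ ^ 2) ≤ 2 * A * l2dx h M u := by
  have := l2dx_le_of_diff (z := fun j => ‖u j‖ ^ 2) (v := u) (u := u) (A := 2 * A) (B := 0) hh (M := M)
    (by positivity) le_rfl fun j hj => ?_
  · simpa using this
  · rw [zero_mul, add_zero, sq, sq, Real.norm_eq_abs]
    have h1 := abs_norm_sub_norm_le (u (j + 1)) (u j)
    have h2 := hu j hj.le
    have h3 := hu (j + 1) hj
    have : ‖u (j + 1)‖ * ‖u (j + 1)‖ - ‖u j‖ * ‖u j‖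
        = (‖u (j + 1)‖ + ‖u j‖) * (‖u (j + 1)‖ - ‖u j‖) := by ring
    rw [this, abs_mul, abs_of_nonneg (by positivity)]
    gcongr; linarith

lemma norm_sq_sub_eq_inner (x u : ℂ) : ‖x‖ ^ 2 - ‖u‖ ^ 2 = inner ℝ (x + u) (x - u) := by
  simp only [norm_sq_eq, Complex.inner]; simp; ring

lemma l2dx_density_le {h : ℝ} (hh : 0 < h) {M : ℕ} {X U : ℕ → ℂ} {A B : ℝ} (hA : 0 ≤ A) (hB : 0 ≤ B)
    (hX : ∀ j ≤ M, ‖X j + U j‖ ≤ A) (hE : ∀ j ≤ M, ‖X j - U j‖ ≤ B) :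
    l2dx h M (fun j => ‖X j‖ ^ 2 - ‖U j‖ ^ 2)
      ≤ A * l2dx h M (fun j => X j - U j) + B * l2dx h M (fun j => X j + U j) := by
  refine l2dx_le_of_diff hh hA hB fun j hj => ?_
  rw [norm_sq_sub_eq_inner, norm_sq_sub_eq_inner]
  have : inner ℝ (X (j + 1) + U (j + 1)) (X (j + 1) - U (j + 1)) - inner ℝ (X j + U j) (X j - U j)
      = inner ℝ (X (j + 1) + U (j + 1)) ((X (j + 1) - U (j + 1)) - (X j - U j))
        + inner ℝ ((X (j + 1) + U (j + 1)) - (X j + U j)) (X j - U j) := by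
    simp only [inner_sub_left, inner_sub_right]; ring
  rw [this, Real.norm_eq_abs]
  refine (abs_add_le _ _).trans ?_
  refine (add_le_add (abs_real_inner_le_norm _ _) (abs_real_inner_le_norm _ _)).trans ?_
  rw [mul_comm (‖(X (j + 1) + U (j + 1)) - (X j + U j)‖)]
  gcongr
  · exact hX _ hj
  · exact hE _ hj.le

lemma l2dx_density_le' {h L Λ Y : ℝ} (hh : 0 < h) {M : ℕ} (hL : h * M = L)
    (hΛ : 1 ≤ Λ) (hLΛ : L ≤ Λ) (hY : 0 ≤ Y) {X U : ℕ → ℂ} (X0 : X 0 = 0) (U0 : U 0 = 0)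
    (hX : ∀ j ≤ M, ‖X j‖ ≤ Λ) (hXd : ∀ j < M, ‖dxp h X j‖ ≤ Λ) (hU : l2dx h M U ≤ Λ)
    (hE : l2dx h M (fun j => X j - U j) ≤ Y) :
    l2dx h M (fun j => ‖X j‖ ^ 2 - ‖U j‖ ^ 2) ≤ 4 * Λ ^ 3 * Y := by
  have hs := sqrt_le_of_le hΛ hLΛ
  have hs0 := Real.sqrt_nonneg L
  have hU' : ∀ j ≤ M, ‖U j‖ ≤ Λ ^ 2 := fun j hj =>
    (norm_le_l2dx hh hL U U0 hj).trans (by rw [sq]; gcongr; exact l2dx_nonneg _ _ _)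
  have hE' : ∀ j ≤ M, ‖X j - U j‖ ≤ Λ * Y := fun j hj =>
    (norm_le_l2dx hh hL (fun j => X j - U j) (by simp [X0, U0]) hj).trans
      (by gcongr; exact l2dx_nonneg _ _ _)
  have hXl : l2dx h M X ≤ Λ ^ 2 := (l2dx_le_of_forall hh hL (by linarith) hXd).trans
    (by rw [sq]; gcongr)
  have h1 := l2dx_density_le (A := Λ + Λ ^ 2) (B := Λ * Y) hh (by positivity) (by positivity)
    (fun j hj => (norm_add_le _ _).trans (add_le_add (hX j hj) (hU' j hj))) hE'
  refine h1.trans ?_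
  have h2 := l2dx_add_le hh M X U
  have h3 : l2dx h M (fun j => X j + U j) ≤ Λ ^ 2 + Λ := by linarith
  calc _ ≤ (Λ + Λ ^ 2) * Y + Λ * Y * (Λ ^ 2 + Λ) := by gcongr
    _ = (Λ + 2 * Λ ^ 2 + Λ ^ 3) * Y := by ring
    _ ≤ 4 * Λ ^ 3 * Y := by
      gcongr
      have : Λ ≤ Λ ^ 3 := le_self_pow₀ hΛ (by norm_num)
      have : Λ ^ 2 ≤ Λ ^ 3 := pow_le_pow_right₀ hΛ (by norm_num)
      linarith

/-- The nonlinear terms of the error equation are bounded in `H¹` by the error. -/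
lemma l2dx_nonlinear_le {h L Λ Y : ℝ} (hh : 0 < h) {M : ℕ} (hL : h * M = L)
    (hΛ : 1 ≤ Λ) (hLΛ : L ≤ Λ) (hY : 0 ≤ Y) {X U w Z : ℕ → ℂ} {A H : ℕ → ℝ}
    (X0 : X 0 = 0) (U0 : U 0 = 0) (w0 : w 0 = 0)
    (hX : ∀ j ≤ M, ‖X j‖ ≤ Λ) (hXd : ∀ j < M, ‖dxp h X j‖ ≤ Λ) (hU : l2dx h M U ≤ Λ)
    (hE : l2dx h M (fun j => X j - U j) ≤ Y) (hw : l2dx h M w ≤ Y)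
    (hZ : ∀ j ≤ M, ‖Z j‖ ≤ Λ) (hZd : ∀ j < M, ‖dxp h Z j‖ ≤ Λ)
    (hA : ∀ j ≤ M, |A j| ≤ Λ) (hAd : ∀ j < M, ‖dxp h A j‖ ≤ Λ)
    (hH : ∀ j ≤ M, |H j| ≤ Λ) (hHd : ∀ j < M, ‖dxp h H j‖ ≤ Λ) :
    l2dx h M (fun j => (-‖U j‖ ^ 2 + H j + A j) • w j - (‖X j‖ ^ 2 - ‖U j‖ ^ 2) • Z j)
      ≤ 15 * Λ ^ 6 * Y := by
  have hs := sqrt_le_of_le hΛ hLΛ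
  have hs0 := Real.sqrt_nonneg L
  have hΛ0 : 0 < Λ := by linarith
  have hU' : ∀ j ≤ M, ‖U j‖ ≤ Λ ^ 2 := fun j hj =>
    (norm_le_l2dx hh hL U U0 hj).trans (by rw [sq]; gcongr; exact l2dx_nonneg _ _ _)
  have hw' : ∀ j ≤ M, ‖w j‖ ≤ Λ * Y := fun j hj =>
    (norm_le_l2dx hh hL w w0 hj).trans (by gcongr; exact l2dx_nonneg _ _ _)
  have hρ := l2dx_density_le' hh hL hΛ hLΛ hY X0 U0 hX hXd hU hE
  have hρ' : ∀ j ≤ M, |‖X j‖ ^ 2 - ‖U j‖ ^ 2| ≤ 4 * Λ ^ 4 * Y := by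
    intro j hj
    have := norm_le_l2dx hh hL (fun j => ‖X j‖ ^ 2 - ‖U j‖ ^ 2) (by simp [X0, U0]) hj
    rw [Real.norm_eq_abs] at this
    refine this.trans ?_
    calc _ ≤ Λ * (4 * Λ ^ 3 * Y) := by gcongr; exact l2dx_nonneg _ _ _
      _ = _ := by ring
  have hZl : l2dx h M Z ≤ Λ ^ 2 := (l2dx_le_of_forall hh hL (by linarith) hZd).trans
    (by rw [sq]; gcongr)
  have hAl : l2dx h M A ≤ Λ ^ 2 := (l2dx_le_of_forall hh hL (by linarith) hAd).trans
    (by rw [sq]; gcongr)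
  have hHl : l2dx h M H ≤ Λ ^ 2 := (l2dx_le_of_forall hh hL (by linarith) hHd).trans
    (by rw [sq]; gcongr)
  have hVs : ∀ j ≤ M, |-‖U j‖ ^ 2 + H j + A j| ≤ 3 * Λ ^ 4 := by
    intro j hj
    have h1 : ‖U j‖ ^ 2 ≤ (Λ ^ 2) ^ 2 := pow_le_pow_left₀ (norm_nonneg _) (hU' j hj) 2
    have h2 := abs_le.1 (hH j hj)
    have h3 := abs_le.1 (hA j hj)
    have h4 : Λ ≤ Λ ^ 4 := le_self_pow₀ hΛ (by norm_num)
    rw [abs_le]; constructor <;> nlinarith [sq_nonneg ‖U j‖]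
  have hVd : l2dx h M (fun j => -‖U j‖ ^ 2 + H j + A j) ≤ 4 * Λ ^ 3 := by
    have h1 := l2dx_normSq_le hh (A := Λ ^ 2) (by positivity) hU'
    have h2 := l2dx_add_le hh M (fun j => -‖U j‖ ^ 2 + H j) A
    have h3 := l2dx_sub_le hh M H (fun j => ‖U j‖ ^ 2)
    have h4 : (fun j => -‖U j‖ ^ 2 + H j) = fun j => H j - ‖U j‖ ^ 2 := by funext j; ring
    rw [h4] at h2
    refine h2.trans ?_
    have h5 : 2 * Λ ^ 2 * l2dx h M U ≤ 2 * Λ ^ 2 * Λ := by gcongr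
    have h6 : Λ ^ 2 ≤ Λ ^ 3 := pow_le_pow_right₀ hΛ (by norm_num)
    nlinarith
  have e1 := l2dx_smul_le hh (by positivity) (by positivity) hVs hw'
  have e2 := l2dx_smul_le hh (by positivity) (by positivity) hρ' hZ
  have e3 := l2dx_sub_le hh M (fun j => (-‖U j‖ ^ 2 + H j + A j) • w j)
    (fun j => (‖X j‖ ^ 2 - ‖U j‖ ^ 2) • Z j)
  calc _ ≤ _ := e3
    _ ≤ (3 * Λ ^ 4 * l2dx h M w + Λ * Y * l2dx h M (fun j => -‖U j‖ ^ 2 + H j + A j))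
      + (4 * Λ ^ 4 * Y * l2dx h M Z + Λ * l2dx h M (fun j => ‖X j‖ ^ 2 - ‖U j‖ ^ 2)) := add_le_add e1 e2
    _ ≤ (3 * Λ ^ 4 * Y + Λ * Y * (4 * Λ ^ 3)) + (4 * Λ ^ 4 * Y * Λ ^ 2 + Λ * (4 * Λ ^ 3 * Y)) := by
      gcongr
    _ = (11 * Λ ^ 4 + 4 * Λ ^ 6) * Y := by ring
    _ ≤ _ := by
      gcongr
      have : Λ ^ 4 ≤ Λ ^ 6 := pow_le_pow_right₀ hΛ (by norm_num)
      linarith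

/-- Pairing of a residual that need not vanish at the boundary with a second difference. -/
lemma abs_ip_dx2_residual_le {h L δ : ℝ} (hh : 0 < h) {m : ℕ} (hL : h * ((m + 1 : ℕ) : ℝ) = L)
    (hδ : 0 ≤ δ) {r w : ℕ → ℂ} (hr : ∀ j ∈ Finset.Ico 1 (m + 1), ‖r j‖ ≤ δ)
    (hrd : ∀ j ∈ Finset.Ico 1 m, ‖dxp h r j‖ ≤ δ) :
    |ip h (m + 1) r (dx2 h w)|
      ≤ √L * δ * l2dx h (m + 1) w + δ * (‖dxp h w 0‖ + ‖dxp h w m‖) := by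
  rcases m with _ | m
  · have : ip h (0 + 1) r (dx2 h w) = 0 := by simp [ip]
    rw [this, abs_zero]
    have := l2dx_nonneg h (0 + 1) w
    positivity
  rw [ip_dx2_of_interior hh]
  have h1 : ‖inner ℝ (r (m + 1)) (dxp h w (m + 1))‖ ≤ δ * ‖dxp h w (m + 1)‖ :=
    (norm_inner_le_norm _ _).trans
      (mul_le_mul_of_nonneg_right (hr _ (by simp)) (norm_nonneg _))
  have h2 : ‖inner ℝ (r 1) (dxp h w 0)‖ ≤ δ * ‖dxp h w 0‖ :=
    (norm_inner_le_norm _ _).trans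
      (mul_le_mul_of_nonneg_right (hr _ (by simp)) (norm_nonneg _))
  have h3 : |h * ∑ j ∈ Finset.range m, inner ℝ (dxp h r (j + 1)) (dxp h w (j + 1))|
      ≤ √L * δ * l2dx h (m + 1 + 1) w := by
    have e : h * ∑ j ∈ Finset.range m, inner ℝ (dxp h r (j + 1)) (dxp h w (j + 1))
        = ip h (m + 1) (dxp h r) (dxp h w) := by rw [ip, sum_Ico_one]
    rw [e]
    refine (abs_ip_le hh _ _ _).trans ?_
    have e1 : l2 h (m + 1) (dxp h w) ≤ l2dx h (m + 1 + 1) w := by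
      refine Real.sqrt_le_sqrt (mul_le_mul_of_nonneg_left ?_ hh.le)
      refine Finset.sum_le_sum_of_subset_of_nonneg (fun j hj => ?_) fun _ _ _ => by positivity
      simp at hj ⊢; omega
    have e2 : l2 h (m + 1) (dxp h r) ≤ √L * δ := by
      refine (l2_le_of_forall hh rfl hδ hrd).trans ?_
      refine mul_le_mul_of_nonneg_right (Real.sqrt_le_sqrt ?_) hδ
      rw [← hL]; push_cast; nlinarith
    exact mul_le_mul e2 e1 (l2_nonneg _ _ _) (by positivity)
  rw [Real.norm_eq_abs, abs_le] at h1 h2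
  rw [abs_le] at h3 ⊢
  constructor <;> linarith [h1.1, h1.2, h2.1, h2.2, h3.1, h3.2]

end StabilityStep

section StabilityStep

lemma l2_I_mul (h : ℝ) (M : ℕ) (u : ℕ → ℂ) : l2 h M (fun j => Complex.I * u j) = l2 h M u := by
  simp [l2]

lemma l2dx_I_mul (h : ℝ) (M : ℕ) (u : ℕ → ℂ) : l2dx h M (fun j => Complex.I * u j) = l2dx h M u := by
  have : ∀ j, dxp h (fun j => Complex.I * u j) j = Complex.I * dxp h u j := by
    intro j; simp only [dxp, ← mul_sub, mul_smul_comm]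
  simp [l2dx, this]

lemma boundary_young {Λ L δ Y τ x y : ℝ} (hΛ : 1 ≤ Λ) (hLΛ' : 1 ≤ Λ * L) (hδY : δ ≤ Y)
    (hτ : 0 < τ) (hx : 0 ≤ x) (hy : 0 ≤ y) :
    4 * τ * (δ * (x + y)) ≤ (2 * Λ ^ 2)⁻¹ * (τ * (L * (x ^ 2 + y ^ 2))) + 16 * Λ ^ 3 * τ * Y ^ 2 := by
  have hΛ0 : 0 < Λ := by linarith
  have hk : (2 * Λ ^ 3)⁻¹ ≤ (2 * Λ ^ 2)⁻¹ * L := by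
    rw [inv_mul_eq_div, le_div_iff₀ (by positivity), inv_mul_le_iff₀ (by positivity)]
    nlinarith [sq_nonneg Λ]
  have a : ∀ x : ℝ, 0 ≤ x → 4 * δ * x ≤ (2 * Λ ^ 2)⁻¹ * L * x ^ 2 + 8 * Λ ^ 3 * Y ^ 2 := by
    intro x hx
    have h2 : 0 ≤ (2 * Λ ^ 3)⁻¹ * (x - 4 * Λ ^ 3 * Y) ^ 2 := by positivity
    have h3 : (2 * Λ ^ 3)⁻¹ * (x - 4 * Λ ^ 3 * Y) ^ 2
      = (2 * Λ ^ 3)⁻¹ * x ^ 2 + 8 * Λ ^ 3 * Y ^ 2 - 4 * Y * x := by field_simp; ring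
    have h4 : 4 * δ * x ≤ 4 * Y * x := by gcongr
    linarith [mul_le_mul_of_nonneg_right hk (sq_nonneg x)]
  have h1 := mul_le_mul_of_nonneg_left (add_le_add (a x hx) (a y hy)) hτ.le
  linarith

set_option maxHeartbeats 1000000 in
/-- The increment of the energy of the error in one step of the scheme. -/
theorem energy_step {h L τ ε Λ δ Y : ℝ} (hh : 0 < h) (hτ : 0 < τ) (hε : 0 < ε) {m : ℕ}
    (hL : h * ((m + 1 : ℕ) : ℝ) = L) (hΛ : 1 ≤ Λ) (hLΛ : L ≤ Λ) (hLΛ' : 1 ≤ Λ * L)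
    (hδ : 0 ≤ δ) (hδY : δ ≤ Y)
    {e2 e0 w Wu dX N₀ r s : ℕ → ℂ} {f2 f0 φ ρ2 ρ0 : ℕ → ℝ} {η₁ η₂ W2 W1 W0 g1 : ℕ → ℝ}
    (hw : ∀ j, w j = (2 : ℝ)⁻¹ • (e2 j + e0 j)) (hφ : ∀ j, φ j = (2 : ℝ)⁻¹ * (f2 j + f0 j))
    (be2 : e2 0 = 0 ∧ e2 (m + 1) = 0) (be0 : e0 0 = 0 ∧ e0 (m + 1) = 0)
    (bf2 : f2 0 = 0 ∧ f2 (m + 1) = 0) (bf0 : f0 0 = 0 ∧ f0 (m + 1) = 0)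
    (bN : N₀ 0 = 0 ∧ N₀ (m + 1) = 0) (bs : s 0 = 0 ∧ s (m + 1) = 0)
    (bW2 : W2 0 = 0 ∧ W2 (m + 1) = 0) (bW1 : W1 0 = 0 ∧ W1 (m + 1) = 0)
    (bW0 : W0 0 = 0 ∧ W0 (m + 1) = 0)
    (heq : ∀ j ∈ Finset.Ico 1 (m + 1), Complex.I * ((2 * τ)⁻¹ • (e2 j - e0 j))
      = - dx2 h w j + (φ j • Wu j + (N₀ j + (r j + s j))))
    (hdens : ∀ j ∈ Finset.Ico 1 (m + 1), 4 * τ * inner ℝ (Wu j) ((2 * τ)⁻¹ • (e2 j - e0 j))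
      = (ρ2 j - ρ0 j) - 4 * τ * inner ℝ (w j) (dX j))
    (hW0 : ∀ j ∈ Finset.Ico 1 (m + 1), - dx2 h W0 j = f0 j - ρ0 j)
    (hW1 : ∀ j ∈ Finset.Ico 1 (m + 1), - dx2 h W1 j = g1 j)
    (hW2 : ∀ j ∈ Finset.Ico 1 (m + 1), - dx2 h W2 j = f2 j - ρ2 j)
    (hwave : ∀ j ∈ Finset.Ico 1 (m + 1),
      ε ^ 2 * ((τ ^ 2)⁻¹ * ((f2 j - ρ2 j) - 2 * g1 j + (f0 j - ρ0 j)))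
      = dx2 h φ j + (η₁ j + η₂ j))
    (hWu : ∀ j ≤ m + 1, ‖Wu j‖ ≤ Λ ^ 2) (hdX : ∀ j ∈ Finset.Ico 1 (m + 1), ‖dX j‖ ≤ Λ)
    (hN : l2dx h (m + 1) N₀ ≤ 15 * Λ ^ 6 * Y)
    (hr : ∀ j ∈ Finset.Ico 1 (m + 1), ‖r j‖ ≤ δ) (hrd : ∀ j ∈ Finset.Ico 1 m, ‖dxp h r j‖ ≤ δ)
    (hsd : ∀ j < m + 1, ‖dxp h s j‖ ≤ δ) (hη₁ : ∀ j ∈ Finset.Ico 1 (m + 1), |η₁ j| ≤ ε * δ)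
    (he2 : l2dx h (m + 1) e2 ≤ Y) (he0 : l2dx h (m + 1) e0 ≤ Y)
    (hf2 : l2 h (m + 1) f2 ≤ 2 * Y) (hf0 : l2 h (m + 1) f0 ≤ 2 * Y)
    (hD1 : ε / τ * l2dx h (m + 1) (fun j => W2 j - W1 j) ≤ Y)
    (hD0 : ε / τ * l2dx h (m + 1) (fun j => W1 j - W0 j) ≤ Y) :
    (l2dx h (m + 1) e2 ^ 2 + (ε / τ) ^ 2 * l2dx h (m + 1) (fun j => W2 j - W1 j) ^ 2
        + l2 h (m + 1) f2 ^ 2 / 2)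
      - (l2dx h (m + 1) e0 ^ 2 + (ε / τ) ^ 2 * l2dx h (m + 1) (fun j => W1 j - W0 j) ^ 2
        + l2 h (m + 1) f0 ^ 2 / 2)
      ≤ 300 * Λ ^ 9 * τ * Y ^ 2
        + (2 * Λ ^ 2)⁻¹ * (mform h L (m + 1) e2 e2 - mform h L (m + 1) e0 e0)
        + ip h (m + 1) η₂ (fun j => W2 j - W0 j) := by
  have hM : 1 ≤ m + 1 := by omega
  have hL0 : 0 < L := by rw [← hL]; positivity
  have hΛ0 : 0 < Λ := by linarith
  have hY : 0 ≤ Y := hδ.trans hδY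
  have hs := sqrt_le_of_le hΛ hLΛ
  have hs0 := Real.sqrt_nonneg L
  have hwf : w = fun j => (2 : ℝ)⁻¹ • (e2 j + e0 j) := funext hw
  have hφf : φ = fun j => (2 : ℝ)⁻¹ • (f2 j + f0 j) := funext hφ
  have w0 : w 0 = 0 := by rw [hw, be2.1, be0.1]; simp
  have w1 : w (m + 1) = 0 := by rw [hw, be2.2, be0.2]; simp
  have hwY : l2dx h (m + 1) w ≤ Y := by
    rw [hwf, l2dx_smul]
    have := l2dx_add_le hh (m + 1) e2 e0
    rw [abs_of_pos (by norm_num)]; linarith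
  have hφY : l2 h (m + 1) φ ≤ 2 * Y := by
    rw [hφf, l2_smul]
    have := l2_add_le hh (m + 1) f2 f0
    rw [abs_of_pos (by norm_num)]; linarith
  have hwn := l2dx_nonneg h (m + 1) w
  set B : ℕ → ℂ := fun j => φ j • Wu j with hB
  set N : ℕ → ℂ := fun j => N₀ j + (r j + s j) with hN'
  -- the three identities
  have id1 := crank_nicolson_identity' (B := B) (N := N) hh hτ hM be2.1 be2.2 be0.1 be0.2
    (by intro j hj; rw [← hwf]; exact heq j hj)
  rw [← hwf] at id1
  have id2 := wave_identity (ε := ε) (τ := τ) (η := fun j => η₁ j + η₂ j) hh hM bW0 bW1 bW2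
    (by rw [hφ, hφ, bf2.1, bf2.2, bf0.1, bf0.2]; simp) hW0 hW1 hW2 hwave
  have id3 : 4 * τ * ip h (m + 1) B (fun j => (2 * τ)⁻¹ • (e2 j - e0 j))
      = ip h (m + 1) φ (fun j => ρ2 j - ρ0 j) - 4 * τ * ip h (m + 1) (fun j => φ j • w j) dX := by
    unfold ip
    have : ∑ j ∈ Finset.Ico 1 (m + 1), 4 * τ * inner ℝ (B j) ((2 * τ)⁻¹ • (e2 j - e0 j))
        = ∑ j ∈ Finset.Ico 1 (m + 1), inner ℝ (φ j) (ρ2 j - ρ0 j)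
          - ∑ j ∈ Finset.Ico 1 (m + 1), 4 * τ * inner ℝ (φ j • w j) (dX j) := by
      rw [← Finset.sum_sub_distrib]
      refine Finset.sum_congr rfl fun j hj => ?_
      have := hdens j hj
      simp only [hB]
      rw [real_inner_smul_left, real_inner_smul_left, mul_left_comm, this]
      simp only [RCLike.inner_apply, conj_trivial]; ring
    rw [← Finset.mul_sum, ← Finset.mul_sum] at this
    linear_combination h * this
  have id4 : ip h (m + 1) φ (fun j => (f2 j - ρ2 j) - (f0 j - ρ0 j))
      = (l2 h (m + 1) f2 ^ 2 - l2 h (m + 1) f0 ^ 2) / 2 - ip h (m + 1) φ (fun j => ρ2 j - ρ0 j) := by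
    have : (fun j => (f2 j - ρ2 j) - (f0 j - ρ0 j)) = fun j => (f2 j - f0 j) - (ρ2 j - ρ0 j) := by
      funext j; ring
    rw [this, ip_sub_right h (m + 1) φ (fun j => f2 j - f0 j), hφf, ip_smul_left, ip_add_left,
      ip_sub_right, ip_sub_right, ip_self hh, ip_self hh, ip_comm h (m + 1) f0 f2]
    ring
  rw [ip_add_left] at id2
  -- bounds
  have t1 : |ip h (m + 1) (fun j => φ j • w j) dX| ≤ 2 * Λ ^ 3 * Y ^ 2 := by
    refine (abs_ip_le hh _ _ _).trans ?_
    have a1 : l2 h (m + 1) (fun j => φ j • w j) ≤ Λ * Y * (2 * Y) := by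
      have : l2 h (m + 1) (fun j => φ j • w j) ≤ l2 h (m + 1) (fun j => (Λ * Y) • φ j) := by
        refine l2_mono hh fun j hj => ?_
        rw [norm_smul, norm_smul, mul_comm, Real.norm_eq_abs (Λ * Y), abs_of_nonneg (by positivity)]
        refine mul_le_mul_of_nonneg_right ?_ (norm_nonneg _)
        exact (norm_le_l2dx hh hL w w0 (Finset.mem_Ico.1 hj).2.le).trans (by gcongr)
      refine this.trans ?_
      rw [l2_smul, abs_of_nonneg (by positivity)]; gcongr
    have a2 : l2 h (m + 1) dX ≤ Λ * Λ :=
      (l2_le_of_forall hh hL hΛ0.le hdX).trans (by gcongr)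
    calc _ ≤ (Λ * Y * (2 * Y)) * (Λ * Λ) := mul_le_mul a1 a2 (l2_nonneg _ _ _) (by positivity)
      _ = _ := by ring
  have hsl : l2dx h (m + 1) s ≤ Λ * Y :=
    (l2dx_le_of_forall hh hL hδ hsd).trans (by gcongr)
  have p67 : Λ ^ 6 ≤ Λ ^ 7 := pow_le_pow_right₀ hΛ (by norm_num)
  have p16 : Λ ≤ Λ ^ 6 := le_self_pow₀ hΛ (by norm_num)
  have p17 : Λ ≤ Λ ^ 7 := le_self_pow₀ hΛ (by norm_num)
  have p27 : Λ ^ 2 ≤ Λ ^ 7 := pow_le_pow_right₀ hΛ (by norm_num)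
  have hns : l2dx h (m + 1) (fun j => N₀ j + s j) ≤ 16 * Λ ^ 6 * Y := by
    refine (l2dx_add_le hh (m + 1) N₀ s).trans ?_
    linarith [mul_le_mul_of_nonneg_right p16 hY]
  have hrl : l2 h (m + 1) r ≤ Λ * Y := (l2_le_of_forall hh hL hδ hr).trans (by gcongr)
  have hNl : l2 h (m + 1) N ≤ 17 * Λ ^ 7 * Y := by
    have a1 : N = fun j => (N₀ j + s j) + r j := by funext j; simp only [hN']; ring
    rw [a1]
    refine (l2_add_le hh (m + 1) (fun j => N₀ j + s j) r).trans ?_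
    have a2 := l2_le_l2dx hh hL (fun j => N₀ j + s j) (by simp [bN.1, bs.1])
    have a3 : L * l2dx h (m + 1) (fun j => N₀ j + s j) ≤ Λ * (16 * Λ ^ 6 * Y) := by
      gcongr; exact l2dx_nonneg _ _ _
    have a4 : Λ * (16 * Λ ^ 6 * Y) = 16 * (Λ ^ 7 * Y) := by ring
    linarith [mul_le_mul_of_nonneg_right p17 hY]
  have hBl : l2 h (m + 1) B ≤ 2 * Λ ^ 2 * Y := by
    have : l2 h (m + 1) B ≤ l2 h (m + 1) (fun j => (Λ ^ 2) • φ j) := by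
      refine l2_mono hh fun j hj => ?_
      simp only [hB]
      rw [norm_smul, norm_smul, mul_comm, Real.norm_eq_abs (Λ ^ 2), abs_of_nonneg (by positivity)]
      exact mul_le_mul_of_nonneg_right (hWu j (Finset.mem_Ico.1 hj).2.le) (norm_nonneg _)
    refine this.trans ?_
    rw [l2_smul, abs_of_nonneg (by positivity)]
    calc _ ≤ Λ ^ 2 * (2 * Y) := by gcongr
      _ = _ := by ring
  have t2 : |ip h (m + 1) (fun j => Complex.I * N j) (dx2 h w)|
      ≤ 17 * Λ ^ 6 * Y ^ 2 + δ * (‖dxp h w 0‖ + ‖dxp h w m‖) := by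
    have a1 : (fun j => Complex.I * N j)
        = fun j => Complex.I * (N₀ j + s j) + Complex.I * r j := by
      funext j; simp only [hN']; ring
    rw [a1, ip_add_left]
    have a2 : |ip h (m + 1) (fun j => Complex.I * (N₀ j + s j)) (dx2 h w)| ≤ 16 * Λ ^ 6 * Y * Y := by
      rw [ip_comm, ip_dx2 hh hM _ _ (by simp [bN.1, bs.1]) (by simp [bN.2, bs.2]), abs_neg]
      refine (abs_ipd_le hh _ _ _).trans ?_
      rw [l2dx_I_mul, mul_comm]
      gcongr
    have a3 := abs_ip_dx2_residual_le (w := w) hh hL hδ (r := fun j => Complex.I * r j)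
      (by simpa using hr) (by
        intro j hj
        have : dxp h (fun j => Complex.I * r j) j = Complex.I * dxp h r j := by
          simp only [dxp, ← mul_sub, mul_smul_comm]
        rw [this, norm_mul, Complex.norm_I, one_mul]; exact hrd j hj)
    have a4 : √L * δ * l2dx h (m + 1) w ≤ Λ ^ 6 * Y ^ 2 := by
      calc _ ≤ Λ * Y * Y := by gcongr
        _ ≤ Λ ^ 6 * Y * Y := by gcongr
        _ = _ := by ring
    refine (abs_add_le _ _).trans ?_
    have a5 : 16 * Λ ^ 6 * Y * Y = 16 * (Λ ^ 6 * Y ^ 2) := by ring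
    linarith
  have t3 : |ip h (m + 1) (fun j => Complex.I * N j) B| ≤ 34 * Λ ^ 9 * Y ^ 2 := by
    refine (abs_ip_le hh _ _ _).trans ?_
    rw [l2_I_mul]
    calc _ ≤ (17 * Λ ^ 7 * Y) * (2 * Λ ^ 2 * Y) :=
          mul_le_mul hNl hBl (l2_nonneg _ _ _) (by positivity)
      _ = _ := by ring
  have t4 : |ip h (m + 1) η₁ (fun j => W2 j - W0 j)| ≤ 2 * Λ ^ 2 * τ * Y ^ 2 := by
    refine (abs_ip_le hh _ _ _).trans ?_
    have a1 : l2 h (m + 1) η₁ ≤ Λ * (ε * Y) :=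
      (l2_le_of_forall hh hL (by positivity) hη₁).trans (by gcongr)
    have a2 := l2_le_l2dx hh hL (fun j => W2 j - W0 j) (by simp [bW2.1, bW0.1])
    have a3 : l2dx h (m + 1) (fun j => W2 j - W0 j) ≤ 2 * Y * (τ / ε) := by
      have := l2dx_add_le hh (m + 1) (fun j => W2 j - W1 j) (fun j => W1 j - W0 j)
      simp only [sub_add_sub_cancel] at this
      refine this.trans ?_
      rw [div_mul_eq_mul_div, div_le_iff₀ hτ] at hD1 hD0
      rw [mul_div_assoc', le_div_iff₀ hε]
      linarith
    calc _ ≤ (Λ * (ε * Y)) * (Λ * (2 * Y * (τ / ε))) := by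
          refine mul_le_mul a1 (a2.trans ?_) (l2_nonneg _ _ _) (by positivity)
          exact mul_le_mul hLΛ a3 (l2dx_nonneg _ _ _) hΛ0.le
      _ = _ := by field_simp
  -- hidden regularity
  have hRl : l2 h (m + 1) (fun j => B j + N j) ≤ 19 * Λ ^ 7 * Y := by
    refine (l2_add_le hh (m + 1) B N).trans ?_
    linarith [mul_le_mul_of_nonneg_right p27 hY]
  have hid := boundary_derivative_le hh hτ hL e2 e0 (fun j => B j + N j) be2.1 be2.2 be0.1 be0.2 w hw heq
  have hid2 : τ * (2 * l2dx h (m + 1) w ^ 2 + 6 * (l2dx h (m + 1) w * l2dx h (m + 1) e0)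
          + 4 * L * (l2 h (m + 1) (fun j => B j + N j) * l2dx h (m + 1) e0)
          + 2 * L * (l2 h (m + 1) (fun j => B j + N j) * l2dx h (m + 1) w))
      ≤ 122 * Λ ^ 8 * τ * Y ^ 2 := by
    have b0 := l2dx_nonneg h (m + 1) e0
    have bR := l2_nonneg h (m + 1) (fun j => B j + N j)
    calc _ ≤ τ * (2 * Y ^ 2 + 6 * (Y * Y) + 4 * Λ * ((19 * Λ ^ 7 * Y) * Y)
          + 2 * Λ * ((19 * Λ ^ 7 * Y) * Y)) := by gcongr
      _ = (8 + 114 * Λ ^ 8) * (τ * Y ^ 2) := by ring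
      _ ≤ (122 * Λ ^ 8) * (τ * Y ^ 2) := by
        have : 1 ≤ Λ ^ 8 := one_le_pow₀ hΛ
        gcongr; linarith
      _ = _ := by ring
  have hbd : 4 * τ * (δ * (‖dxp h w 0‖ + ‖dxp h w m‖))
      ≤ (2 * Λ ^ 2)⁻¹ * (τ * (L * (‖dxp h w 0‖ ^ 2 + ‖dxp h w m‖ ^ 2))) + 16 * Λ ^ 3 * τ * Y ^ 2 := by
    exact boundary_young hΛ hLΛ' hδY hτ (norm_nonneg _) (norm_nonneg _)
  have hid3 := mul_le_mul_of_nonneg_left (hid.trans (add_le_add_right hid2 _))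
    (show 0 ≤ (2 * Λ ^ 2)⁻¹ by positivity)
  have hid4 : (2 * Λ ^ 2)⁻¹ * (122 * Λ ^ 8 * τ * Y ^ 2) = 61 * Λ ^ 6 * τ * Y ^ 2 := by
    field_simp; ring
  -- conclusion
  have p69 : Λ ^ 6 ≤ Λ ^ 9 := pow_le_pow_right₀ hΛ (by norm_num)
  have p39 : Λ ^ 3 ≤ Λ ^ 9 := pow_le_pow_right₀ hΛ (by norm_num)
  have p29 : Λ ^ 2 ≤ Λ ^ 9 := pow_le_pow_right₀ hΛ (by norm_num)
  have hZ : 0 ≤ τ * Y ^ 2 := by positivity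
  have hZ9 : 0 ≤ Λ ^ 9 * (τ * Y ^ 2) := by positivity
  have q69 := mul_le_mul_of_nonneg_right p69 hZ
  have q39 := mul_le_mul_of_nonneg_right p39 hZ
  have q29 := mul_le_mul_of_nonneg_right p29 hZ
  have u1 := mul_le_mul_of_nonneg_left (abs_le.1 t1).2 (show 0 ≤ 4 * τ by positivity)
  have u2 := mul_le_mul_of_nonneg_left (abs_le.1 t2).2 (show 0 ≤ 4 * τ by positivity)
  have u3 := mul_le_mul_of_nonneg_left (abs_le.1 t3).1 (show 0 ≤ 4 * τ by positivity)
  have u4 := (abs_le.1 t4).2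
  rw [mul_add _ (mform h L (m + 1) e2 e2 - mform h L (m + 1) e0 e0)] at hid3
  linarith

end StabilityStep

section Stability

/-- The discrete Gronwall argument for an energy modified by two small corrections. -/
lemma modified_gronwall {n : ℕ} {En B Z : ℕ → ℝ} {c D τ δ : ℝ} (hc : 0 ≤ c) (hτ : 0 < τ)
    (hcτ : 4 * c * τ ≤ 1) (hE : ∀ k < n, 0 ≤ En k) (hB : ∀ k < n, |B k| ≤ En k / 4)
    (hZ : ∀ k < n, |Z k| ≤ En k / 4 + D * δ ^ 2)
    (hstep : ∀ l, l + 1 < n → En (l + 1) - En l ≤ c * τ * (En (l + 1) + En l + δ ^ 2)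
      + (B (l + 1) - B l) + (Z (l + 1) - Z l)) {k : ℕ} (hk : k < n) :
    En k ≤ 2 * (Real.exp (8 * c * (k * τ)) * (3 / 2 * En 0 + (2 * D + 1) * δ ^ 2)) := by
  set X : ℕ → ℝ := fun k => En k - B k - Z k + (D + 1) * δ ^ 2 with hX
  have hlow : ∀ k < n, En k / 2 + δ ^ 2 ≤ X k := fun k hk => by
    have h1 := (abs_le.1 (hB k hk)).2
    have h2 := (abs_le.1 (hZ k hk)).2
    simp only [hX]; linarith
  have hup : X 0 ≤ 3 / 2 * En 0 + (2 * D + 1) * δ ^ 2 := by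
    have h1 := (abs_le.1 (hB 0 (by omega))).1
    have h2 := (abs_le.1 (hZ 0 (by omega))).1
    simp only [hX]; linarith
  have hpos : ∀ k < n, 0 ≤ X k := fun k hk => by
    have := hlow k hk; have := hE k hk; have := sq_nonneg δ; linarith
  have hmain : ∀ k < n, X k ≤ Real.exp (8 * c * (k * τ)) * X 0 := by
    intro k
    induction k with
    | zero => intro _; simp
    | succ l ih =>
      intro hl
      have h0 := ih (by omega)
      have h1 := hstep l hl
      have h2 := hlow l (by omega)
      have h3 := hlow (l + 1) hl
      have h4 := hpos l (by omega)
      have h5 := hpos (l + 1) hl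
      have hct : 0 ≤ c * τ := by positivity
      have h6 : X (l + 1) - X l ≤ 2 * (c * τ) * (X (l + 1) + X l) := by
        have : c * τ * (En (l + 1) + En l + δ ^ 2) ≤ c * τ * (2 * (X (l + 1) + X l)) :=
          mul_le_mul_of_nonneg_left (by have := sq_nonneg δ; linarith) hct
        have e : X (l + 1) - X l = En (l + 1) - En l - (B (l + 1) - B l) - (Z (l + 1) - Z l) := by
          simp only [hX]; ring
        linarith
      have h7 : X (l + 1) ≤ (1 + 8 * (c * τ)) * X l := by
        nlinarith [mul_nonneg hct h5, mul_nonneg hct h4]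
      have h8 := Real.add_one_le_exp (8 * (c * τ))
      have h9 : Real.exp (8 * c * ((l + 1 : ℕ) * τ))
          = Real.exp (8 * (c * τ)) * Real.exp (8 * c * (l * τ)) := by
        rw [← Real.exp_add]; congr 1; push_cast; ring
      rw [h9, mul_assoc]
      calc X (l + 1) ≤ (1 + 8 * (c * τ)) * X l := h7
        _ ≤ Real.exp (8 * (c * τ)) * X l := by gcongr; linarith
        _ ≤ _ := by gcongr
  have h1 := hlow k hk
  have h2 := hmain k hk
  have h3 : Real.exp (8 * c * (k * τ)) * X 0
      ≤ Real.exp (8 * c * (k * τ)) * (3 / 2 * En 0 + (2 * D + 1) * δ ^ 2) := by gcongr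
  have := sq_nonneg δ
  linarith

/-- `(U, P)` solves the scheme with potential `H` on the levels `0, …, n`, and `(X, Y)` solves it up
to residuals of size `δ`; both agree initially up to `δ`. -/
structure Comparison (h τ ε Λ δ : ℝ) (M n : ℕ) (X U : ℕ → ℕ → ℂ) (Y P H : ℕ → ℕ → ℝ)
    (r s : ℕ → ℕ → ℂ) (η₁ η₂ : ℕ → ℕ → ℝ) : Prop where
  bdry_X : ∀ k ≤ n, X k 0 = 0 ∧ X k M = 0
  bdry_U : ∀ k ≤ n, U k 0 = 0 ∧ U k M = 0
  bdry_Y : ∀ k ≤ n, Y k 0 = 0 ∧ Y k M = 0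
  bdry_P : ∀ k ≤ n, P k 0 = 0 ∧ P k M = 0
  norm_X : ∀ k ≤ n, ∀ j ≤ M, ‖X k j‖ ≤ Λ
  dxp_X : ∀ k ≤ n, ∀ j < M, ‖dxp h (X k) j‖ ≤ Λ
  dt_X : ∀ l, l + 2 ≤ n → ∀ j ∈ Finset.Ico 1 M, ‖dt τ X (l + 1) j‖ ≤ Λ
  norm_Y : ∀ k ≤ n, ∀ j ≤ M, |Y k j| ≤ Λ
  dxp_Y : ∀ k ≤ n, ∀ j < M, ‖dxp h (Y k) j‖ ≤ Λ
  norm_H : ∀ l, l + 2 ≤ n → ∀ j ≤ M, |H (l + 1) j| ≤ Λ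
  dxp_H : ∀ l, l + 2 ≤ n → ∀ j < M, ‖dxp h (H (l + 1)) j‖ ≤ Λ
  norm_U : ∀ k ≤ n, l2dx h M (U k) ≤ Λ
  eq_U : ∀ l, l + 2 ≤ n → ∀ j ∈ Finset.Ico 1 M, Complex.I * dt τ U (l + 1) j
    = - dx2 h (avg U (l + 1)) j
      + ((-‖U (l + 1) j‖ ^ 2 + H (l + 1) j + avg P (l + 1) j : ℝ) : ℂ) * avg U (l + 1) j
  eq_X : ∀ l, l + 2 ≤ n → ∀ j ∈ Finset.Ico 1 M, Complex.I * dt τ X (l + 1) j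
    = - dx2 h (avg X (l + 1)) j
      + ((-‖X (l + 1) j‖ ^ 2 + H (l + 1) j + avg Y (l + 1) j : ℝ) : ℂ) * avg X (l + 1) j
      + (r (l + 1) j + s (l + 1) j)
  eq_P : ∀ l, l + 2 ≤ n → ∀ j ∈ Finset.Ico 1 M, ε ^ 2 * dt2 τ P (l + 1) j
    = dx2 h (avg P (l + 1)) j + ε ^ 2 * dt2 τ (fun k i => ‖U k i‖ ^ 2) (l + 1) j
  eq_Y : ∀ l, l + 2 ≤ n → ∀ j ∈ Finset.Ico 1 M, ε ^ 2 * dt2 τ Y (l + 1) j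
    = dx2 h (avg Y (l + 1)) j + ε ^ 2 * dt2 τ (fun k i => ‖X k i‖ ^ 2) (l + 1) j
      + (η₁ (l + 1) j + η₂ (l + 1) j)
  norm_r : ∀ l, l + 2 ≤ n → ∀ j ∈ Finset.Ico 1 M, ‖r (l + 1) j‖ ≤ δ
  dxp_r : ∀ l, l + 2 ≤ n → ∀ j ∈ Finset.Ico 1 (M - 1), ‖dxp h (r (l + 1)) j‖ ≤ δ
  bdry_s : ∀ l, l + 2 ≤ n → s (l + 1) 0 = 0 ∧ s (l + 1) M = 0
  dxp_s : ∀ l, l + 2 ≤ n → ∀ j < M, ‖dxp h (s (l + 1)) j‖ ≤ δ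
  norm_η₁ : ∀ l, l + 2 ≤ n → ∀ j ∈ Finset.Ico 1 M, |η₁ (l + 1) j| ≤ ε * δ
  norm_η₂ : ∀ k, k + 1 ≤ n → ∀ j ∈ Finset.Ico 1 M, |η₂ k j| ≤ δ
  diff_η₂ : ∀ l, l + 2 ≤ n → ∀ j ∈ Finset.Ico 1 M, |η₂ (l + 1) j - η₂ l j| ≤ τ * δ
  init_X : ∀ j ≤ M, X 0 j = U 0 j
  init_Y : ∀ j ≤ M, Y 0 j = P 0 j
  first_X : 1 ≤ n → l2dx h M (fun j => X 1 j - U 1 j) ≤ δ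
  first_Y : 1 ≤ n → l2 h M (fun j => Y 1 j - P 1 j) ≤ δ
  first_g : 1 ≤ n → ε / τ * l2 h M (fun j => (Y 1 j - P 1 j) - (‖X 1 j‖ ^ 2 - ‖U 1 j‖ ^ 2)) ≤ δ

lemma error_equation {h τ : ℝ} {X U : ℕ → ℕ → ℂ} {Y P H : ℕ → ℕ → ℝ} {R : ℂ} {l j : ℕ}
    (hU : Complex.I * dt τ U (l + 1) j = - dx2 h (avg U (l + 1)) j
      + ((-‖U (l + 1) j‖ ^ 2 + H (l + 1) j + avg P (l + 1) j : ℝ) : ℂ) * avg U (l + 1) j)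
    (hX : Complex.I * dt τ X (l + 1) j = - dx2 h (avg X (l + 1)) j
      + ((-‖X (l + 1) j‖ ^ 2 + H (l + 1) j + avg Y (l + 1) j : ℝ) : ℂ) * avg X (l + 1) j + R) :
    Complex.I * ((2 * τ)⁻¹ • ((X (l + 2) j - U (l + 2) j) - (X l j - U l j)))
      = - dx2 h (fun j => (2 : ℝ)⁻¹ • ((X (l + 2) j - U (l + 2) j) + (X l j - U l j))) j
        + (((2 : ℝ)⁻¹ * ((Y (l + 2) j - P (l + 2) j) + (Y l j - P l j))) • avg U (l + 1) j
          + (((-‖U (l + 1) j‖ ^ 2 + H (l + 1) j + avg Y (l + 1) j) •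
              ((2 : ℝ)⁻¹ • ((X (l + 2) j - U (l + 2) j) + (X l j - U l j)))
            - (‖X (l + 1) j‖ ^ 2 - ‖U (l + 1) j‖ ^ 2) • avg X (l + 1) j) + R)) := by
  have e1 : (fun j => (2 : ℝ)⁻¹ • ((X (l + 2) j - U (l + 2) j) + (X l j - U l j)))
      = fun j => avg X (l + 1) j - avg U (l + 1) j := by
    funext j; simp only [avg, Nat.add_sub_cancel]; module
  have e2 : (2 : ℝ)⁻¹ • ((X (l + 2) j - U (l + 2) j) + (X l j - U l j))
      = avg X (l + 1) j - avg U (l + 1) j := congrFun e1 j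
  have e3 : (2 * τ)⁻¹ • ((X (l + 2) j - U (l + 2) j) - (X l j - U l j))
      = dt τ X (l + 1) j - dt τ U (l + 1) j := by
    simp only [dt, Nat.add_sub_cancel]; module
  have e4 : (2 : ℝ)⁻¹ * ((Y (l + 2) j - P (l + 2) j) + (Y l j - P l j))
      = avg Y (l + 1) j - avg P (l + 1) j := by
    simp only [avg, Nat.add_sub_cancel, smul_eq_mul]; ring
  rw [e2, e1, e3, e4, dx2_sub]
  simp only [Complex.real_smul]
  push_cast at hU hX ⊢
  linear_combination hX - hU

lemma le_of_sq_le_mul {x A c : ℝ} (hA : 0 ≤ A) (hc : 0 ≤ c) (h : x ^ 2 ≤ c ^ 2 * A) :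
    x ≤ c * √A := by
  refine abs_le_of_sq_le_sq' ?_ (by positivity) |>.2
  rw [mul_pow, Real.sq_sqrt hA]; exact h

end Stability

section Stability

lemma l2dx_potential_le {h L : ℝ} (hh : 0 < h) {M : ℕ} (hM : 1 ≤ M) (hL : h * M = L)
    {W g : ℕ → ℝ} (b : W 0 = 0 ∧ W M = 0) (hW : ∀ j ∈ Finset.Ico 1 M, - dx2 h W j = g j) :
    l2dx h M W ≤ L * l2 h M g := by
  have hL0 : 0 ≤ L := by rw [← hL]; positivity
  have h1 : l2dx h M W ^ 2 = ip h M g W := by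
    have := ip_dx2 hh hM W W b.1 b.2
    rw [ipd_self hh] at this
    rw [← neg_eq_iff_eq_neg] at this
    rw [← this, ← ip_neg_left]
    exact ip_congr hW fun _ _ => rfl
  have h2 := (le_abs_self _).trans (abs_ip_le hh M g W)
  have h3 := l2_le_l2dx hh hL W b.1
  have h4 := l2dx_nonneg h M W
  have h5 := l2_nonneg h M g
  have h6 : l2dx h M W ^ 2 ≤ (L * l2 h M g) * l2dx h M W := by
    rw [h1]; nlinarith [mul_le_mul_of_nonneg_left h3 h5]
  rcases h4.eq_or_lt with h0 | h0
  · rw [← h0]; positivity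
  · rw [sq] at h6; exact le_of_mul_le_mul_right h6 h0

set_option maxHeartbeats 1000000 in
/-- Stability of the scheme: the distance of a solution to an approximate solution is bounded by the
residuals and the initial distance, uniformly in `ε` and in the mesh sizes. -/
theorem Comparison.error_le {h L T τ ε Λ δ : ℝ} {M n : ℕ} {X U : ℕ → ℕ → ℂ}
    {Y P H : ℕ → ℕ → ℝ} {r s : ℕ → ℕ → ℂ} {η₁ η₂ : ℕ → ℕ → ℝ}
    (hC : Comparison h τ ε Λ δ M n X U Y P H r s η₁ η₂) (hh : 0 < h) (hτ : 0 < τ) (hε : 0 < ε)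
    (hM : 1 ≤ M) (hL : h * M = L) (hΛ : 1 ≤ Λ) (hLΛ : L ≤ Λ) (hLΛ' : 1 ≤ Λ * L) (hδ : 0 ≤ δ)
    (hτΛ : 4 * (312 * Λ ^ 9) * τ ≤ 1) (hn : n * τ ≤ T) {k : ℕ} (hk : k ≤ n) :
    l2dx h M (fun j => X k j - U k j) ≤ √(2 * (Real.exp (8 * (312 * Λ ^ 9) * T) * 500 * Λ ^ 14)) * δ ∧
    l2 h M (fun j => Y k j - P k j)
      ≤ 2 * √(2 * (Real.exp (8 * (312 * Λ ^ 9) * T) * 500 * Λ ^ 14)) * δ := by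
  obtain ⟨m, rfl⟩ := Nat.exists_eq_add_of_le' hM
  set M := m + 1 with hMdef
  have hΛ0 : 0 < Λ := by linarith
  have hL0 : 0 < L := by rw [← hL]; positivity
  have hs := sqrt_le_of_le hΛ hLΛ
  set e : ℕ → ℕ → ℂ := fun k j => X k j - U k j with he
  set f : ℕ → ℕ → ℝ := fun k j => Y k j - P k j with hf
  set ρ : ℕ → ℕ → ℝ := fun k j => ‖X k j‖ ^ 2 - ‖U k j‖ ^ 2 with hρ
  have be : ∀ k ≤ n, e k 0 = 0 ∧ e k M = 0 := fun k hk => by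
    simp [he, hC.bdry_X k hk, hC.bdry_U k hk]
  have bf : ∀ k ≤ n, f k 0 = 0 ∧ f k M = 0 := fun k hk => by
    simp [hf, hC.bdry_Y k hk, hC.bdry_P k hk]
  choose W bW0 bW1 hW using fun k => exists_dx2_eq hh hM (fun j => f k j - ρ k j)
  set En : ℕ → ℝ := fun k => l2dx h M (e (k + 1)) ^ 2 + l2dx h M (e k) ^ 2
    + (ε / τ) ^ 2 * l2dx h M (fun j => W (k + 1) j - W k j) ^ 2
    + (l2 h M (f (k + 1)) ^ 2 + l2 h M (f k) ^ 2) / 2 with hEn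
  have hE0 : ∀ k, 0 ≤ En k := fun k => by positivity
  -- consequences of the energy
  have c1 : ∀ k A, En k ≤ A → l2dx h M (e (k + 1)) ≤ √A ∧ l2dx h M (e k) ≤ √A
      ∧ l2 h M (f (k + 1)) ≤ 2 * √A ∧ l2 h M (f k) ≤ 2 * √A
      ∧ ε / τ * l2dx h M (fun j => W (k + 1) j - W k j) ≤ √A := by
    intro k A hA
    have hA0 := (hE0 k).trans hA
    simp only [hEn] at hA
    have p1 := sq_nonneg (l2dx h M (e (k + 1)))
    have p2 := sq_nonneg (l2dx h M (e k))
    have p3 := sq_nonneg (l2 h M (f (k + 1)))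
    have p4 := sq_nonneg (l2 h M (f k))
    have p5 : 0 ≤ (ε / τ) ^ 2 * l2dx h M (fun j => W (k + 1) j - W k j) ^ 2 := by positivity
    refine ⟨?_, ?_, le_of_sq_le_mul hA0 (by norm_num) (by linarith),
      le_of_sq_le_mul hA0 (by norm_num) (by linarith), ?_⟩
    · exact Real.le_sqrt_of_sq_le (by linarith)
    · exact Real.le_sqrt_of_sq_le (by linarith)
    · exact Real.le_sqrt_of_sq_le (by rw [mul_pow]; linarith)
  have c2 : ∀ k ≤ n, ∀ A, 0 ≤ A → l2dx h M (e k) ≤ A → l2 h M (f k) ≤ 2 * A →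
      l2 h M (W k) ≤ 6 * Λ ^ 6 * A := by
    intro k hk A hA h1 h2
    have d1 := l2dx_density_le' hh hL hΛ hLΛ hA (hC.bdry_X k hk).1 (hC.bdry_U k hk).1
      (hC.norm_X k hk) (hC.dxp_X k hk) (hC.norm_U k hk) h1
    have d2 := l2_le_l2dx hh hL (ρ k) (by simp [hρ, hC.bdry_X k hk, hC.bdry_U k hk])
    have d3 := l2_sub_le hh M (f k) (ρ k)
    have d4 := l2dx_potential_le hh hM hL ⟨bW0 k, bW1 k⟩ (hW k)
    have d5 := l2_le_l2dx hh hL (W k) (bW0 k)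
    have d6 : l2 h M (ρ k) ≤ Λ * (4 * Λ ^ 3 * A) := d2.trans (by gcongr; exact l2dx_nonneg _ _ _)
    have p4 : 1 ≤ Λ ^ 4 := one_le_pow₀ hΛ
    have d7 : l2 h M (fun j => f k j - ρ k j) ≤ 6 * Λ ^ 4 * A := by
      have := mul_le_mul_of_nonneg_right p4 hA
      linarith
    calc l2 h M (W k) ≤ Λ * (Λ * (6 * Λ ^ 4 * A)) := by
          refine d5.trans (mul_le_mul hLΛ (d4.trans ?_) (l2dx_nonneg _ _ _) hΛ0.le)
          exact mul_le_mul hLΛ d7 (l2_nonneg _ _ _) hΛ0.le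
      _ = _ := by ring
  set Bf : ℕ → ℝ := fun k => (2 * Λ ^ 2)⁻¹ * (mform h L M (e (k + 1)) (e (k + 1))
    + mform h L M (e k) (e k)) with hBf
  set Z : ℕ → ℝ := fun k => ip h M (η₂ k) (fun j => W (k + 1) j + W k j) with hZ
  have hB : ∀ k < n, |Bf k| ≤ En k / 4 := by
    intro k hk
    have a1 := abs_mform_le hh hL (e (k + 1)) (be (k + 1) (by omega)).1
    have a2 := abs_mform_le hh hL (e k) (be k (by omega)).1
    have a3 : |mform h L M (e (k + 1)) (e (k + 1)) + mform h L M (e k) (e k)|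
        ≤ Λ ^ 2 / 2 * En k := by
      refine (abs_add_le _ _).trans ((add_le_add a1 a2).trans ?_)
      rw [← mul_add]
      refine mul_le_mul (by gcongr) ?_ (by positivity) (by positivity)
      simp only [hEn]
      have : 0 ≤ (ε / τ) ^ 2 * l2dx h M (fun j => W (k + 1) j - W k j) ^ 2
        + (l2 h M (f (k + 1)) ^ 2 + l2 h M (f k) ^ 2) / 2 := by positivity
      linarith
    simp only [hBf]
    rw [abs_mul, abs_of_pos (by positivity)]
    calc _ ≤ (2 * Λ ^ 2)⁻¹ * (Λ ^ 2 / 2 * En k) := by gcongr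
      _ = _ := by field_simp; ring
  have hη2l : ∀ k, k + 1 ≤ n → l2 h M (η₂ k) ≤ Λ * δ := fun k hk =>
    (l2_le_of_forall hh hL hδ (hC.norm_η₂ k hk)).trans (by gcongr)
  have hZb : ∀ k < n, |Z k| ≤ En k / 4 + 144 * Λ ^ 14 * δ ^ 2 := by
    intro k hk
    obtain ⟨a1, a2, a3, a4, -⟩ := c1 k _ le_rfl
    have b1 := c2 (k + 1) (by omega) _ (Real.sqrt_nonneg _) a1 a3
    have b2 := c2 k (by omega) _ (Real.sqrt_nonneg _) a2 a4
    have b3 := l2_add_le hh M (W (k + 1)) (W k)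
    have b4 : |Z k| ≤ (Λ * δ) * (12 * Λ ^ 6 * √(En k)) := by
      refine (abs_ip_le hh M _ _).trans ?_
      exact mul_le_mul (hη2l k (by omega)) (by linarith) (l2_nonneg _ _ _) (by positivity)
    have b5 := Real.sq_sqrt (hE0 k)
    nlinarith [sq_nonneg (√(En k) / 2 - 12 * Λ ^ 7 * δ)]
  have hstep : ∀ l, l + 1 < n → En (l + 1) - En l ≤ (312 * Λ ^ 9) * τ * (En (l + 1) + En l + δ ^ 2)
      + (Bf (l + 1) - Bf l) + (Z (l + 1) - Z l) := by
    intro l hl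
    set A := En (l + 1) + En l + δ ^ 2 with hA
    have hA0 : 0 ≤ A := by have := hE0 l; have := hE0 (l + 1); positivity
    obtain ⟨a1, a2, a3, a4, a5⟩ := c1 (l + 1) A (by have := hE0 l; have := sq_nonneg δ; linarith)
    obtain ⟨-, b2, -, b4, b5⟩ := c1 l A (by have := hE0 (l + 1); have := sq_nonneg δ; linarith)
    have hδA : δ ≤ √A := Real.le_sqrt_of_sq_le (by have := hE0 l; have := hE0 (l + 1); linarith)
    have l2n : l + 2 ≤ n := by omega
    have hU' : ∀ k ≤ n, ∀ j ≤ M, ‖U k j‖ ≤ Λ ^ 2 := fun k hk j hj =>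
      (norm_le_l2dx hh hL (U k) (hC.bdry_U k hk).1 hj).trans
        (by rw [sq]; exact mul_le_mul hs (hC.norm_U k hk) (l2dx_nonneg _ _ _) hΛ0.le)
    have havg : ∀ {V : Type} [NormedAddCommGroup V] [NormedSpace ℝ V] (x y : V) (B : ℝ),
        ‖x‖ ≤ B → ‖y‖ ≤ B → ‖(2 : ℝ)⁻¹ • (x + y)‖ ≤ B := by
      intro V _ _ x y B hx hy
      rw [norm_smul, Real.norm_eq_abs, abs_of_pos (by norm_num)]
      have := norm_add_le x y
      linarith
    have hdavg : ∀ {V : Type} [NormedAddCommGroup V] [InnerProductSpace ℝ V] (u : ℕ → ℕ → V) j,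
        dxp h (avg u (l + 1)) j = (2 : ℝ)⁻¹ • (dxp h (u (l + 2)) j + dxp h (u l) j) := by
      intro V _ _ u j
      rw [← dxp_add, ← dxp_smul]; rfl
    have hN := l2dx_nonlinear_le (Y := √A) (X := X (l + 1)) (U := U (l + 1)) (Z := avg X (l + 1))
      (w := fun j => (2 : ℝ)⁻¹ • (e (l + 2) j + e l j)) (A := avg Y (l + 1)) (H := H (l + 1))
      hh hL hΛ hLΛ (Real.sqrt_nonneg _) (hC.bdry_X _ (by omega)).1 (hC.bdry_U _ (by omega)).1
      (by simp [be (l + 2) l2n, be l (by omega)]) (hC.norm_X _ (by omega)) (hC.dxp_X _ (by omega))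
      (hC.norm_U _ (by omega)) a2 (by
        rw [l2dx_smul, abs_of_pos (by norm_num)]
        have := l2dx_add_le hh M (e (l + 2)) (e l)
        have a1' : l2dx h M (e (l + 2)) ≤ √A := a1
        linarith)
      (fun j hj => havg _ _ _ (hC.norm_X (l + 2) l2n j hj) (hC.norm_X l (by omega) j hj))
      (fun j hj => by
        rw [hdavg]; exact havg _ _ _ (hC.dxp_X (l + 2) l2n j hj) (hC.dxp_X l (by omega) j hj))
      (fun j hj => (Real.norm_eq_abs _).symm.le.trans (havg (Y (l + 2) j) (Y l j) Λ
        (hC.norm_Y (l + 2) l2n j hj) (hC.norm_Y l (by omega) j hj)))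
      (fun j hj => by
        rw [hdavg]; exact havg _ _ _ (hC.dxp_Y (l + 2) l2n j hj) (hC.dxp_Y l (by omega) j hj))
      (hC.norm_H l l2n) (hC.dxp_H l l2n)
    set N₀ : ℕ → ℂ := fun j => (-‖U (l + 1) j‖ ^ 2 + H (l + 1) j + avg Y (l + 1) j) •
        (2 : ℝ)⁻¹ • (e (l + 2) j + e l j)
        - (‖X (l + 1) j‖ ^ 2 - ‖U (l + 1) j‖ ^ 2) • avg X (l + 1) j with hN₀
    have hN0 : N₀ 0 = 0 ∧ N₀ M = 0 := by
      obtain ⟨x1, x2⟩ := hC.bdry_X (l + 1) (by omega)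
      obtain ⟨x3, x4⟩ := hC.bdry_U (l + 1) (by omega)
      obtain ⟨x5, x6⟩ := be (l + 2) l2n
      obtain ⟨x7, x8⟩ := be l (by omega)
      constructor
      · simp only [hN₀, x1, x3, x5, x7]; simp
      · simp only [hN₀, x2, x4, x6, x8]; simp
    have key := energy_step (ε := ε) (τ := τ) (δ := δ) (Y := √A) (e2 := e (l + 2)) (e0 := e l)
      (w := fun j => (2 : ℝ)⁻¹ • (e (l + 2) j + e l j)) (Wu := avg U (l + 1))
      (dX := dt τ X (l + 1)) (N₀ := N₀) (r := r (l + 1)) (s := s (l + 1)) (f2 := f (l + 2))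
      (f0 := f l) (φ := fun j => (2 : ℝ)⁻¹ * (f (l + 2) j + f l j)) (ρ2 := ρ (l + 2)) (ρ0 := ρ l)
      (η₁ := η₁ (l + 1)) (η₂ := η₂ (l + 1)) (W2 := W (l + 2)) (W1 := W (l + 1)) (W0 := W l)
      (g1 := fun j => f (l + 1) j - ρ (l + 1) j)
      hh hτ hε hL hΛ hLΛ hLΛ' hδ hδA (fun _ => rfl) (fun _ => rfl) (be _ l2n) (be _ (by omega))
      (bf _ l2n) (bf _ (by omega))
      hN0
      (hC.bdry_s l l2n) ⟨bW0 _, bW1 _⟩ ⟨bW0 _, bW1 _⟩ ⟨bW0 _, bW1 _⟩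
      (fun j hj => error_equation (hC.eq_U l l2n j hj) (hC.eq_X l l2n j hj))
      (fun j hj => inner_density_identity hτ _ _ _ _)
      (hW l) (hW (l + 1)) (hW (l + 2)) (fun j hj => by
        have y1 := hC.eq_Y l l2n j hj
        have y2 := hC.eq_P l l2n j hj
        have y3 : (fun j => (2 : ℝ)⁻¹ * (f (l + 2) j + f l j))
            = fun j => avg Y (l + 1) j - avg P (l + 1) j := by
          funext j; simp only [avg, hf, Nat.add_sub_cancel, smul_eq_mul]; ring
        rw [y3, dx2_sub]
        simp only [dt2, Nat.add_sub_cancel, smul_eq_mul] at y1 y2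
        simp only [hf, hρ]
        linear_combination y1 - y2)
      (fun j hj => havg _ _ _ (hU' _ l2n j hj) (hU' _ (by omega) j hj)) (hC.dt_X l l2n) hN
      (hC.norm_r l l2n) (hC.dxp_r l l2n) (hC.dxp_s l l2n) (hC.norm_η₁ l l2n) a1 b2 a3 b4 a5 b5
    have q1 : ip h M (η₂ (l + 1)) (fun j => W (l + 2) j - W l j) = Z (l + 1) - Z l
        - ip h M (fun j => η₂ (l + 1) j - η₂ l j) (fun j => W (l + 1) j + W l j) := by
      simp only [hZ, ip_sub_left, ip_sub_right, ip_add_right]; ring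
    have q2 : |ip h M (fun j => η₂ (l + 1) j - η₂ l j) (fun j => W (l + 1) j + W l j)|
        ≤ 12 * Λ ^ 9 * τ * A := by
      refine (abs_ip_le hh M _ _).trans ?_
      have b1 := c2 (l + 1) (by omega) _ (Real.sqrt_nonneg _) a2 a4
      have b2 := c2 l (by omega) _ (Real.sqrt_nonneg _) b2 b4
      have b3 := l2_add_le hh M (W (l + 1)) (W l)
      have b6 : l2 h M (fun j => η₂ (l + 1) j - η₂ l j) ≤ Λ * (τ * √A) :=
        (l2_le_of_forall hh hL (by positivity) (hC.diff_η₂ l l2n)).trans (by gcongr)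
      calc _ ≤ (Λ * (τ * √A)) * (12 * Λ ^ 6 * √A) :=
            mul_le_mul b6 (by linarith) (l2_nonneg _ _ _) (by positivity)
        _ = 12 * Λ ^ 7 * τ * (√A * √A) := by ring
        _ = 12 * Λ ^ 7 * τ * A := by rw [Real.mul_self_sqrt hA0]
        _ ≤ _ := by gcongr; norm_num
    rw [q1, Real.sq_sqrt hA0] at key
    have q3 := (abs_le.1 q2).1
    simp only [hEn, hBf]
    simp only [hEn] at hA
    linarith
  -- the initial energy
  have z1 : l2dx h M (e 0) = 0 := by
    rw [l2dx_congr (v := fun _ => (0 : ℂ)) (fun j hj => by simp [he, hC.init_X j hj])]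
    simp [l2dx, dxp]
  have z2 : l2 h M (f 0) = 0 := by
    rw [l2_congr (u' := fun _ => (0 : ℝ)) (fun j hj => by
      simp [hf, hC.init_Y j (Finset.mem_Ico.1 hj).2.le])]
    simp [l2]
  have hE00 : 1 ≤ n → En 0 ≤ 3 * Λ ^ 2 * δ ^ 2 := by
    intro hn1
    have z3 : l2dx h M (W 0) ≤ 0 := by
      refine (l2dx_potential_le hh hM hL ⟨bW0 0, bW1 0⟩ (hW 0)).trans ?_
      rw [l2_congr (u' := fun _ => (0 : ℝ)) (fun j hj => by
        have := (Finset.mem_Ico.1 hj).2.le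
        simp [hf, hρ, hC.init_X j this, hC.init_Y j this])]
      simp [l2]
    have z4 := l2dx_potential_le hh hM hL ⟨bW0 1, bW1 1⟩ (hW 1)
    have z5 := l2dx_sub_le hh M (W 1) (W 0)
    have z6 : ε / τ * l2dx h M (fun j => W 1 j - W 0 j) ≤ Λ * δ := by
      have : l2dx h M (fun j => W 1 j - W 0 j) ≤ Λ * l2 h M (fun j => f 1 j - ρ 1 j) :=
        (by linarith : _ ≤ L * l2 h M (fun j => f 1 j - ρ 1 j)).trans
          (mul_le_mul_of_nonneg_right hLΛ (l2_nonneg _ _ _))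
      calc _ ≤ ε / τ * (Λ * l2 h M (fun j => f 1 j - ρ 1 j)) := by gcongr
        _ = Λ * (ε / τ * l2 h M (fun j => f 1 j - ρ 1 j)) := by ring
        _ ≤ _ := mul_le_mul_of_nonneg_left (hC.first_g hn1) hΛ0.le
    have y1 := pow_le_pow_left₀ (by have := l2dx_nonneg h M (fun j => W 1 j - W 0 j); positivity) z6 2
    have y2 := pow_le_pow_left₀ (l2dx_nonneg _ _ _) (hC.first_X hn1) 2
    have y3 := pow_le_pow_left₀ (l2_nonneg _ _ _) (hC.first_Y hn1) 2
    rw [mul_pow, mul_pow] at y1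
    have p2 : 1 ≤ Λ ^ 2 := one_le_pow₀ hΛ
    have p2' := mul_le_mul_of_nonneg_right p2 (sq_nonneg δ)
    simp only [hEn, z1, z2, Nat.zero_add]
    have y2' : l2dx h M (e 1) ^ 2 ≤ δ ^ 2 := y2
    have y3' : l2 h M (f 1) ^ 2 ≤ δ ^ 2 := y3
    linarith [sq_nonneg δ]
  have hfin : ∀ k < n, En k ≤ (2 * (Real.exp (8 * (312 * Λ ^ 9) * T) * 500 * Λ ^ 14)) * δ ^ 2 := by
    intro k hk
    have g1 := modified_gronwall (c := 312 * Λ ^ 9) (D := 144 * Λ ^ 14) (by positivity) hτ hτΛ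
      (fun k _ => hE0 k) hB hZb hstep hk
    refine g1.trans ?_
    rw [mul_assoc 2]
    refine mul_le_mul_of_nonneg_left ?_ (by norm_num)
    have hkT : (k : ℝ) * τ ≤ T := by
      refine le_trans ?_ hn
      have : (k : ℝ) ≤ n := by exact_mod_cast hk.le
      gcongr
    have g2 := hE00 (by omega)
    have p14 : 1 ≤ Λ ^ 14 := one_le_pow₀ hΛ
    have p2 : Λ ^ 2 ≤ Λ ^ 14 := pow_le_pow_right₀ hΛ (by norm_num)
    have p14' := mul_le_mul_of_nonneg_right p14 (sq_nonneg δ)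
    have p2' := mul_le_mul_of_nonneg_right p2 (sq_nonneg δ)
    calc _ ≤ Real.exp (8 * (312 * Λ ^ 9) * T) * (500 * Λ ^ 14 * δ ^ 2) := by
          refine mul_le_mul (Real.exp_le_exp.2 (by gcongr)) ?_ ?_ (Real.exp_pos _).le
          · linarith [sq_nonneg δ]
          · have := hE0 0; positivity
      _ = _ := by ring
  set C := 2 * (Real.exp (8 * (312 * Λ ^ 9) * T) * 500 * Λ ^ 14) with hCdef
  have hC0 : 0 ≤ C := by positivity
  have hsq : √(C * δ ^ 2) = √C * δ := by rw [Real.sqrt_mul hC0, Real.sqrt_sq hδ]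
  rcases Nat.eq_zero_or_pos k with rfl | hkpos
  · refine ⟨z1.le.trans (by positivity), z2.le.trans (by positivity)⟩
  · obtain ⟨i, rfl⟩ := Nat.exists_eq_add_of_le' hkpos
    obtain ⟨a1, -, a3, -, -⟩ := c1 i _ (hfin i (by omega))
    rw [hsq] at a1 a3
    exact ⟨a1, by linarith⟩

end Stability

section OneStep

lemma l2_normSq_le {h : ℝ} (hh : 0 < h) {M : ℕ} {u : ℕ → ℂ} {A : ℝ} (hA : 0 ≤ A)
    (hu : ∀ j ∈ Finset.Ico 1 M, ‖u j‖ ≤ A) : l2 h M (fun j => ‖u j‖ ^ 2) ≤ A * l2 h M u := by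
  have : l2 h M (fun j => ‖u j‖ ^ 2) ≤ l2 h M (fun j => A • u j) := by
    refine l2_mono hh fun j hj => ?_
    rw [norm_smul, Real.norm_eq_abs, Real.norm_eq_abs, abs_of_nonneg hA, abs_of_nonneg (by positivity),
      sq]
    exact mul_le_mul_of_nonneg_right (hu j hj) (norm_nonneg _)
  rwa [l2_smul, abs_of_nonneg hA] at this

/-- Conservation of mass in one step of the scheme. -/
lemma mass_conservation {h τ : ℝ} (hh : 0 < h) (hτ : 0 < τ) {M : ℕ} (hM : 1 ≤ M) {p q : ℕ → ℂ}
    {V : ℕ → ℝ} (bp : p 0 = 0 ∧ p M = 0) (bq : q 0 = 0 ∧ q M = 0)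
    (heq : ∀ j ∈ Finset.Ico 1 M, Complex.I * ((2 * τ)⁻¹ • (p j - q j))
      = - dx2 h (fun j => (2 : ℝ)⁻¹ • (p j + q j)) j + V j • ((2 : ℝ)⁻¹ • (p j + q j))) :
    l2 h M p = l2 h M q := by
  set w : ℕ → ℂ := fun j => (2 : ℝ)⁻¹ • (p j + q j) with hw
  have h1 : ip h M (fun j => Complex.I * ((2 * τ)⁻¹ • (p j - q j))) (fun j => Complex.I * w j)
      = (4 * τ)⁻¹ * (l2 h M p ^ 2 - l2 h M q ^ 2) := by
    have e : (∑ j ∈ Finset.Ico 1 M, ‖p j‖ ^ 2) - ∑ j ∈ Finset.Ico 1 M, ‖q j‖ ^ 2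
        = ∑ j ∈ Finset.Ico 1 M, (‖p j‖ ^ 2 - ‖q j‖ ^ 2) :=
      (Finset.sum_sub_distrib (fun j => ‖p j‖ ^ 2) (fun j => ‖q j‖ ^ 2)).symm
    rw [l2_sq hh, l2_sq hh, ← mul_sub, e, ip, mul_left_comm]
    refine congrArg (h * ·) ((Finset.sum_congr rfl fun j _ => ?_).trans (Finset.mul_sum _ _ _).symm)
    simp only [hw, norm_sq_eq, Complex.inner, Complex.real_smul]
    simp
    field_simp; ring
  have h2 : ip h M (fun j => Complex.I * ((2 * τ)⁻¹ • (p j - q j))) (fun j => Complex.I * w j)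
      = ip h M (fun j => - dx2 h w j + V j • w j) (fun j => Complex.I * w j) :=
    ip_congr heq fun _ _ => rfl
  have h3 : ip h M (dx2 h w) (fun j => Complex.I * w j) = 0 := by
    rw [ip_dx2 hh hM _ _ (by simp [hw, bp.1, bq.1]) (by simp [hw, bp.2, bq.2]), ipd,
      Finset.sum_eq_zero, mul_zero, neg_zero]
    intro j _
    have : dxp h (fun j => Complex.I * w j) j = Complex.I * dxp h w j := by
      simp only [dxp, ← mul_sub, mul_smul_comm]
    rw [this]; simp [Complex.inner]; ring
  have h4 : ip h M (fun j => V j • w j) (fun j => Complex.I * w j) = 0 := by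
    rw [ip, Finset.sum_eq_zero, mul_zero]
    intro j _
    simp only [Complex.inner, Complex.real_smul]; simp; ring
  rw [ip_add_left, ip_neg_left, h3, h4, h1] at h2
  have h5 : l2 h M p ^ 2 - l2 h M q ^ 2 = 0 := by
    have : (4 * τ)⁻¹ ≠ 0 := by positivity
    rw [neg_zero, zero_add] at h2
    exact (mul_eq_zero.1 h2).resolve_left this
  exact (pow_left_inj₀ (l2_nonneg _ _ _) (l2_nonneg _ _ _) two_ne_zero).1 (by linarith)

lemma energy_identity {h τ : ℝ} (hh : 0 < h) (hτ : 0 < τ) {M : ℕ} (hM : 1 ≤ M) {p q : ℕ → ℂ}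
    {V : ℕ → ℝ} (bp : p 0 = 0 ∧ p M = 0) (bq : q 0 = 0 ∧ q M = 0)
    (heq : ∀ j ∈ Finset.Ico 1 M, Complex.I * ((2 * τ)⁻¹ • (p j - q j))
      = - dx2 h (fun j => (2 : ℝ)⁻¹ • (p j + q j)) j + V j • ((2 : ℝ)⁻¹ • (p j + q j))) :
    l2dx h M p ^ 2 - l2dx h M q ^ 2 = - ip h M V (fun j => ‖p j‖ ^ 2 - ‖q j‖ ^ 2) := by
  rw [crank_nicolson_identity hh hτ hM bp.1 bp.2 bq.1 bq.2 heq, neg_mul, neg_inj, ip, ip,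
    mul_left_comm, Finset.mul_sum]
  congr 1
  refine Finset.sum_congr rfl fun j _ => ?_
  simp only [norm_sq_eq, Complex.inner, Complex.real_smul]
  simp
  field_simp; ring

lemma elliptic_bound {h μ : ℝ} (hh : 0 < h) (hμ : 0 ≤ μ) {M : ℕ} (hM : 1 ≤ M) {Q F : ℕ → ℝ}
    (bQ : Q 0 = 0 ∧ Q M = 0) (heq : ∀ j ∈ Finset.Ico 1 M, 2 * Q j - μ * dx2 h Q j = F j) :
    2 * l2 h M Q ≤ l2 h M F := by
  have h1 : ip h M F Q = 2 * l2 h M Q ^ 2 + μ * l2dx h M Q ^ 2 := by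
    rw [← ip_congr (u := fun j => (2 : ℝ) • Q j - μ • dx2 h Q j) (v := Q) (fun j hj => heq j hj)
      (fun _ _ => rfl), ip_sub_left, ip_smul_left, ip_smul_left, ip_dx2 hh hM _ _ bQ.1 bQ.2,
      ip_self hh, ipd_self hh]
    ring
  have h2 := (le_abs_self _).trans (abs_ip_le hh M F Q)
  have h3 : 0 ≤ μ * l2dx h M Q ^ 2 := by positivity
  rcases (l2_nonneg h M Q).eq_or_lt with h0 | h0
  · rw [← h0, mul_zero]; exact l2_nonneg _ _ _
  · exact le_of_mul_le_mul_right (by nlinarith : 2 * l2 h M Q * l2 h M Q ≤ l2 h M F * l2 h M Q) h0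

lemma l2_normSq_le_sqrt {h : ℝ} (hh : 0 < h) {M : ℕ} {u : ℕ → ℂ} {Λ A : ℝ} (hΛ : 0 ≤ Λ)
    (bu : u 0 = 0 ∧ u M = 0) (hu : l2 h M u ≤ Λ ^ 2) (hA : l2dx h M u ≤ A) :
    l2 h M (fun j => ‖u j‖ ^ 2) ≤ 2 * Λ ^ 3 * √A := by
  have hA0 := (l2dx_nonneg h M u).trans hA
  have h1 : ∀ j ∈ Finset.Ico 1 M, ‖u j‖ ≤ 2 * Λ * √A := by
    intro j hj
    have := norm_sq_le_l2_mul hh u bu.1 (Finset.mem_Ico.1 hj).2.le bu.2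
    refine le_of_sq_le_mul hA0 (by positivity) (this.trans ?_)
    have : l2 h M u * l2dx h M u ≤ Λ ^ 2 * A :=
      mul_le_mul hu hA (l2dx_nonneg _ _ _) (by positivity)
    nlinarith [mul_nonneg (sq_nonneg Λ) hA0]
  refine (l2_normSq_le hh (by positivity) h1).trans ?_
  calc _ ≤ 2 * Λ * √A * Λ ^ 2 := by gcongr
    _ = _ := by ring

lemma quartic_bound {Λ z : ℝ} (hΛ : 1 ≤ Λ) (hz0 : 0 ≤ z)
    (hkey : (z ^ 2) ^ 2 ≤ Λ ^ 2 + 4 * Λ ^ 8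
      + (3 * Λ ^ 4 + Λ ^ 3 * z) * (2 * Λ ^ 3 * z + Λ ^ 4)) : z ≤ 5 * Λ ^ 4 := by
  by_contra! hzb
  have p4 : 1 ≤ Λ ^ 4 := one_le_pow₀ hΛ
  have hz1 : 1 ≤ z := by linarith
  have p28 : Λ ^ 2 ≤ Λ ^ 8 := pow_le_pow_right₀ hΛ (by norm_num)
  have p78 : Λ ^ 7 ≤ Λ ^ 8 := pow_le_pow_right₀ hΛ (by norm_num)
  have p68 : Λ ^ 6 ≤ Λ ^ 8 := pow_le_pow_right₀ hΛ (by norm_num)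
  have hz2 : z ≤ z ^ 2 := le_self_pow₀ hz1 (by norm_num)
  have hz3 : 1 ≤ z ^ 2 := one_le_pow₀ hz1
  have p8 : 0 < Λ ^ 8 := by positivity
  have k1 : (z ^ 2) ^ 2 ≤ 17 * Λ ^ 8 * z ^ 2 := by
    have e1 : Λ ^ 7 * z ≤ Λ ^ 8 * z ^ 2 := mul_le_mul p78 hz2 hz0 p8.le
    have e2 : Λ ^ 6 * z ^ 2 ≤ Λ ^ 8 * z ^ 2 := mul_le_mul_of_nonneg_right p68 (by positivity)
    have e3 : Λ ^ 8 * 1 ≤ Λ ^ 8 * z ^ 2 := mul_le_mul_of_nonneg_left hz3 p8.le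
    calc (z ^ 2) ^ 2 ≤ _ := hkey
      _ = Λ ^ 2 + 7 * Λ ^ 8 + 7 * (Λ ^ 7 * z) + 2 * (Λ ^ 6 * z ^ 2) := by ring
      _ ≤ _ := by linarith
  have k2 : z ^ 2 ≤ 17 * Λ ^ 8 := by
    have : 0 < z ^ 2 := by positivity
    rw [sq (z ^ 2)] at k1
    exact le_of_mul_le_mul_right k1 this
  have k3 : (5 * Λ ^ 4) ^ 2 < z ^ 2 := pow_lt_pow_left₀ hzb (by positivity) two_ne_zero
  have k4 : (5 * Λ ^ 4) ^ 2 = 25 * Λ ^ 8 := by ring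
  linarith

/-- Bounds on the data of one step. -/
structure StepData (h Λ : ℝ) (M : ℕ) (Um Uo : ℕ → ℂ) (Po H : ℕ → ℝ) : Prop where
  bdry_m : Um 0 = 0 ∧ Um M = 0
  bdry_o : Uo 0 = 0 ∧ Uo M = 0
  norm_m : l2dx h M Um ≤ Λ
  norm_o : l2dx h M Uo ≤ Λ
  norm_P : l2 h M Po ≤ Λ
  norm_H : ∀ j ≤ M, |H j| ≤ Λ

variable {h L τ ε Λ : ℝ} {M : ℕ} {Um Uo : ℕ → ℂ} {Po H : ℕ → ℝ}

/-- `H¹` bound of one step of the scheme, where the density at the new time in the equation for the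
second component is that of an arbitrary grid function `u`. -/
lemma StepData.bound (hD : StepData h Λ M Um Uo Po H) (hh : 0 < h) (hτ : 0 < τ) (hM : 1 ≤ M)
    (hL : h * M = L) (hΛ : 1 ≤ Λ) (hLΛ : L ≤ Λ) {μ : ℝ} (hμ : 0 ≤ μ) {u p : ℕ → ℂ} {Q : ℕ → ℝ}
    (bu : u 0 = 0 ∧ u M = 0) (bp : p 0 = 0 ∧ p M = 0) (bQ : Q 0 = 0 ∧ Q M = 0)
    (hu : l2 h M u ≤ l2 h M Um) (hu' : l2dx h M u ≤ max (25 * Λ ^ 8) (l2dx h M p))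
    (hQ : ∀ j ∈ Finset.Ico 1 M, 2 * Q j - μ * dx2 h Q j
      = 2 * Po j + ‖u j‖ ^ 2 - 2 * ‖Uo j‖ ^ 2 + ‖Um j‖ ^ 2)
    (hp : ∀ j ∈ Finset.Ico 1 M, Complex.I * ((2 * τ)⁻¹ • (p j - Um j))
      = - dx2 h (fun j => (2 : ℝ)⁻¹ • (p j + Um j)) j
        + (-‖Uo j‖ ^ 2 + H j + Q j) • ((2 : ℝ)⁻¹ • (p j + Um j))) :
    l2dx h M p ≤ 25 * Λ ^ 8 := by
  by_contra hcon
  push Not at hcon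
  rw [max_eq_right hcon.le] at hu'
  have hΛ0 : 0 < Λ := by linarith
  have hs := sqrt_le_of_le hΛ hLΛ
  set y := l2dx h M p with hy
  have hy0 : 0 ≤ y := l2dx_nonneg _ _ _
  have hmass := mass_conservation hh hτ hM bp hD.bdry_m hp
  have hen := energy_identity hh hτ hM bp hD.bdry_m hp
  have hm : l2 h M Um ≤ Λ ^ 2 := (l2_le_l2dx hh hL Um hD.bdry_m.1).trans
    (by rw [sq]; exact mul_le_mul hLΛ hD.norm_m (l2dx_nonneg _ _ _) hΛ0.le)
  have ho : l2 h M Uo ≤ Λ ^ 2 := (l2_le_l2dx hh hL Uo hD.bdry_o.1).trans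
    (by rw [sq]; exact mul_le_mul hLΛ hD.norm_o (l2dx_nonneg _ _ _) hΛ0.le)
  have sm : ∀ j ∈ Finset.Ico 1 M, ‖Um j‖ ≤ Λ ^ 2 := fun j hj =>
    (norm_le_l2dx hh hL Um hD.bdry_m.1 (Finset.mem_Ico.1 hj).2.le).trans
      (by rw [sq]; exact mul_le_mul hs hD.norm_m (l2dx_nonneg _ _ _) hΛ0.le)
  have so : ∀ j ∈ Finset.Ico 1 M, ‖Uo j‖ ≤ Λ ^ 2 := fun j hj =>
    (norm_le_l2dx hh hL Uo hD.bdry_o.1 (Finset.mem_Ico.1 hj).2.le).trans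
      (by rw [sq]; exact mul_le_mul hs hD.norm_o (l2dx_nonneg _ _ _) hΛ0.le)
  have dm : l2 h M (fun j => ‖Um j‖ ^ 2) ≤ Λ ^ 4 := (l2_normSq_le hh (by positivity) sm).trans
    (by calc _ ≤ Λ ^ 2 * Λ ^ 2 := by gcongr
          _ = _ := by ring)
  have do' : l2 h M (fun j => ‖Uo j‖ ^ 2) ≤ Λ ^ 4 := (l2_normSq_le hh (by positivity) so).trans
    (by calc _ ≤ Λ ^ 2 * Λ ^ 2 := by gcongr
          _ = _ := by ring)
  have du := l2_normSq_le_sqrt hh hΛ0.le bu (hu.trans hm) hu'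
  have dp := l2_normSq_le_sqrt hh hΛ0.le bp (hmass.le.trans hm) le_rfl
  rw [← hy] at dp
  have p14 : Λ ≤ Λ ^ 4 := le_self_pow₀ hΛ (by norm_num)
  have hQl : l2 h M Q ≤ 3 * Λ ^ 4 + Λ ^ 3 * √y := by
    have a1 := elliptic_bound hh hμ hM bQ hQ
    have a2 := l2_add_le hh M (fun j => 2 * Po j + ‖u j‖ ^ 2 - 2 * ‖Uo j‖ ^ 2) (fun j => ‖Um j‖ ^ 2)
    have a3 := l2_sub_le hh M (fun j => 2 * Po j + ‖u j‖ ^ 2) (fun j => (2 : ℝ) • ‖Uo j‖ ^ 2)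
    have a4 := l2_add_le hh M (fun j => (2 : ℝ) • Po j) (fun j => ‖u j‖ ^ 2)
    rw [l2_smul, abs_of_pos (by norm_num)] at a3 a4
    simp only [smul_eq_mul] at a3 a4
    have := hD.norm_P
    linarith
  have hV : ip h M (fun j => -‖Uo j‖ ^ 2 + H j + Q j) (fun j => ‖p j‖ ^ 2 - ‖Um j‖ ^ 2)
      = ip h M (fun j => -‖Uo j‖ ^ 2 + H j) (fun j => ‖p j‖ ^ 2 - ‖Um j‖ ^ 2)
        + ip h M Q (fun j => ‖p j‖ ^ 2 - ‖Um j‖ ^ 2) := ip_add_left _ _ _ _ _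
  have hV0 : |ip h M (fun j => -‖Uo j‖ ^ 2 + H j) (fun j => ‖p j‖ ^ 2 - ‖Um j‖ ^ 2)|
      ≤ 4 * Λ ^ 8 := by
    have b1 : ∀ j ∈ Finset.Ico 1 M, |(-‖Uo j‖ ^ 2 + H j)| ≤ 2 * Λ ^ 4 := by
      intro j hj
      have := pow_le_pow_left₀ (norm_nonneg _) (so j hj) 2
      have h2 := abs_le.1 (hD.norm_H j (Finset.mem_Ico.1 hj).2.le)
      rw [abs_le]; constructor <;> nlinarith [sq_nonneg ‖Uo j‖]
    have b2 : |ip h M (fun j => -‖Uo j‖ ^ 2 + H j) (fun j => ‖p j‖ ^ 2 - ‖Um j‖ ^ 2)|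
        ≤ h * ∑ j ∈ Finset.Ico 1 M, 2 * Λ ^ 4 * (‖p j‖ ^ 2 + ‖Um j‖ ^ 2) := by
      rw [ip, abs_mul, abs_of_pos hh]
      refine mul_le_mul_of_nonneg_left ((Finset.abs_sum_le_sum_abs _ _).trans
        (Finset.sum_le_sum fun j hj => ?_)) hh.le
      refine (abs_real_inner_le_norm _ _).trans ?_
      refine mul_le_mul (b1 j hj) ?_ (norm_nonneg _) (by positivity)
      refine (norm_sub_le _ _).trans (by simp)
    rw [← Finset.mul_sum, Finset.sum_add_distrib, mul_left_comm, mul_add, ← l2_sq hh, ← l2_sq hh,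
      hmass] at b2
    have b3 := pow_le_pow_left₀ (l2_nonneg _ _ _) hm 2
    refine b2.trans ?_
    calc _ ≤ 2 * Λ ^ 4 * ((Λ ^ 2) ^ 2 + (Λ ^ 2) ^ 2) := by gcongr
      _ = _ := by ring
  have hQ0 : |ip h M Q (fun j => ‖p j‖ ^ 2 - ‖Um j‖ ^ 2)|
      ≤ (3 * Λ ^ 4 + Λ ^ 3 * √y) * (2 * Λ ^ 3 * √y + Λ ^ 4) := by
    refine (abs_ip_le hh M _ _).trans ?_
    refine mul_le_mul hQl ?_ (l2_nonneg _ _ _) (by positivity)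
    exact (l2_sub_le hh M (fun j => ‖p j‖ ^ 2) (fun j => ‖Um j‖ ^ 2)).trans (add_le_add dp dm)
  have hm2 := pow_le_pow_left₀ (l2dx_nonneg _ _ _) hD.norm_m 2
  rw [hV] at hen
  have hkey : y ^ 2 ≤ Λ ^ 2 + 4 * Λ ^ 8 + (3 * Λ ^ 4 + Λ ^ 3 * √y) * (2 * Λ ^ 3 * √y + Λ ^ 4) := by
    have := (abs_le.1 hV0).1
    have := (abs_le.1 hQ0).1
    linarith
  have hz := quartic_bound hΛ (Real.sqrt_nonneg y) (by rwa [Real.sq_sqrt hy0])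
  have := pow_le_pow_left₀ (Real.sqrt_nonneg y) hz 2
  rw [Real.sq_sqrt hy0, mul_pow, ← pow_mul] at this
  norm_num at this
  linarith

/-- A discrete linear boundary value problem with trivial kernel is solvable. -/
lemma exists_grid_solution {V : Type*} [NormedAddCommGroup V] [NormedSpace ℝ V]
    [FiniteDimensional ℝ V] (T : (ℕ → V) →ₗ[ℝ] (ℕ → V))
    (hT : ∀ w : ℕ → V, (∀ j ∉ Finset.Ico 1 M, w j = 0) → (∀ j ∈ Finset.Ico 1 M, T w j = 0) → w = 0)
    (F : ℕ → V) :
    ∃ w : ℕ → V, (∀ j ∉ Finset.Ico 1 M, w j = 0) ∧ ∀ j ∈ Finset.Ico 1 M, T w j = F j := by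
  classical
  let ext : ({j // j ∈ Finset.Ico 1 M} → V) →ₗ[ℝ] (ℕ → V) :=
    { toFun := fun v j => if hj : j ∈ Finset.Ico 1 M then v ⟨j, hj⟩ else 0
      map_add' := fun u v => by
        funext j; by_cases hj : j ∈ Finset.Ico 1 M
        · simp only [hj, dite_true, Pi.add_apply]
        · simp only [hj, dite_false, Pi.add_apply, add_zero]
      map_smul' := fun c v => by
        funext j; by_cases hj : j ∈ Finset.Ico 1 M
        · simp only [hj, dite_true, Pi.smul_apply, RingHom.id_apply]
        · simp only [hj, dite_false, Pi.smul_apply, smul_zero] }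
  let A : ({j // j ∈ Finset.Ico 1 M} → V) →ₗ[ℝ] ({j // j ∈ Finset.Ico 1 M} → V) :=
    { toFun := fun v j => T (ext v) j
      map_add' := fun u v => by funext j; simp
      map_smul' := fun c v => by funext j; simp }
  have hout : ∀ v, ∀ j ∉ Finset.Ico 1 M, ext v j = 0 := fun v j hj => by
    simp only [ext, LinearMap.coe_mk, AddHom.coe_mk, hj, dite_false]
  have hin : ∀ v, ∀ j (hj : j ∈ Finset.Ico 1 M), ext v j = v ⟨j, hj⟩ := fun v j hj => by
    simp only [ext, LinearMap.coe_mk, AddHom.coe_mk, hj, dite_true]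
  have hinj : Function.Injective A := by
    rw [injective_iff_map_eq_zero]
    intro v hv
    have h1 := hT (ext v) (hout v) fun j hj => congrFun hv ⟨j, hj⟩
    funext j
    have := congrFun h1 j.1
    rw [hin v j.1 j.2] at this
    exact this
  obtain ⟨v, hv⟩ := (LinearMap.injective_iff_surjective.1 hinj) (fun j => F j)
  exact ⟨ext v, hout v, fun j hj => congrFun hv ⟨j, hj⟩⟩

end OneStep

section Existence

lemma eq_zero_of_l2_le_zero {V : Type*} [NormedAddCommGroup V] [InnerProductSpace ℝ V] {h : ℝ}
    (hh : 0 < h) {M : ℕ} {w : ℕ → V} (hw : l2 h M w ≤ 0) : ∀ j ∈ Finset.Ico 1 M, w j = 0 := by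
  have h0 : l2 h M w = 0 := le_antisymm hw (l2_nonneg _ _ _)
  have h1 := l2_sq hh M w
  rw [h0] at h1
  have h2 : ∑ j ∈ Finset.Ico 1 M, ‖w j‖ ^ 2 = 0 := by
    rcases mul_eq_zero.1 (h1.symm.trans (by norm_num)) with h2 | h2
    · exact absurd h2 hh.ne'
    · exact h2
  intro j hj
  have := (Finset.sum_eq_zero_iff_of_nonneg fun i _ => sq_nonneg ‖w i‖).1 h2 j hj
  exact norm_eq_zero.1 (pow_eq_zero_iff two_ne_zero |>.1 this)

lemma schrodinger_bound {h τ : ℝ} (hh : 0 < h) (hτ : 0 < τ) {M : ℕ} (hM : 1 ≤ M) {w f : ℕ → ℂ}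
    {V : ℕ → ℝ} (bw : w 0 = 0 ∧ w M = 0)
    (heq : ∀ j ∈ Finset.Ico 1 M, Complex.I * ((2 * τ)⁻¹ • w j)
      = - dx2 h (fun j => (2 : ℝ)⁻¹ • w j) j + V j • ((2 : ℝ)⁻¹ • w j) + f j) :
    l2 h M w ≤ 2 * τ * l2 h M f := by
  have h1 : ip h M (fun j => Complex.I * ((2 * τ)⁻¹ • w j)) (fun j => Complex.I * w j)
      = (2 * τ)⁻¹ * l2 h M w ^ 2 := by
    rw [l2_sq hh, ip, mul_left_comm]
    refine congrArg (h * ·) ((Finset.sum_congr rfl fun j _ => ?_).trans (Finset.mul_sum _ _ _).symm)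
    simp only [norm_sq_eq, Complex.inner, Complex.real_smul]
    simp
    ring
  have h2 : ip h M (fun j => Complex.I * ((2 * τ)⁻¹ • w j)) (fun j => Complex.I * w j)
      = ip h M (fun j => - dx2 h (fun j => (2 : ℝ)⁻¹ • w j) j + V j • ((2 : ℝ)⁻¹ • w j) + f j)
        (fun j => Complex.I * w j) :=
    ip_congr heq fun _ _ => rfl
  have h3 : ip h M (dx2 h (fun j => (2 : ℝ)⁻¹ • w j)) (fun j => Complex.I * w j) = 0 := by
    rw [ip_dx2 hh hM _ _ (by simp [bw.1]) (by simp [bw.2]), ipd,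
      Finset.sum_eq_zero, mul_zero, neg_zero]
    intro j _
    have e1 : dxp h (fun j => Complex.I * w j) j = Complex.I * dxp h w j := by
      simp only [dxp, ← mul_sub, mul_smul_comm]
    have e2 : dxp h (fun j => (2 : ℝ)⁻¹ • w j) j = (2 : ℝ)⁻¹ • dxp h w j := by
      simp only [dxp, ← smul_sub, smul_comm (2 : ℝ)⁻¹]
    rw [e1, e2]; simp [Complex.inner]; ring
  have h4 : ip h M (fun j => V j • ((2 : ℝ)⁻¹ • w j)) (fun j => Complex.I * w j) = 0 := by
    rw [ip, Finset.sum_eq_zero, mul_zero]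
    intro j _
    simp only [Complex.inner, Complex.real_smul]; simp; ring
  rw [ip_add_left, ip_add_left, ip_neg_left, h3, h4, h1, neg_zero, zero_add, zero_add] at h2
  have h5 := (le_abs_self _).trans (abs_ip_le hh M f (fun j => Complex.I * w j))
  rw [← h2, l2_I_mul] at h5
  rcases (l2_nonneg h M w).eq_or_lt with h0 | h0
  · rw [← h0]; exact mul_nonneg (by positivity) (l2_nonneg _ _ _)
  · rw [sq, ← mul_assoc] at h5
    have h6 := le_of_mul_le_mul_right h5 h0
    rwa [inv_mul_le_iff₀ (by positivity)] at h6

lemma exists_elliptic {h μ : ℝ} (hh : 0 < h) (hμ : 0 ≤ μ) {M : ℕ} (hM : 1 ≤ M) (F : ℕ → ℝ) :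
    ∃ Q : ℕ → ℝ, (Q 0 = 0 ∧ Q M = 0) ∧ ∀ j ∈ Finset.Ico 1 M, 2 * Q j - μ * dx2 h Q j = F j := by
  obtain ⟨Q, h1, h2⟩ := exists_grid_solution (M := M)
    ({ toFun := fun Q j => 2 * Q j - μ * dx2 h Q j
       map_add' := fun u v => by
        funext j; simp only [dx2, Pi.add_apply, smul_eq_mul]; ring
       map_smul' := fun c v => by
        funext j; simp only [dx2, Pi.smul_apply, smul_eq_mul, RingHom.id_apply]; ring } :
      (ℕ → ℝ) →ₗ[ℝ] (ℕ → ℝ)) (fun w hw hw' => by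
        have := elliptic_bound (F := fun _ => 0) hh hμ hM (Q := w)
          ⟨hw 0 (by simp), hw M (by simp)⟩ (fun j hj => hw' j hj)
        have h0 : l2 h M (fun _ : ℕ => (0 : ℝ)) = 0 := by simp [l2]
        rw [h0] at this
        funext j
        by_cases hj : j ∈ Finset.Ico 1 M
        · exact eq_zero_of_l2_le_zero hh (by linarith) j hj
        · exact hw j hj) F
  exact ⟨Q, ⟨h1 0 (by simp), h1 M (by simp)⟩, h2⟩

lemma exists_schrodinger {h τ : ℝ} (hh : 0 < h) (hτ : 0 < τ) {M : ℕ} (hM : 1 ≤ M) (V : ℕ → ℝ)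
    (q : ℕ → ℂ) :
    ∃ p : ℕ → ℂ, (∀ j ∉ Finset.Ico 1 M, p j = 0) ∧ ∀ j ∈ Finset.Ico 1 M,
      Complex.I * ((2 * τ)⁻¹ • (p j - q j))
      = - dx2 h (fun j => (2 : ℝ)⁻¹ • (p j + q j)) j + V j • ((2 : ℝ)⁻¹ • (p j + q j)) := by
  obtain ⟨p, h1, h2⟩ := exists_grid_solution (M := M)
    ({ toFun := fun w j => Complex.I * ((2 * τ)⁻¹ • w j) + dx2 h (fun j => (2 : ℝ)⁻¹ • w j) j
        - V j • ((2 : ℝ)⁻¹ • w j)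
       map_add' := fun u v => by
        funext j; simp only [dx2, Pi.add_apply, Complex.real_smul]; ring
       map_smul' := fun c v => by
        funext j; simp only [dx2, Pi.smul_apply, Complex.real_smul, RingHom.id_apply]; ring } :
      (ℕ → ℂ) →ₗ[ℝ] (ℕ → ℂ)) (fun w hw hw' => by
        have := schrodinger_bound (f := fun _ => 0) (V := V) hh hτ hM (w := w)
          ⟨hw 0 (by simp), hw M (by simp)⟩ (fun j hj => by
            have := hw' j hj
            simp only [LinearMap.coe_mk, AddHom.coe_mk] at this
            linear_combination this)
        have h0 : l2 h M (fun _ : ℕ => (0 : ℂ)) = 0 := by simp [l2]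
        rw [h0, mul_zero] at this
        funext j
        by_cases hj : j ∈ Finset.Ico 1 M
        · exact eq_zero_of_l2_le_zero hh this j hj
        · exact hw j hj)
    (fun j => Complex.I * ((2 * τ)⁻¹ • q j) - dx2 h (fun j => (2 : ℝ)⁻¹ • q j) j
        + V j • ((2 : ℝ)⁻¹ • q j))
  refine ⟨p, h1, fun j hj => ?_⟩
  have := h2 j hj
  simp only [LinearMap.coe_mk, AddHom.coe_mk] at this
  simp only [dx2, Complex.real_smul] at this ⊢
  linear_combination this

lemma l2_normSq_sub_le {h : ℝ} (hh : 0 < h) {M : ℕ} {u v : ℕ → ℂ} {A : ℝ} (hA : 0 ≤ A)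
    (hu : ∀ j ∈ Finset.Ico 1 M, ‖u j‖ ≤ A) (hv : ∀ j ∈ Finset.Ico 1 M, ‖v j‖ ≤ A) :
    l2 h M (fun j => ‖u j‖ ^ 2 - ‖v j‖ ^ 2) ≤ 2 * A * l2 h M (fun j => u j - v j) := by
  have : l2 h M (fun j => ‖u j‖ ^ 2 - ‖v j‖ ^ 2)
      ≤ l2 h M (fun j => (2 * A) • (u j - v j)) := by
    refine l2_mono hh fun j hj => ?_
    rw [norm_smul, Real.norm_eq_abs, Real.norm_eq_abs, abs_of_nonneg (by positivity : 0 ≤ 2 * A),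
      sq_sub_sq, abs_mul, abs_of_nonneg (by positivity)]
    exact mul_le_mul (by linarith [hu j hj, hv j hj]) (abs_norm_sub_norm_le _ _) (abs_nonneg _)
      (by positivity)
  rwa [l2_smul, abs_of_nonneg (by positivity)] at this

variable {h L τ ε Λ : ℝ} {M : ℕ} {Um Uo : ℕ → ℂ} {Po H : ℕ → ℝ}

lemma StepData.sup_bound {u : ℕ → ℂ} {A : ℝ} (hh : 0 < h) (hL : h * M = L) (hΛ : 1 ≤ Λ)
    (hLΛ : L ≤ Λ) (bu : u 0 = 0) (hu : l2dx h M u ≤ A) :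
    ∀ j ∈ Finset.Ico 1 M, ‖u j‖ ≤ Λ * A := fun j hj =>
  (norm_le_l2dx hh hL u bu (Finset.mem_Ico.1 hj).2.le).trans
    (mul_le_mul (sqrt_le_of_le hΛ hLΛ) hu (l2dx_nonneg _ _ _) (by linarith))

/-- One step of the scheme is solvable. -/
lemma StepData.exists_step (hD : StepData h Λ M Um Uo Po H) (hh : 0 < h) (hτ : 0 < τ) (hM : 1 ≤ M)
    (hL : h * M = L) (hΛ : 1 ≤ Λ) (hLΛ : L ≤ Λ) (hε : 0 < ε)
    (hsmall : 4 * (Λ * (25 * Λ ^ 8)) ^ 2 * τ ≤ 1) {Pm : ℕ → ℝ} (bPm : Pm 0 = 0 ∧ Pm M = 0) :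
    ∃ (Up : ℕ → ℂ) (Pp : ℕ → ℝ), (Up 0 = 0 ∧ Up M = 0) ∧ (Pp 0 = 0 ∧ Pp M = 0) ∧
      (∀ j ∈ Finset.Ico 1 M, Complex.I * ((2 * τ)⁻¹ • (Up j - Um j))
        = - dx2 h (fun j => (2 : ℝ)⁻¹ • (Up j + Um j)) j
          + (-‖Uo j‖ ^ 2 + H j + (2 : ℝ)⁻¹ * (Pp j + Pm j)) • ((2 : ℝ)⁻¹ • (Up j + Um j))) ∧
      ∀ j ∈ Finset.Ico 1 M, ε ^ 2 * ((τ ^ 2)⁻¹ * (Pp j - 2 * Po j + Pm j))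
        = dx2 h (fun j => (2 : ℝ)⁻¹ * (Pp j + Pm j)) j
          + ε ^ 2 * ((τ ^ 2)⁻¹ * (‖Up j‖ ^ 2 - 2 * ‖Uo j‖ ^ 2 + ‖Um j‖ ^ 2)) := by
  classical
  set μ : ℝ := τ ^ 2 / ε ^ 2 with hμ
  have hμ0 : 0 ≤ μ := by positivity
  set R : ℝ := 25 * Λ ^ 8 with hR
  have hR0 : 0 ≤ R := by positivity
  have hΛ0 : 0 < Λ := by linarith
  have hΛR : Λ ≤ R := by
    have := le_self_pow₀ hΛ (by norm_num : 8 ≠ 0)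
    have : 0 < Λ ^ 8 := by positivity
    linarith
  choose Q bQ eQ using fun u : ℕ → ℂ => exists_elliptic hh hμ0 hM
    (fun j => 2 * Po j + ‖u j‖ ^ 2 - 2 * ‖Uo j‖ ^ 2 + ‖Um j‖ ^ 2)
  choose p bp ep using fun u : ℕ → ℂ => exists_schrodinger hh hτ hM
    (fun j => -‖Uo j‖ ^ 2 + H j + Q u j) Um
  have bp' : ∀ u, p u 0 = 0 ∧ p u M = 0 := fun u => ⟨bp u 0 (by simp), bp u M (by simp)⟩
  have hpm : ∀ u, l2 h M (p u) = l2 h M Um := fun u =>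
    mass_conservation hh hτ hM (bp' u) hD.bdry_m (ep u)
  have hpR : ∀ u : ℕ → ℂ, (u 0 = 0 ∧ u M = 0) → l2 h M u ≤ l2 h M Um → l2dx h M u ≤ R →
      l2dx h M (p u) ≤ R := fun u bu hu hu' =>
    hD.bound hh hτ hM hL hΛ hLΛ hμ0 bu (bp' u) (bQ u) hu (hu'.trans (le_max_left _ _)) (eQ u) (ep u)
  have hcontr : ∀ u v : ℕ → ℂ, (u 0 = 0 ∧ u M = 0) → (v 0 = 0 ∧ v M = 0) →
      l2 h M v ≤ l2 h M Um →
      l2dx h M u ≤ R → l2dx h M v ≤ R →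
      l2 h M (fun j => p u j - p v j) ≤ 1 / 2 * l2 h M (fun j => u j - v j) := by
    intro u v bu bv hv0 hu hv
    have c1 : l2 h M (fun j => ‖u j‖ ^ 2 - ‖v j‖ ^ 2)
        ≤ 2 * (Λ * R) * l2 h M (fun j => u j - v j) :=
      l2_normSq_sub_le hh (by positivity) (StepData.sup_bound hh hL hΛ hLΛ bu.1 hu)
        (StepData.sup_bound hh hL hΛ hLΛ bv.1 hv)
    have c2 : 2 * l2 h M (fun j => Q u j - Q v j) ≤ l2 h M (fun j => ‖u j‖ ^ 2 - ‖v j‖ ^ 2) :=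
      elliptic_bound hh hμ0 hM ⟨by simp [bQ], by simp [bQ]⟩ (fun j hj => by
        rw [dx2_sub]; linear_combination eQ u j hj - eQ v j hj)
    have c3 := schrodinger_bound (w := fun j => p u j - p v j)
      (f := fun j => (Q u j - Q v j) • ((2 : ℝ)⁻¹ • (p v j + Um j)))
      (V := fun j => -‖Uo j‖ ^ 2 + H j + Q u j) hh hτ hM ⟨by simp [bp'], by simp [bp']⟩
      (fun j hj => by
        have e1 := ep u j hj
        have e2 := ep v j hj
        simp only [dx2, Complex.real_smul] at e1 e2 ⊢
        push_cast at e1 e2 ⊢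
        linear_combination e1 - e2)
    have c4 : l2 h M (fun j => (Q u j - Q v j) • ((2 : ℝ)⁻¹ • (p v j + Um j)))
        ≤ Λ * R * l2 h M (fun j => Q u j - Q v j) := by
      have : l2 h M (fun j => (Q u j - Q v j) • ((2 : ℝ)⁻¹ • (p v j + Um j)))
          ≤ l2 h M (fun j => (Λ * R) • (Q u j - Q v j)) := by
        refine l2_mono hh fun j hj => ?_
        have n1 := StepData.sup_bound hh hL hΛ hLΛ (bp' v).1 (hpR v bv hv0 hv) j hj
        have n2 := StepData.sup_bound hh hL hΛ hLΛ hD.bdry_m.1 (hD.norm_m.trans hΛR) j hj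
        rw [norm_smul, norm_smul, norm_smul, mul_comm, Real.norm_of_nonneg (by positivity : 0 ≤ Λ * R),
          Real.norm_of_nonneg (by norm_num : (0:ℝ) ≤ 2⁻¹)]
        refine mul_le_mul_of_nonneg_right ?_ (norm_nonneg _)
        linarith [norm_add_le (p v j) (Um j)]
      rwa [l2_smul, abs_of_nonneg (by positivity)] at this
    have n0 := l2_nonneg h M (fun j => u j - v j)
    have n1 : l2 h M (fun j => Q u j - Q v j) ≤ Λ * R * l2 h M (fun j => u j - v j) := by linarith
    have n2 : l2 h M (fun j => p u j - p v j)
        ≤ 2 * τ * (Λ * R * (Λ * R * l2 h M (fun j => u j - v j))) :=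
      c3.trans (by gcongr; exact c4.trans (by gcongr))
    refine n2.trans ?_
    calc _ = (4 * (Λ * R) ^ 2 * τ) * (1 / 2 * l2 h M (fun j => u j - v j)) := by ring
      _ ≤ 1 * (1 / 2 * l2 h M (fun j => u j - v j)) := by gcongr
      _ = _ := one_mul _
  let ext : EuclideanSpace ℂ {j // j ∈ Finset.Ico 1 M} → ℕ → ℂ := fun v j => if hj : j ∈ Finset.Ico 1 M then v ⟨j, hj⟩ else 0
  let res : (ℕ → ℂ) → EuclideanSpace ℂ {j // j ∈ Finset.Ico 1 M} := fun u => WithLp.toLp 2 fun j => u j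
  have hext : ∀ u : ℕ → ℂ, (∀ j ∉ Finset.Ico 1 M, u j = 0) → ext (res u) = u := by
    intro u hu
    funext j
    by_cases hj : j ∈ Finset.Ico 1 M
    · simp only [ext, res, hj, dite_true]
    · simp only [ext, hj, dite_false, hu j hj]
  have hext0 : ∀ v, ext v 0 = 0 ∧ ext v M = 0 := fun v => by simp [ext]
  have hnorm : ∀ u v : EuclideanSpace ℂ {j // j ∈ Finset.Ico 1 M}, l2 h M (fun j => ext u j - ext v j) = √h * dist u v := by
    intro u v
    rw [l2, Real.sqrt_mul hh.le, EuclideanSpace.dist_eq, ← Finset.sum_coe_sort]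
    congr 2
    refine Finset.sum_congr rfl fun j _ => ?_
    have := j.2
    simp only [ext, this, dite_true, dist_eq_norm]
  have hcont : ∀ j, Continuous fun v : EuclideanSpace ℂ {j // j ∈ Finset.Ico 1 M} => ext v j := by
    intro j
    by_cases hj : j ∈ Finset.Ico 1 M
    · simp only [ext, hj, dite_true]; fun_prop
    · simp only [ext, hj, dite_false]; fun_prop
  let S : Set (EuclideanSpace ℂ {j // j ∈ Finset.Ico 1 M}) := {v | l2 h M (ext v) ≤ l2 h M Um ∧ l2dx h M (ext v) ≤ R}
  have hS : IsClosed S := by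
    refine IsClosed.inter (isClosed_le (f := fun v => l2 h M (ext v)) ?_ continuous_const)
      (isClosed_le (f := fun v => l2dx h M (ext v)) ?_ continuous_const)
    · unfold l2
      exact Real.continuous_sqrt.comp (continuous_const.mul
        (continuous_finsetSum _ fun j _ => ((hcont j).norm.pow 2)))
    · unfold l2dx dxp
      exact Real.continuous_sqrt.comp (continuous_const.mul
        (continuous_finsetSum _ fun j _ =>
          ((((hcont (j + 1)).sub (hcont j)).const_smul h⁻¹).norm.pow 2)))
  let Φ : EuclideanSpace ℂ {j // j ∈ Finset.Ico 1 M} → EuclideanSpace ℂ {j // j ∈ Finset.Ico 1 M} := fun v => res (p (ext v))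
  have hΦe : ∀ v, ext (Φ v) = p (ext v) := fun v => hext _ (bp _)
  have hmaps : MapsTo Φ S S := by
    intro v hv
    refine ⟨?_, ?_⟩
    · rw [hΦe, hpm]
    · rw [hΦe]; exact hpR _ (hext0 v) hv.1 hv.2
  have hcw : ContractingWith (1 / 2) (hmaps.restrict Φ S S) := by
    refine ⟨by rw [← NNReal.coe_lt_coe]; norm_num, LipschitzWith.of_dist_le_mul fun u v => ?_⟩
    have := hcontr (ext u) (ext v) (hext0 _) (hext0 _) v.2.1 u.2.2 v.2.2
    rw [← hΦe, ← hΦe, hnorm, hnorm] at this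
    have hs : 0 < √h := Real.sqrt_pos.2 hh
    have h2 : √h * dist (Φ u) (Φ v) ≤ √h * (1 / 2 * dist (u : EuclideanSpace ℂ {j // j ∈ Finset.Ico 1 M}) v) := by linarith
    have := le_of_mul_le_mul_left h2 hs
    have e : ((1 / 2 : NNReal) : ℝ) = 1 / 2 := by norm_num
    rw [e]
    exact this
  have h0S : (0 : EuclideanSpace ℂ {j // j ∈ Finset.Ico 1 M}) ∈ S := by
    have : ext 0 = fun _ => 0 := by funext j; simp [ext]
    refine ⟨?_, ?_⟩
    · rw [this]
      have h0 : l2 h M (fun _ : ℕ => (0 : ℂ)) = 0 := by simp [l2]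
      rw [h0]; exact l2_nonneg _ _ _
    · rw [this]
      have h0 : l2dx h M (fun _ : ℕ => (0 : ℂ)) = 0 := by simp [l2dx, dxp]
      rw [h0]; exact hR0
  obtain ⟨v, -, hv, -⟩ := hcw.exists_fixedPoint' hS.isComplete hmaps h0S (edist_ne_top _ _)
  have hfix : p (ext v) = ext v := by rw [← hΦe, hv]
  refine ⟨ext v, fun j => 2 * Q (ext v) j - Pm j, hext0 v, ⟨by simp [bQ, bPm.1], by simp [bQ, bPm.2]⟩,
    fun j hj => ?_, fun j hj => ?_⟩
  · have := ep (ext v) j hj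
    rw [hfix] at this
    have e : (2 : ℝ)⁻¹ * (2 * Q (ext v) j - Pm j + Pm j) = Q (ext v) j := by ring
    rw [e]; exact this
  · have := eQ (ext v) j hj
    have e : (fun j => (2 : ℝ)⁻¹ * (2 * Q (ext v) j - Pm j + Pm j)) = Q (ext v) := by
      funext i; ring
    rw [e]
    have hμ' : ε ^ 2 * ((τ ^ 2)⁻¹ * μ) = 1 := by rw [hμ]; field_simp
    linear_combination (ε ^ 2 * (τ ^ 2)⁻¹) * this + dx2 h (Q (ext v)) j * hμ'

end Existence

section Bootstrap

/-- `(U, P)` solves the scheme with potential `H` on the levels `0, …, n`. -/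
structure GridScheme (h τ ε : ℝ) (M n : ℕ) (U : ℕ → ℕ → ℂ) (P H : ℕ → ℕ → ℝ) : Prop where
  bdry_U : ∀ k ≤ n, U k 0 = 0 ∧ U k M = 0
  bdry_P : ∀ k ≤ n, P k 0 = 0 ∧ P k M = 0
  eq_U : ∀ l, l + 2 ≤ n → ∀ j ∈ Finset.Ico 1 M, Complex.I * dt τ U (l + 1) j
    = - dx2 h (avg U (l + 1)) j
      + ((-‖U (l + 1) j‖ ^ 2 + H (l + 1) j + avg P (l + 1) j : ℝ) : ℂ) * avg U (l + 1) j
  eq_P : ∀ l, l + 2 ≤ n → ∀ j ∈ Finset.Ico 1 M, ε ^ 2 * dt2 τ P (l + 1) j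
    = dx2 h (avg P (l + 1)) j + ε ^ 2 * dt2 τ (fun k i => ‖U k i‖ ^ 2) (l + 1) j

lemma two_mul_sq_le {Λ : ℝ} (hΛ : 1 ≤ Λ) :
    Λ ≤ Λ ^ 2 ∧ 1 ≤ Λ ^ 2 ∧ 2 * Λ ^ 2 ≤ 25 * (2 * Λ ^ 2) ^ 8 := by
  have h : 1 ≤ Λ ^ 2 := one_le_pow₀ hΛ
  have := le_self_pow₀ (by linarith : 1 ≤ 2 * Λ ^ 2) (by norm_num : 8 ≠ 0)
  exact ⟨le_self_pow₀ hΛ (by norm_num), h, by linarith⟩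

/-- `(X, Y)` solves the scheme with potential `H` and first two levels `u₀, u₁, p₀, p₁` up to
residuals of size `δ`. -/
structure Consistent (h τ ε Λ δ : ℝ) (M N : ℕ) (X : ℕ → ℕ → ℂ) (Y H : ℕ → ℕ → ℝ)
    (u₀ u₁ : ℕ → ℂ) (p₀ p₁ : ℕ → ℝ) (r s : ℕ → ℕ → ℂ) (η₁ η₂ : ℕ → ℕ → ℝ) : Prop where
  bdry_X : ∀ k ≤ N, X k 0 = 0 ∧ X k M = 0
  bdry_Y : ∀ k ≤ N, Y k 0 = 0 ∧ Y k M = 0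
  norm_X : ∀ k ≤ N, ∀ j ≤ M, ‖X k j‖ ≤ Λ
  dxp_X : ∀ k ≤ N, ∀ j < M, ‖dxp h (X k) j‖ ≤ Λ
  dt_X : ∀ l, l + 2 ≤ N → ∀ j ∈ Finset.Ico 1 M, ‖dt τ X (l + 1) j‖ ≤ Λ
  norm_Y : ∀ k ≤ N, ∀ j ≤ M, |Y k j| ≤ Λ
  dxp_Y : ∀ k ≤ N, ∀ j < M, ‖dxp h (Y k) j‖ ≤ Λ
  norm_H : ∀ l, l + 2 ≤ N → ∀ j ≤ M, |H (l + 1) j| ≤ Λ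
  dxp_H : ∀ l, l + 2 ≤ N → ∀ j < M, ‖dxp h (H (l + 1)) j‖ ≤ Λ
  eq_X : ∀ l, l + 2 ≤ N → ∀ j ∈ Finset.Ico 1 M, Complex.I * dt τ X (l + 1) j
    = - dx2 h (avg X (l + 1)) j
      + ((-‖X (l + 1) j‖ ^ 2 + H (l + 1) j + avg Y (l + 1) j : ℝ) : ℂ) * avg X (l + 1) j
      + (r (l + 1) j + s (l + 1) j)
  eq_Y : ∀ l, l + 2 ≤ N → ∀ j ∈ Finset.Ico 1 M, ε ^ 2 * dt2 τ Y (l + 1) j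
    = dx2 h (avg Y (l + 1)) j + ε ^ 2 * dt2 τ (fun k i => ‖X k i‖ ^ 2) (l + 1) j
      + (η₁ (l + 1) j + η₂ (l + 1) j)
  norm_r : ∀ l, l + 2 ≤ N → ∀ j ∈ Finset.Ico 1 M, ‖r (l + 1) j‖ ≤ δ
  dxp_r : ∀ l, l + 2 ≤ N → ∀ j ∈ Finset.Ico 1 (M - 1), ‖dxp h (r (l + 1)) j‖ ≤ δ
  bdry_s : ∀ l, l + 2 ≤ N → s (l + 1) 0 = 0 ∧ s (l + 1) M = 0
  dxp_s : ∀ l, l + 2 ≤ N → ∀ j < M, ‖dxp h (s (l + 1)) j‖ ≤ δ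
  norm_η₁ : ∀ l, l + 2 ≤ N → ∀ j ∈ Finset.Ico 1 M, |η₁ (l + 1) j| ≤ ε * δ
  norm_η₂ : ∀ k, k + 1 ≤ N → ∀ j ∈ Finset.Ico 1 M, |η₂ k j| ≤ δ
  diff_η₂ : ∀ l, l + 2 ≤ N → ∀ j ∈ Finset.Ico 1 M, |η₂ (l + 1) j - η₂ l j| ≤ τ * δ
  init_X : ∀ j ≤ M, X 0 j = u₀ j
  init_Y : ∀ j ≤ M, Y 0 j = p₀ j
  first_X : 1 ≤ N → l2dx h M (fun j => X 1 j - u₁ j) ≤ δ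
  first_Y : 1 ≤ N → l2 h M (fun j => Y 1 j - p₁ j) ≤ δ
  first_g : 1 ≤ N → ε / τ * l2 h M (fun j => (Y 1 j - p₁ j) - (‖X 1 j‖ ^ 2 - ‖u₁ j‖ ^ 2)) ≤ δ

/-- The stability constant of the scheme. -/
noncomputable def stabilityConst (T Λ : ℝ) : ℝ :=
  √(2 * (Real.exp (8 * (312 * Λ ^ 9) * T) * 500 * Λ ^ 14))

lemma one_le_stabilityConst {T Λ : ℝ} (hT : 0 ≤ T) (hΛ : 1 ≤ Λ) : 1 ≤ stabilityConst T Λ := by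
  rw [stabilityConst, Real.one_le_sqrt]
  have h1 : 1 ≤ Real.exp (8 * (312 * Λ ^ 9) * T) := Real.one_le_exp (by positivity)
  have h2 : 1 ≤ Λ ^ 14 := one_le_pow₀ hΛ
  nlinarith

variable {h L T τ ε Λ Λ' δ : ℝ} {M N n : ℕ} {X U : ℕ → ℕ → ℂ} {Y P H : ℕ → ℕ → ℝ}
  {u₀ u₁ : ℕ → ℂ} {p₀ p₁ : ℕ → ℝ} {r s : ℕ → ℕ → ℂ} {η₁ η₂ : ℕ → ℕ → ℝ}

lemma Consistent.comparison (hC : Consistent h τ ε Λ δ M N X Y H u₀ u₁ p₀ p₁ r s η₁ η₂)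
    (hG : GridScheme h τ ε M n U P H) (hn : n ≤ N) (hU0 : ∀ j ≤ M, U 0 j = u₀ j ∧ P 0 j = p₀ j)
    (hU1 : 1 ≤ n → ∀ j ≤ M, U 1 j = u₁ j ∧ P 1 j = p₁ j) (hΛ : Λ ≤ Λ')
    (hU : ∀ k ≤ n, l2dx h M (U k) ≤ Λ') :
    Comparison h τ ε Λ' δ M n X U Y P H r s η₁ η₂ where
  bdry_X k hk := hC.bdry_X k (hk.trans hn)
  bdry_U := hG.bdry_U
  bdry_Y k hk := hC.bdry_Y k (hk.trans hn)
  bdry_P := hG.bdry_P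
  norm_X k hk j hj := (hC.norm_X k (hk.trans hn) j hj).trans hΛ
  dxp_X k hk j hj := (hC.dxp_X k (hk.trans hn) j hj).trans hΛ
  dt_X l hl j hj := (hC.dt_X l (hl.trans hn) j hj).trans hΛ
  norm_Y k hk j hj := (hC.norm_Y k (hk.trans hn) j hj).trans hΛ
  dxp_Y k hk j hj := (hC.dxp_Y k (hk.trans hn) j hj).trans hΛ
  norm_H l hl j hj := (hC.norm_H l (hl.trans hn) j hj).trans hΛ
  dxp_H l hl j hj := (hC.dxp_H l (hl.trans hn) j hj).trans hΛ
  norm_U := hU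
  eq_U := hG.eq_U
  eq_X l hl := hC.eq_X l (hl.trans hn)
  eq_P := hG.eq_P
  eq_Y l hl := hC.eq_Y l (hl.trans hn)
  norm_r l hl := hC.norm_r l (hl.trans hn)
  dxp_r l hl := hC.dxp_r l (hl.trans hn)
  bdry_s l hl := hC.bdry_s l (hl.trans hn)
  dxp_s l hl := hC.dxp_s l (hl.trans hn)
  norm_η₁ l hl := hC.norm_η₁ l (hl.trans hn)
  norm_η₂ l hl := hC.norm_η₂ l (hl.trans hn)
  diff_η₂ l hl := hC.diff_η₂ l (hl.trans hn)
  init_X j hj := (hC.init_X j hj).trans (hU0 j hj).1.symm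
  init_Y j hj := (hC.init_Y j hj).trans (hU0 j hj).2.symm
  first_X h1 := by
    rw [l2dx_congr (v := fun j => X 1 j - u₁ j) (fun j hj => by simp only [(hU1 h1 j hj).1])]
    exact hC.first_X (h1.trans hn)
  first_Y h1 := by
    rw [l2_congr (u' := fun j => Y 1 j - p₁ j)
      (fun j hj => by simp only [(hU1 h1 j (Finset.mem_Ico.1 hj).2.le).2])]
    exact hC.first_Y (h1.trans hn)
  first_g h1 := by
    rw [l2_congr (u' := fun j => (Y 1 j - p₁ j) - (‖X 1 j‖ ^ 2 - ‖u₁ j‖ ^ 2))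
      (fun j hj => by
        have := hU1 h1 j (Finset.mem_Ico.1 hj).2.le
        simp only [this.1, this.2])]
    exact hC.first_g (h1.trans hn)

lemma GridScheme.mono {m : ℕ} (hG : GridScheme h τ ε M n U P H) (hm : m ≤ n) :
    GridScheme h τ ε M m U P H where
  bdry_U k hk := hG.bdry_U k (hk.trans hm)
  bdry_P k hk := hG.bdry_P k (hk.trans hm)
  eq_U l hl := hG.eq_U l (hl.trans hm)
  eq_P l hl := hG.eq_P l (hl.trans hm)

lemma GridScheme.step_bound {m : ℕ} (hG : GridScheme h τ ε M (m + 2) U P H)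
    (hD : StepData h Λ M (U m) (U (m + 1)) (P (m + 1)) (H (m + 1)))
    (hh : 0 < h) (hτ : 0 < τ) (hε : 0 < ε) (hM : 1 ≤ M) (hL : h * M = L) (hΛ : 1 ≤ Λ)
    (hLΛ : L ≤ Λ) : l2dx h M (U (m + 2)) ≤ 25 * Λ ^ 8 := by
  have bU := hG.bdry_U (m + 2) le_rfl
  have bP := hG.bdry_P (m + 2) le_rfl
  have bU0 := hG.bdry_U m (by omega)
  have bP0 := hG.bdry_P m (by omega)
  have e1 : avg P (m + 1) = fun j => (2 : ℝ)⁻¹ * (P (m + 2) j + P m j) := by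
    funext j; simp only [avg, Nat.add_sub_cancel, smul_eq_mul]
  have hE := hG.eq_U m le_rfl
  simp only [e1] at hE
  have hQ := hG.eq_P m le_rfl
  simp only [e1, dt2, Nat.add_sub_cancel, smul_eq_mul] at hQ
  have e2 : avg U (m + 1) = fun j => (2 : ℝ)⁻¹ • (U (m + 2) j + U m j) := by
    funext j; simp only [avg, Nat.add_sub_cancel]
  have e3 : ∀ j, dt τ U (m + 1) j = (2 * τ)⁻¹ • (U (m + 2) j - U m j) := fun j => by
    simp only [dt, Nat.add_sub_cancel]
  simp only [e2, e3] at hE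
  have hp : ∀ j ∈ Finset.Ico 1 M, Complex.I * ((2 * τ)⁻¹ • (U (m + 2) j - U m j))
      = - dx2 h (fun j => (2 : ℝ)⁻¹ • (U (m + 2) j + U m j)) j
        + (-‖U (m + 1) j‖ ^ 2 + H (m + 1) j + (2 : ℝ)⁻¹ * (P (m + 2) j + P m j)) •
          ((2 : ℝ)⁻¹ • (U (m + 2) j + U m j)) := fun j hj => by
    have := hE j hj
    rw [this, Complex.real_smul (x := -‖U (m + 1) j‖ ^ 2 + _ + _)]
  refine hD.bound (μ := τ ^ 2 / ε ^ 2) (u := U (m + 2)) (p := U (m + 2))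
    (Q := fun j => (2 : ℝ)⁻¹ * (P (m + 2) j + P m j)) hh hτ hM hL hΛ hLΛ (by positivity) bU bU
    ⟨by simp [bP.1, bP0.1], by simp [bP.2, bP0.2]⟩
    (mass_conservation hh hτ hM bU bU0 hp).le (le_max_right _ _) (fun j hj => ?_) hp
  have := hQ j hj
  field_simp at this ⊢
  linear_combination this

lemma Consistent.stepData (hC : Consistent h τ ε Λ δ M N X Y H u₀ u₁ p₀ p₁ r s η₁ η₂) {m : ℕ}
    (hm : m + 2 ≤ N) (hΛ : Λ ≤ Λ') (bm : U m 0 = 0 ∧ U m M = 0)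
    (bo : U (m + 1) 0 = 0 ∧ U (m + 1) M = 0) (nm : l2dx h M (U m) ≤ Λ')
    (no : l2dx h M (U (m + 1)) ≤ Λ') (nP : l2 h M (P (m + 1)) ≤ Λ') :
    StepData h Λ' M (U m) (U (m + 1)) (P (m + 1)) (H (m + 1)) :=
  ⟨bm, bo, nm, no, nP, fun j hj => (hC.norm_H m hm j hj).trans hΛ⟩

lemma Consistent.bounds (hC : Consistent h τ ε Λ δ M N X Y H u₀ u₁ p₀ p₁ r s η₁ η₂)
    (hG : GridScheme h τ ε M n U P H) (hn : n ≤ N) (hU0 : ∀ j ≤ M, U 0 j = u₀ j ∧ P 0 j = p₀ j)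
    (hU1 : 1 ≤ n → ∀ j ≤ M, U 1 j = u₁ j ∧ P 1 j = p₁ j) (hh : 0 < h) (hτ : 0 < τ)
    (hε : 0 < ε) (hM : 1 ≤ M) (hL : h * M = L) (hΛ : 1 ≤ Λ) (hLΛ : L ≤ Λ) (hLΛ' : 1 ≤ Λ * L)
    (hδ : 0 ≤ δ) (hT : N * τ ≤ T)
    (hsmall : 2 * stabilityConst T (25 * (2 * Λ ^ 2) ^ 8) * δ ≤ 1)
    (hτΛ : 4 * (312 * (25 * (2 * Λ ^ 2) ^ 8) ^ 9) * τ ≤ 1) :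
    ∀ k ≤ n, l2dx h M (U k) ≤ 2 * Λ ^ 2 ∧ l2 h M (P k) ≤ 2 * Λ ^ 2 := by
  have hT0 : 0 ≤ T := le_trans (by positivity) hT
  obtain ⟨q1, q1', q2⟩ := two_mul_sq_le hΛ
  set Λ₂ := 25 * (2 * Λ ^ 2) ^ 8 with hΛ₂
  have hs := sqrt_le_of_le hΛ hLΛ
  have hS := one_le_stabilityConst hT0 (by linarith : 1 ≤ Λ₂)
  have hδ1 : δ ≤ 1 := by nlinarith
  -- closeness implies the bounds
  have close : ∀ k ≤ n, l2dx h M (fun j => X k j - U k j) ≤ 1 →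
      l2 h M (fun j => Y k j - P k j) ≤ 1 →
      l2dx h M (U k) ≤ 2 * Λ ^ 2 ∧ l2 h M (P k) ≤ 2 * Λ ^ 2 := by
    intro k hk h1 h2
    have x1 : l2dx h M (X k) ≤ Λ ^ 2 :=
      (l2dx_le_of_forall hh hL (by linarith) (hC.dxp_X k (hk.trans hn))).trans
        (by rw [sq]; gcongr)
    have y1 : l2 h M (Y k) ≤ Λ ^ 2 :=
      (l2_le_of_forall hh hL (by linarith) (fun j hj => hC.norm_Y k (hk.trans hn) j
        (Finset.mem_Ico.1 hj).2.le)).trans (by rw [sq]; gcongr)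
    have x2 := l2dx_sub_le hh M (X k) (fun j => X k j - U k j)
    have y2 := l2_sub_le hh M (Y k) (fun j => Y k j - P k j)
    simp only [sub_sub_cancel] at x2 y2
    exact ⟨by linarith, by linarith⟩
  intro k
  induction k using Nat.strong_induction_on with
  | _ k ih =>
    intro hk
    rcases k with _ | _ | m
    · refine close 0 hk ?_ ?_
      · rw [l2dx_congr (v := fun _ => (0 : ℂ)) (fun j hj => by
          simp [hC.init_X j hj, (hU0 j hj).1])]
        simp [l2dx, dxp]
      · rw [l2_congr (u' := fun _ => (0 : ℝ)) (fun j hj => by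
          have hj' := (Finset.mem_Ico.1 hj).2.le
          simp [hC.init_Y j hj', (hU0 j hj').2])]
        simp [l2]
    · rw [zero_add] at hk ⊢
      refine close 1 hk ?_ ?_
      · rw [l2dx_congr (v := fun j => X 1 j - u₁ j) (fun j hj => by simp only [(hU1 hk j hj).1])]
        exact (hC.first_X (hk.trans hn)).trans hδ1
      · rw [l2_congr (u' := fun j => Y 1 j - p₁ j)
          (fun j hj => by simp only [(hU1 hk j (Finset.mem_Ico.1 hj).2.le).2])]
        exact (hC.first_Y (hk.trans hn)).trans hδ1
    · have i0 := ih m (by omega) (by omega)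
      have i1 := ih (m + 1) (by omega) (by omega)
      have hb := (hG.mono hk).step_bound (hC.stepData (hk.trans hn) (by linarith : Λ ≤ 2 * Λ ^ 2)
        (hG.bdry_U _ (by omega)) (hG.bdry_U _ (by omega)) i0.1 i1.1 i1.2) hh hτ hε hM hL
        (by linarith) (by linarith)
      have hcomp := hC.comparison (hG.mono hk) (hk.trans hn) hU0 (fun _ => hU1 (by omega))
        (by linarith : Λ ≤ Λ₂) (fun i hi => by
          rcases hi.lt_or_eq with hi | rfl
          · exact (ih i (by omega) (by omega)).1.trans q2
          · exact hb)
      obtain ⟨c1, c2⟩ := hcomp.error_le (T := T) hh hτ hε hM hL (by linarith) (by linarith)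
        (hLΛ'.trans (by have : 0 < L := by rw [← hL]; positivity
                        gcongr; linarith)) hδ hτΛ
        (le_trans (by gcongr; exact_mod_cast hk.trans hn) hT) le_rfl
      change _ ≤ stabilityConst T Λ₂ * δ at c1
      change _ ≤ 2 * stabilityConst T Λ₂ * δ at c2
      refine close (m + 2) hk (c1.trans ?_) (c2.trans hsmall)
      nlinarith

lemma Consistent.error_le (hC : Consistent h τ ε Λ δ M N X Y H u₀ u₁ p₀ p₁ r s η₁ η₂)
    (hG : GridScheme h τ ε M N U P H) (hU0 : ∀ j ≤ M, U 0 j = u₀ j ∧ P 0 j = p₀ j)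
    (hU1 : 1 ≤ N → ∀ j ≤ M, U 1 j = u₁ j ∧ P 1 j = p₁ j)
    (hU : ∀ k ≤ N, l2dx h M (U k) ≤ 2 * Λ ^ 2) (hh : 0 < h) (hτ : 0 < τ)
    (hε : 0 < ε) (hM : 1 ≤ M) (hL : h * M = L) (hΛ : 1 ≤ Λ) (hLΛ : L ≤ Λ) (hLΛ' : 1 ≤ Λ * L)
    (hδ : 0 ≤ δ) (hT : N * τ ≤ T)
    (hτΛ : 4 * (312 * (25 * (2 * Λ ^ 2) ^ 8) ^ 9) * τ ≤ 1) {k : ℕ} (hk : k ≤ N) :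
    l2dx h M (fun j => X k j - U k j) ≤ stabilityConst T (25 * (2 * Λ ^ 2) ^ 8) * δ ∧
    l2 h M (fun j => Y k j - P k j) ≤ 2 * stabilityConst T (25 * (2 * Λ ^ 2) ^ 8) * δ := by
  obtain ⟨q1, q1', q2⟩ := two_mul_sq_le hΛ
  set Λ₂ := 25 * (2 * Λ ^ 2) ^ 8 with hΛ₂
  have hcomp := hC.comparison hG le_rfl hU0 hU1 (by linarith : Λ ≤ Λ₂)
    (fun i hi => (hU i hi).trans q2)
  exact hcomp.error_le hh hτ hε hM hL (by linarith) (by linarith)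
        (hLΛ'.trans (by have : 0 < L := by rw [← hL]; positivity
                        gcongr; linarith)) hδ hτΛ hT hk

lemma Consistent.exists_gridScheme
    (hC : Consistent h τ ε Λ δ M N X Y H u₀ u₁ p₀ p₁ r s η₁ η₂) (hh : 0 < h) (hτ : 0 < τ)
    (hε : 0 < ε) (hM : 1 ≤ M) (hL : h * M = L) (hΛ : 1 ≤ Λ) (hLΛ : L ≤ Λ) (hLΛ' : 1 ≤ Λ * L)
    (hδ : 0 ≤ δ) (hT : N * τ ≤ T)
    (hsmall : 2 * stabilityConst T (25 * (2 * Λ ^ 2) ^ 8) * δ ≤ 1)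
    (hτΛ : 4 * (312 * (25 * (2 * Λ ^ 2) ^ 8) ^ 9) * τ ≤ 1)
    (bu₀ : u₀ 0 = 0 ∧ u₀ M = 0) (bu₁ : u₁ 0 = 0 ∧ u₁ M = 0) (bp₀ : p₀ 0 = 0 ∧ p₀ M = 0)
    (bp₁ : p₁ 0 = 0 ∧ p₁ M = 0) :
    ∃ U P, GridScheme h τ ε M N U P H ∧ U 0 = u₀ ∧ P 0 = p₀ ∧ U 1 = u₁ ∧ P 1 = p₁ ∧
      ∀ k, (U k 0 = 0 ∧ U k M = 0) ∧ (P k 0 = 0 ∧ P k M = 0) := by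
  have q1 : Λ ≤ Λ ^ 2 := le_self_pow₀ hΛ (by norm_num)
  have q1' : 1 ≤ Λ ^ 2 := one_le_pow₀ hΛ
  have hsm : 4 * (2 * Λ ^ 2 * (25 * (2 * Λ ^ 2) ^ 8)) ^ 2 * τ ≤ 1 := by
    refine le_trans (mul_le_mul_of_nonneg_right ?_ hτ.le) hτΛ
    have a1 : 2 * Λ ^ 2 ≤ 25 * (2 * Λ ^ 2) ^ 8 := by
      have := le_self_pow₀ (by linarith : 1 ≤ 2 * Λ ^ 2) (by norm_num : 8 ≠ 0)
      have : 0 ≤ (2 * Λ ^ 2) ^ 8 := by positivity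
      linarith
    set R := 25 * (2 * Λ ^ 2) ^ 8
    have hR : 1 ≤ R := by linarith
    have a2 : R ^ 4 ≤ R ^ 9 := pow_le_pow_right₀ hR (by norm_num)
    have a3 : 0 ≤ R ^ 9 := by positivity
    calc 4 * (2 * Λ ^ 2 * R) ^ 2 ≤ 4 * (R * R) ^ 2 := by gcongr
      _ = 4 * R ^ 4 := by ring
      _ ≤ _ := by linarith
  suffices ∀ n ≤ N, ∃ U P, GridScheme h τ ε M n U P H ∧ U 0 = u₀ ∧ P 0 = p₀ ∧ U 1 = u₁ ∧
      P 1 = p₁ ∧ ∀ k, (U k 0 = 0 ∧ U k M = 0) ∧ (P k 0 = 0 ∧ P k M = 0) from this N le_rfl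
  intro n
  induction n with
  | zero =>
    intro _
    refine ⟨fun k => if k = 0 then u₀ else u₁, fun k => if k = 0 then p₀ else p₁, ?_, by simp,
      by simp, by simp, by simp, ?_⟩
    · refine ⟨fun k hk => ?_, fun k hk => ?_, fun l hl => by omega, fun l hl => by omega⟩
      · obtain rfl : k = 0 := by omega
        simpa using bu₀
      · obtain rfl : k = 0 := by omega
        simpa using bp₀
    · intro k
      by_cases hk : k = 0
      · simp [hk, bu₀, bp₀]
      · simp [hk, bu₁, bp₁]
  | succ n ih =>
    intro hn
    obtain ⟨U, P, hG, hu0, hp0, hu1, hp1, hb⟩ := ih (by omega)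
    rcases n with _ | m
    · refine ⟨U, P, ⟨fun k _ => (hb k).1, fun k _ => (hb k).2, fun l hl => by omega,
        fun l hl => by omega⟩, hu0, hp0, hu1, hp1, hb⟩
    have hbd := hC.bounds hG (by omega) (fun j _ => by rw [hu0, hp0]; exact ⟨rfl, rfl⟩)
      (fun _ j _ => by rw [hu1, hp1]; exact ⟨rfl, rfl⟩) hh hτ hε hM hL hΛ hLΛ hLΛ' hδ hT hsmall hτΛ
    have hD := hC.stepData (P := P) (m := m) (by omega) (by linarith : Λ ≤ 2 * Λ ^ 2) (hb m).1
      (hb (m + 1)).1 (hbd m (by omega)).1 (hbd (m + 1) le_rfl).1 (hbd (m + 1) le_rfl).2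
    obtain ⟨Up, Pp, b1, b2, e1, e2⟩ := hD.exists_step hh hτ hM hL (by linarith) (by linarith) hε hsm
      (hb m).2
    have hne : ∀ k, k ≤ m + 1 → k ≠ m + 2 := fun k hk => by omega
    refine ⟨Function.update U (m + 2) Up, Function.update P (m + 2) Pp, ?_, ?_, ?_, ?_, ?_, ?_⟩
    · have hb' : ∀ k, (Function.update U (m + 2) Up k 0 = 0 ∧ Function.update U (m + 2) Up k M = 0) ∧
          (Function.update P (m + 2) Pp k 0 = 0 ∧ Function.update P (m + 2) Pp k M = 0) := by
        intro k
        by_cases hk : k = m + 2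
        · subst hk; simp only [Function.update_self]; exact ⟨b1, b2⟩
        · simp only [Function.update_of_ne hk]; exact hb k
      refine ⟨fun k _ => (hb' k).1, fun k _ => (hb' k).2, fun l hl j hj => ?_, fun l hl j hj => ?_⟩
      · rcases (show l + 2 ≤ m + 1 ∨ l = m by omega) with hl' | rfl
        · have := hG.eq_U l hl' j hj
          simpa only [dt, avg, Nat.add_sub_cancel, dx2, Function.update_of_ne (hne (l + 1 + 1) hl'),
            Function.update_of_ne (hne (l + 1) (by omega)), Function.update_of_ne (hne l (by omega))]
            using this
        · have := e1 j hj
          simp only [dt, avg, Nat.add_sub_cancel, dx2, Function.update_self,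
            Function.update_of_ne (hne (l + 1) (by omega)), Function.update_of_ne (hne l (by omega)),
            Complex.real_smul, smul_eq_mul] at this ⊢
          exact this
      · rcases (show l + 2 ≤ m + 1 ∨ l = m by omega) with hl' | rfl
        · have := hG.eq_P l hl' j hj
          simpa only [dt2, avg, Nat.add_sub_cancel, dx2, Function.update_of_ne (hne (l + 1 + 1) hl'),
            Function.update_of_ne (hne (l + 1) (by omega)), Function.update_of_ne (hne l (by omega))]
            using this
        · have := e2 j hj
          simp only [dt2, avg, Nat.add_sub_cancel, dx2, Function.update_self,
            Function.update_of_ne (hne (l + 1) (by omega)), Function.update_of_ne (hne l (by omega)),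
            smul_eq_mul] at this ⊢
          exact this
    · rw [Function.update_of_ne (by omega), hu0]
    · rw [Function.update_of_ne (by omega), hp0]
    · rw [Function.update_of_ne (by omega), hu1]
    · rw [Function.update_of_ne (by omega), hp1]
    · intro k
      by_cases hk : k = m + 2
      · subst hk; simp only [Function.update_self]; exact ⟨b1, b2⟩
      · simp only [Function.update_of_ne hk]; exact hb k

end Bootstrap

section Partials

set_option linter.unusedSectionVars false

variable {V : Type*} [NormedAddCommGroup V] [NormedSpace ℝ V]

/-- The closed rectangle `[a, b] × [0, T]`. -/
def rect (a b T : ℝ) : Set (ℝ × ℝ) := Icc a b ×ˢ Icc 0 T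

variable {a b T : ℝ}

lemma uniqueDiffOn_rect (hab : a < b) (hT : 0 < T) : UniqueDiffOn ℝ (rect a b T) :=
  (uniqueDiffOn_Icc hab).prod (uniqueDiffOn_Icc hT)

lemma mem_closure_interior_rect (hab : a < b) (hT : 0 < T) {p : ℝ × ℝ} (hp : p ∈ rect a b T) :
    p ∈ closure (interior (rect a b T)) := by
  rw [rect, interior_prod_eq, closure_prod_eq, interior_Icc, interior_Icc, closure_Ioo hab.ne,
    closure_Ioo hT.ne]
  exact hp

lemma hasDerivWithinAt_fst {g : ℝ × ℝ → V} {x t : ℝ} (hg : DifferentiableOn ℝ g (rect a b T))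
    (hx : x ∈ Icc a b) (ht : t ∈ Icc 0 T) :
    HasDerivWithinAt (fun y => g (y, t)) (fderivWithin ℝ g (rect a b T) (x, t) (1, 0))
      (Icc a b) x := by
  have h1 := (hg (x, t) ⟨hx, ht⟩).hasFDerivWithinAt
  have h2 : HasDerivWithinAt (fun y : ℝ => (y, t)) ((1 : ℝ), (0 : ℝ)) (Icc a b) x :=
    (hasDerivWithinAt_id x _).prodMk (hasDerivWithinAt_const x _ t)
  exact HasFDerivWithinAt.comp_hasDerivWithinAt (t := rect a b T) x h1 h2 fun y hy => ⟨hy, ht⟩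

lemma hasDerivWithinAt_snd {g : ℝ × ℝ → V} {x t : ℝ} (hg : DifferentiableOn ℝ g (rect a b T))
    (hx : x ∈ Icc a b) (ht : t ∈ Icc 0 T) :
    HasDerivWithinAt (fun s => g (x, s)) (fderivWithin ℝ g (rect a b T) (x, t) (0, 1))
      (Icc 0 T) t := by
  have h1 := (hg (x, t) ⟨hx, ht⟩).hasFDerivWithinAt
  have h2 : HasDerivWithinAt (fun s : ℝ => (x, s)) ((0 : ℝ), (1 : ℝ)) (Icc 0 T) t :=
    (hasDerivWithinAt_const t _ x).prodMk (hasDerivWithinAt_id t _)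
  exact HasFDerivWithinAt.comp_hasDerivWithinAt (t := rect a b T) t h1 h2 fun y hy => ⟨hx, hy⟩

lemma contDiffOn_fderivWithin_apply (hab : a < b) (hT : 0 < T) {g : ℝ × ℝ → V} {k : ℕ}
    (hg : ContDiffOn ℝ (k + 1 : ℕ) g (rect a b T)) (v : ℝ × ℝ) :
    ContDiffOn ℝ k (fun p => fderivWithin ℝ g (rect a b T) p v) (rect a b T) :=
  (hg.fderivWithin (uniqueDiffOn_rect hab hT) (by exact_mod_cast le_rfl)).clm_apply contDiffOn_const

lemma fderivWithin_comm (hab : a < b) (hT : 0 < T) {g : ℝ × ℝ → V} {k : ℕ} (hk : 2 ≤ k)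
    (hg : ContDiffOn ℝ k g (rect a b T)) {p : ℝ × ℝ} (hp : p ∈ rect a b T) (v w : ℝ × ℝ) :
    fderivWithin ℝ (fun q => fderivWithin ℝ g (rect a b T) q v) (rect a b T) p w
      = fderivWithin ℝ (fun q => fderivWithin ℝ g (rect a b T) q w) (rect a b T) p v := by
  have hu := uniqueDiffOn_rect hab hT
  have hg2 : ContDiffOn ℝ 2 g (rect a b T) := hg.of_le (by exact_mod_cast hk)
  have hd : DifferentiableWithinAt ℝ (fderivWithin ℝ g (rect a b T)) (rect a b T) p :=
    ((hg2.fderivWithin (m := 1) hu (by norm_num)).differentiableOn (by norm_num)) p hp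
  have hs := (hg2 p hp).isSymmSndFDerivWithinAt (by simp) hu (mem_closure_interior_rect hab hT hp) hp
  have e : ∀ v w, fderivWithin ℝ (fun q => fderivWithin ℝ g (rect a b T) q v) (rect a b T) p w
      = fderivWithin ℝ (fderivWithin ℝ g (rect a b T)) (rect a b T) p w v := by
    intro v w
    rw [fderivWithin_clm_apply (hu p hp) hd (differentiableWithinAt_const v)]
    simp
  rw [e, e]
  exact hs w v

variable {r : ℕ} {u : ℝ → ℝ → V}

lemma pd_zero_zero (x t : ℝ) : pd a b T u 0 0 x t = u x t := by simp [pd]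

lemma pd_succ_left (m n : ℕ) (x t : ℝ) :
    pd a b T u (m + 1) n x t = derivWithin (fun y => pd a b T u m n y t) (Icc a b) x := by
  simp only [pd]; rw [iteratedDerivWithin_succ]

lemma pd_zero_succ (n : ℕ) (x t : ℝ) :
    pd a b T u 0 (n + 1) x t = derivWithin (fun s => pd a b T u 0 n x s) (Icc 0 T) t := by
  simp only [pd, iteratedDerivWithin_zero]; rw [iteratedDerivWithin_succ]

lemma contDiffOn_pd_zero (hab : a < b) (hT : 0 < T) (hu : IsSmoothOn a b T r u) {n k : ℕ}
    (h : n + k ≤ r) : ContDiffOn ℝ k (fun p => pd a b T u 0 n p.1 p.2) (rect a b T) := by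
  induction n generalizing k with
  | zero => 
    simp only [pd_zero_zero]
    exact ContDiffOn.of_le hu (by exact_mod_cast (by omega : k ≤ r))
  | succ n ih =>
    have h1 := ih (k := k + 1) (by omega)
    refine (contDiffOn_fderivWithin_apply hab hT h1 (0, 1)).congr fun p hp => ?_
    rw [pd_zero_succ]
    exact (hasDerivWithinAt_snd (h1.differentiableOn (by simp)) hp.1 hp.2).derivWithin
      (uniqueDiffOn_Icc hT _ hp.2)

lemma IsSmoothOn.contDiffOn_pd (hu : IsSmoothOn a b T r u) (hab : a < b) (hT : 0 < T) {m n k : ℕ}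
    (h : m + n + k ≤ r) : ContDiffOn ℝ k (fun p => pd a b T u m n p.1 p.2) (rect a b T) := by
  induction m generalizing k with
  | zero => exact contDiffOn_pd_zero hab hT hu (by omega)
  | succ m ih =>
    have h1 := ih (k := k + 1) (by omega)
    refine (contDiffOn_fderivWithin_apply hab hT h1 (1, 0)).congr fun p hp => ?_
    rw [pd_succ_left]
    exact (hasDerivWithinAt_fst (h1.differentiableOn (by simp)) hp.1 hp.2).derivWithin
      (uniqueDiffOn_Icc hab _ hp.1)

lemma IsSmoothOn.continuousOn_pd (hu : IsSmoothOn a b T r u) (hab : a < b) (hT : 0 < T) {m n : ℕ}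
    (h : m + n ≤ r) : ContinuousOn (fun p : ℝ × ℝ => pd a b T u m n p.1 p.2) (rect a b T) :=
  (hu.contDiffOn_pd hab hT (k := 0) (by omega)).continuousOn

lemma IsSmoothOn.differentiableOn_pd (hu : IsSmoothOn a b T r u) (hab : a < b) (hT : 0 < T)
    {m n : ℕ} (h : m + n + 1 ≤ r) :
    DifferentiableOn ℝ (fun p : ℝ × ℝ => pd a b T u m n p.1 p.2) (rect a b T) :=
  (hu.contDiffOn_pd hab hT (k := 1) (by omega)).differentiableOn (by simp)

lemma IsSmoothOn.hasDerivWithinAt_pd_x (hu : IsSmoothOn a b T r u) (hab : a < b) (hT : 0 < T)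
    {m n : ℕ} (h : m + n + 1 ≤ r) {x t : ℝ} (hx : x ∈ Icc a b) (ht : t ∈ Icc 0 T) :
    HasDerivWithinAt (fun y => pd a b T u m n y t) (pd a b T u (m + 1) n x t) (Icc a b) x := by
  have h1 := hasDerivWithinAt_fst (hu.differentiableOn_pd hab hT h) hx ht
  rw [pd_succ_left]
  exact h1.differentiableWithinAt.hasDerivWithinAt

lemma IsSmoothOn.hasDerivWithinAt_pd_t (hu : IsSmoothOn a b T r u) (hab : a < b) (hT : 0 < T)
    {m n : ℕ} (h : m + n + 1 ≤ r) {x t : ℝ} (hx : x ∈ Icc a b) (ht : t ∈ Icc 0 T) :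
    HasDerivWithinAt (fun s => pd a b T u m n x s) (pd a b T u m (n + 1) x t) (Icc 0 T) t := by
  induction m generalizing x t with
  | zero =>
    have h1 := hasDerivWithinAt_snd (hu.differentiableOn_pd hab hT h) hx ht
    rw [pd_zero_succ]
    exact h1.differentiableWithinAt.hasDerivWithinAt
  | succ m ih =>
    have hd := hu.differentiableOn_pd hab hT (m := m) (n := n) (by omega)
    have hX : ∀ p ∈ rect a b T, pd a b T u (m + 1) n p.1 p.2
        = fderivWithin ℝ (fun p : ℝ × ℝ => pd a b T u m n p.1 p.2) (rect a b T) p (1, 0) :=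
      fun p hp => by
        rw [pd_succ_left]
        exact (hasDerivWithinAt_fst hd hp.1 hp.2).derivWithin (uniqueDiffOn_Icc hab _ hp.1)
    have hTm : ∀ p ∈ rect a b T, pd a b T u m (n + 1) p.1 p.2
        = fderivWithin ℝ (fun p : ℝ × ℝ => pd a b T u m n p.1 p.2) (rect a b T) p (0, 1) :=
      fun p hp => ((ih (by omega) hp.1 hp.2).derivWithin (uniqueDiffOn_Icc hT _ hp.2)).symm.trans
        ((hasDerivWithinAt_snd hd hp.1 hp.2).derivWithin (uniqueDiffOn_Icc hT _ hp.2))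
    have hp : (x, t) ∈ rect a b T := ⟨hx, ht⟩
    have h1 := hasDerivWithinAt_snd (hu.differentiableOn_pd hab hT h) hx ht
    have h2 : fderivWithin ℝ (fun p : ℝ × ℝ => pd a b T u (m + 1) n p.1 p.2) (rect a b T) (x, t)
        (0, 1) = pd a b T u (m + 1) (n + 1) x t := by
      rw [fderivWithin_congr hX (hX _ hp), fderivWithin_comm hab hT le_rfl
        (hu.contDiffOn_pd hab hT (k := 2) (by omega)) hp, ← fderivWithin_congr hTm (hTm _ hp),
        pd_succ_left]
      exact ((hasDerivWithinAt_fst (hu.differentiableOn_pd hab hT (by omega)) hx ht).derivWithin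
        (uniqueDiffOn_Icc hab _ hx)).symm
    rw [← h2]
    exact h1

lemma IsSmoothOn.continuousOn_pd_t (hu : IsSmoothOn a b T r u) (hab : a < b) (hT : 0 < T) {m n : ℕ}
    (h : m + n ≤ r) {x : ℝ} (hx : x ∈ Icc a b) :
    ContinuousOn (fun s => pd a b T u m n x s) (Icc 0 T) :=
  ContinuousOn.comp (g := fun p : ℝ × ℝ => pd a b T u m n p.1 p.2) (f := fun s => (x, s))
    (hu.continuousOn_pd hab hT h) (Continuous.continuousOn (by fun_prop)) fun _ hs => ⟨hx, hs⟩

lemma IsSmoothOn.continuousOn_pd_x (hu : IsSmoothOn a b T r u) (hab : a < b) (hT : 0 < T) {m n : ℕ}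
    (h : m + n ≤ r) {t : ℝ} (ht : t ∈ Icc 0 T) :
    ContinuousOn (fun y => pd a b T u m n y t) (Icc a b) :=
  ContinuousOn.comp (g := fun p : ℝ × ℝ => pd a b T u m n p.1 p.2) (f := fun y => (y, t))
    (hu.continuousOn_pd hab hT h) (Continuous.continuousOn (by fun_prop)) fun _ hy => ⟨hy, ht⟩

/-- Two functions that are continuous on the rectangle and agree in `(a, b) × (0, T]` agree on the
rectangle. -/
lemma eqOn_rect (hab : a < b) (hT : 0 < T) {f g : ℝ → ℝ → V}
    (hf : ContinuousOn (fun p : ℝ × ℝ => f p.1 p.2) (rect a b T))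
    (hg : ContinuousOn (fun p : ℝ × ℝ => g p.1 p.2) (rect a b T))
    (h : ∀ x ∈ Ioo a b, ∀ t ∈ Ioc 0 T, f x t = g x t) {x t : ℝ} (hx : x ∈ Icc a b)
    (ht : t ∈ Icc 0 T) : f x t = g x t := by
  have hs : rect a b T ⊆ closure (Ioo a b ×ˢ Ioc 0 T) := by
    rw [closure_prod_eq, closure_Ioo hab.ne, closure_Ioc hT.ne]
    exact subset_rfl
  have key : EqOn (fun p : ℝ × ℝ => f p.1 p.2) (fun p => g p.1 p.2) (rect a b T) :=
    EqOn.of_subset_closure (fun p hp => h p.1 hp.1 p.2 hp.2) hf hg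
      (prod_mono Ioo_subset_Icc_self Ioc_subset_Icc_self) hs
  exact key (show (x, t) ∈ rect a b T from ⟨hx, ht⟩)

end Partials

section Lipschitz

set_option linter.unusedSectionVars false

variable {V : Type*} [NormedAddCommGroup V] [NormedSpace ℝ V] {a b A B T τ θ : ℝ}

/-- `f` is bounded by `B` and `B`-Lipschitz on `[a, b]`. -/
def BL (a b B : ℝ) (f : ℝ → V) : Prop :=
  (∀ x ∈ Icc a b, ‖f x‖ ≤ B) ∧ ∀ x ∈ Icc a b, ∀ y ∈ Icc a b, ‖f x - f y‖ ≤ B * |x - y|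

lemma BL.mono {f : ℝ → V} (h : BL a b A f) (hAB : A ≤ B) : BL a b B f :=
  ⟨fun x hx => (h.1 x hx).trans hAB,
    fun x hx y hy => (h.2 x hx y hy).trans (mul_le_mul_of_nonneg_right hAB (abs_nonneg _))⟩

lemma BL.mono_set {f : ℝ → V} {c d : ℝ} (h : BL a b A f) (hs : Icc c d ⊆ Icc a b) : BL c d A f :=
  ⟨fun x hx => h.1 x (hs hx), fun x hx y hy => h.2 x (hs hx) y (hs hy)⟩

lemma BL.congr {f g : ℝ → V} (h : BL a b B f) (hfg : ∀ x ∈ Icc a b, g x = f x) : BL a b B g :=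
  ⟨fun x hx => by rw [hfg x hx]; exact h.1 x hx,
    fun x hx y hy => by rw [hfg x hx, hfg y hy]; exact h.2 x hx y hy⟩

lemma BL.add {f g : ℝ → V} (hf : BL a b A f) (hg : BL a b B g) :
    BL a b (A + B) (fun x => f x + g x) :=
  ⟨fun x hx => (norm_add_le _ _).trans (add_le_add (hf.1 x hx) (hg.1 x hx)),
    fun x hx y hy => by
      rw [add_sub_add_comm, add_mul]
      exact (norm_add_le _ _).trans (add_le_add (hf.2 x hx y hy) (hg.2 x hx y hy))⟩

lemma BL.neg {f : ℝ → V} (hf : BL a b A f) : BL a b A (fun x => - f x) :=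
  ⟨fun x hx => by rw [norm_neg]; exact hf.1 x hx,
    fun x hx y hy => by rw [← neg_sub', norm_neg]; exact hf.2 x hx y hy⟩

lemma BL.sub {f g : ℝ → V} (hf : BL a b A f) (hg : BL a b B g) :
    BL a b (A + B) (fun x => f x - g x) := by
  simpa only [sub_eq_add_neg] using hf.add hg.neg

lemma BL.const_smul {f : ℝ → V} (hf : BL a b A f) (c : ℝ) : BL a b (|c| * A) (fun x => c • f x) :=
  ⟨fun x hx => by
      rw [norm_smul, Real.norm_eq_abs]; exact mul_le_mul_of_nonneg_left (hf.1 x hx) (abs_nonneg _),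
    fun x hx y hy => by
      rw [← smul_sub, norm_smul, Real.norm_eq_abs, mul_assoc]
      exact mul_le_mul_of_nonneg_left (hf.2 x hx y hy) (abs_nonneg _)⟩

lemma BL.nonneg {f : ℝ → V} (hf : BL a b A f) (hab : a < b) : 0 ≤ A :=
  (norm_nonneg _).trans (hf.1 a (left_mem_Icc.2 hab.le))

lemma BL.mul {R : Type*} [NormedRing R] {f g : ℝ → R} (hf : BL a b A f)
    (hg : BL a b B g) : BL a b (2 * (A * B)) (fun x => f x * g x) := by
  refine ⟨fun x hx => ?_, fun x hx y hy => ?_⟩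
  · have hA := (norm_nonneg _).trans (hf.1 x hx)
    have hB := (norm_nonneg _).trans (hg.1 x hx)
    refine (norm_mul_le _ _).trans ((mul_le_mul (hf.1 x hx) (hg.1 x hx) (norm_nonneg _) hA).trans ?_)
    have := mul_nonneg hA hB
    linarith
  · have hA := (norm_nonneg _).trans (hf.1 x hx)
    have hB := (norm_nonneg _).trans (hg.1 x hx)
    have e : f x * g x - f y * g y = f x * (g x - g y) + (f x - f y) * g y := by noncomm_ring
    rw [e]
    refine (norm_add_le _ _).trans ?_
    have h1 := (norm_mul_le (f x) (g x - g y)).trans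
      (mul_le_mul (hf.1 x hx) (hg.2 x hx y hy) (norm_nonneg _) hA)
    have h2 := (norm_mul_le (f x - f y) (g y)).trans
      (mul_le_mul (hf.2 x hx y hy) (hg.1 y hy) (norm_nonneg _) (mul_nonneg hA (abs_nonneg _)))
    linarith

lemma BL.I_mul {f : ℝ → ℂ} (hf : BL a b A f) : BL a b A (fun x => Complex.I * f x) :=
  ⟨fun x hx => by simpa using hf.1 x hx,
    fun x hx y hy => by rw [← mul_sub]; simpa using hf.2 x hx y hy⟩

lemma BL.conj {f : ℝ → ℂ} (hf : BL a b A f) : BL a b A (fun x => starRingEnd ℂ (f x)) :=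
  ⟨fun x hx => by simpa using hf.1 x hx,
    fun x hx y hy => by rw [← map_sub, RCLike.norm_conj]; exact hf.2 x hx y hy⟩

lemma BL.ofReal {f : ℝ → ℝ} (hf : BL a b A f) : BL a b A (fun x => (f x : ℂ)) :=
  ⟨fun x hx => by simpa using hf.1 x hx,
    fun x hx y hy => by
      rw [← Complex.ofReal_sub, Complex.norm_real]; exact hf.2 x hx y hy⟩

lemma BL.im {f : ℝ → ℂ} (hf : BL a b A f) : BL a b A (fun x => (f x).im) :=
  ⟨fun x hx => (Complex.abs_im_le_norm _).trans (hf.1 x hx),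
    fun x hx y hy => by
      rw [← Complex.sub_im]; exact (Complex.abs_im_le_norm _).trans (hf.2 x hx y hy)⟩

lemma BL.of_hasDerivWithinAt {f f' : ℝ → V}
    (hd : ∀ x ∈ Icc a b, HasDerivWithinAt f (f' x) (Icc a b) x) (h0 : ∀ x ∈ Icc a b, ‖f x‖ ≤ B)
    (h1 : ∀ x ∈ Icc a b, ‖f' x‖ ≤ B) : BL a b B f :=
  ⟨h0, fun x hx y hy => (convex_Icc a b).norm_image_sub_le_of_norm_hasDerivWithin_le hd h1 hy hx⟩

lemma WNormLE.bl {m n r : ℕ} {u : ℝ → ℝ → V} (h : WNormLE a b T m n u B)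
    (hu : IsSmoothOn a b T r u) (hab : a < b) (hT : 0 < T) {j : ℕ} (hj : j + 1 ≤ m)
    (hr : j + n + 1 ≤ r) {t : ℝ} (ht : t ∈ Icc 0 T) : BL a b B (fun x => pd a b T u j n x t) :=
  BL.of_hasDerivWithinAt (fun _ hx => hu.hasDerivWithinAt_pd_x hab hT hr hx ht)
    (fun x hx => h t ht x hx j (by omega)) (fun x hx => h t ht x hx (j + 1) hj)

/-- A family of functions on `[a, b]`, continuous in `t`, that is bounded by `B ^ n` and oscillates
by at most `B ^ n * θ` on time intervals of length `2τ`, in the Lipschitz norm. -/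
structure Osc (a b T τ B θ : ℝ) (n : ℕ) (f : ℝ → ℝ → V) : Prop where
  four_le : 4 ≤ B
  nonneg : 0 ≤ θ
  cont : ∀ x ∈ Icc a b, ContinuousOn (f x) (Icc 0 T)
  bd : ∀ t ∈ Icc 0 T, BL a b (B ^ n) (fun x => f x t)
  osc : ∀ s ∈ Icc 0 T, ∀ t ∈ Icc 0 T, |s - t| ≤ 2 * τ → BL a b (B ^ n * θ) (fun x => f x s - f x t)

lemma Osc.mono {m n : ℕ} {f : ℝ → ℝ → V} (h : Osc a b T τ B θ m f) (hmn : m ≤ n) :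
    Osc a b T τ B θ n f := by
  have h4 := h.four_le
  have hp : B ^ m ≤ B ^ n := pow_le_pow_right₀ (by linarith) hmn
  exact ⟨h4, h.nonneg, h.cont, fun t ht => (h.bd t ht).mono hp,
    fun s hs t ht hst => (h.osc s hs t ht hst).mono (mul_le_mul_of_nonneg_right hp h.nonneg)⟩

lemma Osc.congr {n : ℕ} {f g : ℝ → ℝ → V} (h : Osc a b T τ B θ n f)
    (hfg : ∀ x ∈ Icc a b, ∀ t ∈ Icc 0 T, g x t = f x t) : Osc a b T τ B θ n g :=
  ⟨h.four_le, h.nonneg, fun x hx => (h.cont x hx).congr fun t ht => hfg x hx t ht,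
    fun t ht => (h.bd t ht).congr fun x hx => hfg x hx t ht,
    fun s hs t ht hst => (h.osc s hs t ht hst).congr fun x hx => by
      rw [hfg x hx t ht, hfg x hx s hs]⟩

lemma two_pow_le (h4 : 4 ≤ B) (n : ℕ) : B ^ n + B ^ n ≤ B ^ (n + 1) := by
  have : 0 < B ^ n := by positivity
  rw [pow_succ]; nlinarith

lemma Osc.add {n : ℕ} {f g : ℝ → ℝ → V} (hf : Osc a b T τ B θ n f) (hg : Osc a b T τ B θ n g) :
    Osc a b T τ B θ (n + 1) (fun x t => f x t + g x t) := by
  have hp := two_pow_le hf.four_le n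
  refine ⟨hf.four_le, hf.nonneg, fun x hx => (hf.cont x hx).add (hg.cont x hx),
    fun t ht => ((hf.bd t ht).add (hg.bd t ht)).mono hp, fun s hs t ht hst => ?_⟩
  refine (((hf.osc s hs t ht hst).add (hg.osc s hs t ht hst)).mono ?_).congr fun x _ => by abel
  rw [← add_mul]; exact mul_le_mul_of_nonneg_right hp hf.nonneg

lemma Osc.neg {n : ℕ} {f : ℝ → ℝ → V} (hf : Osc a b T τ B θ n f) :
    Osc a b T τ B θ n (fun x t => - f x t) :=
  ⟨hf.four_le, hf.nonneg, fun x hx => (hf.cont x hx).neg, fun t ht => (hf.bd t ht).neg,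
    fun s hs t ht hst => (hf.osc s hs t ht hst).neg.congr fun x _ => by abel⟩

lemma Osc.sub {n : ℕ} {f g : ℝ → ℝ → V} (hf : Osc a b T τ B θ n f) (hg : Osc a b T τ B θ n g) :
    Osc a b T τ B θ (n + 1) (fun x t => f x t - g x t) := by
  simpa only [sub_eq_add_neg] using hf.add hg.neg

lemma Osc.mul {m n : ℕ} {f g : ℝ → ℝ → ℂ} (hf : Osc a b T τ B θ m f) (hg : Osc a b T τ B θ n g) :
    Osc a b T τ B θ (m + n + 1) (fun x t => f x t * g x t) := by
  have h4 := hf.four_le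
  have h0 := hf.nonneg
  have hp : 4 * (B ^ m * B ^ n) ≤ B ^ (m + n + 1) := by
    rw [pow_succ, pow_add, mul_comm]
    exact mul_le_mul_of_nonneg_left h4 (by positivity)
  have hpp : 0 < B ^ m * B ^ n := by positivity
  refine ⟨h4, h0, fun x hx => (hf.cont x hx).mul (hg.cont x hx),
    fun t ht => ((hf.bd t ht).mul (hg.bd t ht)).mono (by linarith), fun s hs t ht hst => ?_⟩
  refine ((((hf.bd s hs).mul (hg.osc s hs t ht hst)).add
    ((hf.osc s hs t ht hst).mul (hg.bd t ht))).mono ?_).congr fun x _ => by ring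
  calc _ = 4 * (B ^ m * B ^ n) * θ := by ring
    _ ≤ _ := mul_le_mul_of_nonneg_right hp h0

lemma Osc.I_mul {n : ℕ} {f : ℝ → ℝ → ℂ} (hf : Osc a b T τ B θ n f) :
    Osc a b T τ B θ n (fun x t => Complex.I * f x t) :=
  ⟨hf.four_le, hf.nonneg, fun x hx => continuousOn_const.mul (hf.cont x hx),
    fun t ht => (hf.bd t ht).I_mul,
    fun s hs t ht hst => (hf.osc s hs t ht hst).I_mul.congr fun x _ => by ring⟩

lemma Osc.conj {n : ℕ} {f : ℝ → ℝ → ℂ} (hf : Osc a b T τ B θ n f) :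
    Osc a b T τ B θ n (fun x t => starRingEnd ℂ (f x t)) :=
  ⟨hf.four_le, hf.nonneg, fun x hx => Complex.continuous_conj.comp_continuousOn (hf.cont x hx),
    fun t ht => (hf.bd t ht).conj,
    fun s hs t ht hst => (hf.osc s hs t ht hst).conj.congr fun x _ => (map_sub _ _ _).symm⟩

lemma Osc.ofReal {n : ℕ} {f : ℝ → ℝ → ℝ} (hf : Osc a b T τ B θ n f) :
    Osc a b T τ B θ n (fun x t => (f x t : ℂ)) :=
  ⟨hf.four_le, hf.nonneg, fun x hx => Complex.continuous_ofReal.comp_continuousOn (hf.cont x hx),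
    fun t ht => (hf.bd t ht).ofReal,
    fun s hs t ht hst => (hf.osc s hs t ht hst).ofReal.congr fun x _ => by push_cast; rfl⟩

end Lipschitz

section TimeMeans

set_option linter.unusedSectionVars false

variable {V : Type*} [NormedAddCommGroup V] [NormedSpace ℝ V] {a b A B T τ θ : ℝ}

/-- The mean of the two values at `t ± τ`. -/
noncomputable def tavg (τ t : ℝ) (f : ℝ → V) : V := (2 : ℝ)⁻¹ • (f (t + τ) + f (t - τ))

/-- The integral mean over `[t - τ, t + τ]`. -/
noncomputable def tmean (τ t : ℝ) (f : ℝ → V) : V := (2 * τ)⁻¹ • ∫ s in (t - τ)..(t + τ), f s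

lemma norm_tmean_le (hτ : 0 < τ) {t C : ℝ} {f : ℝ → V}
    (h : ∀ s ∈ Icc (t - τ) (t + τ), ‖f s‖ ≤ C) : ‖tmean τ t f‖ ≤ C := by
  have h1 : ‖∫ s in (t - τ)..(t + τ), f s‖ ≤ C * |t + τ - (t - τ)| :=
    intervalIntegral.norm_integral_le_of_norm_le_const fun s hs => h s (by
      rw [uIoc_of_le (by linarith)] at hs; exact Ioc_subset_Icc_self hs)
  rw [tmean, norm_smul, Real.norm_of_nonneg (by positivity), inv_mul_le_iff₀ (by positivity)]
  refine h1.trans_eq ?_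
  rw [abs_of_pos (by linarith)]; ring

lemma intervalIntegrable_window (hτ : 0 < τ) {t : ℝ} {f : ℝ → V}
    (hf : ContinuousOn f (Icc (t - τ) (t + τ))) :
    IntervalIntegrable f volume (t - τ) (t + τ) :=
  ContinuousOn.intervalIntegrable (by rwa [uIcc_of_le (by linarith)])

lemma tmean_sub (hτ : 0 < τ) {t : ℝ} {f g : ℝ → V} (hf : ContinuousOn f (Icc (t - τ) (t + τ)))
    (hg : ContinuousOn g (Icc (t - τ) (t + τ))) :
    tmean τ t (fun s => f s - g s) = tmean τ t f - tmean τ t g := by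
  rw [tmean, intervalIntegral.integral_sub (intervalIntegrable_window hτ hf)
    (intervalIntegrable_window hτ hg), smul_sub]; rfl

lemma tmean_add (hτ : 0 < τ) {t : ℝ} {f g : ℝ → V} (hf : ContinuousOn f (Icc (t - τ) (t + τ)))
    (hg : ContinuousOn g (Icc (t - τ) (t + τ))) :
    tmean τ t (fun s => f s + g s) = tmean τ t f + tmean τ t g := by
  rw [tmean, intervalIntegral.integral_add (intervalIntegrable_window hτ hf)
    (intervalIntegrable_window hτ hg), smul_add]; rfl

lemma tmean_const [CompleteSpace V] (hτ : 0 < τ) (t : ℝ) (c : V) : tmean τ t (fun _ => c) = c := by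
  rw [tmean, intervalIntegral.integral_const, smul_smul]
  have : (2 * τ)⁻¹ * (t + τ - (t - τ)) = 1 := by field_simp; ring
  rw [this, one_smul]

lemma tmean_congr (hτ : 0 < τ) {t : ℝ} {f g : ℝ → V}
    (h : ∀ s ∈ Icc (t - τ) (t + τ), f s = g s) : tmean τ t f = tmean τ t g := by
  rw [tmean, tmean, intervalIntegral.integral_congr fun s hs => h s (by
    rwa [uIcc_of_le (by linarith)] at hs)]

lemma tmean_mul_const {t : ℝ} (f : ℝ → ℂ) (c : ℂ) :
    tmean τ t (fun s => f s * c) = tmean τ t f * c := by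
  rw [tmean, intervalIntegral.integral_mul_const, tmean, smul_mul_assoc]

lemma tmean_const_mul {t : ℝ} (f : ℝ → ℂ) (c : ℂ) :
    tmean τ t (fun s => c * f s) = c * tmean τ t f := by
  rw [tmean, intervalIntegral.integral_const_mul, tmean, mul_smul_comm]

lemma tmean_ofReal {t : ℝ} (f : ℝ → ℝ) : tmean τ t (fun s => (f s : ℂ)) = (tmean τ t f : ℝ) := by
  rw [tmean, intervalIntegral.integral_ofReal, tmean, Complex.real_smul, smul_eq_mul]
  push_cast; rfl

lemma mean_deviation [CompleteSpace V] (hτ : 0 < τ) {t ν : ℝ} {f f' : ℝ → V}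
    (hd : ∀ s ∈ Icc (t - τ) (t + τ), HasDerivWithinAt f (f' s) (Icc (t - τ) (t + τ)) s)
    (hν : ∀ s ∈ Icc (t - τ) (t + τ), ‖f' s - f' t‖ ≤ ν) :
    ‖tavg τ t f - f t‖ ≤ τ * ν ∧ ‖tmean τ t f - f t‖ ≤ τ * ν := by
  have htm : t ∈ Icc (t - τ) (t + τ) := ⟨by linarith, by linarith⟩
  have hν0 : 0 ≤ ν := (norm_nonneg _).trans (hν t htm)
  set g : ℝ → V := fun s => f s - (s - t) • f' t with hg
  have hgd : ∀ s ∈ Icc (t - τ) (t + τ),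
      HasDerivWithinAt g (f' s - f' t) (Icc (t - τ) (t + τ)) s := fun s hs => by
    have := (hd s hs).sub ((((hasDerivWithinAt_id s _).sub_const t).smul_const (f' t)))
    rw [one_smul] at this
    exact this
  have hgt : g t = f t := by simp [hg]
  have key : ∀ s ∈ Icc (t - τ) (t + τ), ‖g s - f t‖ ≤ τ * ν := fun s hs => by
    have := (convex_Icc _ _).norm_image_sub_le_of_norm_hasDerivWithin_le hgd hν htm hs
    rw [hgt] at this
    refine this.trans ?_
    rw [mul_comm]
    refine mul_le_mul_of_nonneg_right ?_ hν0
    rw [Real.norm_eq_abs, abs_le]; constructor <;> linarith [hs.1, hs.2]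
  constructor
  · have e : tavg τ t f - f t = (2 : ℝ)⁻¹ • ((g (t + τ) - f t) + (g (t - τ) - f t)) := by
      simp only [tavg, hg]; module
    rw [e, norm_smul, Real.norm_of_nonneg (by norm_num)]
    have h1 := key (t + τ) ⟨by linarith, le_rfl⟩
    have h2 := key (t - τ) ⟨le_rfl, by linarith⟩
    have := norm_add_le (g (t + τ) - f t) (g (t - τ) - f t)
    linarith
  · have hfc : ContinuousOn f (Icc (t - τ) (t + τ)) := fun s hs => (hd s hs).continuousWithinAt
    have hlc : ContinuousOn (fun s => (s - t) • f' t) (Icc (t - τ) (t + τ)) := by fun_prop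
    have hgc : ContinuousOn g (Icc (t - τ) (t + τ)) := hfc.sub hlc
    have hl : tmean τ t (fun s => (s - t) • f' t) = 0 := by
      rw [tmean, intervalIntegral.integral_smul_const]
      have : ∫ s in (t - τ)..(t + τ), (s - t) = 0 := by
        rw [intervalIntegral.integral_sub (by simp) (by simp)]
        simp only [integral_id, intervalIntegral.integral_const, smul_eq_mul]
        ring
      rw [this, zero_smul, smul_zero]
    have e : tmean τ t f - f t = tmean τ t (fun s => g s - f t) := by
      rw [tmean_sub hτ hgc continuousOn_const, tmean_const hτ, hg, tmean_sub hτ hfc hlc, hl, sub_zero]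
    rw [e]
    exact norm_tmean_le hτ key

lemma BL.tmean (hτ : 0 < τ) {t : ℝ} {f : ℝ → ℝ → V}
    (hc : ∀ x ∈ Icc a b, ContinuousOn (f x) (Icc (t - τ) (t + τ)))
    (hf : ∀ s ∈ Icc (t - τ) (t + τ), BL a b B (fun x => f x s)) :
    BL a b B (fun x => Zakharov.tmean τ t (f x)) := by
  refine ⟨fun x hx => norm_tmean_le hτ fun s hs => (hf s hs).1 x hx, fun x hx y hy => ?_⟩
  rw [← tmean_sub hτ (hc x hx) (hc y hy)]
  exact norm_tmean_le hτ fun s hs => (hf s hs).2 x hx y hy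

lemma BL.tavg (hτ : 0 < τ) {t : ℝ} {f : ℝ → ℝ → V}
    (hf : ∀ s ∈ Icc (t - τ) (t + τ), BL a b B (fun x => f x s)) :
    BL a b B (fun x => Zakharov.tavg τ t (f x)) := by
  refine (((hf (t + τ) ⟨by linarith, le_rfl⟩).add (hf (t - τ) ⟨le_rfl, by linarith⟩)).const_smul
    (2 : ℝ)⁻¹).mono (le_of_eq ?_)
  rw [abs_of_pos (by norm_num)]; ring

lemma BL.mean_deviation [CompleteSpace V] (hτ : 0 < τ) {t ν : ℝ}
    {f f' : ℝ → ℝ → V}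
    (hd : ∀ x ∈ Icc a b, ∀ s ∈ Icc (t - τ) (t + τ),
      HasDerivWithinAt (f x) (f' x s) (Icc (t - τ) (t + τ)) s)
    (hν : ∀ s ∈ Icc (t - τ) (t + τ), BL a b ν (fun x => f' x s - f' x t)) :
    BL a b (τ * ν) (fun x => Zakharov.tavg τ t (f x) - f x t) ∧
      BL a b (τ * ν) (fun x => Zakharov.tmean τ t (f x) - f x t) := by
  have h0 := fun x hx => Zakharov.mean_deviation hτ (hd x hx) (fun s hs => (hν s hs).1 x hx)
  have h1 : ∀ x ∈ Icc a b, ∀ y ∈ Icc a b, _ := fun x hx y hy =>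
    Zakharov.mean_deviation (ν := ν * |x - y|) hτ (f := fun s => f x s - f y s)
      (f' := fun s => f' x s - f' y s) (fun s hs => (hd x hx s hs).sub (hd y hy s hs))
      (fun s hs => by
        have := (hν s hs).2 x hx y hy
        rwa [sub_sub_sub_comm] at this)
  refine ⟨⟨fun x hx => (h0 x hx).1, fun x hx y hy => ?_⟩, ⟨fun x hx => (h0 x hx).2,
    fun x hx y hy => ?_⟩⟩
  · have := (h1 x hx y hy).1
    rw [← mul_assoc] at this
    convert this using 2
    simp only [Zakharov.tavg]; module
  · have := (h1 x hx y hy).2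
    rw [← mul_assoc, tmean_sub hτ (fun s hs => (hd x hx s hs).continuousWithinAt)
      (fun s hs => (hd y hy s hs).continuousWithinAt)] at this
    convert this using 2
    module

/-- The mean of a derivative is a difference quotient. -/
lemma tmean_deriv [CompleteSpace V] (hτ : 0 < τ) {t : ℝ} {f f' : ℝ → V}
    (hd : ∀ s ∈ Icc (t - τ) (t + τ), HasDerivWithinAt f (f' s) (Icc (t - τ) (t + τ)) s)
    (hc : ContinuousOn f' (Icc (t - τ) (t + τ))) :
    tmean τ t f' = (2 * τ)⁻¹ • (f (t + τ) - f (t - τ)) := by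
  rw [tmean, intervalIntegral.integral_eq_sub_of_hasDerivAt_of_le (by linarith)
    (fun s hs => (hd s hs).continuousWithinAt)
    (fun s hs => (hd s (Ioo_subset_Icc_self hs)).hasDerivAt (Icc_mem_nhds hs.1 hs.2))
    (intervalIntegrable_window hτ hc)]

end TimeMeans

section Taylor

variable {V : Type*} [NormedAddCommGroup V] [NormedSpace ℝ V]

lemma norm_le_pow_of_deriv_le {g g' : ℝ → V} {h C : ℝ} {n : ℕ} (hC : 0 ≤ C) (h0 : g 0 = 0)
    (hd : ∀ s ∈ Icc 0 h, HasDerivWithinAt g (g' s) (Icc 0 h) s)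
    (hb : ∀ s ∈ Icc 0 h, ‖g' s‖ ≤ C * s ^ n) : ∀ s ∈ Icc 0 h, ‖g s‖ ≤ C * s ^ (n + 1) := by
  intro s hs
  have hsub : Icc 0 s ⊆ Icc 0 h := Icc_subset_Icc le_rfl hs.2
  have := (convex_Icc 0 s).norm_image_sub_le_of_norm_hasDerivWithin_le (C := C * s ^ n)
    (fun r hr => (hd r (hsub hr)).mono hsub)
    (fun r hr => (hb r (hsub hr)).trans (by gcongr; exacts [hr.1, hr.2]))
    (left_mem_Icc.2 hs.1) (right_mem_Icc.2 hs.1)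
  rw [h0, sub_zero, sub_zero, Real.norm_of_nonneg hs.1] at this
  rw [pow_succ, ← mul_assoc]; exact this

lemma hasDerivWithinAt_comp_const_add {g g' : ℝ → V} {c d t h : ℝ}
    (hg : ∀ s ∈ Icc c d, HasDerivWithinAt g (g' s) (Icc c d) s)
    (mp : MapsTo (fun s => t + s) (Icc 0 h) (Icc c d)) :
    ∀ s ∈ Icc 0 h, HasDerivWithinAt (fun s => g (t + s)) (g' (t + s)) (Icc 0 h) s := fun s hs => by
  simpa [Function.comp_def] using
    (hg (t + s) (mp hs)).scomp s ((hasDerivWithinAt_id s (Icc 0 h)).const_add t) mp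

lemma hasDerivWithinAt_comp_const_sub {g g' : ℝ → V} {c d t h : ℝ}
    (hg : ∀ s ∈ Icc c d, HasDerivWithinAt g (g' s) (Icc c d) s)
    (mm : MapsTo (fun s => t - s) (Icc 0 h) (Icc c d)) :
    ∀ s ∈ Icc 0 h, HasDerivWithinAt (fun s => g (t - s)) (- g' (t - s)) (Icc 0 h) s := fun s hs => by
  simpa [Function.comp_def] using
    (hg (t - s) (mm hs)).scomp s ((hasDerivWithinAt_id s (Icc 0 h)).const_sub t) mm

/-- Fourth order Taylor estimate of the symmetric second difference. -/
lemma norm_second_difference_sub_le {f f₁ f₂ f₃ f₄ : ℝ → V} {c d t h B : ℝ} (hh : 0 ≤ h)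
    (hc : c ≤ t - h) (hd : t + h ≤ d)
    (h0 : ∀ s ∈ Icc c d, HasDerivWithinAt f (f₁ s) (Icc c d) s)
    (h1 : ∀ s ∈ Icc c d, HasDerivWithinAt f₁ (f₂ s) (Icc c d) s)
    (h2 : ∀ s ∈ Icc c d, HasDerivWithinAt f₂ (f₃ s) (Icc c d) s)
    (h3 : ∀ s ∈ Icc c d, HasDerivWithinAt f₃ (f₄ s) (Icc c d) s)
    (hB : ∀ s ∈ Icc c d, ‖f₄ s‖ ≤ B) :
    ‖f (t + h) - (2 : ℝ) • f t + f (t - h) - h ^ 2 • f₂ t‖ ≤ 2 * B * h ^ 4 := by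
  have mp : MapsTo (fun s => t + s) (Icc 0 h) (Icc c d) := fun s hs =>
    ⟨by linarith [hs.1], by linarith [hs.2]⟩
  have mm : MapsTo (fun s => t - s) (Icc 0 h) (Icc c d) := fun s hs =>
    ⟨by linarith [hs.2], by linarith [hs.1]⟩
  have dp {g g' : ℝ → V} (hg) := hasDerivWithinAt_comp_const_add (g := g) (g' := g') hg mp
  have dm {g g' : ℝ → V} (hg) := hasDerivWithinAt_comp_const_sub (g := g) (g' := g') hg mm
  have hBn : 0 ≤ B := (norm_nonneg _).trans (hB t ⟨by linarith, by linarith⟩)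
  have k3 : ∀ s ∈ Icc 0 h, ‖f₃ (t + s) - f₃ (t - s)‖ ≤ 2 * B * s ^ (0 + 1) :=
    norm_le_pow_of_deriv_le (g := fun s => f₃ (t + s) - f₃ (t - s))
      (g' := fun s => f₄ (t + s) - - f₄ (t - s)) (by positivity) (by simp)
      (fun s hs => (dp h3 s hs).sub (dm h3 s hs)) (fun s hs => by
        rw [sub_neg_eq_add, pow_zero, mul_one]
        have := hB _ (mp hs); have := hB _ (mm hs)
        exact (norm_add_le _ _).trans (by linarith))
  have k2 : ∀ s ∈ Icc 0 h, ‖f₂ (t + s) + f₂ (t - s) - (2 : ℝ) • f₂ t‖ ≤ 2 * B * s ^ (0 + 1 + 1) :=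
    norm_le_pow_of_deriv_le (g := fun s => f₂ (t + s) + f₂ (t - s) - (2 : ℝ) • f₂ t)
      (g' := fun s => f₃ (t + s) + - f₃ (t - s)) (by positivity)
      (by simp only [add_zero, sub_zero]; module)
      (fun s hs => ((dp h2 s hs).add (dm h2 s hs)).sub_const _) (fun s hs => by
        rw [← sub_eq_add_neg]; exact k3 s hs)
  have lin : ∀ s ∈ Icc 0 h, HasDerivWithinAt (fun s : ℝ => (2 * s) • f₂ t) ((2 : ℝ) • f₂ t)
      (Icc 0 h) s := fun s _ => by
    have := ((hasDerivWithinAt_id s (Icc 0 h)).const_mul (2 : ℝ)).smul_const (f₂ t)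
    simpa using this
  have quad : ∀ s ∈ Icc 0 h, HasDerivWithinAt (fun s : ℝ => (s ^ 2) • f₂ t) ((2 * s) • f₂ t)
      (Icc 0 h) s := fun s _ => by
    have := ((hasDerivWithinAt_id s (Icc 0 h)).pow 2).smul_const (f₂ t)
    simpa using this
  have k1 : ∀ s ∈ Icc 0 h, ‖f₁ (t + s) - f₁ (t - s) - (2 * s) • f₂ t‖
      ≤ 2 * B * s ^ (0 + 1 + 1 + 1) :=
    norm_le_pow_of_deriv_le (g := fun s => f₁ (t + s) - f₁ (t - s) - (2 * s) • f₂ t)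
      (g' := fun s => f₂ (t + s) - - f₂ (t - s) - (2 : ℝ) • f₂ t) (by positivity)
      (by simp)
      (fun s hs => ((dp h1 s hs).sub (dm h1 s hs)).sub (lin s hs)) (fun s hs => by
        rw [sub_neg_eq_add]; exact k2 s hs)
  have k0 : ∀ s ∈ Icc 0 h, ‖f (t + s) + f (t - s) - (s ^ 2) • f₂ t - (2 : ℝ) • f t‖
      ≤ 2 * B * s ^ (0 + 1 + 1 + 1 + 1) :=
    norm_le_pow_of_deriv_le
      (g := fun s => f (t + s) + f (t - s) - (s ^ 2) • f₂ t - (2 : ℝ) • f t)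
      (g' := fun s => f₁ (t + s) + - f₁ (t - s) - (2 * s) • f₂ t) (by positivity)
      (by simp only [add_zero, sub_zero]; module)
      (fun s hs => (((dp h0 s hs).add (dm h0 s hs)).sub (quad s hs)).sub_const _) (fun s hs => by
        rw [← sub_eq_add_neg]; exact k1 s hs)
  have := k0 h ⟨hh, le_rfl⟩
  refine le_trans (le_of_eq ?_) this
  congr 1; module

lemma norm_second_difference_le {f f₁ f₂ : ℝ → V} {c d t h B : ℝ} (hh : 0 ≤ h)
    (hc : c ≤ t - h) (hd : t + h ≤ d)
    (h0 : ∀ s ∈ Icc c d, HasDerivWithinAt f (f₁ s) (Icc c d) s)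
    (h1 : ∀ s ∈ Icc c d, HasDerivWithinAt f₁ (f₂ s) (Icc c d) s)
    (hB : ∀ s ∈ Icc c d, ‖f₂ s‖ ≤ B) :
    ‖f (t + h) - (2 : ℝ) • f t + f (t - h)‖ ≤ 2 * B * h ^ 2 := by
  have mp : MapsTo (fun s => t + s) (Icc 0 h) (Icc c d) := fun s hs =>
    ⟨by linarith [hs.1], by linarith [hs.2]⟩
  have mm : MapsTo (fun s => t - s) (Icc 0 h) (Icc c d) := fun s hs =>
    ⟨by linarith [hs.2], by linarith [hs.1]⟩
  have dp {g g' : ℝ → V} (hg) := hasDerivWithinAt_comp_const_add (g := g) (g' := g') hg mp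
  have dm {g g' : ℝ → V} (hg) := hasDerivWithinAt_comp_const_sub (g := g) (g' := g') hg mm
  have hBn : 0 ≤ B := (norm_nonneg _).trans (hB t ⟨by linarith, by linarith⟩)
  have k1 : ∀ s ∈ Icc 0 h, ‖f₁ (t + s) - f₁ (t - s)‖ ≤ 2 * B * s ^ (0 + 1) :=
    norm_le_pow_of_deriv_le (g := fun s => f₁ (t + s) - f₁ (t - s))
      (g' := fun s => f₂ (t + s) - - f₂ (t - s)) (by positivity) (by simp)
      (fun s hs => (dp h1 s hs).sub (dm h1 s hs)) (fun s hs => by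
        rw [sub_neg_eq_add, pow_zero, mul_one]
        have := hB _ (mp hs); have := hB _ (mm hs)
        exact (norm_add_le _ _).trans (by linarith))
  have k0 : ∀ s ∈ Icc 0 h, ‖f (t + s) + f (t - s) - (2 : ℝ) • f t‖ ≤ 2 * B * s ^ (0 + 1 + 1) :=
    norm_le_pow_of_deriv_le (g := fun s => f (t + s) + f (t - s) - (2 : ℝ) • f t)
      (g' := fun s => f₁ (t + s) + - f₁ (t - s)) (by positivity)
      (by simp only [add_zero, sub_zero]; module)
      (fun s hs => ((dp h0 s hs).add (dm h0 s hs)).sub_const _) (fun s hs => by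
        rw [← sub_eq_add_neg]; exact k1 s hs)
  have := k0 h ⟨hh, le_rfl⟩
  refine le_trans (le_of_eq ?_) this
  congr 1; module

end Taylor

section Wave

variable {a b K S : ℝ} {g₀ g₁ : ℝ → ℝ} {G : ℝ → ℝ → ℝ}

lemma IsWaveSolution.isSmoothOn (hG : IsWaveSolution a b g₀ g₁ G) (S : ℝ) : IsSmoothOn a b S 2 G :=
  hG.smooth.mono (prod_mono subset_rfl Icc_subset_Ici_self)

lemma BL.glue {V : Type*} [NormedAddCommGroup V] {f : ℝ → V} {c d e B : ℝ}
    (h1 : BL c d B f) (h2 : BL d e B f) (hcd : c ≤ d) (hde : d ≤ e) : BL c e B f := by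
  have key : ∀ x ∈ Icc c e, ∀ y ∈ Icc c e, x ≤ y → ‖f x - f y‖ ≤ B * |x - y| := by
    intro x hx y hy hxy
    rcases le_total y d with h | h
    · exact h1.2 x ⟨hx.1, by linarith⟩ y ⟨hy.1, h⟩
    · rcases le_total x d with h' | h'
      · have e1 := h1.2 x ⟨hx.1, h'⟩ d ⟨hcd, le_rfl⟩
        have e2 := h2.2 d ⟨le_rfl, hde⟩ y ⟨h, hy.2⟩
        rw [abs_sub_comm, abs_of_nonneg (by linarith)] at e1 e2 ⊢
        have := norm_sub_le_norm_sub_add_norm_sub (f x) (f d) (f y)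
        linarith
      · exact h2.2 x ⟨h', hx.2⟩ y ⟨h, hy.2⟩
  refine ⟨fun x hx => ?_, fun x hx y hy => ?_⟩
  · rcases le_total x d with h | h
    · exact h1.1 x ⟨hx.1, h⟩
    · exact h2.1 x ⟨h, hx.2⟩
  · rcases le_total x y with h | h
    · exact key x hx y hy h
    · rw [norm_sub_rev, abs_sub_comm]; exact key y hy x hx h

/-- A bounded Lipschitz function on one period extends to a bounded Lipschitz function. -/
lemma BL.of_periodic {V : Type*} [NormedAddCommGroup V] [NormedSpace ℝ V] {f : ℝ → V}
    {c p D B : ℝ} (hp : 0 < p) (hf : BL c (c + p) B f) (hper : ∀ y, c ≤ y → y + p ≤ D → f (y + p) = f y) : BL c D B f := by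
  have key : ∀ n : ℕ, BL c (min (c + (n + 1) * p) D) B f := fun n => by
    induction n with
    | zero => exact hf.mono_set (Icc_subset_Icc le_rfl ((min_le_left _ _).trans (by simp)))
    | succ n ih =>
      rcases le_total D (c + p) with hD | hD
      · exact hf.mono_set (Icc_subset_Icc le_rfl ((min_le_right _ _).trans hD))
      push_cast
      have hnp : 0 ≤ n * p := by positivity
      have hsh : ∀ y ∈ Icc (c + p) (min (c + (n + 1 + 1) * p) D),
          f y = f (y - p) ∧ y - p ∈ Icc c (min (c + (n + 1) * p) D) := fun y hy => by
        obtain ⟨h1, h2⟩ := hy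
        obtain ⟨h2, h3⟩ := le_min_iff.1 h2
        have := hper (y - p) (by linarith) (by linarith)
        rw [sub_add_cancel] at this
        exact ⟨this, by linarith, le_min (by linarith) (by linarith)⟩
      refine hf.glue ⟨fun x hx => ?_, fun x hx y hy => ?_⟩ (by linarith)
        (le_min (by linarith) hD)
      · rw [(hsh x hx).1]; exact ih.1 _ (hsh x hx).2
      · rw [(hsh x hx).1, (hsh y hy).1]
        simpa using ih.2 _ (hsh x hx).2 _ (hsh y hy).2
  obtain ⟨n, hn⟩ := exists_nat_ge ((D - c) / p)
  rw [div_le_iff₀ hp] at hn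
  exact (key n).mono_set (Icc_subset_Icc le_rfl (le_min (by linarith) le_rfl))

lemma IsWaveSolution.contDiffOn_time (hG : IsWaveSolution a b g₀ g₁ G) {x : ℝ} (hx : x ∈ Icc a b) :
    ContDiffOn ℝ 2 (fun r => G x r) (Ici 0) :=
  ContDiffOn.comp (g := fun p : ℝ × ℝ => G p.1 p.2) (f := fun r => (x, r)) (s := Ici 0)
    hG.smooth (contDiffOn_const.prodMk contDiffOn_id) fun _ hr => ⟨hx, hr⟩

lemma IsWaveSolution.contDiffOn_space (hG : IsWaveSolution a b g₀ g₁ G) {s : ℝ} (hs : 0 ≤ s) :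
    ContDiffOn ℝ 2 (fun y => G y s) (Icc a b) :=
  ContDiffOn.comp (g := fun p : ℝ × ℝ => G p.1 p.2) (f := fun y => (y, s)) (s := Icc a b)
    hG.smooth (contDiffOn_id.prodMk contDiffOn_const) fun _ hy => ⟨hy, hs⟩

lemma IsWaveSolution.pd_eq_interior (hG : IsWaveSolution a b g₀ g₁ G) (hab : a < b) (hS : 0 < S)
    {x s : ℝ} (hx : x ∈ Ioo a b) (hs : s ∈ Ioc 0 S) :
    pd a b S G 0 2 x s = pd a b S G 2 0 x s := by
  have c1 : ContDiffAt ℝ 2 (fun r => G x r) s :=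
    (hG.contDiffOn_time (Ioo_subset_Icc_self hx)).contDiffAt (Ici_mem_nhds hs.1)
  have c2 : ContDiffAt ℝ 2 (fun y => G y s) x :=
    (hG.contDiffOn_space hs.1.le).contDiffAt (Icc_mem_nhds hx.1 hx.2)
  have := hG.eqn x hx s hs.1
  simp only [pd, iteratedDerivWithin_zero]
  rw [iteratedDerivWithin_eq_iteratedDeriv (uniqueDiffOn_Icc hS) c1 (Ioc_subset_Icc_self hs),
    iteratedDerivWithin_eq_iteratedDeriv (uniqueDiffOn_Icc hab) c2 (Ioo_subset_Icc_self hx)]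
  linarith

lemma IsWaveSolution.pd_eq (hG : IsWaveSolution a b g₀ g₁ G) (hab : a < b) (hS : 0 < S) {x s : ℝ}
    (hx : x ∈ Icc a b) (hs : s ∈ Icc 0 S) : pd a b S G 0 2 x s = pd a b S G 2 0 x s := by
  have hu := hG.isSmoothOn S
  have h1 := hu.continuousOn_pd hab hS (m := 0) (n := 2) (by norm_num)
  have h2 := hu.continuousOn_pd hab hS (m := 2) (n := 0) (by norm_num)
  exact eqOn_rect (f := pd a b S G 0 2) (g := pd a b S G 2 0) hab hS h1 h2
    (fun x hx s hs => hG.pd_eq_interior hab hS hx hs) hx hs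

lemma pd_bdry_eq_zero {V : Type*} [NormedAddCommGroup V] [NormedSpace ℝ V] {T : ℝ}
    {u : ℝ → ℝ → V} {x : ℝ}
    (h : ∀ s ∈ Icc 0 T, u x s = 0) (n : ℕ) {s : ℝ} (hs : s ∈ Icc 0 T) :
    pd a b T u 0 n x s = 0 := by
  simp only [pd, iteratedDerivWithin_zero]
  rw [iteratedDerivWithin_congr (g := fun _ => 0) h hs]
  simp

lemma fderivWithin_pd {V : Type*} [NormedAddCommGroup V] [NormedSpace ℝ V] {T : ℝ}
    {u : ℝ → ℝ → V} {r : ℕ} (hu : IsSmoothOn a b T r u) (hab : a < b) (hT : 0 < T)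
    {m n : ℕ} (h : m + n + 1 ≤ r) {p : ℝ × ℝ} (hp : p ∈ rect a b T) (c d : ℝ) :
    fderivWithin ℝ (fun p : ℝ × ℝ => pd a b T u m n p.1 p.2) (rect a b T) p (c, d)
      = c • pd a b T u (m + 1) n p.1 p.2 + d • pd a b T u m (n + 1) p.1 p.2 := by
  have e : ((c, d) : ℝ × ℝ) = c • (1, 0) + d • (0, 1) := by simp
  rw [e, map_add, map_smul, map_smul]
  congr 2
  · exact ((hasDerivWithinAt_fst (hu.differentiableOn_pd hab hT h) hp.1 hp.2).derivWithin
      (uniqueDiffOn_Icc hab _ hp.1)).symm.trans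
      ((hu.hasDerivWithinAt_pd_x hab hT h hp.1 hp.2).derivWithin (uniqueDiffOn_Icc hab _ hp.1))
  · exact ((hasDerivWithinAt_snd (hu.differentiableOn_pd hab hT h) hp.1 hp.2).derivWithin
      (uniqueDiffOn_Icc hT _ hp.2)).symm.trans
      ((hu.hasDerivWithinAt_pd_t hab hT h hp.1 hp.2).derivWithin (uniqueDiffOn_Icc hT _ hp.2))

lemma hasDerivWithinAt_pd_line {V : Type*} [NormedAddCommGroup V] [NormedSpace ℝ V] {T : ℝ}
    {u : ℝ → ℝ → V} {r : ℕ} (hu : IsSmoothOn a b T r u) (hab : a < b) (hT : 0 < T)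
    {m n : ℕ} (h : m + n + 1 ≤ r) {x s c l : ℝ}
    (hl : MapsTo (fun σ => (x + c * σ, s + σ)) (Icc 0 l) (rect a b T)) {σ : ℝ} (hσ : σ ∈ Icc 0 l) :
    HasDerivWithinAt (fun σ => pd a b T u m n (x + c * σ) (s + σ))
      (c • pd a b T u (m + 1) n (x + c * σ) (s + σ) + pd a b T u m (n + 1) (x + c * σ) (s + σ))
      (Icc 0 l) σ := by
  have h1 := ((hu.differentiableOn_pd hab hT h) _ (hl hσ)).hasFDerivWithinAt
  have h2 : HasDerivWithinAt (fun σ : ℝ => (x + c * σ, s + σ)) ((c : ℝ), (1 : ℝ)) (Icc 0 l) σ := by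
    have h3 : HasDerivWithinAt (fun σ : ℝ => x + c * σ) c (Icc 0 l) σ := by
      simpa using ((hasDerivWithinAt_id σ (Icc 0 l)).const_mul c).const_add x
    have h4 : HasDerivWithinAt (fun σ : ℝ => s + σ) 1 (Icc 0 l) σ :=
      (hasDerivWithinAt_id σ (Icc 0 l)).const_add s
    exact h3.prodMk h4
  have h3 := HasFDerivWithinAt.comp_hasDerivWithinAt (t := rect a b T) σ h1 h2 hl
  rw [fderivWithin_pd hu hab hT h (hl hσ), one_smul] at h3
  exact h3

/-- Transport along characteristics. -/
lemma IsWaveSolution.transport (hG : IsWaveSolution a b g₀ g₁ G) (hab : a < b) (hS : 0 < S)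
    {x s c l : ℝ} (hc : c * c = 1) (h0 : 0 ≤ l)
    (hl : MapsTo (fun σ => (x + c * σ, s + σ)) (Icc 0 l) (rect a b S)) :
    pd a b S G 0 1 (x + c * l) (s + l) - c * pd a b S G 1 0 (x + c * l) (s + l)
      = pd a b S G 0 1 x s - c * pd a b S G 1 0 x s := by
  have hu := hG.isSmoothOn S
  have hd := fun σ hσ =>
    (hasDerivWithinAt_pd_line hu hab hS (m := 0) (n := 1) (by norm_num) hl (σ := σ) hσ).sub
    ((hasDerivWithinAt_pd_line hu hab hS (m := 1) (n := 0) (by norm_num) hl (σ := σ) hσ).const_mul c)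
  have := (convex_Icc 0 l).norm_image_sub_le_of_norm_hasDerivWithin_le (C := 0) hd
    (fun σ hσ => by
      have := hG.pd_eq hab hS (hl hσ).1 (hl hσ).2
      simp only [zero_add, one_add_one_eq_two, smul_eq_mul] at this ⊢
      rw [this]; apply le_of_eq; rw [norm_eq_zero]
      linear_combination (-pd a b S G 2 0 (x + c * σ) (s + σ)) * hc)
    (left_mem_Icc.2 h0) (right_mem_Icc.2 h0)
  rw [zero_mul, norm_le_zero_iff, sub_eq_zero] at this
  simpa only [Pi.sub_apply, mul_zero, add_zero] using this

lemma IsWaveSolution.right_char (hG : IsWaveSolution a b g₀ g₁ G) (hab : a < b) (hS : 0 < S)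
    {x s : ℝ} (hx : x ∈ Icc a b) (hs : 0 ≤ s) (hsS : s + x - a ≤ S) :
    pd a b S G 0 1 x s + pd a b S G 1 0 x s = pd a b S G 1 0 a (s + x - a) := by
  have := hG.transport hab hS (x := x) (s := s) (c := -1) (l := x - a) (by norm_num)
    (by linarith [hx.1]) fun σ hσ => ⟨⟨by linarith [hσ.2], by linarith [hσ.1, hx.2]⟩,
      ⟨by linarith [hσ.1], by linarith [hσ.2]⟩⟩
  rw [show x + -1 * (x - a) = a by ring, show s + (x - a) = s + x - a by ring,
    pd_bdry_eq_zero (fun r hr => hG.left r hr.1) 1 ⟨by linarith [hx.1], hsS⟩] at this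
  linarith

lemma IsWaveSolution.left_char (hG : IsWaveSolution a b g₀ g₁ G) (hab : a < b) (hS : 0 < S)
    {x s : ℝ} (hx : x ∈ Icc a b) (hs : 0 ≤ s) (hsS : s + (2 * b - x) - a ≤ S) :
    pd a b S G 0 1 x s - pd a b S G 1 0 x s = - pd a b S G 1 0 a (s + (2 * b - x) - a) := by
  have h0 : 0 ≤ b - x := by linarith [hx.2]
  have := hG.transport hab hS (x := x) (s := s) (c := 1) (l := b - x) (by norm_num) h0
    fun σ hσ => ⟨⟨by linarith [hσ.1, hx.1], by linarith [hσ.2]⟩,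
      ⟨by linarith [hσ.1], by linarith [hσ.2]⟩⟩
  have hr := hG.right_char hab hS (x := b) (s := s + (b - x)) ⟨hab.le, le_rfl⟩ (by linarith)
    (by linarith)
  have hz := pd_bdry_eq_zero (a := a) (b := b) (fun r hr => hG.right r hr.1) 1
    (s := s + (b - x)) (T := S) ⟨by linarith, by linarith⟩
  rw [show x + 1 * (b - x) = b by ring, hz] at this
  rw [hz, show s + (b - x) + b - a = s + (2 * b - x) - a by ring] at hr
  linarith

lemma IsWaveSolution.right_char_deriv (hG : IsWaveSolution a b g₀ g₁ G) (hab : a < b) (hS : 0 < S)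
    {x s : ℝ} (hx : x ∈ Icc a b) (hs : 0 ≤ s) (hsS : s + b - a ≤ S) :
    pd a b S G 1 1 x s + pd a b S G 2 0 x s = pd a b S G 1 1 a (s + x - a) := by
  have hu := hG.isSmoothOn S
  have hs' : s ∈ Icc 0 S := ⟨hs, by linarith⟩
  have h1 := (hu.hasDerivWithinAt_pd_x hab hS (m := 0) (n := 1) (by norm_num) hx hs').add
    (hu.hasDerivWithinAt_pd_x hab hS (m := 1) (n := 0) (by norm_num) hx hs')
  have hm : MapsTo (fun y => s + y - a) (Icc a b) (Icc 0 S) := fun y hy =>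
    ⟨by linarith [hy.1], by linarith [hy.2]⟩
  have h2 := (hu.hasDerivWithinAt_pd_t hab hS (m := 1) (n := 0) (by norm_num) (left_mem_Icc.2 hab.le)
    (hm hx)).scomp x (((hasDerivWithinAt_id x (Icc a b)).const_add s).sub_const a) hm
  have h3 := h1.congr (f₁ := (fun s => pd a b S G 1 0 a s) ∘ fun y => s + y - a) (fun y hy =>
    (hG.right_char hab hS hy hs (by linarith [hy.2])).symm)
    (hG.right_char hab hS hx hs (by linarith [hx.2])).symm
  have := (uniqueDiffOn_Icc hab x hx).eq_deriv _ h3 h2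
  simpa using this

lemma IsWaveSolution.left_char_deriv (hG : IsWaveSolution a b g₀ g₁ G) (hab : a < b) (hS : 0 < S)
    {x s : ℝ} (hx : x ∈ Icc a b) (hs : 0 ≤ s) (hsS : s + 2 * (b - a) ≤ S) :
    pd a b S G 1 1 x s - pd a b S G 2 0 x s = pd a b S G 1 1 a (s + (2 * b - x) - a) := by
  have hu := hG.isSmoothOn S
  have hs' : s ∈ Icc 0 S := ⟨hs, by linarith⟩
  have h1 := (hu.hasDerivWithinAt_pd_x hab hS (m := 0) (n := 1) (by norm_num) hx hs').sub
    (hu.hasDerivWithinAt_pd_x hab hS (m := 1) (n := 0) (by norm_num) hx hs')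
  have hm : MapsTo (fun y => s + (2 * b - y) - a) (Icc a b) (Icc 0 S) := fun y hy =>
    ⟨by linarith [hy.2], by linarith [hy.1]⟩
  have h2 := ((hu.hasDerivWithinAt_pd_t hab hS (m := 1) (n := 0) (by norm_num)
    (left_mem_Icc.2 hab.le) (hm hx)).scomp x
      ((((hasDerivWithinAt_id x (Icc a b)).const_sub (2 * b)).const_add s).sub_const a) hm).neg
  have h3 := h1.congr (f₁ := -((fun s => pd a b S G 1 0 a s) ∘ fun y => s + (2 * b - y) - a))
    (fun y hy => (hG.left_char hab hS hy hs (by linarith [hy.1])).symm)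
    (hG.left_char hab hS hx hs (by linarith [hx.1])).symm
  have := (uniqueDiffOn_Icc hab x hx).eq_deriv _ h3 h2
  simpa using this

/-- Bounds on the data of the wave equation. -/
structure WaveData (a b K : ℝ) (g₀ g₁ : ℝ → ℝ) : Prop where
  bound₀ : ∀ x ∈ Icc a b, |derivWithin g₀ (Icc a b) x| ≤ K
  bl₀ : BL a b K (fun x => iteratedDerivWithin 2 g₀ (Icc a b) x)
  bound₁ : ∀ x ∈ Icc a b, |g₁ x| ≤ K
  bl₁ : BL a b K (fun x => derivWithin g₁ (Icc a b) x)

lemma IsWaveSolution.pd_init (hG : IsWaveSolution a b g₀ g₁ G) {x : ℝ} (hx : x ∈ Icc a b) (m : ℕ) :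
    pd a b S G m 0 x 0 = iteratedDerivWithin m g₀ (Icc a b) x := by
  simp only [pd, iteratedDerivWithin_zero]
  exact iteratedDerivWithin_congr (fun y hy => hG.init y hy) hx

lemma IsWaveSolution.pd_zero_one_init (hG : IsWaveSolution a b g₀ g₁ G) (hS : 0 < S)
    {x : ℝ} (hx : x ∈ Icc a b) : pd a b S G 0 1 x 0 = g₁ x := by
  have hd : DifferentiableWithinAt ℝ (fun r => G x r) (Ici 0) 0 :=
    (hG.contDiffOn_time hx).differentiableOn (by norm_num) 0 self_mem_Ici
  rw [← hG.init_deriv x hx, pd_zero_succ]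
  simp only [pd_zero_zero]
  exact (hd.hasDerivWithinAt.mono Icc_subset_Ici_self).derivWithin
    (uniqueDiffOn_Icc hS 0 (left_mem_Icc.2 hS.le))

lemma IsWaveSolution.pd_one_one_init (hG : IsWaveSolution a b g₀ g₁ G) (hS : 0 < S)
    {x : ℝ} (hx : x ∈ Icc a b) : pd a b S G 1 1 x 0 = derivWithin g₁ (Icc a b) x := by
  rw [pd_succ_left]
  exact derivWithin_congr (fun y hy => hG.pd_zero_one_init hS hy) (hG.pd_zero_one_init hS hx)

lemma IsWaveSolution.trace_bl (hG : IsWaveSolution a b g₀ g₁ G) (hD : WaveData a b K g₀ g₁)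
    (hab : a < b) (hS : 2 * (b - a) ≤ S) :
    BL a (a + S) (2 * K) (fun y => pd a b S G 1 1 a (y - a)) ∧
      ∀ y ∈ Icc a (a + S), |pd a b S G 1 0 a (y - a)| ≤ 2 * K := by
  have hS0 : 0 < S := by linarith
  have e : b + (b - a) = a + 2 * (b - a) := by ring
  -- first half period
  have q1 : ∀ y ∈ Icc a b, pd a b S G 1 1 a (y - a)
      = derivWithin g₁ (Icc a b) y + iteratedDerivWithin 2 g₀ (Icc a b) y := fun y hy => by
    rw [← hG.pd_one_one_init hS0 hy, ← hG.pd_init hy 2 (S := S),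
      hG.right_char_deriv hab hS0 hy le_rfl (by linarith), zero_add]
  have q2 : ∀ y ∈ Icc a b, pd a b S G 1 1 a ((2 * b - y) - a)
      = derivWithin g₁ (Icc a b) y - iteratedDerivWithin 2 g₀ (Icc a b) y := fun y hy => by
    rw [← hG.pd_one_one_init hS0 hy, ← hG.pd_init hy 2 (S := S),
      hG.left_char_deriv hab hS0 hy le_rfl (by linarith), zero_add]
  have b1 : BL a b (2 * K) (fun y => pd a b S G 1 1 a (y - a)) :=
    ((hD.bl₁.add hD.bl₀).mono (by linarith)).congr q1
  have b2' : BL a b (2 * K) (fun y => pd a b S G 1 1 a ((2 * b - y) - a)) :=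
    ((hD.bl₁.sub hD.bl₀).mono (by linarith)).congr q2
  have b2 : BL b (b + (b - a)) (2 * K) (fun y => pd a b S G 1 1 a (y - a)) := by
    refine ⟨fun x hx => ?_, fun x hx y hy => ?_⟩
    · have := b2'.1 (2 * b - x) ⟨by linarith [hx.2], by linarith [hx.1]⟩
      simpa only [sub_sub_cancel] using this
    · have := b2'.2 (2 * b - x) ⟨by linarith [hx.2], by linarith [hx.1]⟩ (2 * b - y)
        ⟨by linarith [hy.2], by linarith [hy.1]⟩
      simp only [sub_sub_cancel, sub_sub_sub_cancel_left] at this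
      rwa [abs_sub_comm y x] at this
  have b3 := b1.glue b2 hab.le (by linarith)
  rw [e] at b3
  refine ⟨b3.of_periodic (by linarith) fun y h1 h2 => ?_, ?_⟩
  · have c1 := hG.right_char_deriv hab hS0 (x := a) (s := y - a) (left_mem_Icc.2 hab.le)
      (by linarith) (by linarith)
    have c2 := hG.left_char_deriv hab hS0 (x := a) (s := y - a) (left_mem_Icc.2 hab.le)
      (by linarith) (by linarith)
    have c3 := hG.pd_eq hab hS0 (x := a) (s := y - a) (left_mem_Icc.2 hab.le)
      ⟨by linarith, by linarith⟩
    rw [pd_bdry_eq_zero (fun r hr => hG.left r hr.1) 2 ⟨by linarith, by linarith⟩] at c3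
    have e1 : y - a + (2 * b - a) - a = y + 2 * (b - a) - a := by ring
    have e2 : y - a + a - a = y - a := by ring
    rw [e1] at c2; rw [e2] at c1
    show pd a b S G 1 1 a (y + 2 * (b - a) - a) = pd a b S G 1 1 a (y - a)
    rw [← c1, ← c2, ← c3]; ring
  · have hb : ∀ n : ℕ, ∀ y, a ≤ y → y ≤ a + S → y ≤ a + (n + 1) * (2 * (b - a)) →
        |pd a b S G 1 0 a (y - a)| ≤ 2 * K := by
      intro n
      induction n with
      | zero =>
        intro y h1 h2 h3
        norm_num at h3
        rcases le_total y b with h | h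
        · have := hG.right_char hab hS0 (x := y) (s := 0) ⟨h1, h⟩ le_rfl (by linarith)
          rw [zero_add] at this
          rw [← this, hG.pd_zero_one_init hS0 ⟨h1, h⟩, hG.pd_init ⟨h1, h⟩,
            iteratedDerivWithin_one]
          have := abs_add_le (g₁ y) (derivWithin g₀ (Icc a b) y)
          linarith [hD.bound₀ y ⟨h1, h⟩, hD.bound₁ y ⟨h1, h⟩]
        · have hy : 2 * b - y ∈ Icc a b := ⟨by linarith, by linarith⟩
          have := hG.left_char hab hS0 (x := 2 * b - y) (s := 0) hy le_rfl (by linarith)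
          rw [zero_add, sub_sub_cancel] at this
          rw [← abs_neg, ← this, hG.pd_zero_one_init hS0 hy, hG.pd_init hy,
            iteratedDerivWithin_one]
          have := abs_sub (g₁ (2 * b - y)) (derivWithin g₀ (Icc a b) (2 * b - y))
          linarith [hD.bound₀ _ hy, hD.bound₁ _ hy]
      | succ n ih =>
        intro y h1 h2 h3
        push_cast at h3
        rcases le_total y (a + (n + 1) * (2 * (b - a))) with h | h
        · exact ih y h1 h2 h
        · have hnp : 0 ≤ n * (2 * (b - a)) := by
            have : 0 ≤ 2 * (b - a) := by linarith
            positivity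
          have c1 := hG.right_char hab hS0 (x := a) (s := y - 2 * (b - a) - a)
            (left_mem_Icc.2 hab.le) (by linarith) (by linarith)
          have c2 := hG.left_char hab hS0 (x := a) (s := y - 2 * (b - a) - a)
            (left_mem_Icc.2 hab.le) (by linarith) (by linarith)
          rw [pd_bdry_eq_zero (fun r hr => hG.left r hr.1) 1 ⟨by linarith, by linarith⟩] at c1 c2
          have e1 : y - 2 * (b - a) - a + (2 * b - a) - a = y - a := by ring
          have e2 : y - 2 * (b - a) - a + a - a = y - 2 * (b - a) - a := by ring
          rw [e1] at c2; rw [e2] at c1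
          have : pd a b S G 1 0 a (y - a) = pd a b S G 1 0 a (y - 2 * (b - a) - a) := by linarith
          rw [this]
          exact ih _ (by linarith) (by linarith) (by linarith)
    intro y hy
    obtain ⟨n, hn⟩ := exists_nat_ge ((y - a) / (2 * (b - a)))
    rw [div_le_iff₀ (by linarith)] at hn
    exact hb n y hy.1 hy.2 (by linarith)

/-- Uniform bounds for the solution of the wave equation. -/
lemma IsWaveSolution.bounds (hG : IsWaveSolution a b g₀ g₁ G) (hD : WaveData a b K g₀ g₁)
    (hab : a < b) (hS : 0 < S) :
    (∀ s ∈ Icc 0 S, BL a b (2 * K * (1 + (b - a))) (fun x => G x s) ∧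
      BL a b (2 * K) (fun x => pd a b S G 1 0 x s) ∧ BL a b (2 * K) (fun x => pd a b S G 2 0 x s)) ∧
    ∀ s ∈ Icc 0 S, ∀ t ∈ Icc 0 S, BL a b (2 * K * |s - t|) (fun x => G x s - G x t) := by
  set S' := S + 2 * (b - a) with hS'
  have hS0 : 0 < S' := by linarith
  obtain ⟨hP1, hP⟩ := hG.trace_bl hD hab (S := S') (by linarith)
  have hK : 0 ≤ K := (abs_nonneg _).trans (hD.bound₁ a (left_mem_Icc.2 hab.le))
  have hu := hG.isSmoothOn S'
  have hsub : Icc 0 S ⊆ Icc 0 S' := Icc_subset_Icc le_rfl (by linarith)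
  have m1 : ∀ {x s}, x ∈ Icc a b → s ∈ Icc 0 S → s + x ∈ Icc a (a + S') := fun hx hs =>
    ⟨by linarith [hx.1, hs.1], by linarith [hx.2, hs.2]⟩
  have m2 : ∀ {x s}, x ∈ Icc a b → s ∈ Icc 0 S → s + (2 * b - x) ∈ Icc a (a + S') := fun hx hs =>
    ⟨by linarith [hx.2, hs.1], by linarith [hx.1, hs.2]⟩
  have c1 : ∀ {x s}, x ∈ Icc a b → s ∈ Icc 0 S → _ := fun {x s} hx hs =>
    hG.right_char hab hS0 (x := x) (s := s) hx hs.1 (by linarith [hx.2, hs.2])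
  have c2 : ∀ {x s}, x ∈ Icc a b → s ∈ Icc 0 S → _ := fun {x s} hx hs =>
    hG.left_char hab hS0 (x := x) (s := s) hx hs.1 (by linarith [hx.1, hs.2])
  have c3 : ∀ {x s}, x ∈ Icc a b → s ∈ Icc 0 S → _ := fun {x s} hx hs =>
    hG.right_char_deriv hab hS0 (x := x) (s := s) hx hs.1 (by linarith [hx.2, hs.2])
  have c4 : ∀ {x s}, x ∈ Icc a b → s ∈ Icc 0 S → _ := fun {x s} hx hs =>
    hG.left_char_deriv hab hS0 (x := x) (s := s) hx hs.1 (by linarith [hx.1, hs.2])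
  have u20 : ∀ s ∈ Icc 0 S, BL a b (2 * K) (fun x => pd a b S' G 2 0 x s) := by
    intro s hs
    have e : ∀ x ∈ Icc a b, pd a b S' G 2 0 x s = (2 : ℝ)⁻¹ * (pd a b S' G 1 1 a (s + x - a)
        - pd a b S' G 1 1 a (s + (2 * b - x) - a)) := fun x hx => by
      rw [← c3 hx hs, ← c4 hx hs]; ring
    refine BL.congr ⟨fun x hx => ?_, fun x hx y hy => ?_⟩ e
    · rw [norm_mul, Real.norm_of_nonneg (by norm_num)]
      have h1 := hP1.1 _ (m1 hx hs)
      have h2 := hP1.1 _ (m2 hx hs)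
      have := norm_sub_le (pd a b S' G 1 1 a (s + x - a)) (pd a b S' G 1 1 a (s + (2 * b - x) - a))
      linarith
    · rw [← mul_sub, norm_mul, Real.norm_of_nonneg (by norm_num), sub_sub_sub_comm]
      have h1 := hP1.2 _ (m1 hx hs) _ (m1 hy hs)
      have h2 := hP1.2 _ (m2 hx hs) _ (m2 hy hs)
      have e1 : s + x - (s + y) = x - y := by ring
      have e2 : s + (2 * b - x) - (s + (2 * b - y)) = - (x - y) := by ring
      rw [e1] at h1
      rw [e2, abs_neg] at h2
      have := norm_sub_le (pd a b S' G 1 1 a (s + x - a) - pd a b S' G 1 1 a (s + y - a))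
        (pd a b S' G 1 1 a (s + (2 * b - x) - a) - pd a b S' G 1 1 a (s + (2 * b - y) - a))
      linarith
  have v10 : ∀ s ∈ Icc 0 S, ∀ x ∈ Icc a b, ‖pd a b S' G 1 0 x s‖ ≤ 2 * K := by
    intro s hs x hx
    have h1 := abs_le.1 (hP _ (m1 hx hs))
    have h2 := abs_le.1 (hP _ (m2 hx hs))
    have h3 := c1 hx hs
    have h4 := c2 hx hs
    rw [Real.norm_eq_abs, abs_le]; constructor <;> linarith [h1.1, h1.2, h2.1, h2.2]
  have v01 : ∀ s ∈ Icc 0 S, ∀ x ∈ Icc a b, ‖pd a b S' G 0 1 x s‖ ≤ 2 * K := by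
    intro s hs x hx
    have h1 := abs_le.1 (hP _ (m1 hx hs))
    have h2 := abs_le.1 (hP _ (m2 hx hs))
    have h3 := c1 hx hs
    have h4 := c2 hx hs
    rw [Real.norm_eq_abs, abs_le]; constructor <;> linarith [h1.1, h1.2, h2.1, h2.2]
  have v11 : ∀ s ∈ Icc 0 S, ∀ x ∈ Icc a b, ‖pd a b S' G 1 1 x s‖ ≤ 2 * K := by
    intro s hs x hx
    have h1 := abs_le.1 (hP1.1 _ (m1 hx hs))
    have h2 := abs_le.1 (hP1.1 _ (m2 hx hs))
    have h3 := c3 hx hs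
    have h4 := c4 hx hs
    rw [Real.norm_eq_abs, abs_le]; constructor <;> linarith [h1.1, h1.2, h2.1, h2.2]
  have u10 : ∀ s ∈ Icc 0 S, BL a b (2 * K) (fun x => pd a b S' G 1 0 x s) := fun s hs =>
    BL.of_hasDerivWithinAt (fun x hx => hu.hasDerivWithinAt_pd_x hab hS0 (by norm_num) hx (hsub hs))
      (v10 s hs) ((u20 s hs).1)
  have u01 : ∀ s ∈ Icc 0 S, BL a b (2 * K) (fun x => pd a b S' G 0 1 x s) := fun s hs =>
    BL.of_hasDerivWithinAt (fun x hx => hu.hasDerivWithinAt_pd_x hab hS0 (by norm_num) hx (hsub hs))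
      (v01 s hs) (v11 s hs)
  have d0 : ∀ {x s}, x ∈ Icc a b → s ∈ Icc 0 S → HasDerivWithinAt (fun y => G y s)
      (pd a b S' G 1 0 x s) (Icc a b) x := fun hx hs => by
    have := hu.hasDerivWithinAt_pd_x hab hS0 (m := 0) (n := 0) (by norm_num) hx (hsub hs)
    simpa only [pd_zero_zero] using this
  have dt0 : ∀ {x s}, x ∈ Icc a b → s ∈ Icc 0 S → HasDerivWithinAt (fun r => G x r)
      (pd a b S' G 0 1 x s) (Icc 0 S) s := fun hx hs => by
    have := hu.hasDerivWithinAt_pd_t hab hS0 (m := 0) (n := 0) (by norm_num) hx (hsub hs)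
    simp only [pd_zero_zero] at this
    exact this.mono hsub
  have hKL : 2 * K ≤ 2 * K * (1 + (b - a)) := by nlinarith
  refine ⟨fun s hs => ⟨?_, u10 s hs, u20 s hs⟩, fun s hs t ht => ⟨fun x hx => ?_,
    fun x hx y hy => ?_⟩⟩
  · refine BL.of_hasDerivWithinAt (fun x hx => d0 hx hs) (fun x hx => ?_)
      (fun x hx => (v10 s hs x hx).trans hKL)
    have := (convex_Icc a b).norm_image_sub_le_of_norm_hasDerivWithin_le
      (fun y hy => d0 hy hs) (v10 s hs) (left_mem_Icc.2 hab.le) hx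
    rw [hG.left s hs.1, sub_zero, Real.norm_of_nonneg (by linarith [hx.1] : 0 ≤ x - a)] at this
    have h2 : 2 * K * (x - a) ≤ 2 * K * (1 + (b - a)) := by
      apply mul_le_mul_of_nonneg_left _ (by positivity); linarith [hx.2]
    linarith
  · exact (convex_Icc 0 S).norm_image_sub_le_of_norm_hasDerivWithin_le
      (fun r hr => dt0 hx hr) (fun r hr => v01 r hr x hx) ht hs
  · have := (convex_Icc 0 S).norm_image_sub_le_of_norm_hasDerivWithin_le
      (fun r hr => (dt0 hx hr).sub (dt0 hy hr)) (fun r hr => (u01 r hr).2 x hx y hy) ht hs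
    simp only [Pi.sub_apply] at this
    rw [sub_sub_sub_comm]
    refine this.trans_eq ?_
    rw [Real.norm_eq_abs]; ring

end Wave

section WeakDerivatives

variable {a b K : ℝ} {f g : ℝ → ℝ}

lemma integral_Ioo_eq (hab : a ≤ b) (u : ℝ → ℝ) : ∫ x in Ioo a b, u x = ∫ x in a..b, u x := by
  rw [intervalIntegral.integral_of_le hab, integral_Ioc_eq_integral_Ioo]

lemma HasWeakDeriv.integrableOn (h : HasWeakDeriv a b f g)
    (hK : ∀ᵐ x ∂(volume.restrict (Ioo a b)), ‖g x‖ ≤ K) : IntegrableOn g (Ioo a b) :=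
  IntegrableOn.of_bound (by simp) h.2.1.aestronglyMeasurable K hK

lemma HasWeakDeriv.ae_eq (h : HasWeakDeriv a b f g) (hab : a < b)
    (hK : ∀ᵐ x ∂(volume.restrict (Ioo a b)), ‖g x‖ ≤ K) {f' : ℝ → ℝ}
    (hd : ∀ x ∈ Icc a b, HasDerivWithinAt f (f' x) (Icc a b) x) (hc : ContinuousOn f' (Icc a b)) :
    ∀ᵐ x ∂(volume.restrict (Ioo a b)), g x = f' x := by
  have hgi := h.integrableOn hK
  have hf'i : IntegrableOn f' (Ioo a b) := (hc.integrableOn_Icc).mono_set Ioo_subset_Icc_self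
  have hfc : ContinuousOn f (Icc a b) := fun x hx => (hd x hx).continuousWithinAt
  have key := IsOpen.ae_eq_zero_of_integral_contDiff_smul_eq_zero (μ := volume) isOpen_Ioo
    (f := fun x => g x - f' x) ((hgi.sub hf'i).locallyIntegrableOn) (fun φ hφ hφc hφs => ?_)
  · rw [ae_restrict_iff' measurableSet_Ioo]
    filter_upwards [key] with x hx hxs
    exact sub_eq_zero.1 (hx hxs)
  have hz : ∀ x ∉ Ioo a b, φ x = 0 := fun x hx => image_eq_zero_of_notMem_tsupport fun h => hx (hφs h)
  rw [← setIntegral_eq_integral_of_forall_compl_eq_zero (s := Ioo a b)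
    (fun x hx => by rw [hz x hx, zero_smul])]
  have hφcont : Continuous φ := hφ.continuous
  have hφ' : Continuous (deriv φ) := hφ.continuous_deriv (by simp)
  have i1 : IntegrableOn (fun x => φ x * f' x) (Ioo a b) :=
    ((hφcont.continuousOn.mul hc).integrableOn_Icc).mono_set Ioo_subset_Icc_self
  have i2 : IntegrableOn (fun x => φ x * g x) (Ioo a b) := by
    obtain ⟨C, hC⟩ := hφc.exists_bound_of_continuous hφcont
    exact Integrable.bdd_mul (c := C) hgi hφcont.aestronglyMeasurable (Filter.Eventually.of_forall hC)
  have i3 : IntegrableOn (fun x => deriv φ x * f x) (Icc a b) :=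
    (hφ'.continuousOn.mul hfc).integrableOn_Icc
  have e1 : ∫ x in Ioo a b, φ x • (g x - f' x)
      = (∫ x in Ioo a b, φ x * g x) - ∫ x in Ioo a b, φ x * f' x := by
    rw [← integral_sub i2 i1]
    simp only [smul_eq_mul, mul_sub]
  have e2 : ∫ x in a..b, (deriv φ x * f x + φ x * f' x) = φ b * f b - φ a * f a := by
    refine intervalIntegral.integral_eq_sub_of_hasDerivAt_of_le (f := fun x => φ x * f x) hab.le
      (hφcont.continuousOn.mul hfc) (fun x hx => ?_) ?_
    · exact ((hφ.differentiable (by simp)) x).hasDerivAt.mul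
        ((hd x (Ioo_subset_Icc_self hx)).hasDerivAt (Icc_mem_nhds hx.1 hx.2))
    · refine ContinuousOn.intervalIntegrable ?_
      rw [uIcc_of_le hab.le]
      exact (hφ'.continuousOn.mul hfc).add (hφcont.continuousOn.mul hc)
  rw [← integral_Ioo_eq hab.le, integral_add (i3.mono_set Ioo_subset_Icc_self) i1, hz a (by simp),
    hz b (by simp)] at e2
  have e3 := h.2.2 φ hφ hφc hφs
  simp only [smul_eq_mul] at e3
  rw [e1]
  linarith

lemma HasWeakDeriv.abs_sub_le (h : HasWeakDeriv a b f g) (hf : ContinuousOn f (Icc a b))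
    (hK : ∀ᵐ x ∂(volume.restrict (Ioo a b)), ‖g x‖ ≤ K) (hK0 : 0 ≤ K) {x y : ℝ} (hx : a < x)
    (hxy : x < y) (hy : y < b) : |f x - f y| ≤ K * (y - x) := by
  refine le_of_forall_pos_le_add fun η₀ hη₀ => ?_
  set η := η₀ / 3 with hηd
  have hη : 0 < η := by positivity
  have hab : a < b := by linarith
  have cont : ∀ z ∈ Icc a b, ∃ δ > 0, ∀ w ∈ Icc a b, |w - z| ≤ δ → |f w - f z| ≤ η := by
    intro z hz
    obtain ⟨δ, hδ, H⟩ := Metric.continuousOn_iff.1 hf z hz η hη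
    refine ⟨δ / 2, by positivity, fun w hw hwz => (H w hw ?_).le⟩
    rw [Real.dist_eq]; linarith
  obtain ⟨δ₁, hδ₁, H₁⟩ := cont x ⟨hx.le, by linarith⟩
  obtain ⟨δ₂, hδ₂, H₂⟩ := cont y ⟨by linarith, hy.le⟩
  obtain ⟨δ, hδ, hd1, hd2, hd3, hd4⟩ : ∃ δ > 0, δ ≤ δ₁ ∧ δ ≤ δ₂ ∧ y + δ < b ∧ K * δ ≤ η := by
    refine ⟨min (min δ₁ δ₂) (min ((b - y) / 2) (η / (K + 1))), ?_, ?_, ?_, ?_, ?_⟩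
    · have : 0 < b - y := by linarith
      positivity
    · exact (min_le_left _ _).trans (min_le_left _ _)
    · exact (min_le_left _ _).trans (min_le_right _ _)
    · have := (min_le_right (min δ₁ δ₂) (min ((b - y) / 2) (η / (K + 1)))).trans (min_le_left _ _)
      linarith
    · have := (min_le_right (min δ₁ δ₂) (min ((b - y) / 2) (η / (K + 1)))).trans (min_le_right _ _)
      refine (mul_le_mul_of_nonneg_left this hK0).trans ?_
      rw [mul_div_assoc', div_le_iff₀ (by linarith)]
      nlinarith
  set s : ℝ → ℝ := fun w => Real.smoothTransition (w / δ) with hs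
  have hsC : ContDiff ℝ ∞ s :=
    (Real.smoothTransition.contDiff (n := ⊤)).comp (contDiff_id.div_const δ)
  have hsD : Differentiable ℝ s := hsC.differentiable (by simp)
  have hs0 : ∀ w ≤ 0, s w = 0 := fun w hw =>
    Real.smoothTransition.zero_of_nonpos (div_nonpos_of_nonpos_of_nonneg hw hδ.le)
  have hs1 : ∀ w, δ ≤ w → s w = 1 := fun w hw =>
    Real.smoothTransition.one_of_one_le ((one_le_div hδ).2 hw)
  have hsm : Monotone s := fun u v huv =>
    Real.smoothTransition.monotone (div_le_div_of_nonneg_right huv hδ.le)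
  have hd0 : ∀ w, 0 ≤ deriv s w := fun w => hsm.deriv_nonneg
  have hdc : Continuous (deriv s) := hsC.continuous_deriv (by simp)
  have hdz : ∀ w, w ∉ Icc 0 δ → deriv s w = 0 := by
    intro w hw
    rw [mem_Icc, not_and_or, not_le, not_le] at hw
    rcases hw with hw | hw
    · have : s =ᶠ[nhds w] fun _ => 0 :=
        Filter.eventuallyEq_of_mem (Iio_mem_nhds hw) fun v hv => hs0 v (le_of_lt hv)
      rw [this.deriv_eq]; simp
    · have : s =ᶠ[nhds w] fun _ => 1 :=
        Filter.eventuallyEq_of_mem (Ioi_mem_nhds hw) fun v hv => hs1 v (le_of_lt hv)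
      rw [this.deriv_eq]; simp
  have hder : ∀ z w, HasDerivAt (fun z => s (z - w)) (deriv s (z - w)) z := fun z w => by
    have := (hsD (z - w)).hasDerivAt.comp z ((hasDerivAt_id z).sub_const w)
    simpa [Function.comp_def] using this
  have hint : ∀ w, a ≤ w → w + δ ≤ b → ∫ z in a..b, deriv s (z - w) = 1 := fun w h1 h2 => by
    rw [intervalIntegral.integral_eq_sub_of_hasDerivAt (f := fun z => s (z - w))
      (fun z _ => hder z w) ((hdc.comp (continuous_sub_right w)).intervalIntegrable _ _),
      hs1 _ (by linarith), hs0 _ (by linarith), sub_zero]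
  have happrox : ∀ w, a ≤ w → w + δ ≤ b → (∀ v ∈ Icc a b, |v - w| ≤ δ → |f v - f w| ≤ η) →
      |(∫ z in a..b, deriv s (z - w) * f z) - f w| ≤ η := by
    intro w h1 h2 h3
    have hcw : Continuous fun z => deriv s (z - w) := hdc.comp (continuous_sub_right w)
    have i1 : IntervalIntegrable (fun z => deriv s (z - w) * f z) volume a b :=
      ContinuousOn.intervalIntegrable (by
        rw [uIcc_of_le hab.le]; exact hcw.continuousOn.mul hf)
    have i2 : IntervalIntegrable (fun z => deriv s (z - w) * f w) volume a b :=
      (hcw.mul continuous_const).intervalIntegrable _ _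
    have e : (∫ z in a..b, deriv s (z - w) * f z) - f w
        = ∫ z in a..b, (deriv s (z - w) * f z - deriv s (z - w) * f w) := by
      rw [intervalIntegral.integral_sub i1 i2, intervalIntegral.integral_mul_const, hint w h1 h2,
        one_mul]
    rw [e, ← Real.norm_eq_abs]
    refine (intervalIntegral.norm_integral_le_of_norm_le hab.le (g := fun z => deriv s (z - w) * η)
      (Filter.Eventually.of_forall fun z hz => ?_)
      ((hcw.mul continuous_const).intervalIntegrable _ _)).trans ?_
    · rw [← mul_sub, norm_mul, Real.norm_of_nonneg (hd0 _)]
      by_cases hzw : z - w ∈ Icc 0 δ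
      · refine mul_le_mul_of_nonneg_left (h3 z (Ioc_subset_Icc_self hz) ?_) (hd0 _)
        rw [abs_of_nonneg hzw.1]; exact hzw.2
      · rw [hdz _ hzw]; simp
    · rw [intervalIntegral.integral_mul_const, hint w h1 h2, one_mul]
  set φ : ℝ → ℝ := fun z => s (z - x) - s (z - y) with hφ
  have hφC : ContDiff ℝ ∞ φ :=
    (hsC.comp (contDiff_id.sub contDiff_const)).sub (hsC.comp (contDiff_id.sub contDiff_const))
  have hφz : ∀ z ∉ Icc x (y + δ), φ z = 0 := by
    intro z hz
    rw [mem_Icc, not_and_or, not_le, not_le] at hz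
    rcases hz with hz | hz
    · simp only [hφ]; rw [hs0 _ (by linarith), hs0 _ (by linarith), sub_zero]
    · simp only [hφ]; rw [hs1 _ (by linarith), hs1 _ (by linarith), sub_self]
  have hφs : tsupport φ ⊆ Icc x (y + δ) :=
    closure_minimal (fun z hz => by by_contra hc; exact hz (hφz z hc)) isClosed_Icc
  have hsubs : Icc x (y + δ) ⊆ Ioo a b := fun z hz => ⟨by linarith [hz.1], by linarith [hz.2]⟩
  have hφc : HasCompactSupport φ := HasCompactSupport.of_support_subset_isCompact isCompact_Icc
    ((subset_tsupport φ).trans hφs)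
  have hφ1 : ∀ z, ‖φ z‖ ≤ 1 := fun z => by
    have h1 := Real.smoothTransition.nonneg ((z - x) / δ)
    have h2 := Real.smoothTransition.le_one ((z - x) / δ)
    have h3 := Real.smoothTransition.nonneg ((z - y) / δ)
    have h4 := Real.smoothTransition.le_one ((z - y) / δ)
    rw [Real.norm_eq_abs, abs_le]; simp only [hφ, hs]; constructor <;> linarith
  have hw := h.2.2 φ hφC hφc (hφs.trans hsubs)
  have hφd : ∀ z, deriv φ z = deriv s (z - x) - deriv s (z - y) := fun z =>
    ((hder z x).sub (hder z y)).deriv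
  have hl : ∫ z in Ioo a b, deriv φ z • f z
      = (∫ z in a..b, deriv s (z - x) * f z) - ∫ z in a..b, deriv s (z - y) * f z := by
    rw [integral_Ioo_eq hab.le, ← intervalIntegral.integral_sub]
    · simp only [hφd, smul_eq_mul, sub_mul]
    all_goals
      refine ContinuousOn.intervalIntegrable ?_
      rw [uIcc_of_le hab.le]
      exact (hdc.comp (continuous_sub_right _)).continuousOn.mul hf
  have hr : |∫ z in Ioo a b, φ z • g z| ≤ K * (y + δ - x) := by
    rw [setIntegral_eq_of_subset_of_forall_sdiff_eq_zero measurableSet_Ioo hsubs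
      (fun z hz => by rw [hφz z hz.2, zero_smul])]
    have := norm_setIntegral_le_of_norm_le_const_ae (μ := volume) (s := Icc x (y + δ))
      (f := fun z => φ z • g z) (C := K) (by simp) (by
        have := ae_restrict_of_ae_restrict_of_subset hsubs hK
        filter_upwards [this] with z hz'
        rw [norm_smul]
        calc _ ≤ 1 * K := mul_le_mul (hφ1 z) hz' (norm_nonneg _) zero_le_one
          _ = K := one_mul K)
    rw [Real.volume_real_Icc_of_le (by linarith)] at this
    exact this
  rw [hl] at hw
  have a1 := abs_le.1 (happrox x hx.le (by linarith) fun v hv hvx => H₁ v hv (hvx.trans hd1))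
  have a2 := abs_le.1 (happrox y (by linarith) (by linarith) fun v hv hvx => H₂ v hv (hvx.trans hd2))
  have a3 := abs_le.1 hr
  have e3 : 3 * η = η₀ := by rw [hηd]; ring
  rw [abs_le]
  constructor <;> nlinarith [a1.1, a1.2, a2.1, a2.2, a3.1, a3.2]

lemma lipschitz_Icc_of_Ioo (hab : a < b) (hf : ContinuousOn f (Icc a b))
    (h : ∀ x ∈ Ioo a b, ∀ y ∈ Ioo a b, |f x - f y| ≤ K * |x - y|) :
    ∀ x ∈ Icc a b, ∀ y ∈ Icc a b, |f x - f y| ≤ K * |x - y| := by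
  intro x hx y hy
  have hcl : closure (Ioo a b ×ˢ Ioo a b) = Icc a b ×ˢ Icc a b := by
    rw [closure_prod_eq, closure_Ioo hab.ne]
  have c1 : ContinuousOn (fun p : ℝ × ℝ => |f p.1 - f p.2|) (closure (Ioo a b ×ˢ Ioo a b)) := by
    rw [hcl]
    exact ((hf.comp continuousOn_fst fun p hp => hp.1).sub
      (hf.comp continuousOn_snd fun p hp => hp.2)).abs
  have c2 : ContinuousOn (fun p : ℝ × ℝ => K * |p.1 - p.2|) (closure (Ioo a b ×ˢ Ioo a b)) :=
    Continuous.continuousOn (by fun_prop)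
  exact le_on_closure (fun p hp => h p.1 hp.1 p.2 hp.2) c1 c2
    (show (x, y) ∈ closure (Ioo a b ×ˢ Ioo a b) by rw [hcl]; exact ⟨hx, hy⟩)

lemma HasWeakDeriv.bl (h : HasWeakDeriv a b f g) (hab : a < b) (hf : ContinuousOn f (Icc a b))
    (hK0 : ∀ᵐ x ∂(volume.restrict (Ioo a b)), ‖f x‖ ≤ K)
    (hK : ∀ᵐ x ∂(volume.restrict (Ioo a b)), ‖g x‖ ≤ K) : BL a b K f := by
  have hne : (volume.restrict (Ioo a b)) ≠ 0 := by
    rw [Ne, Measure.restrict_eq_zero, Real.volume_Ioo]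
    simpa using hab
  have : Filter.NeBot (ae (volume.restrict (Ioo a b))) := ae_neBot.2 hne
  obtain ⟨z, hz⟩ := hK.exists
  have hKn : 0 ≤ K := (norm_nonneg _).trans hz
  have hopen : EqOn (fun x => max ‖f x‖ K) (fun _ => K) (Ioo a b) := by
    refine Measure.eqOn_open_of_ae_eq (μ := volume) ?_ isOpen_Ioo
      ((hf.norm.mono Ioo_subset_Icc_self).sup continuousOn_const) continuousOn_const
    filter_upwards [hK0] with x hx
    exact max_eq_right hx
  have hcl : closure (Ioo a b) = Icc a b := closure_Ioo hab.ne
  refine ⟨fun x hx => ?_, lipschitz_Icc_of_Ioo hab hf fun x hx y hy => ?_⟩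
  · refine le_on_closure (s := Ioo a b) (f := fun x => ‖f x‖) (g := fun _ => K) (fun y hy => ?_)
      (by rw [hcl]; exact hf.norm) continuousOn_const (by rwa [hcl])
    have := hopen hy
    exact max_eq_right_iff.1 this
  · rcases lt_trichotomy x y with hxy | rfl | hxy
    · rw [abs_sub_comm x y, abs_of_pos (sub_pos.2 hxy)]
      exact h.abs_sub_le hf hK hKn hx.1 hxy hy.2
    · simp
    · rw [abs_sub_comm, abs_of_pos (sub_pos.2 hxy)]
      exact h.abs_sub_le hf hK hKn hy.1 hxy hx.2

lemma HasWeakDeriv.congr {f₁ : ℝ → ℝ} (h : HasWeakDeriv a b f g) (hf₁ : ContinuousOn f₁ (Icc a b))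
    (hff : ∀ᵐ x ∂(volume.restrict (Ioo a b)), f x = f₁ x) : HasWeakDeriv a b f₁ g := by
  refine ⟨(hf₁.mono Ioo_subset_Icc_self).locallyIntegrableOn measurableSet_Ioo, h.2.1,
    fun φ h1 h2 h3 => ?_⟩
  rw [← h.2.2 φ h1 h2 h3]
  refine integral_congr_ae ?_
  filter_upwards [hff] with x hx
  rw [hx]

/-- The classical derivatives of a `C^m` function with a `W^{m+1,∞}` bound. -/
lemma SobolevNormLE.bl {m n : ℕ} (h : SobolevNormLE a b n f K) (hmn : m + 1 ≤ n) (hab : a < b)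
    (hf : ContDiffOn ℝ m f (Icc a b)) {j : ℕ} (hj : j ≤ m) :
    BL a b K (fun x => iteratedDerivWithin j f (Icc a b) x) := by
  obtain ⟨g, h0, h1, h2⟩ := h
  have hc : ∀ i ≤ m, ContinuousOn (iteratedDerivWithin i f (Icc a b)) (Icc a b) := fun i hi =>
    hf.continuousOn_iteratedDerivWithin (by exact_mod_cast hi) (uniqueDiffOn_Icc hab)
  have hae : ∀ i ≤ m, ∀ᵐ x ∂(volume.restrict (Ioo a b)),
      g i x = iteratedDerivWithin i f (Icc a b) x := by
    intro i
    induction i with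
    | zero => intro _; rw [h0]; simp
    | succ i ih =>
      intro hi
      refine ((h1 i (by omega)).congr (hc i (by omega)) (ih (by omega))).ae_eq hab
        (h2 (i + 1) (by omega)) (fun x hx => ?_) (hc (i + 1) hi)
      rw [iteratedDerivWithin_succ]
      exact (hf.differentiableOn_iteratedDerivWithin (by exact_mod_cast hi)
        (uniqueDiffOn_Icc hab) x hx).hasDerivWithinAt
  refine ((h1 j (by omega)).congr (hc j hj) (hae j hj)).bl hab (hc j hj) ?_ (h2 (j + 1) (by omega))
  filter_upwards [hae j hj, h2 j (by omega)] with x hx1 hx2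
  rwa [← hx1]

lemma IsWaveSolution.waveData_left {G : ℝ → ℝ → ℝ} {ω₀ : ℝ → ℝ}
    (hG : IsWaveSolution a b ω₀ (fun _ => 0) G) (hab : a < b) (h : SobolevNormLE a b 3 ω₀ K) :
    WaveData a b K ω₀ (fun _ => 0) := by
  have hC : ContDiffOn ℝ 2 ω₀ (Icc a b) :=
    (hG.contDiffOn_space le_rfl).congr fun x hx => (hG.init x hx).symm
  have h1 := h.bl (m := 2) (by norm_num) hab hC (j := 1) (by norm_num)
  have h2 := h.bl (m := 2) (by norm_num) hab hC (j := 2) (by norm_num)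
  have hK := h1.nonneg hab
  refine ⟨fun x hx => ?_, h2, fun x hx => by simpa using hK, fun x hx => by simpa using hK,
    fun x hx y hy => by simpa using mul_nonneg hK (abs_nonneg _)⟩
  have := h1.1 x hx
  rwa [iteratedDerivWithin_one] at this

lemma IsWaveSolution.waveData_right {G : ℝ → ℝ → ℝ} {ω₁ : ℝ → ℝ}
    (hG : IsWaveSolution a b (fun _ => 0) ω₁ G) (hab : a < b) (h : SobolevNormLE a b 3 ω₁ K) :
    WaveData a b K (fun _ => 0) ω₁ := by
  have hC : ContDiffOn ℝ 1 ω₁ (Icc a b) := by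
    have := (hG.isSmoothOn 1).contDiffOn_pd hab one_pos (m := 0) (n := 1) (k := 1) (by norm_num)
    have h2 : ContDiffOn ℝ 1 (fun x => pd a b 1 G 0 1 x 0) (Icc a b) :=
      ContDiffOn.comp (g := fun p : ℝ × ℝ => pd a b 1 G 0 1 p.1 p.2) (f := fun y => (y, 0)) this
        (contDiffOn_id.prodMk contDiffOn_const) fun y hy => ⟨hy, by simp⟩
    exact h2.congr fun x hx => (hG.pd_zero_one_init one_pos hx).symm
  have h0 := h.bl (m := 1) (by norm_num) hab hC (j := 0) (by norm_num)
  have h1 := h.bl (m := 1) (by norm_num) hab hC (j := 1) (by norm_num)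
  have hK := h1.nonneg hab
  simp only [iteratedDerivWithin_zero] at h0
  simp only [iteratedDerivWithin_one] at h1
  refine ⟨fun x hx => by simpa using hK, ⟨fun x hx => by simpa using hK,
    fun x hx y hy => by simpa using mul_nonneg hK (abs_nonneg _)⟩, h0.1, h1⟩

end WeakDerivatives

section Nodes

variable {V : Type*} [NormedAddCommGroup V] [NormedSpace ℝ V] {a b B : ℝ} {M : ℕ}

lemma mesh_mul (hM : 1 ≤ M) : mesh a b M * M = b - a := by
  have : (M : ℝ) ≠ 0 := by positivity
  rw [mesh]; field_simp

lemma mesh_pos (hab : a < b) (hM : 1 ≤ M) : 0 < mesh a b M := by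
  have : 0 < b - a := by linarith
  rw [mesh]; positivity

lemma node_succ (j : ℕ) : node a b M (j + 1) = node a b M j + mesh a b M := by
  simp only [node]; push_cast; ring

lemma node_zero : node a b M 0 = a := by simp [node]

lemma node_last (hM : 1 ≤ M) : node a b M M = b := by
  rw [node, mul_comm, mesh_mul hM]; ring

lemma node_mem (hab : a < b) (hM : 1 ≤ M) {j : ℕ} (hj : j ≤ M) : node a b M j ∈ Icc a b := by
  have h1 := mesh_pos hab hM
  have h2 : (j : ℝ) * mesh a b M ≤ M * mesh a b M := by gcongr
  rw [mul_comm (M : ℝ), mesh_mul hM] at h2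
  have h3 : 0 ≤ (j : ℝ) * mesh a b M := by positivity
  exact ⟨by simp only [node]; linarith, by simp only [node]; linarith⟩

lemma BL.dxp_node (hab : a < b) (hM : 1 ≤ M) {f : ℝ → V} (hf : BL a b B f) {j : ℕ} (hj : j < M) :
    ‖dxp (mesh a b M) (fun i => f (node a b M i)) j‖ ≤ B := by
  have h1 := mesh_pos hab hM
  have h2 := hf.2 _ (node_mem hab hM (j := j + 1) hj) _ (node_mem hab hM hj.le)
  rw [node_succ, add_sub_cancel_left, abs_of_pos h1, ← node_succ] at h2
  rw [dxp, norm_smul, Real.norm_of_nonneg (by positivity), inv_mul_le_iff₀ h1, mul_comm]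
  exact h2

lemma node_pred {j : ℕ} (hj : 1 ≤ j) : node a b M (j - 1) = node a b M j - mesh a b M := by
  obtain ⟨i, rfl⟩ := Nat.exists_eq_add_of_le' hj
  rw [Nat.add_sub_cancel, node_succ]; ring

/-- Consistency of the second difference quotient. -/
lemma norm_dx2_sub_le (hab : a < b) (hM : 1 ≤ M) {f : ℕ → ℝ → V}
    (hf : ∀ i < 4, ∀ x ∈ Icc a b, HasDerivWithinAt (f i) (f (i + 1) x) (Icc a b) x)
    (hB : ∀ x ∈ Icc a b, ‖f 4 x‖ ≤ B) {j : ℕ} (hj : j ∈ Finset.Ico 1 M) :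
    ‖dx2 (mesh a b M) (fun i => f 0 (node a b M i)) j - f 2 (node a b M j)‖
      ≤ 2 * B * mesh a b M ^ 2 := by
  have h1 := mesh_pos hab hM
  obtain ⟨hj1, hj2⟩ := Finset.mem_Ico.1 hj
  have e1 := node_mem hab hM (j := j + 1) hj2
  have e2 := node_mem hab hM (j := j - 1) (by omega)
  rw [node_succ] at e1
  rw [node_pred hj1] at e2
  have := norm_second_difference_sub_le h1.le e2.1 e1.2 (hf 0 (by norm_num)) (hf 1 (by norm_num))
    (hf 2 (by norm_num)) (hf 3 (by norm_num)) hB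
  set h := mesh a b M
  have e : dx2 h (fun i => f 0 (node a b M i)) j - f 2 (node a b M j)
      = (h ^ 2)⁻¹ • (f 0 (node a b M j + h) - (2 : ℝ) • f 0 (node a b M j)
        + f 0 (node a b M j - h) - h ^ 2 • f 2 (node a b M j)) := by
    rw [dx2, node_succ, node_pred hj1, smul_sub, smul_smul, inv_mul_cancel₀ (by positivity), one_smul]
  rw [e, norm_smul, Real.norm_of_nonneg (by positivity), inv_mul_le_iff₀ (by positivity)]
  refine this.trans_eq ?_
  ring

lemma norm_dxp_dx2_sub_le (hab : a < b) (hM : 1 ≤ M) {f : ℕ → ℝ → V}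
    (hf : ∀ i < 4, ∀ x ∈ Icc a b, HasDerivWithinAt (f i) (f (i + 1) x) (Icc a b) x)
    (hB : BL a b B (f 4)) {j : ℕ} (hj : j ∈ Finset.Ico 1 (M - 1)) :
    ‖dxp (mesh a b M) (fun i => dx2 (mesh a b M) (fun i => f 0 (node a b M i)) i
      - f 2 (node a b M i)) j‖ ≤ 2 * B * mesh a b M ^ 2 := by
  have h1 := mesh_pos hab hM
  obtain ⟨hj1, hj2⟩ := Finset.mem_Ico.1 hj
  have e1 := node_mem hab hM (j := j + 1 + 1) (by omega)
  have e2 := node_mem hab hM (j := j - 1) (by omega)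
  rw [node_succ, node_succ] at e1
  rw [node_pred hj1] at e2
  set h := mesh a b M with hh
  set x := node a b M j with hx
  have hm : MapsTo (fun y => y + h) (Icc (x - h) (x + h)) (Icc a b) := fun y hy =>
    ⟨by linarith [hy.1, e2.1], by linarith [hy.2, e1.2]⟩
  have hs : Icc (x - h) (x + h) ⊆ Icc a b := Icc_subset_Icc e2.1 (by linarith [e1.2])
  have hd : ∀ i < 4, ∀ y ∈ Icc (x - h) (x + h), HasDerivWithinAt (fun y => f i (y + h) - f i y)
      (f (i + 1) (y + h) - f (i + 1) y) (Icc (x - h) (x + h)) y := fun i hi y hy => by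
    have h1 := (hf i hi (y + h) (hm hy)).scomp y
      ((hasDerivWithinAt_id y (Icc (x - h) (x + h))).add_const h) hm
    rw [one_smul] at h1
    exact h1.sub ((hf i hi y (hs hy)).mono hs)
  have := norm_second_difference_sub_le h1.le (t := x) le_rfl le_rfl (hd 0 (by norm_num))
    (hd 1 (by norm_num)) (hd 2 (by norm_num)) (hd 3 (by norm_num)) (B := B * h) (fun y hy => by
      have := hB.2 (y + h) (hm hy) y (hs hy)
      rwa [add_sub_cancel_left, abs_of_pos h1] at this)
  have e : dxp h (fun i => dx2 h (fun i => f 0 (node a b M i)) i - f 2 (node a b M i)) j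
      = (h ^ 3)⁻¹ • (f 0 (x + h + h) - f 0 (x + h) - (2 : ℝ) • (f 0 (x + h) - f 0 x)
        + (f 0 (x - h + h) - f 0 (x - h)) - h ^ 2 • (f 2 (x + h) - f 2 x)) := by
    have hc : (h ^ 3)⁻¹ * h ^ 2 = h⁻¹ := by field_simp
    have hc' : h⁻¹ * (h ^ 2)⁻¹ = (h ^ 3)⁻¹ := by field_simp
    rw [smul_sub, smul_smul, hc]
    simp only [dxp, dx2, node_succ, node_pred hj1, Nat.add_sub_cancel, ← hx, ← hh, sub_add_cancel]
    rw [← hc']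
    module
  rw [e, norm_smul, Real.norm_of_nonneg (by positivity), inv_mul_le_iff₀ (by positivity)]
  refine this.trans_eq ?_
  ring

end Nodes

section Residual

variable {a b T τ B θ : ℝ} {g Y : ℝ → ℝ → ℝ} {X : ℝ → ℝ → ℂ}

/-- `X` is a smooth solution of the Schrödinger equation with potential `|X|² - Y - g` on the closed
rectangle. -/
structure IsSchrodinger (a b T : ℝ) (g Y : ℝ → ℝ → ℝ) (X : ℝ → ℝ → ℂ) : Prop where
  smooth : IsSmoothOn a b T 6 X
  smoothY : IsSmoothOn a b T 6 Y
  eqn : ∀ x ∈ Icc a b, ∀ t ∈ Icc 0 T, Complex.I * pd a b T X 0 1 x t + pd a b T X 2 0 x t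
    + ((‖X x t‖ ^ 2 - Y x t - g x t : ℝ) : ℂ) * X x t = 0
  bdry : ∀ t ∈ Icc 0 T, X a t = 0 ∧ X b t = 0
  bdryY : ∀ t ∈ Icc 0 T, Y a t = 0 ∧ Y b t = 0

lemma IsSmoothOn.hasDerivWithinAt_t {V : Type*} [NormedAddCommGroup V] [NormedSpace ℝ V] {r : ℕ}
    {u : ℝ → ℝ → V} (hu : IsSmoothOn a b T r u) (hab : a < b) (hT : 0 < T) (hr : 1 ≤ r) {x t : ℝ}
    (hx : x ∈ Icc a b) (ht : t ∈ Icc 0 T) :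
    HasDerivWithinAt (u x) (pd a b T u 0 1 x t) (Icc 0 T) t := by
  have := hu.hasDerivWithinAt_pd_t hab hT (m := 0) (n := 0) (by omega) hx ht
  simpa only [pd_zero_zero] using this

/-- The residual in time of the discrete Schrödinger equation at time `t`. -/
noncomputable def residual (a b T τ t : ℝ) (g Y : ℝ → ℝ → ℝ) (X : ℝ → ℝ → ℂ) (x : ℝ) : ℂ :=
  Complex.I * ((2 * τ)⁻¹ • (X x (t + τ) - X x (t - τ))) + tavg τ t (fun s => pd a b T X 2 0 x s)
    + ((‖X x t‖ ^ 2 - tmean τ t (g x) - tavg τ t (Y x) : ℝ) : ℂ) * tavg τ t (X x)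

lemma IsSchrodinger.pd_two_bdry (hX : IsSchrodinger a b T g Y X) (hab : a < b) {t : ℝ}
    (ht : t ∈ Icc 0 T) : pd a b T X 2 0 a t = 0 ∧ pd a b T X 2 0 b t = 0 := by
  have h1 := hX.eqn a (left_mem_Icc.2 hab.le) t ht
  have h2 := hX.eqn b (right_mem_Icc.2 hab.le) t ht
  rw [pd_bdry_eq_zero (fun s hs => (hX.bdry s hs).1) 1 ht, (hX.bdry t ht).1] at h1
  rw [pd_bdry_eq_zero (fun s hs => (hX.bdry s hs).2) 1 ht, (hX.bdry t ht).2] at h2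
  exact ⟨by simpa using h1, by simpa using h2⟩

lemma IsSchrodinger.residual_bdry (hX : IsSchrodinger a b T g Y X) (hab : a < b) {t : ℝ}
    (hτ : 0 < τ) (h0 : 0 ≤ t - τ) (h1 : t + τ ≤ T) :
    residual a b T τ t g Y X a = 0 ∧ residual a b T τ t g Y X b = 0 := by
  have hp : t + τ ∈ Icc 0 T := ⟨by linarith, h1⟩
  have hm : t - τ ∈ Icc 0 T := ⟨h0, by linarith⟩
  constructor
  · simp [residual, tavg, (hX.bdry _ hp).1, (hX.bdry _ hm).1, (hX.pd_two_bdry hab hp).1,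
      (hX.pd_two_bdry hab hm).1]
  · simp [residual, tavg, (hX.bdry _ hp).2, (hX.bdry _ hm).2, (hX.pd_two_bdry hab hp).2,
      (hX.pd_two_bdry hab hm).2]

variable {V : Type*} [NormedAddCommGroup V] [NormedSpace ℝ V]

lemma Osc.deviation [CompleteSpace V] {n : ℕ} {f f' : ℝ → ℝ → V} (hf : Osc a b T τ B θ n f')
    (hd : ∀ x ∈ Icc a b, ∀ s ∈ Icc 0 T, HasDerivWithinAt (f x) (f' x s) (Icc 0 T) s) (hτ : 0 < τ)
    {t : ℝ} (h0 : 0 ≤ t - τ) (h1 : t + τ ≤ T) :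
    BL a b (τ * (B ^ n * θ)) (fun x => tavg τ t (f x) - f x t) ∧
      BL a b (τ * (B ^ n * θ)) (fun x => tmean τ t (f x) - f x t) := by
  have hsub : Icc (t - τ) (t + τ) ⊆ Icc 0 T := Icc_subset_Icc h0 h1
  refine BL.mean_deviation hτ (fun x hx s hs => (hd x hx s (hsub hs)).mono hsub) (fun s hs =>
    hf.osc s (hsub hs) t ⟨by linarith, by linarith⟩ ?_)
  rw [abs_le]; constructor <;> linarith [hs.1, hs.2]

lemma BL.time_lipschitz {A : ℝ} {f f' : ℝ → ℝ → V} (hf : ∀ s ∈ Icc 0 T, BL a b A (fun x => f' x s))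
    (hd : ∀ x ∈ Icc a b, ∀ s ∈ Icc 0 T, HasDerivWithinAt (f x) (f' x s) (Icc 0 T) s)
    {s t : ℝ} (hs : s ∈ Icc 0 T) (ht : t ∈ Icc 0 T) :
    BL a b (A * |s - t|) (fun x => f x s - f x t) := by
  refine ⟨fun x hx => ?_, fun x hx y hy => ?_⟩
  · exact (convex_Icc 0 T).norm_image_sub_le_of_norm_hasDerivWithin_le (hd x hx)
      (fun r hr => (hf r hr).1 x hx) ht hs
  · have := (convex_Icc 0 T).norm_image_sub_le_of_norm_hasDerivWithin_le
      (fun r hr => (hd x hx r hr).sub (hd y hy r hr)) (fun r hr => (hf r hr).2 x hx y hy) ht hs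
    simp only [Pi.sub_apply] at this
    rw [sub_sub_sub_comm]
    refine this.trans_eq ?_
    rw [Real.norm_eq_abs]; ring

/-- The time residual is small if the time derivatives oscillate little. -/
lemma IsSchrodinger.residual_bl (hX : IsSchrodinger a b T g Y X) (hab : a < b) (hT : 0 < T)
    (hτ : 0 < τ) (o0 : Osc a b T τ B θ 1 X) (o1 : Osc a b T τ B θ 1 (pd a b T X 0 1))
    (o2 : Osc a b T τ B θ 1 (pd a b T X 2 1)) (oY : Osc a b T τ B θ 1 Y)
    (oY1 : Osc a b T τ B θ 1 (pd a b T Y 0 1)) (og : Osc a b T τ B θ 1 g) {t : ℝ}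
    (h0 : 0 ≤ t - τ) (h1 : t + τ ≤ T) :
    BL a b (B ^ 8 * (τ * θ)) (residual a b T τ t g Y X) := by
  have hB := o0.four_le
  have hθ := o0.nonneg
  have ht : t ∈ Icc 0 T := ⟨by linarith, by linarith⟩
  have hsub : Icc (t - τ) (t + τ) ⊆ Icc 0 T := Icc_subset_Icc h0 h1
  have dX : ∀ x ∈ Icc a b, ∀ s ∈ Icc 0 T, HasDerivWithinAt (X x) (pd a b T X 0 1 x s) (Icc 0 T) s :=
    fun x hx s hs => hX.smooth.hasDerivWithinAt_t hab hT (by norm_num) hx hs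
  have dY : ∀ x ∈ Icc a b, ∀ s ∈ Icc 0 T, HasDerivWithinAt (fun s => (Y x s : ℂ))
      ((pd a b T Y 0 1 x s : ℝ) : ℂ) (Icc 0 T) s := fun x hx s hs =>
    (hX.smoothY.hasDerivWithinAt_t hab hT (by norm_num) hx hs).ofReal_comp
  have dc : ∀ x ∈ Icc a b, ∀ s ∈ Icc 0 T, HasDerivWithinAt (fun s => starRingEnd ℂ (X x s))
      (starRingEnd ℂ (pd a b T X 0 1 x s)) (Icc 0 T) s := fun x hx s hs => (dX x hx s hs).star
  set N : ℝ → ℝ → ℂ := fun x s => X x s * X x s * starRingEnd ℂ (X x s) with hN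
  set Z : ℝ → ℝ → ℂ := fun x s => (Y x s : ℂ) * X x s with hZ
  have dN : ∀ x ∈ Icc a b, ∀ s ∈ Icc 0 T, HasDerivWithinAt (N x)
      ((pd a b T X 0 1 x s * X x s + X x s * pd a b T X 0 1 x s) * starRingEnd ℂ (X x s)
        + X x s * X x s * starRingEnd ℂ (pd a b T X 0 1 x s)) (Icc 0 T) s := fun x hx s hs =>
    ((dX x hx s hs).mul (dX x hx s hs)).mul (dc x hx s hs)
  have dZ : ∀ x ∈ Icc a b, ∀ s ∈ Icc 0 T, HasDerivWithinAt (Z x)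
      (((pd a b T Y 0 1 x s : ℝ) : ℂ) * X x s + (Y x s : ℂ) * pd a b T X 0 1 x s) (Icc 0 T) s :=
    fun x hx s hs => (dY x hx s hs).mul (dX x hx s hs)
  have oN : Osc a b T τ B θ 7 _ := (((o1.mul o0).add (o0.mul o1)).mul o0.conj).add
    (((o0.mul o0).mul o1.conj).mono (by norm_num))
  have oZ : Osc a b T τ B θ 4 _ := (oY1.ofReal.mul o0).add (oY.ofReal.mul o1)
  obtain ⟨v1, v2⟩ := o1.deviation dX hτ h0 h1
  obtain ⟨w1, w2⟩ := o2.deviation (f := pd a b T X 2 0) (fun x hx s hs =>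
    hX.smooth.hasDerivWithinAt_pd_t hab hT (by norm_num) hx hs) hτ h0 h1
  have vN := (oN.deviation dN hτ h0 h1).2
  have vZ := (oZ.deviation dZ hτ h0 h1).2
  have vY := (oY1.ofReal.deviation dY hτ h0 h1).1
  have bX := o0.bd t ht
  have bg := (og.bd t ht).ofReal
  have bY := (oY.bd t ht).ofReal
  have btX : BL a b (B ^ 1) (fun x => tavg τ t (X x)) := BL.tavg hτ fun s hs => o0.bd s (hsub hs)
  have btg : BL a b (B ^ 1) (fun x => tmean τ t (fun s => (g x s : ℂ))) :=
    BL.tmean hτ (fun x hx => (og.ofReal.cont x hx).mono hsub)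
      fun s hs => (og.bd s (hsub hs)).ofReal
  have cX : ∀ x ∈ Icc a b, ContinuousOn (X x) (Icc (t - τ) (t + τ)) := fun x hx =>
    (o0.cont x hx).mono hsub
  have cg : ∀ x ∈ Icc a b, ContinuousOn (fun s => (g x s : ℂ)) (Icc (t - τ) (t + τ)) := fun x hx =>
    (og.ofReal.cont x hx).mono hsub
  have cY : ∀ x ∈ Icc a b, ContinuousOn (fun s => (Y x s : ℂ)) (Icc (t - τ) (t + τ)) := fun x hx =>
    (oY.ofReal.cont x hx).mono hsub
  have bgX : BL a b (2 * ((B ^ 1 * θ) * (B ^ 1 * τ)))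
      (fun x => tmean τ t (fun s => ((g x s : ℂ) - g x t) * (X x s - X x t))) := by
    refine BL.tmean hτ (fun x hx => ((cg x hx).sub continuousOn_const).mul
      ((cX x hx).sub continuousOn_const)) fun s hs => ?_
    have hst : |s - t| ≤ τ := by rw [abs_le]; constructor <;> linarith [hs.1, hs.2]
    refine (og.ofReal.osc s (hsub hs) t ht (by linarith)).mul ?_
    exact (BL.time_lipschitz (fun r hr => o1.bd r hr) dX (hsub hs) ht).mono (by gcongr)
  have total := (((((((((w1.sub w2).sub vN).add ((bX.mul bX.conj).mul v1)).add vZ).sub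
    (vY.mul btX)).sub (bY.mul v1)).add bgX).add (bg.mul v2)).sub (btg.mul v1))
  refine (total.mono ?_).congr fun x hx => ?_
  · have hτθ : 0 ≤ τ * θ := by positivity
    have key : 2 * B + B ^ 7 + 4 * B ^ 3 + B ^ 4 + 10 * B ^ 2 ≤ B ^ 8 := by
      have p : ∀ k ≤ 7, B ^ k * 4 ^ (7 - k) ≤ B ^ 7 := fun k hk => by
        calc _ ≤ B ^ k * B ^ (7 - k) := by gcongr
          _ = B ^ 7 := by rw [← pow_add]; congr 1; omega
      have p1 := p 1 (by norm_num)
      have p2 := p 2 (by norm_num)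
      have p3 := p 3 (by norm_num)
      have p4 := p 4 (by norm_num)
      norm_num at p1 p2 p3 p4
      have p8 : 4 * B ^ 7 ≤ B ^ 8 := by
        rw [pow_succ B 7, mul_comm]; gcongr
      have : 0 ≤ B ^ 2 := by positivity
      have : 0 ≤ B ^ 3 := by positivity
      have : 0 ≤ B ^ 4 := by positivity
      linarith
    calc _ = (2 * B + B ^ 7 + 4 * B ^ 3 + B ^ 4 + 10 * B ^ 2) * (τ * θ) := by ring
      _ ≤ _ := mul_le_mul_of_nonneg_right key hτθ
  · have e0 : Complex.I * ((2 * τ)⁻¹ • (X x (t + τ) - X x (t - τ)))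
        = tmean τ t (fun s => Complex.I * pd a b T X 0 1 x s) := by
      rw [tmean_const_mul, tmean_deriv hτ (fun s hs => (dX x hx s (hsub hs)).mono hsub)
        ((o1.cont x hx).mono hsub)]
    have c2 : ContinuousOn (fun s => pd a b T X 2 0 x s) (Icc (t - τ) (t + τ)) :=
      (hX.smooth.continuousOn_pd_t hab hT (by norm_num) hx).mono hsub
    have cN : ContinuousOn (N x) (Icc (t - τ) (t + τ)) := fun s hs =>
      ((dN x hx s (hsub hs)).continuousWithinAt).mono hsub
    have cZ : ContinuousOn (Z x) (Icc (t - τ) (t + τ)) := (cY x hx).mul (cX x hx)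
    have cgX : ContinuousOn (fun s => (g x s : ℂ) * X x s) (Icc (t - τ) (t + τ)) :=
      (cg x hx).mul (cX x hx)
    have e1 : tmean τ t (fun s => Complex.I * pd a b T X 0 1 x s)
        = tmean τ t (fun s => Z x s + (g x s : ℂ) * X x s)
          - tmean τ t (fun s => pd a b T X 2 0 x s + N x s) := by
      have q1 : ContinuousOn (fun s => Z x s + (g x s : ℂ) * X x s) (Icc (t - τ) (t + τ)) :=
        cZ.add cgX
      have q2 : ContinuousOn (fun s => pd a b T X 2 0 x s + N x s) (Icc (t - τ) (t + τ)) :=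
        c2.add cN
      rw [← tmean_sub hτ q1 q2]
      refine tmean_congr hτ fun s hs => ?_
      have := hX.eqn x hx s (hsub hs)
      have hn := Complex.mul_conj' (X x s)
      push_cast at this
      simp only [hZ, hN]
      linear_combination this + X x s * hn
    have e2 : tmean τ t (fun s => ((g x s : ℂ) - g x t) * (X x s - X x t))
        = tmean τ t (fun s => (g x s : ℂ) * X x s) - tmean τ t (fun s => (g x s : ℂ)) * X x t
          - ((g x t : ℂ) * tmean τ t (X x) - (g x t : ℂ) * X x t) := by
      have q1 : tmean τ t (fun s => ((g x s : ℂ) - g x t) * (X x s - X x t))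
          = tmean τ t (fun s => ((g x s : ℂ) * X x s - (g x s : ℂ) * X x t)
            - ((g x t : ℂ) * X x s - (g x t : ℂ) * X x t)) :=
        tmean_congr hτ fun s _ => by ring
      have q2 : ContinuousOn (fun s => (g x s : ℂ) * X x t) (Icc (t - τ) (t + τ)) :=
        (cg x hx).mul continuousOn_const
      have q3 : ContinuousOn (fun s => (g x t : ℂ) * X x s) (Icc (t - τ) (t + τ)) :=
        continuousOn_const.mul (cX x hx)
      have q4 : ContinuousOn (fun s => (g x s : ℂ) * X x s - (g x s : ℂ) * X x t)
        (Icc (t - τ) (t + τ)) := cgX.sub q2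
      have q5 : ContinuousOn (fun s => (g x t : ℂ) * X x s - (g x t : ℂ) * X x t)
        (Icc (t - τ) (t + τ)) := q3.sub continuousOn_const
      rw [q1, tmean_sub hτ q4 q5, tmean_sub hτ cgX q2, tmean_sub hτ q3 continuousOn_const,
        tmean_mul_const,
        tmean_const_mul, tmean_const hτ]
    have e3 : ((tavg τ t (Y x) : ℝ) : ℂ) = tavg τ t (fun s => (Y x s : ℂ)) := by
      simp only [tavg, Complex.real_smul, smul_eq_mul]; push_cast; ring
    have hn := Complex.mul_conj' (X x t)
    rw [residual, e0, e1, tmean_add hτ cZ cgX, tmean_add hτ c2 cN, e2]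
    push_cast
    rw [← tmean_ofReal, e3]
    simp only [hN, hZ]
    linear_combination (- tavg τ t (X x)) * hn

end Residual

section Potential

variable {a b T α β ε K B κ : ℝ} {ω₀ ω₁ : ℝ → ℝ} {G₁ G₂ : ℝ → ℝ → ℝ}

/-- The `x`-derivatives of the oscillatory potential `G(x, t/ε)`. -/
noncomputable def potential (a b T α β ε : ℝ) (G₁ G₂ : ℝ → ℝ → ℝ) (m : ℕ) (x t : ℝ) : ℝ :=
  ε ^ α * pd a b (T / ε) G₁ m 0 x (t / ε) + ε ^ (1 + β) * pd a b (T / ε) G₂ m 0 x (t / ε)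

/-- Bounds for a potential with amplitude `κ` and time scale `ε`. -/
structure PotentialBounds (a b T B κ ε : ℝ) (γ : ℕ → ℝ → ℝ → ℝ) : Prop where
  deriv : ∀ m < 2, ∀ x ∈ Icc a b, ∀ t ∈ Icc 0 T,
    HasDerivWithinAt (fun y => γ m y t) (γ (m + 1) x t) (Icc a b) x
  bd : ∀ m ≤ 2, ∀ t ∈ Icc 0 T, BL a b (B * κ) (fun x => γ m x t)
  osc : ∀ s ∈ Icc 0 T, ∀ t ∈ Icc 0 T, BL a b (B * (|s - t| / ε)) (fun x => γ 0 x s - γ 0 x t)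
  cont : ∀ m ≤ 2, ContinuousOn (fun p : ℝ × ℝ => γ m p.1 p.2) (rect a b T)

lemma PotentialBounds.cont_t {γ : ℕ → ℝ → ℝ → ℝ} (h : PotentialBounds a b T B κ ε γ) {m : ℕ}
    (hm : m ≤ 2) {x : ℝ} (hx : x ∈ Icc a b) : ContinuousOn (γ m x) (Icc 0 T) :=
  ContinuousOn.comp (g := fun p : ℝ × ℝ => γ m p.1 p.2) (f := fun s => (x, s)) (h.cont m hm)
    (Continuous.continuousOn (by fun_prop)) fun _ hs => ⟨hx, hs⟩

lemma potential_zero (x t : ℝ) :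
    potential a b T α β ε G₁ G₂ 0 x t = oscG α β ε G₁ G₂ x (t / ε) := by
  simp only [potential, pd_zero_zero, oscG]

lemma rpow_amplitude (hε : 0 < ε) (hε1 : ε ≤ 1) (hα : 0 ≤ α) (hβ : 0 ≤ β) :
    ε ^ α ≤ ε ^ min α 1 ∧ ε ^ (1 + β) ≤ ε ∧ ε ≤ ε ^ min α 1 ∧ ε ^ min α 1 ≤ 1 := by
  refine ⟨Real.rpow_le_rpow_of_exponent_ge hε hε1 (min_le_left _ _), ?_, ?_,
    Real.rpow_le_one hε.le hε1 (le_min hα zero_le_one)⟩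
  · simpa using Real.rpow_le_rpow_of_exponent_ge hε hε1 (by linarith : (1 : ℝ) ≤ 1 + β)
  · simpa using Real.rpow_le_rpow_of_exponent_ge hε hε1 (min_le_right α 1)

lemma potentialBounds (hab : a < b) (hT : 0 < T) (hα : 0 ≤ α) (hβ : 0 ≤ β) (hε : 0 < ε)
    (hε1 : ε ≤ 1) (h₁ : IsWaveSolution a b ω₀ (fun _ => 0) G₁)
    (h₂ : IsWaveSolution a b (fun _ => 0) ω₁ G₂) (hω₀ : SobolevNormLE a b 3 ω₀ K)
    (hω₁ : SobolevNormLE a b 3 ω₁ K) :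
    PotentialBounds a b T (4 * K * (1 + (b - a))) (ε ^ min α 1) ε
      (potential a b T α β ε G₁ G₂) := by
  have hS : 0 < T / ε := by positivity
  have d₁ := h₁.waveData_left hab hω₀
  have d₂ := h₂.waveData_right hab hω₁
  obtain ⟨b₁, o₁⟩ := h₁.bounds d₁ hab hS
  obtain ⟨b₂, o₂⟩ := h₂.bounds d₂ hab hS
  obtain ⟨r1, r2, r3, r4⟩ := rpow_amplitude hε hε1 hα hβ
  have hK : 0 ≤ K := (d₂.bl₁).nonneg hab
  have hL : 0 < b - a := by linarith
  have hm : ∀ t ∈ Icc 0 T, t / ε ∈ Icc 0 (T / ε) := fun t ht =>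
    ⟨div_nonneg ht.1 hε.le, by gcongr; exact ht.2⟩
  have p1 : 0 < ε ^ α := by positivity
  have p2 : 0 < ε ^ (1 + β) := by positivity
  have hκ : 0 ≤ ε ^ min α 1 := by positivity
  refine ⟨fun m hm2 x hx t ht => ?_, fun m hm2 t ht => ?_, fun s hs t ht => ?_, fun m hm2 => ?_⟩
  · exact (((h₁.isSmoothOn _).hasDerivWithinAt_pd_x hab hS (by omega) hx (hm t ht)).const_mul _).add
      (((h₂.isSmoothOn _).hasDerivWithinAt_pd_x hab hS (by omega) hx (hm t ht)).const_mul _)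
  · have key : ∀ {f₁ f₂ : ℝ → ℝ} {A : ℝ}, BL a b A f₁ → BL a b A f₂ → A ≤ 2 * K * (1 + (b - a)) →
        BL a b (4 * K * (1 + (b - a)) * ε ^ min α 1)
          (fun x => ε ^ α * f₁ x + ε ^ (1 + β) * f₂ x) := by
      intro f₁ f₂ A h1 h2 hA
      refine ((h1.const_smul (ε ^ α)).add (h2.const_smul (ε ^ (1 + β)))).mono ?_
      rw [abs_of_pos p1, abs_of_pos p2, ← add_mul]
      calc _ ≤ (2 * ε ^ min α 1) * (2 * K * (1 + (b - a))) := by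
            gcongr
            · exact h1.nonneg hab
            · linarith
        _ = _ := by ring
    have hA : 2 * K ≤ 2 * K * (1 + (b - a)) := by nlinarith
    obtain ⟨u0, u1, u2⟩ := b₁ _ (hm t ht)
    obtain ⟨v0, v1, v2⟩ := b₂ _ (hm t ht)
    interval_cases m
    · simp only [potential, pd_zero_zero]
      exact key u0 v0 le_rfl
    · exact key u1 v1 hA
    · exact key u2 v2 hA
  · have h1 := o₁ _ (hm s hs) _ (hm t ht)
    have h2 := o₂ _ (hm s hs) _ (hm t ht)
    refine (((h1.const_smul (ε ^ α)).add (h2.const_smul (ε ^ (1 + β)))).mono ?_).congr fun x _ => ?_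
    · rw [abs_of_pos p1, abs_of_pos p2, ← add_mul, ← sub_div, abs_div, abs_of_pos hε]
      calc _ ≤ (1 + 1) * (2 * K * (|s - t| / ε)) := by gcongr <;> linarith
        _ = 4 * K * 1 * (|s - t| / ε) := by ring
        _ ≤ _ := by gcongr; linarith
    · simp only [potential, pd_zero_zero, smul_eq_mul]; ring
  · have hc : ∀ {G : ℝ → ℝ → ℝ}, IsSmoothOn a b (T / ε) 2 G →
        ContinuousOn (fun p : ℝ × ℝ => pd a b (T / ε) G m 0 p.1 (p.2 / ε)) (rect a b T) :=
      fun hG => ContinuousOn.comp (g := fun p : ℝ × ℝ => pd a b (T / ε) _ m 0 p.1 p.2)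
        (f := fun p : ℝ × ℝ => (p.1, p.2 / ε)) (hG.continuousOn_pd hab hS (by omega))
        (Continuous.continuousOn (by fun_prop)) fun p hp => ⟨hp.1, hm _ hp.2⟩
    exact (continuousOn_const.mul (hc (h₁.isSmoothOn _))).add
      (continuousOn_const.mul (hc (h₂.isSmoothOn _)))

lemma potential_init (h₁ : IsWaveSolution a b ω₀ (fun _ => 0) G₁)
    (h₂ : IsWaveSolution a b (fun _ => 0) ω₁ G₂) {x : ℝ} (hx : x ∈ Icc a b) :
    potential a b T α β ε G₁ G₂ 0 x 0 = ε ^ α * ω₀ x := by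
  simp [potential_zero, oscG, h₁.init x hx, h₂.init x hx]

lemma potential_init_deriv (hab : a < b) (hT : 0 < T) (hε : 0 < ε)
    (h₁ : IsWaveSolution a b ω₀ (fun _ => 0) G₁)
    (h₂ : IsWaveSolution a b (fun _ => 0) ω₁ G₂) {x : ℝ} (hx : x ∈ Icc a b) :
    HasDerivWithinAt (potential a b T α β ε G₁ G₂ 0 x) (ε ^ β * ω₁ x) (Icc 0 T) 0 := by
  have hS : 0 < T / ε := by positivity
  have key : ∀ {g₀ g₁ : ℝ → ℝ} {G : ℝ → ℝ → ℝ}, IsWaveSolution a b g₀ g₁ G →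
      HasDerivWithinAt (fun t => pd a b (T / ε) G 0 0 x (t / ε)) (ε⁻¹ * g₁ x) (Icc 0 T) 0 := by
    intro g₀ g₁ G hG
    have h := (hG.isSmoothOn (T / ε)).hasDerivWithinAt_pd_t hab hS (m := 0) (n := 0) (by norm_num)
      hx (left_mem_Icc.2 hS.le)
    rw [zero_add, hG.pd_zero_one_init hS hx] at h
    have h2 := HasDerivWithinAt.scomp_of_eq (t' := Icc 0 (T / ε)) (s := Icc 0 T)
      (h := fun t => t / ε) (0 : ℝ) h
      ((hasDerivWithinAt_id (0 : ℝ) (Icc 0 T)).div_const ε) (fun t ht =>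
        ⟨div_nonneg ht.1 hε.le, by simp only; gcongr; exact ht.2⟩) (by simp)
    simpa [Function.comp_def] using h2
  have := ((key h₁).const_mul (ε ^ α)).add ((key h₂).const_mul (ε ^ (1 + β)))
  refine this.congr_deriv ?_
  rw [Real.rpow_add hε, Real.rpow_one]; field_simp; ring

end Potential

section Solutions

variable {a b T ε : ℝ} {γ : ℕ → ℝ → ℝ → ℝ} {G F : ℝ → ℝ → ℝ} {E₀ : ℝ → ℂ} {E : ℝ → ℝ → ℂ}

lemma IsSchrodinger.of_interior {g Y : ℝ → ℝ → ℝ} {X : ℝ → ℝ → ℂ} (hab : a < b) (hT : 0 < T)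
    (hX : IsSmoothOn a b T 6 X) (hY : IsSmoothOn a b T 6 Y)
    (hg : ContinuousOn (fun p : ℝ × ℝ => g p.1 p.2) (rect a b T))
    (eqn : ∀ x ∈ Ioo a b, ∀ t ∈ Ioc 0 T, Complex.I * pd a b T X 0 1 x t + pd a b T X 2 0 x t
      + ((‖X x t‖ ^ 2 - Y x t - g x t : ℝ) : ℂ) * X x t = 0)
    (bdry : ∀ t ∈ Icc 0 T, X a t = 0 ∧ X b t = 0) (bdryY : ∀ t ∈ Icc 0 T, Y a t = 0 ∧ Y b t = 0) :
    IsSchrodinger a b T g Y X := by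
  refine ⟨hX, hY, fun x hx t ht => ?_, bdry, bdryY⟩
  have cX : ContinuousOn (fun p : ℝ × ℝ => X p.1 p.2) (rect a b T) := hX.continuousOn
  have cY : ContinuousOn (fun p : ℝ × ℝ => Y p.1 p.2) (rect a b T) := hY.continuousOn
  refine eqOn_rect (f := fun x t => Complex.I * pd a b T X 0 1 x t + pd a b T X 2 0 x t
      + ((‖X x t‖ ^ 2 - Y x t - g x t : ℝ) : ℂ) * X x t) (g := fun _ _ => 0) hab hT ?_
      continuousOn_const eqn hx ht
  refine ((continuousOn_const.mul (hX.continuousOn_pd hab hT (by norm_num))).add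
    (hX.continuousOn_pd hab hT (by norm_num))).add (ContinuousOn.mul ?_ cX)
  exact Complex.continuous_ofReal.comp_continuousOn (((cX.norm.pow 2).sub cY).sub hg)

lemma IsZSSolution.isSchrodinger (h : IsZSSolution a b T ε G E₀ E F) (hab : a < b) (hT : 0 < T)
    (hγ : ∀ x t, γ 0 x t = G x (t / ε))
    (hc : ContinuousOn (fun p : ℝ × ℝ => γ 0 p.1 p.2) (rect a b T)) :
    IsSchrodinger a b T (γ 0) F E :=
  IsSchrodinger.of_interior hab hT (ContDiffOn.of_le h.smooth_E (by norm_num)) h.smooth_F hc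
    (fun x hx t ht => by rw [hγ]; exact h.eqn_E x hx t ht) h.bdry_E h.bdry_F

lemma IsNLSEOPSolution.isSchrodinger (h : IsNLSEOPSolution a b T ε G E₀ E) (hab : a < b)
    (hT : 0 < T) (hγ : ∀ x t, γ 0 x t = G x (t / ε))
    (hc : ContinuousOn (fun p : ℝ × ℝ => γ 0 p.1 p.2) (rect a b T)) :
    IsSchrodinger a b T (γ 0) (fun _ _ => 0) E :=
  IsSchrodinger.of_interior hab hT h.smooth contDiffOn_const hc
    (fun x hx t ht => by rw [hγ, sub_zero]; exact h.eqn x hx t ht) h.bdry fun _ _ => ⟨rfl, rfl⟩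

end Solutions

section Initial

variable {a b T α β ε : ℝ} {g Y : ℝ → ℝ → ℝ} {X : ℝ → ℝ → ℂ} {E₀ : ℝ → ℂ} {ω₀ ω₁ : ℝ → ℝ}

lemma dd_init (hX₀ : ∀ x ∈ Icc a b, X x 0 = E₀ x) {x : ℝ} (hx : x ∈ Icc a b) :
    dd a b E₀ x = pd a b T X 2 0 x 0 := by
  simp only [dd, pd, iteratedDerivWithin_zero]
  exact iteratedDerivWithin_congr (fun y hy => (hX₀ y hy).symm) hx

lemma IsSchrodinger.phi2_eq (hX : IsSchrodinger a b T g Y X) (hT : 0 < T)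
    (hX₀ : ∀ x ∈ Icc a b, X x 0 = E₀ x) (hY₀ : ∀ x ∈ Icc a b, Y x 0 = 0)
    (hg : ∀ x ∈ Icc a b, g x 0 = ε ^ α * ω₀ x) {x : ℝ} (hx : x ∈ Icc a b) :
    phi2 a b α ε E₀ ω₀ x = pd a b T X 0 1 x 0 := by
  have h := hX.eqn x hx 0 (left_mem_Icc.2 hT.le)
  rw [phi2, N0, dd_init (T := T) hX₀ hx, ← hX₀ x hx]
  rw [hY₀ x hx, hg x hx] at h
  push_cast at h ⊢
  linear_combination Complex.I * h - pd a b T X 0 1 x 0 * Complex.I_mul_I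

lemma IsSchrodinger.dd_phi2_eq (hX : IsSchrodinger a b T g Y X) (hT : 0 < T)
    (hX₀ : ∀ x ∈ Icc a b, X x 0 = E₀ x) (hY₀ : ∀ x ∈ Icc a b, Y x 0 = 0)
    (hg : ∀ x ∈ Icc a b, g x 0 = ε ^ α * ω₀ x) {x : ℝ} (hx : x ∈ Icc a b) :
    dd a b (phi2 a b α ε E₀ ω₀) x = pd a b T X 2 1 x 0 := by
  rw [dd, pd]
  refine iteratedDerivWithin_congr (fun y hy => ?_) hx
  rw [hX.phi2_eq hT hX₀ hY₀ hg hy]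
  simp only [pd, iteratedDerivWithin_zero]

/-- The third and fourth coefficient of the first step in terms of the solution. -/
lemma IsSchrodinger.phi3_eq (hX : IsSchrodinger a b T g Y X) (hT : 0 < T)
    (hX₀ : ∀ x ∈ Icc a b, X x 0 = E₀ x) (hY₀ : ∀ x ∈ Icc a b, Y x 0 = 0)
    (hg : ∀ x ∈ Icc a b, g x 0 = ε ^ α * ω₀ x) {x : ℝ} (hx : x ∈ Icc a b) :
    phi3 a b α β ε E₀ ω₀ ω₁ x = Complex.I * (pd a b T X 2 1 x 0
      - ((2 * (pd a b T X 2 0 x 0 * starRingEnd ℂ (X x 0)).im + ε ^ β * ω₁ x : ℝ) : ℂ) * X x 0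
      - ((-‖X x 0‖ ^ 2 + g x 0 : ℝ) : ℂ) * pd a b T X 0 1 x 0) := by
  rw [phi3, hX.dd_phi2_eq hT hX₀ hY₀ hg hx, hX.phi2_eq hT hX₀ hY₀ hg hx, N1, phi1, N0,
    dd_init (T := T) hX₀ hx, ← hX₀ x hx, ← hg x hx]

lemma IsSchrodinger.phi4_eq (hX : IsSchrodinger a b T g Y X) (hT : 0 < T)
    (hX₀ : ∀ x ∈ Icc a b, X x 0 = E₀ x) (hY₀ : ∀ x ∈ Icc a b, Y x 0 = 0)
    (hg : ∀ x ∈ Icc a b, g x 0 = ε ^ α * ω₀ x) {x : ℝ} (hx : x ∈ Icc a b) :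
    phi4 a b α ε E₀ ω₀ x = 2 * (pd a b T X 0 1 x 0 * starRingEnd ℂ (pd a b T X 2 0 x 0)
      + X x 0 * starRingEnd ℂ (pd a b T X 2 1 x 0)).im := by
  rw [phi4, hX.dd_phi2_eq hT hX₀ hY₀ hg hx, hX.phi2_eq hT hX₀ hY₀ hg hx,
    dd_init (T := T) hX₀ hx, ← hX₀ x hx]

lemma IsSchrodinger.pd_two_one_bdry (hX : IsSchrodinger a b T g Y X) (hab : a < b) (hT : 0 < T)
    {t : ℝ} (ht : t ∈ Icc 0 T) : pd a b T X 2 1 a t = 0 ∧ pd a b T X 2 1 b t = 0 := by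
  have key : ∀ x ∈ Icc a b, (∀ s ∈ Icc 0 T, pd a b T X 2 0 x s = 0) → pd a b T X 2 1 x t = 0 := by
    intro x hx h
    have h1 := hX.smooth.hasDerivWithinAt_pd_t hab hT (m := 2) (n := 0) (by norm_num) hx ht
    have h2 : HasDerivWithinAt (fun s => pd a b T X 2 0 x s) 0 (Icc 0 T) t :=
      (hasDerivWithinAt_const t _ (0 : ℂ)).congr h (h t ht)
    exact (uniqueDiffOn_Icc hT t ht).eq_deriv _ h1 h2
  exact ⟨key a (left_mem_Icc.2 hab.le) fun s hs => (hX.pd_two_bdry hab hs).1,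
    key b (right_mem_Icc.2 hab.le) fun s hs => (hX.pd_two_bdry hab hs).2⟩

end Initial

section Oscillation

variable {V : Type*} [NormedAddCommGroup V] [NormedSpace ℝ V] {a b T τ A B C θ : ℝ}
  {f f' : ℝ → ℝ → V}

lemma Osc.of_bl {n : ℕ} (h4 : 4 ≤ B) (hc : ∀ x ∈ Icc a b, ContinuousOn (f x) (Icc 0 T))
    (hf : ∀ t ∈ Icc 0 T, BL a b (B ^ n) (fun x => f x t)) : Osc a b T τ B 2 n f :=
  ⟨h4, by norm_num, hc, hf, fun s hs t ht _ => ((hf s hs).sub (hf t ht)).mono (by linarith)⟩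

lemma Osc.of_hasDerivWithinAt {n : ℕ} (h4 : 4 ≤ B) (hθ : 0 ≤ θ) (hτ : A * (2 * τ) ≤ B ^ n * θ)
    (hA : 0 ≤ A)
    (hd : ∀ x ∈ Icc a b, ∀ s ∈ Icc 0 T, HasDerivWithinAt (f x) (f' x s) (Icc 0 T) s)
    (hf : ∀ t ∈ Icc 0 T, BL a b (B ^ n) (fun x => f x t))
    (hf' : ∀ t ∈ Icc 0 T, BL a b A (fun x => f' x t)) : Osc a b T τ B θ n f :=
  ⟨h4, hθ, fun x hx s hs => (hd x hx s hs).continuousWithinAt, hf, fun s hs t ht hst =>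
    (BL.time_lipschitz hf' hd hs ht).mono ((mul_le_mul_of_nonneg_left hst hA).trans hτ)⟩

lemma Osc.rebase {n : ℕ} (h : Osc a b T τ B θ n f) (hn : B ^ n ≤ C) (h4 : 4 ≤ C) :
    Osc a b T τ C θ 1 f := by
  have h0 := h.nonneg
  exact ⟨h4, h0, h.cont, fun t ht => (h.bd t ht).mono (by simpa using hn), fun s hs t ht hst =>
    (h.osc s hs t ht hst).mono (by rw [pow_one]; gcongr)⟩

lemma Osc.mono_osc {n : ℕ} {θ' : ℝ} (h : Osc a b T τ B θ n f) (hθ : θ ≤ θ') :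
    Osc a b T τ B θ' n f := by
  have h4 := h.four_le
  exact ⟨h4, h.nonneg.trans hθ, h.cont, h.bd, fun s hs t ht hst =>
    (h.osc s hs t ht hst).mono (by gcongr)⟩

lemma Osc.zero (h4 : 4 ≤ B) (hθ : 0 ≤ θ) : Osc a b T τ B θ 1 (fun _ _ => (0 : V)) := by
  have hB : 0 ≤ B := by linarith
  exact ⟨h4, hθ, fun _ _ => continuousOn_const,
    fun _ _ => ⟨fun x _ => by simpa using hB, fun x _ y _ => by simpa using by positivity⟩,
    fun _ _ _ _ _ => ⟨fun x _ => by simpa using by positivity,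
      fun x _ y _ => by simpa using by positivity⟩⟩

lemma pd_zero_fun (m n : ℕ) (x t : ℝ) : pd a b T (fun _ _ => (0 : V)) m n x t = 0 := by
  have h : ∀ (k : ℕ) (s : Set ℝ) (y : ℝ), iteratedDerivWithin k (fun _ => (0 : V)) s y = 0 := by
    intro k s y
    rw [iteratedDerivWithin_const]; simp
  simp only [pd, h]

end Oscillation

section TimeDerivative

variable {a b T τ B θ κ ε : ℝ} {γ : ℕ → ℝ → ℝ → ℝ} {Y : ℝ → ℝ → ℝ} {X : ℝ → ℝ → ℂ}

/-- The time derivatives `X_t` and `X_xxt` are controlled by the `x`-derivatives through the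
equation. -/
lemma IsSchrodinger.osc_time (hX : IsSchrodinger a b T (γ 0) Y X) (hab : a < b) (hT : 0 < T)
    (oX : ∀ j ≤ 4, Osc a b T τ B θ 1 (pd a b T X j 0))
    (oY : ∀ j ≤ 2, Osc a b T τ B θ 1 (pd a b T Y j 0))
    (hγ : ∀ m < 2, ∀ x ∈ Icc a b, ∀ t ∈ Icc 0 T,
      HasDerivWithinAt (fun y => γ m y t) (γ (m + 1) x t) (Icc a b) x)
    (oγ : ∀ j ≤ 2, Osc a b T τ B θ 1 (γ j)) :
    Osc a b T τ B θ 12 (pd a b T X 0 1) ∧ Osc a b T τ B θ 12 (pd a b T X 2 1) := by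
  set x0 := pd a b T X 0 0 with hx0
  set x1 := pd a b T X 1 0 with hx1
  set x2 := pd a b T X 2 0 with hx2
  set x3 := pd a b T X 3 0 with hx3
  set x4 := pd a b T X 4 0 with hx4
  set Q : ℝ → ℝ → ℂ := fun x t => x0 x t * starRingEnd ℂ (x0 x t) - ((pd a b T Y 0 0 x t : ℝ) : ℂ)
    - (γ 0 x t : ℂ) with hQ
  set Q1 : ℝ → ℝ → ℂ := fun x t => x1 x t * starRingEnd ℂ (x0 x t)
    + x0 x t * starRingEnd ℂ (x1 x t) - ((pd a b T Y 1 0 x t : ℝ) : ℂ) - (γ 1 x t : ℂ) with hQ1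
  set Q2 : ℝ → ℝ → ℂ := fun x t => x2 x t * starRingEnd ℂ (x0 x t)
    + x1 x t * starRingEnd ℂ (x1 x t)
    + (x1 x t * starRingEnd ℂ (x1 x t) + x0 x t * starRingEnd ℂ (x2 x t))
    - ((pd a b T Y 2 0 x t : ℝ) : ℂ) - (γ 2 x t : ℂ) with hQ2
  have e0 : ∀ x ∈ Icc a b, ∀ t ∈ Icc 0 T,
      pd a b T X 0 1 x t = Complex.I * (x2 x t + Q x t * x0 x t) := by
    intro x hx t ht
    have h := hX.eqn x hx t ht
    have hn := Complex.mul_conj' (X x t)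
    simp only [hQ, hx0, pd_zero_zero, hn]
    push_cast at h ⊢
    linear_combination (-Complex.I) * h + pd a b T X 0 1 x t * Complex.I_mul_I
  have e2 : ∀ x ∈ Icc a b, ∀ t ∈ Icc 0 T, pd a b T X 2 1 x t = Complex.I * (x4 x t
      + ((Q2 x t * x0 x t + Q1 x t * x1 x t) + (Q1 x t * x1 x t + Q x t * x2 x t))) := by
    have d : ∀ j < 4, ∀ x ∈ Icc a b, ∀ t ∈ Icc 0 T, HasDerivWithinAt (fun y => pd a b T X j 0 y t)
        (pd a b T X (j + 1) 0 x t) (Icc a b) x := fun j hj x hx t ht =>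
      hX.smooth.hasDerivWithinAt_pd_x hab hT (by omega) hx ht
    have dc : ∀ j < 4, ∀ x ∈ Icc a b, ∀ t ∈ Icc 0 T,
        HasDerivWithinAt (fun y => starRingEnd ℂ (pd a b T X j 0 y t))
        (starRingEnd ℂ (pd a b T X (j + 1) 0 x t)) (Icc a b) x := fun j hj x hx t ht =>
      (d j hj x hx t ht).star
    have dY : ∀ j < 2, ∀ x ∈ Icc a b, ∀ t ∈ Icc 0 T,
        HasDerivWithinAt (fun y => ((pd a b T Y j 0 y t : ℝ) : ℂ))
        ((pd a b T Y (j + 1) 0 x t : ℝ) : ℂ) (Icc a b) x := fun j hj x hx t ht =>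
      (hX.smoothY.hasDerivWithinAt_pd_x hab hT (by omega) hx ht).ofReal_comp
    have dγ : ∀ j < 2, ∀ x ∈ Icc a b, ∀ t ∈ Icc 0 T,
        HasDerivWithinAt (fun y => (γ j y t : ℂ)) (γ (j + 1) x t : ℂ) (Icc a b) x :=
      fun j hj x hx t ht => (hγ j hj x hx t ht).ofReal_comp
    have dQ : ∀ x ∈ Icc a b, ∀ t ∈ Icc 0 T, HasDerivWithinAt (fun y => Q y t) (Q1 x t) (Icc a b) x :=
      fun x hx t ht => ((((d 0 (by norm_num) x hx t ht).mul (dc 0 (by norm_num) x hx t ht)).sub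
        (dY 0 (by norm_num) x hx t ht)).sub (dγ 0 (by norm_num) x hx t ht))
    have dQ1 : ∀ x ∈ Icc a b, ∀ t ∈ Icc 0 T,
        HasDerivWithinAt (fun y => Q1 y t) (Q2 x t) (Icc a b) x := fun x hx t ht =>
      (((((d 1 (by norm_num) x hx t ht).mul (dc 0 (by norm_num) x hx t ht)).add
        ((d 0 (by norm_num) x hx t ht).mul (dc 1 (by norm_num) x hx t ht))).sub
        (dY 1 (by norm_num) x hx t ht)).sub (dγ 1 (by norm_num) x hx t ht))
    have e1 : ∀ x ∈ Icc a b, ∀ t ∈ Icc 0 T, pd a b T X 1 1 x t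
        = Complex.I * (x3 x t + (Q1 x t * x0 x t + Q x t * x1 x t)) := by
      intro x hx t ht
      have h1 := hX.smooth.hasDerivWithinAt_pd_x hab hT (m := 0) (n := 1) (by norm_num) hx ht
      have h2 := (((d 2 (by norm_num) x hx t ht).add ((dQ x hx t ht).mul
        (d 0 (by norm_num) x hx t ht))).const_mul Complex.I).congr
        (fun y hy => e0 y hy t ht) (e0 x hx t ht)
      exact (uniqueDiffOn_Icc hab x hx).eq_deriv _ h1 h2
    intro x hx t ht
    have h1 := hX.smooth.hasDerivWithinAt_pd_x hab hT (m := 1) (n := 1) (by norm_num) hx ht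
    have h2 := (((d 3 (by norm_num) x hx t ht).add (((dQ1 x hx t ht).mul
      (d 0 (by norm_num) x hx t ht)).add ((dQ x hx t ht).mul
      (d 1 (by norm_num) x hx t ht)))).const_mul Complex.I).congr
      (fun y hy => e1 y hy t ht) (e1 x hx t ht)
    exact (uniqueDiffOn_Icc hab x hx).eq_deriv _ h1 h2
  have o0 := oX 0 (by norm_num)
  have o1 := oX 1 (by norm_num)
  have o2 := oX 2 (by norm_num)
  have oQ : Osc a b T τ B θ 5 Q :=
    ((o0.mul o0.conj).sub ((oY 0 (by norm_num)).ofReal.mono (by norm_num))).sub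
      ((oγ 0 (by norm_num)).ofReal.mono (by norm_num))
  have oQ1 : Osc a b T τ B θ 6 Q1 :=
    (((o1.mul o0.conj).add (o0.mul o1.conj)).sub
      ((oY 1 (by norm_num)).ofReal.mono (by norm_num))).sub
      ((oγ 1 (by norm_num)).ofReal.mono (by norm_num))
  have oQ2 : Osc a b T τ B θ 7 Q2 :=
    ((((o2.mul o0.conj).add (o1.mul o1.conj)).add ((o1.mul o1.conj).add (o0.mul o2.conj))).sub
      ((oY 2 (by norm_num)).ofReal.mono (by norm_num))).sub
      ((oγ 2 (by norm_num)).ofReal.mono (by norm_num))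
  constructor
  · have h : Osc a b T τ B θ 8 _ := ((o2.mono (by norm_num)).add (oQ.mul o0)).I_mul
    exact (h.mono (by norm_num)).congr e0
  · have h : Osc a b T τ B θ 12 _ := (((oX 4 (by norm_num)).mono (by norm_num)).add
      (((oQ2.mul o0).add ((oQ1.mul o1).mono (by norm_num))).add
        (((oQ1.mul o1).add ((oQ.mul o2).mono (by norm_num))).mono (by norm_num)))).I_mul
    exact h.congr e2

end TimeDerivative

section Density

variable {a b T : ℝ} {g Y : ℝ → ℝ → ℝ} {X : ℝ → ℝ → ℂ}

/-- `conj (∂_t^m X) ∂_xx ∂_t^n X`. -/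
noncomputable def flux (a b T : ℝ) (X : ℝ → ℝ → ℂ) (m n : ℕ) (x t : ℝ) : ℂ :=
  starRingEnd ℂ (pd a b T X 0 m x t) * pd a b T X 2 n x t

/-- The time derivatives of `|X|²` for a solution `X` of a Schrödinger equation. -/
noncomputable def density (a b T : ℝ) (X : ℝ → ℝ → ℂ) : ℕ → ℝ → ℝ → ℝ
  | 0, x, t => ‖X x t‖ ^ 2
  | n + 1, x, t => -2 * (∑ i ∈ Finset.range (n + 1), (n.choose i : ℂ) * flux a b T X i (n - i) x t).im

lemma IsSchrodinger.hasDerivWithinAt_flux (hX : IsSchrodinger a b T g Y X) (hab : a < b)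
    (hT : 0 < T) {m n : ℕ} (h : m + n ≤ 2) {x t : ℝ} (hx : x ∈ Icc a b) (ht : t ∈ Icc 0 T) :
    HasDerivWithinAt (flux a b T X m n x) (flux a b T X (m + 1) n x t + flux a b T X m (n + 1) x t)
      (Icc 0 T) t :=
  (hX.smooth.hasDerivWithinAt_pd_t hab hT (by omega) hx ht).star.mul
    (hX.smooth.hasDerivWithinAt_pd_t hab hT (by omega) hx ht)

lemma HasDerivWithinAt.im {f : ℝ → ℂ} {f' : ℂ} {s : Set ℝ} {t : ℝ} (h : HasDerivWithinAt f f' s t) :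
    HasDerivWithinAt (fun r => (f r).im) f'.im s t :=
  Complex.imCLM.hasFDerivAt.comp_hasDerivWithinAt t h

lemma IsSchrodinger.hasDerivWithinAt_density (hX : IsSchrodinger a b T g Y X) (hab : a < b)
    (hT : 0 < T) {n : ℕ} (hn : n < 4) {x t : ℝ} (hx : x ∈ Icc a b) (ht : t ∈ Icc 0 T) :
    HasDerivWithinAt (density a b T X n x) (density a b T X (n + 1) x t) (Icc 0 T) t := by
  have d : ∀ {m n : ℕ}, m + n ≤ 2 → _ := fun {m n} h =>
    hX.hasDerivWithinAt_flux hab hT (m := m) (n := n) h hx ht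
  obtain rfl | rfl | rfl | rfl : n = 0 ∨ n = 1 ∨ n = 2 ∨ n = 3 := by omega
  · have h := (hX.smooth.hasDerivWithinAt_t hab hT (by norm_num) hx ht).norm_sq
    refine h.congr_deriv ?_
    have e := hX.eqn x hx t ht
    have er := congrArg Complex.re e
    have ei := congrArg Complex.im e
    simp only [Complex.add_re, Complex.add_im, Complex.mul_re, Complex.mul_im, Complex.I_re,
      Complex.I_im, Complex.ofReal_re, Complex.ofReal_im, Complex.zero_re, Complex.zero_im] at er ei
    simp [density, flux, Complex.inner, pd_zero_zero]
    linear_combination 2 * (X x t).re * ei - 2 * (X x t).im * er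
  · have h := (HasDerivWithinAt.im (d (m := 0) (n := 0) (by norm_num))).const_mul (-2 : ℝ)
    refine (h.congr_deriv ?_).congr (fun s _ => ?_) ?_ <;>
    simp [density, Finset.sum_range_succ, add_comm]
  · have h := (HasDerivWithinAt.im ((d (m := 1) (n := 0) (by norm_num)).add
      (d (m := 0) (n := 1) (by norm_num)))).const_mul (-2 : ℝ)
    refine (h.congr_deriv ?_).congr (fun s _ => ?_) ?_ <;>
    simp [density, Finset.sum_range_succ] <;> ring
  · have h := (HasDerivWithinAt.im (((d (m := 2) (n := 0) (by norm_num)).add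
      ((d (m := 1) (n := 1) (by norm_num)).const_mul 2)).add
      (d (m := 0) (n := 2) (by norm_num)))).const_mul (-2 : ℝ)
    refine (h.congr_deriv ?_).congr (fun s _ => ?_) ?_ <;>
    simp [density, Finset.sum_range_succ] <;> ring

lemma abs_density_le {B : ℝ} {c : ℕ → ℝ} {x t : ℝ} {n : ℕ}
    (h0 : ∀ i ≤ n, ‖pd a b T X 0 i x t‖ ≤ c i) (h2 : ∀ i ≤ n, ‖pd a b T X 2 i x t‖ ≤ c i)
    (hc : ∀ i ≤ n, c i * c (n - i) ≤ B) :
    |density a b T X (n + 1) x t| ≤ 2 ^ (n + 1) * B := by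
  rw [density, abs_mul]
  have h : ‖∑ i ∈ Finset.range (n + 1), (n.choose i : ℂ) * flux a b T X i (n - i) x t‖
      ≤ ∑ i ∈ Finset.range (n + 1), (n.choose i : ℝ) * B := by
    refine (norm_sum_le _ _).trans (Finset.sum_le_sum fun i hi => ?_)
    have hi' : i ≤ n := by simpa [Nat.lt_succ_iff] using hi
    rw [norm_mul, flux, norm_mul, RCLike.norm_conj, Complex.norm_natCast]
    refine mul_le_mul_of_nonneg_left (le_trans ?_ (hc i hi')) (by positivity)
    exact mul_le_mul (h0 i hi') (h2 _ (by omega)) (norm_nonneg _) ((norm_nonneg _).trans (h0 i hi'))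
  rw [← Finset.sum_mul, ← Nat.cast_sum, Nat.sum_range_choose] at h
  push_cast at h
  have := Complex.abs_im_le_norm (∑ i ∈ Finset.range (n + 1), (n.choose i : ℂ) * flux a b T X i (n - i) x t)
  rw [show |(-2 : ℝ)| = 2 by norm_num, pow_succ]
  linarith

end Density

section Grid

variable {V : Type*} [NormedAddCommGroup V] [NormedSpace ℝ V] {a b T τ B δ θ ε : ℝ} {M N : ℕ}

/-- The values of a function at the grid points. -/
noncomputable def grid (a b : ℝ) (M : ℕ) (τ : ℝ) (u : ℝ → ℝ → V) (k j : ℕ) : V :=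
  u (node a b M j) (k * τ)

lemma grid_next (u : ℝ → ℝ → V) (l j : ℕ) :
    grid a b M τ u (l + 1 + 1) j = u (node a b M j) ((l + 1 : ℕ) * τ + τ) := by
  rw [grid]; push_cast; ring_nf

lemma grid_prev (u : ℝ → ℝ → V) (l j : ℕ) :
    grid a b M τ u (l + 1 - 1) j = u (node a b M j) ((l + 1 : ℕ) * τ - τ) := by
  rw [grid, Nat.add_sub_cancel]; push_cast; ring_nf

lemma avg_grid (u : ℝ → ℝ → V) (l j : ℕ) :
    avg (grid a b M τ u) (l + 1) j = tavg τ ((l + 1 : ℕ) * τ) (u (node a b M j)) := by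
  rw [avg, grid_next, grid_prev, tavg]

lemma dt_grid (u : ℝ → ℝ → V) (l j : ℕ) :
    dt τ (grid a b M τ u) (l + 1) j = (2 * τ)⁻¹ • (u (node a b M j) ((l + 1 : ℕ) * τ + τ)
      - u (node a b M j) ((l + 1 : ℕ) * τ - τ)) := by
  rw [dt, grid_next, grid_prev]

lemma dt2_grid (u : ℝ → ℝ → V) (l j : ℕ) :
    dt2 τ (grid a b M τ u) (l + 1) j = (τ ^ 2)⁻¹ • (u (node a b M j) ((l + 1 : ℕ) * τ + τ)
      - (2 : ℝ) • u (node a b M j) ((l + 1 : ℕ) * τ)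
      + u (node a b M j) ((l + 1 : ℕ) * τ - τ)) := by
  rw [dt2, grid_next, grid_prev]; rfl

lemma tavg_hasDerivWithinAt {f f' : ℝ → ℝ → V} {t x : ℝ}
    (hd : ∀ s ∈ Icc 0 T, HasDerivWithinAt (fun y => f y s) (f' x s) (Icc a b) x)
    (hτ : 0 < τ) (h0 : 0 ≤ t - τ) (h1 : t + τ ≤ T) :
    HasDerivWithinAt (fun y => tavg τ t (f y)) (tavg τ t (f' x)) (Icc a b) x :=
  ((hd (t + τ) ⟨by linarith, h1⟩).add (hd (t - τ) ⟨h0, by linarith⟩)).const_smul (2 : ℝ)⁻¹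

lemma level_mem (hτ : 0 < τ) (hN : N * τ ≤ T) {k : ℕ} (hk : k ≤ N) : (k : ℝ) * τ ∈ Icc 0 T :=
  ⟨by positivity, le_trans (by gcongr) hN⟩

lemma level_inner (hτ : 0 < τ) (hN : N * τ ≤ T) {l : ℕ} (hl : l + 2 ≤ N) :
    0 ≤ ((l + 1 : ℕ) : ℝ) * τ - τ ∧ ((l + 1 : ℕ) : ℝ) * τ + τ ≤ T := by
  have h := (level_mem hτ hN hl).2
  have h2 : 0 ≤ (l : ℝ) * τ := by positivity
  push_cast at h ⊢
  constructor <;> linarith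

variable {g Y : ℝ → ℝ → ℝ} {X : ℝ → ℝ → ℂ} {u₀ u₁ : ℕ → ℂ} {p₀ p₁ : ℕ → ℝ} {η₁ η₂ : ℕ → ℕ → ℝ}

/-- A smooth solution of the Schrödinger equation whose time derivatives oscillate little solves the
scheme up to small residuals. -/
lemma IsSchrodinger.consistent (hX : IsSchrodinger a b T g Y X) (hab : a < b) (hT : 0 < T)
    (hτ : 0 < τ) (hM : 1 ≤ M) (hN : N * τ ≤ T) (o0 : Osc a b T τ B θ 1 X)
    (o1 : Osc a b T τ B θ 1 (pd a b T X 0 1)) (o2 : Osc a b T τ B θ 1 (pd a b T X 2 1))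
    (oY : Osc a b T τ B θ 1 Y) (oY1 : Osc a b T τ B θ 1 (pd a b T Y 0 1))
    (og : Osc a b T τ B θ 1 g) (b4 : ∀ t ∈ Icc 0 T, BL a b B (fun x => pd a b T X 4 0 x t))
    (hδ1 : 2 * B * mesh a b M ^ 2 ≤ δ) (hδ2 : B ^ 8 * (τ * θ) ≤ δ)
    (eq_Y : ∀ l, l + 2 ≤ N → ∀ j ∈ Finset.Ico 1 M, ε ^ 2 * dt2 τ (grid a b M τ Y) (l + 1) j
      = dx2 (mesh a b M) (avg (grid a b M τ Y) (l + 1)) j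
        + ε ^ 2 * dt2 τ (fun k i => ‖grid a b M τ X k i‖ ^ 2) (l + 1) j
        + (η₁ (l + 1) j + η₂ (l + 1) j))
    (norm_η₁ : ∀ l, l + 2 ≤ N → ∀ j ∈ Finset.Ico 1 M, |η₁ (l + 1) j| ≤ ε * δ)
    (norm_η₂ : ∀ k, k + 1 ≤ N → ∀ j ∈ Finset.Ico 1 M, |η₂ k j| ≤ δ)
    (diff_η₂ : ∀ l, l + 2 ≤ N → ∀ j ∈ Finset.Ico 1 M, |η₂ (l + 1) j - η₂ l j| ≤ τ * δ)
    (init_X : ∀ j ≤ M, grid a b M τ X 0 j = u₀ j) (init_Y : ∀ j ≤ M, grid a b M τ Y 0 j = p₀ j)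
    (first_X : 1 ≤ N → l2dx (mesh a b M) M (fun j => grid a b M τ X 1 j - u₁ j) ≤ δ)
    (first_Y : 1 ≤ N → l2 (mesh a b M) M (fun j => grid a b M τ Y 1 j - p₁ j) ≤ δ)
    (first_g : 1 ≤ N → ε / τ * l2 (mesh a b M) M (fun j => (grid a b M τ Y 1 j - p₁ j)
      - (‖grid a b M τ X 1 j‖ ^ 2 - ‖u₁ j‖ ^ 2)) ≤ δ) :
    Consistent (mesh a b M) τ ε B δ M N (grid a b M τ X) (grid a b M τ Y)
      (fun k j => tmean τ (k * τ) (g (node a b M j))) u₀ u₁ p₀ p₁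
      (fun k j => dx2 (mesh a b M) (fun i => tavg τ (k * τ) (X (node a b M i))) j
        - tavg τ (k * τ) (pd a b T X 2 0 (node a b M j)))
      (fun k j => residual a b T τ (k * τ) g Y X (node a b M j)) η₁ η₂ := by
  have hB : 0 ≤ B := by linarith [o0.four_le]
  have na : node a b M 0 = a := node_zero
  have e00 : ∀ x, pd a b T X 0 0 x = X x := fun x => funext fun s => pd_zero_zero x s
  have nb : node a b M M = b := node_last hM
  have mj : ∀ {j}, j ∈ Finset.Ico 1 M → node a b M j ∈ Icc a b := fun hj =>
    node_mem hab hM (Finset.mem_Ico.1 hj).2.le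
  have chain : ∀ l, l + 2 ≤ N → ∀ i < 4, ∀ x ∈ Icc a b, HasDerivWithinAt
      (fun x => tavg τ ((l + 1 : ℕ) * τ) (pd a b T X i 0 x))
      (tavg τ ((l + 1 : ℕ) * τ) (pd a b T X (i + 1) 0 x)) (Icc a b) x := fun l hl i hi x hx =>
    tavg_hasDerivWithinAt (fun s hs => hX.smooth.hasDerivWithinAt_pd_x hab hT (by omega) hx hs) hτ
      (level_inner hτ hN hl).1 (level_inner hτ hN hl).2
  have hsub : ∀ l, l + 2 ≤ N → Icc ((l + 1 : ℕ) * τ - τ) ((l + 1 : ℕ) * τ + τ) ⊆ Icc 0 T :=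
    fun l hl => Icc_subset_Icc (level_inner hτ hN hl).1 (level_inner hτ hN hl).2
  have bl4 : ∀ l, l + 2 ≤ N → BL a b B (fun x => tavg τ ((l + 1 : ℕ) * τ) (pd a b T X 4 0 x)) :=
    fun l hl => BL.tavg hτ fun s hs => b4 s (hsub l hl hs)
  have res : ∀ l, l + 2 ≤ N → BL a b δ (residual a b T τ ((l + 1 : ℕ) * τ) g Y X) := fun l hl =>
    (hX.residual_bl hab hT hτ o0 o1 o2 oY oY1 og (level_inner hτ hN hl).1
      (level_inner hτ hN hl).2).mono hδ2
  have pot : ∀ l, l + 2 ≤ N → BL a b B (fun x => tmean τ ((l + 1 : ℕ) * τ) (g x)) := fun l hl =>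
    BL.tmean hτ (fun x hx => (og.cont x hx).mono (hsub l hl))
      fun s hs => by simpa using og.bd s (hsub l hl hs)
  have b0 : ∀ t ∈ Icc 0 T, BL a b B (fun x => X x t) := fun t ht => by simpa using o0.bd t ht
  have bY : ∀ t ∈ Icc 0 T, BL a b B (fun x => Y x t) := fun t ht => by simpa using oY.bd t ht
  refine
  { bdry_X := fun k hk => ?_
    bdry_Y := fun k hk => ?_
    norm_X := fun k hk j hj => (b0 _ (level_mem hτ hN hk)).1 _ (node_mem hab hM hj)
    dxp_X := fun k hk j hj => (b0 _ (level_mem hτ hN hk)).dxp_node hab hM hj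
    dt_X := fun l hl j hj => ?_
    norm_Y := fun k hk j hj => (bY _ (level_mem hτ hN hk)).1 _ (node_mem hab hM hj)
    dxp_Y := fun k hk j hj => (bY _ (level_mem hτ hN hk)).dxp_node hab hM hj
    norm_H := fun l hl j hj => (pot l hl).1 _ (node_mem hab hM hj)
    dxp_H := fun l hl j hj => (pot l hl).dxp_node hab hM hj
    eq_X := fun l hl j hj => ?_
    eq_Y := eq_Y
    norm_r := fun l hl j hj => ?_
    dxp_r := fun l hl j hj => ?_
    bdry_s := fun l hl => ?_
    dxp_s := fun l hl j hj => (res l hl).dxp_node hab hM hj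
    norm_η₁ := norm_η₁
    norm_η₂ := norm_η₂
    diff_η₂ := diff_η₂
    init_X := init_X
    init_Y := init_Y
    first_X := first_X
    first_Y := first_Y
    first_g := first_g }
  · have := hX.bdry _ (level_mem hτ hN hk)
    simpa only [grid, na, nb] using this
  · have := hX.bdryY _ (level_mem hτ hN hk)
    simpa only [grid, na, nb] using this
  · rw [dt_grid, ← tmean_deriv hτ (f' := pd a b T X 0 1 (node a b M j)) (fun s hs =>
      (hX.smooth.hasDerivWithinAt_t hab hT (by norm_num) (mj hj) (hsub l hl hs)).mono (hsub l hl))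
      ((o1.cont _ (mj hj)).mono (hsub l hl))]
    exact norm_tmean_le hτ fun s hs => by simpa using (o1.bd s (hsub l hl hs)).1 _ (mj hj)
  · have e : (fun i => tavg τ ((l + 1 : ℕ) * τ) (X (node a b M i)))
        = avg (grid a b M τ X) (l + 1) := funext fun i => (avg_grid X l i).symm
    simp only [residual]
    rw [e, dt_grid, avg_grid Y, avg_grid X]
    simp only [grid]
    push_cast
    ring
  · have := norm_dx2_sub_le hab hM (chain l hl) (bl4 l hl).1 hj
    simp only [e00] at this
    exact this.trans hδ1
  · have := norm_dxp_dx2_sub_le hab hM (chain l hl) (bl4 l hl) hj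
    simp only [e00] at this
    exact this.trans hδ1
  · have := hX.residual_bdry hab hτ (level_inner hτ hN hl).1 (level_inner hτ hN hl).2
    simpa only [na, nb] using this

end Grid

section FirstStep

variable {V : Type*} [NormedAddCommGroup V] [NormedSpace ℝ V] {a b T τ A : ℝ}
  {f f₁ f₂ f₃ : ℝ → ℝ → V}

/-- Integration in time of a Lipschitz bound. -/
lemma BL.integrate {n : ℕ} (hA : 0 ≤ A)
    (hd : ∀ x ∈ Icc a b, ∀ s ∈ Icc 0 τ, HasDerivWithinAt (f x) (f₁ x s) (Icc 0 τ) s)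
    (h0 : ∀ x ∈ Icc a b, f x 0 = 0) (hf : ∀ s ∈ Icc 0 τ, BL a b (A * s ^ n) (fun x => f₁ x s)) :
    ∀ s ∈ Icc 0 τ, BL a b (A * s ^ (n + 1)) (fun x => f x s) := by
  intro s hs
  refine ⟨fun x hx => norm_le_pow_of_deriv_le hA (h0 x hx) (hd x hx) (fun r hr => (hf r hr).1 x hx)
    s hs, fun x hx y hy => ?_⟩
  have := norm_le_pow_of_deriv_le (g := fun s => f x s - f y s) (C := A * |x - y|)
    (by positivity) (by simp [h0 x hx, h0 y hy]) (fun r hr => (hd x hx r hr).sub (hd y hy r hr))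
    (fun r hr => ((hf r hr).2 x hx y hy).trans_eq (by ring)) s hs
  exact this.trans_eq (by ring)

lemma BL.taylor_one (hτ : 0 ≤ τ)
    (hd : ∀ x ∈ Icc a b, ∀ s ∈ Icc 0 τ, HasDerivWithinAt (f x) (f₁ x s) (Icc 0 τ) s)
    (hf : ∀ s ∈ Icc 0 τ, BL a b A (fun x => f₁ x s - f₁ x 0)) (hA : 0 ≤ A) :
    BL a b (A * τ) (fun x => f x τ - f x 0 - τ • f₁ x 0) := by
  have h := BL.integrate (n := 0) (f := fun x s => f x s - f x 0 - s • f₁ x 0)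
    (f₁ := fun x s => f₁ x s - f₁ x 0) hA (fun x hx s hs => by
      have := ((hd x hx s hs).sub_const (f x 0)).sub
        ((hasDerivWithinAt_id s _).smul_const (f₁ x 0))
      rwa [one_smul] at this) (by simp) (by simpa using hf) τ (right_mem_Icc.2 hτ)
  simpa using h

lemma BL.taylor_two (hτ : 0 ≤ τ)
    (h0 : ∀ x ∈ Icc a b, ∀ s ∈ Icc 0 τ, HasDerivWithinAt (f x) (f₁ x s) (Icc 0 τ) s)
    (h1 : ∀ x ∈ Icc a b, ∀ s ∈ Icc 0 τ, HasDerivWithinAt (f₁ x) (f₂ x s) (Icc 0 τ) s)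
    (h2 : ∀ x ∈ Icc a b, ∀ s ∈ Icc 0 τ, HasDerivWithinAt (f₂ x) (f₃ x s) (Icc 0 τ) s)
    (hf : ∀ s ∈ Icc 0 τ, BL a b A (fun x => f₃ x s)) (hA : 0 ≤ A) :
    BL a b (A * τ ^ 3) (fun x => f x τ - f x 0 - τ • f₁ x 0 - (τ ^ 2 / 2) • f₂ x 0) := by
  have k2 := BL.integrate (n := 0) (f := fun x s => f₂ x s - f₂ x 0) hA
    (fun x hx s hs => (h2 x hx s hs).sub_const _) (by simp) (by simpa using hf)
  have k1 := BL.integrate (n := 0 + 1) (f := fun x s => f₁ x s - f₁ x 0 - s • f₂ x 0) hA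
    (fun x hx s hs => by
      have := ((h1 x hx s hs).sub_const (f₁ x 0)).sub
        ((hasDerivWithinAt_id s _).smul_const (f₂ x 0))
      rwa [one_smul] at this) (by simp) k2
  have k0 := BL.integrate (n := 0 + 1 + 1)
    (f := fun x s => f x s - f x 0 - s • f₁ x 0 - (s ^ 2 / 2) • f₂ x 0) hA
    (fun x hx s hs => by
      have h2' := (((hasDerivWithinAt_id s (Icc 0 τ)).pow 2).div_const 2).smul_const (f₂ x 0)
      have := (((h0 x hx s hs).sub_const (f x 0)).sub
        ((hasDerivWithinAt_id s _).smul_const (f₁ x 0))).sub h2'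
      refine this.congr_deriv ?_
      simp) (by simp) k1 τ (right_mem_Icc.2 hτ)
  simpa using k0

end FirstStep

section FirstLevel

variable {a b T α β ε B τ L A : ℝ} {M : ℕ} {g Y : ℝ → ℝ → ℝ} {X : ℝ → ℝ → ℂ} {E₀ : ℝ → ℂ}
  {ω₀ ω₁ : ℝ → ℝ}

/-- The first level of the scheme for `E`. -/
noncomputable def firstE (a b α β ε : ℝ) (E₀ : ℝ → ℂ) (ω₀ ω₁ : ℝ → ℝ) (M : ℕ) (τ : ℝ) (j : ℕ) : ℂ :=
  E₀ (node a b M j) + (τ : ℂ) * phi2 a b α ε E₀ ω₀ (node a b M j)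
    + ((τ ^ 2 / 2 : ℝ) : ℂ) * phi3 a b α β ε E₀ ω₀ ω₁ (node a b M j)

/-- The first level of the scheme for `F`. -/
noncomputable def firstF (a b α ε : ℝ) (E₀ : ℝ → ℂ) (ω₀ : ℝ → ℝ) (M : ℕ) (τ : ℝ) (j : ℕ) : ℝ :=
  τ ^ 2 / 2 * phi4 a b α ε E₀ ω₀ (node a b M j)

lemma IsSchrodinger.phi3_bl (hX : IsSchrodinger a b T g Y X) (hT : 0 < T)
    (hX₀ : ∀ x ∈ Icc a b, X x 0 = E₀ x) (hY₀ : ∀ x ∈ Icc a b, Y x 0 = 0)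
    (hg : ∀ x ∈ Icc a b, g x 0 = ε ^ α * ω₀ x) (hB : 4 ≤ B) (b0 : BL a b B (fun x => X x 0))
    (b2 : BL a b B (fun x => pd a b T X 2 0 x 0)) (b01 : BL a b B (fun x => pd a b T X 0 1 x 0))
    (b21 : BL a b B (fun x => pd a b T X 2 1 x 0)) (bg : BL a b B (fun x => g x 0))
    (bω : BL a b B (fun x => ε ^ β * ω₁ x)) : BL a b (B ^ 5) (phi3 a b α β ε E₀ ω₀ ω₁) := by
  have h1 := (((((b2.mul b0.conj).im).const_smul 2).add bω).ofReal).mul b0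
  have h2 := ((b0.mul b0.conj).neg.add bg.ofReal).mul b01
  refine (((b21.sub h1).sub h2).I_mul.mono ?_).congr fun x hx => ?_
  · rw [abs_of_pos (by norm_num : (0 : ℝ) < 2)]
    have p2 : B * 4 ≤ B ^ 2 := by nlinarith
    have p3 : B ^ 2 * 4 ≤ B ^ 3 := by nlinarith [sq_nonneg B]
    have p5 : B ^ 3 * 16 ≤ B ^ 5 := by
      have : (4 : ℝ) ^ 2 ≤ B ^ 2 := by gcongr
      have : 0 ≤ B ^ 3 := by positivity
      nlinarith
    nlinarith
  · rw [hX.phi3_eq hT hX₀ hY₀ hg hx]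
    have hn := Complex.mul_conj' (X x 0)
    rw [hn]
    push_cast
    simp only [smul_eq_mul]
    push_cast
    ring

lemma IsSchrodinger.first_bdry (hX : IsSchrodinger a b T g Y X) (hab : a < b) (hT : 0 < T)
    (hX₀ : ∀ x ∈ Icc a b, X x 0 = E₀ x) (hY₀ : ∀ x ∈ Icc a b, Y x 0 = 0)
    (hg : ∀ x ∈ Icc a b, g x 0 = ε ^ α * ω₀ x) (hM : 1 ≤ M) :
    (firstE a b α β ε E₀ ω₀ ω₁ M τ 0 = 0 ∧ firstE a b α β ε E₀ ω₀ ω₁ M τ M = 0) ∧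
      (firstF a b α ε E₀ ω₀ M τ 0 = 0 ∧ firstF a b α ε E₀ ω₀ M τ M = 0) := by
  have h0 : (0 : ℝ) ∈ Icc 0 T := left_mem_Icc.2 hT.le
  have ha := left_mem_Icc.2 hab.le
  have hb := right_mem_Icc.2 hab.le
  have key : ∀ x ∈ Icc a b, X x 0 = 0 → pd a b T X 0 1 x 0 = 0 → pd a b T X 2 1 x 0 = 0 →
      E₀ x + (τ : ℂ) * phi2 a b α ε E₀ ω₀ x
        + ((τ ^ 2 / 2 : ℝ) : ℂ) * phi3 a b α β ε E₀ ω₀ ω₁ x = 0 ∧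
      τ ^ 2 / 2 * phi4 a b α ε E₀ ω₀ x = 0 := by
    intro x hx h1 h2 h3
    rw [hX.phi3_eq hT hX₀ hY₀ hg hx, hX.phi2_eq hT hX₀ hY₀ hg hx, hX.phi4_eq hT hX₀ hY₀ hg hx,
      ← hX₀ x hx, h1, h2, h3]
    simp
  have h21 := hX.pd_two_one_bdry hab hT h0
  have k1 := key a ha (hX.bdry 0 h0).1 (pd_bdry_eq_zero (fun s hs => (hX.bdry s hs).1) 1 h0) h21.1
  have k2 := key b hb (hX.bdry 0 h0).2 (pd_bdry_eq_zero (fun s hs => (hX.bdry s hs).2) 1 h0) h21.2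
  simp only [firstE, firstF, node_zero, node_last hM]
  exact ⟨⟨k1.1, k2.1⟩, k1.2, k2.2⟩

/-- Estimates on the first level from pointwise bounds. -/
lemma first_level_le {δ C D : ℝ} {p : ℝ → ℝ} {e : ℝ → ℂ} {Y₁ p₁ : ℕ → ℝ} {X₁ u₁ : ℕ → ℂ}
    (hab : a < b) (hM : 1 ≤ M) (hτ : 0 < τ) (hε : 0 < ε)
    (hL : √(b - a) ≤ B) (he : BL a b A e) (hp : ∀ x ∈ Icc a b, |p x| ≤ C)
    (hX₁ : ∀ j ≤ M, ‖X₁ j‖ ≤ D) (hA : A ≤ D)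
    (hu : ∀ j ≤ M, X₁ j - u₁ j = e (node a b M j)) (hpp : ∀ j ≤ M, Y₁ j - p₁ j = p (node a b M j))
    (h1 : B * A ≤ δ) (h2 : B * C ≤ δ) (h3 : ε / τ * (B * (C + 3 * D * A)) ≤ δ) :
    l2dx (mesh a b M) M (fun j => X₁ j - u₁ j) ≤ δ ∧
    l2 (mesh a b M) M (fun j => Y₁ j - p₁ j) ≤ δ ∧
    ε / τ * l2 (mesh a b M) M (fun j => (Y₁ j - p₁ j) - (‖X₁ j‖ ^ 2 - ‖u₁ j‖ ^ 2)) ≤ δ := by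
  have hh := mesh_pos hab hM
  have hLm := mesh_mul (a := a) (b := b) hM
  have hA0 := he.nonneg hab
  have hC0 : 0 ≤ C := (abs_nonneg _).trans (hp a (left_mem_Icc.2 hab.le))
  have mj : ∀ {j}, j ∈ Finset.Ico 1 M → j ≤ M := fun hj => (Finset.mem_Ico.1 hj).2.le
  refine ⟨?_, ?_, ?_⟩
  · rw [l2dx_congr (v := fun j => e (node a b M j)) hu]
    exact (l2dx_le_of_forall hh hLm hA0 fun j hj => he.dxp_node hab hM hj).trans
      ((mul_le_mul_of_nonneg_right hL hA0).trans h1)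
  · rw [l2_congr (u' := fun j => p (node a b M j)) fun j hj => hpp j (mj hj)]
    exact (l2_le_of_forall hh hLm hC0 fun j hj => hp _ (node_mem hab hM (mj hj))).trans
      ((mul_le_mul_of_nonneg_right hL hC0).trans h2)
  · have hD : 0 ≤ C + 3 * D * A := by
      have : 0 ≤ D := hA0.trans hA
      positivity
    refine le_trans ?_ h3
    refine mul_le_mul_of_nonneg_left ((l2_le_of_forall hh hLm hD fun j hj => ?_).trans
      (mul_le_mul_of_nonneg_right hL hD)) (by positivity)
    have q1 := hp _ (node_mem hab hM (mj hj))
    have q2 := he.1 _ (node_mem hab hM (mj hj))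
    rw [← hpp j (mj hj)] at q1
    rw [← hu j (mj hj)] at q2
    have q3 := hX₁ j (mj hj)
    have q4 := abs_norm_sub_norm_le (X₁ j) (u₁ j)
    have q5 : ‖u₁ j‖ ≤ 2 * D := by
      have := (abs_le.1 q4).1
      linarith
    have q6 : |‖X₁ j‖ ^ 2 - ‖u₁ j‖ ^ 2| ≤ A * (3 * D) := by
      have : ‖X₁ j‖ ^ 2 - ‖u₁ j‖ ^ 2 = (‖X₁ j‖ - ‖u₁ j‖) * (‖X₁ j‖ + ‖u₁ j‖) := by ring
      rw [this, abs_mul, abs_of_nonneg (by positivity : 0 ≤ ‖X₁ j‖ + ‖u₁ j‖)]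
      exact mul_le_mul (q4.trans q2) (by linarith) (by positivity) hA0
    refine (norm_sub_le _ _).trans ?_
    rw [Real.norm_eq_abs, Real.norm_eq_abs]
    linarith

end FirstLevel

section ThirdDifference

variable {V : Type*} [NormedAddCommGroup V] [NormedSpace ℝ V]

lemma norm_third_difference_le {f f₁ f₂ f₃ : ℝ → V} {c d t h B : ℝ} (hh : 0 ≤ h)
    (hc : c ≤ t - h) (hd : t + h + h ≤ d)
    (h0 : ∀ s ∈ Icc c d, HasDerivWithinAt f (f₁ s) (Icc c d) s)
    (h1 : ∀ s ∈ Icc c d, HasDerivWithinAt f₁ (f₂ s) (Icc c d) s)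
    (h2 : ∀ s ∈ Icc c d, HasDerivWithinAt f₂ (f₃ s) (Icc c d) s)
    (hB : ∀ s ∈ Icc c d, ‖f₃ s‖ ≤ B) :
    ‖(f (t + h + h) - (2 : ℝ) • f (t + h) + f t) - (f (t + h) - (2 : ℝ) • f t + f (t - h))‖
      ≤ 2 * (B * h) * h ^ 2 := by
  have hm : MapsTo (fun y => y + h) (Icc (t - h) (t + h)) (Icc c d) := fun y hy =>
    ⟨by linarith [hy.1], by linarith [hy.2]⟩
  have hs : Icc (t - h) (t + h) ⊆ Icc c d := Icc_subset_Icc hc (by linarith)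
  have sh : ∀ {g g' : ℝ → V}, (∀ s ∈ Icc c d, HasDerivWithinAt g (g' s) (Icc c d) s) →
      ∀ s ∈ Icc (t - h) (t + h), HasDerivWithinAt (fun s => g (s + h) - g s) (g' (s + h) - g' s)
        (Icc (t - h) (t + h)) s := by
    intro g g' hg s hss
    have h1 := (hg (s + h) (hm hss)).scomp s
      ((hasDerivWithinAt_id s (Icc (t - h) (t + h))).add_const h) hm
    rw [one_smul] at h1
    exact h1.sub ((hg s (hs hss)).mono hs)
  have := norm_second_difference_le (f := fun s => f (s + h) - f s)
    (f₁ := fun s => f₁ (s + h) - f₁ s) (f₂ := fun s => f₂ (s + h) - f₂ s) hh (t := t) le_rfl le_rfl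
    (sh h0) (sh h1) (B := B * h) (fun s hss => by
      have := (convex_Icc c d).norm_image_sub_le_of_norm_hasDerivWithin_le h2 hB (hs hss) (hm hss)
      rwa [add_sub_cancel_left, Real.norm_of_nonneg hh] at this)
  refine le_trans (le_of_eq ?_) this
  congr 1
  simp only [sub_add_cancel]
  module

end ThirdDifference

section NLS

variable {a b T α β ε B τ θ κ A : ℝ} {M N : ℕ} {g : ℝ → ℝ → ℝ} {X : ℝ → ℝ → ℂ} {E₀ : ℝ → ℂ}
  {ω₀ ω₁ : ℝ → ℝ}

/-- The residual in the wave equation if `F` is replaced by `0`. -/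
noncomputable def densityResidual (a b : ℝ) (M N : ℕ) (τ ε : ℝ) (X : ℝ → ℝ → ℂ) (k j : ℕ) : ℝ :=
  if 2 ≤ N then - (ε ^ 2 * dt2 τ (grid a b M τ fun x t => ‖X x t‖ ^ 2) (max k 1) j) else 0

/-- The grid functions `X`, `Y` satisfy the scheme with the potential `g`, with its initial data,
up to errors of size `δ`. -/
def SchemeConsistent (a b α β ε : ℝ) (E₀ : ℝ → ℂ) (ω₀ ω₁ : ℝ → ℝ) (g : ℝ → ℝ → ℝ) (τ B δ : ℝ)
    (M N : ℕ) (X : ℕ → ℕ → ℂ) (Y : ℕ → ℕ → ℝ) : Prop :=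
  ∃ r s η₁ η₂, Consistent (mesh a b M) τ ε B δ M N X Y
    (fun k j => tmean τ (k * τ) (g (node a b M j))) (fun j => E₀ (node a b M j))
    (firstE a b α β ε E₀ ω₀ ω₁ M τ) (fun _ => 0) (firstF a b α ε E₀ ω₀ M τ) r s η₁ η₂

set_option maxHeartbeats 1000000 in
lemma IsSchrodinger.consistent_zero (hX : IsSchrodinger a b T g (fun _ _ => 0) X) (hab : a < b)
    (hT : 0 < T) (hτ : 0 < τ) (hM : 1 ≤ M) (hN : N * τ ≤ T) (hε : 0 < ε)
    (o0 : Osc a b T τ B θ 1 X)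
    (o1 : Osc a b T τ B θ 1 (pd a b T X 0 1)) (o2 : Osc a b T τ B θ 1 (pd a b T X 2 1))
    (og : Osc a b T τ B θ 1 g) (b2 : ∀ t ∈ Icc 0 T, BL a b B (fun x => pd a b T X 2 0 x t))
    (b4 : ∀ t ∈ Icc 0 T, BL a b B (fun x => pd a b T X 4 0 x t))
    (d0 : ∀ x ∈ Icc a b, ∀ t ∈ Icc 0 T, ‖pd a b T X 0 2 x t‖ ≤ A)
    (d2 : ∀ x ∈ Icc a b, ∀ t ∈ Icc 0 T, ‖pd a b T X 2 2 x t‖ ≤ A) (hA : ε * A ≤ B * θ)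
    (hX₀ : ∀ x ∈ Icc a b, X x 0 = E₀ x) (hg : ∀ x ∈ Icc a b, g x 0 = ε ^ α * ω₀ x)
    (bω : BL a b B (fun x => ε ^ β * ω₁ x)) (hL : √(b - a) ≤ B) (hτθ : τ ≤ θ) (hεθ : ε ≤ θ)
    (hτ1 : τ ≤ 1) (hθ2 : θ ≤ 4) :
    SchemeConsistent a b α β ε E₀ ω₀ ω₁ g τ B (B ^ 17 * (mesh a b M ^ 2 + (τ + ε) * θ)) M N
      (grid a b M τ X) (fun _ _ => 0) := by
  have hB := o0.four_le
  have hB0 : 0 ≤ B := by linarith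
  have hθ := o0.nonneg
  have h00 : (0 : ℝ) ∈ Icc 0 T := left_mem_Icc.2 hT.le
  have hA0 : 0 ≤ A := (norm_nonneg _).trans (d0 a (left_mem_Icc.2 hab.le) 0 h00)
  set δ := B ^ 17 * (mesh a b M ^ 2 + (τ + ε) * θ) with hδ
  have hδ1 : ∀ n ≤ 17, B ^ n * (mesh a b M ^ 2) ≤ δ := fun n hn => by
    rw [hδ]
    have : B ^ n ≤ B ^ 17 := pow_le_pow_right₀ (by linarith) hn
    gcongr
    have : 0 ≤ (τ + ε) * θ := by positivity
    linarith
  have hδ2 : ∀ n ≤ 17, B ^ n * (τ * θ) ≤ δ := fun n hn => by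
    rw [hδ]
    have : B ^ n ≤ B ^ 17 := pow_le_pow_right₀ (by linarith) hn
    gcongr
    have : 0 ≤ ε * θ := by positivity
    have : 0 ≤ mesh a b M ^ 2 := by positivity
    linarith
  have hδ3 : ∀ n ≤ 17, B ^ n * (ε * θ) ≤ δ := fun n hn => by
    rw [hδ]
    have : B ^ n ≤ B ^ 17 := pow_le_pow_right₀ (by linarith) hn
    gcongr
    have : 0 ≤ τ * θ := by positivity
    have : 0 ≤ mesh a b M ^ 2 := by positivity
    linarith
  have hδ0 : 0 ≤ δ := le_trans (by positivity) (hδ2 0 (by norm_num))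
  have pB : ∀ n, 4 * B ^ n ≤ B ^ (n + 1) := fun n => by rw [pow_succ]; nlinarith [pow_nonneg hB0 n]
  have mj : ∀ {j}, j ∈ Finset.Ico 1 M → node a b M j ∈ Icc a b := fun hj =>
    node_mem hab hM (Finset.mem_Ico.1 hj).2.le
  have c0 : ∀ i ≤ 1, ∀ x ∈ Icc a b, ∀ t ∈ Icc 0 T, ‖pd a b T X 0 i x t‖ ≤ B := by
    intro i hi x hx t ht
    interval_cases i
    · rw [pd_zero_zero]; simpa using (o0.bd t ht).1 x hx
    · simpa using (o1.bd t ht).1 x hx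
  have c2 : ∀ i ≤ 1, ∀ x ∈ Icc a b, ∀ t ∈ Icc 0 T, ‖pd a b T X 2 i x t‖ ≤ B := by
    intro i hi x hx t ht
    interval_cases i
    · exact (b2 t ht).1 x hx
    · simpa using (o2.bd t ht).1 x hx
  have ρ2 : ∀ x ∈ Icc a b, ∀ t ∈ Icc 0 T, ‖density a b T X 2 x t‖ ≤ 4 * B ^ 2 := by
    intro x hx t ht
    refine (abs_density_le (c := fun _ => B) (B := B ^ 2) (n := 1) (fun i hi => c0 i hi x hx t ht)
      (fun i hi => c2 i hi x hx t ht) (fun i hi => by rw [sq])).trans_eq (by norm_num)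
  have ρ3 : ∀ x ∈ Icc a b, ∀ t ∈ Icc 0 T, ‖density a b T X 3 x t‖ ≤ 8 * (B * (B + A)) := by
    intro x hx t ht
    refine (abs_density_le (c := fun i => if i ≤ 1 then B else A) (B := B * (B + A)) (n := 2)
      (fun i hi => ?_) (fun i hi => ?_) (fun i hi => ?_)).trans_eq (by norm_num)
    · split_ifs with h
      · exact c0 i h x hx t ht
      · obtain rfl : i = 2 := by omega
        exact d0 x hx t ht
    · split_ifs with h
      · exact c2 i h x hx t ht
      · obtain rfl : i = 2 := by omega
        exact d2 x hx t ht
    · have : 0 ≤ B * A := by positivity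
      have : 0 ≤ B * B := by positivity
      interval_cases i <;> norm_num <;> nlinarith
  have dρ : ∀ n < 4, ∀ x ∈ Icc a b, ∀ t ∈ Icc 0 T, HasDerivWithinAt (density a b T X n x)
      (density a b T X (n + 1) x t) (Icc 0 T) t := fun n hn x hx t ht =>
    hX.hasDerivWithinAt_density hab hT hn hx ht
  have hη : ∀ l, l + 2 ≤ N → ∀ j ∈ Finset.Ico 1 M,
      |ε ^ 2 * dt2 τ (grid a b M τ fun x t => ‖X x t‖ ^ 2) (l + 1) j| ≤ δ := by
    intro l hl j hj
    have := norm_second_difference_le hτ.le (level_inner hτ hN hl).1 (level_inner hτ hN hl).2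
      (dρ 0 (by norm_num) _ (mj hj)) (dρ 1 (by norm_num) _ (mj hj)) (ρ2 _ (mj hj))
    rw [dt2_grid, abs_mul, abs_of_nonneg (by positivity), ← Real.norm_eq_abs, norm_smul,
      Real.norm_of_nonneg (by positivity)]
    calc _ ≤ ε ^ 2 * ((τ ^ 2)⁻¹ * (2 * (4 * B ^ 2) * τ ^ 2)) := by gcongr; exact this
      _ = 8 * B ^ 2 * (ε * ε) := by field_simp; norm_num
      _ ≤ B ^ 4 * (ε * θ) := by
        have h2 := pB 2
        have h3 := pB 3
        norm_num at h2 h3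
        gcongr
        linarith [pow_nonneg hB0 2]
      _ ≤ δ := hδ3 4 (by norm_num)
  have hfirst : 1 ≤ N → _ := fun h1N => by
    have hτT : τ ≤ T := by
      have := (level_mem hτ hN h1N).2
      simpa using this
    have hsub : Icc 0 τ ⊆ Icc 0 T := Icc_subset_Icc le_rfl hτT
    have tay := BL.taylor_one (f := X) (f₁ := pd a b T X 0 1) hτ.le (A := B * θ) (fun x hx s hs =>
      (hX.smooth.hasDerivWithinAt_t hab hT (by norm_num) hx (hsub hs)).mono hsub)
      (fun s hs => by
        have := o1.osc s (hsub hs) 0 h00 (by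
          rw [sub_zero, abs_of_nonneg hs.1]; linarith [hs.2])
        simpa using this) (by positivity)
    have p3 := hX.phi3_bl (β := β) (ω₁ := ω₁) hT hX₀ (fun _ _ => rfl) hg hB
      (by simpa using o0.bd 0 h00)
      (b2 0 h00) (by simpa using o1.bd 0 h00) (by simpa using o2.bd 0 h00)
      (by simpa using og.bd 0 h00) bω
    have he := (tay.sub (p3.const_smul (τ ^ 2 / 2))).mono (B := B ^ 6 * (τ * θ)) (by
      rw [abs_of_nonneg (by positivity)]
      have h1 := pB 5
      have h2 : B ≤ B ^ 5 := le_self_pow₀ (by linarith) (by norm_num)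
      have h3 : τ ^ 2 / 2 * B ^ 5 ≤ B ^ 5 * (τ * θ) := by
        have : τ ^ 2 ≤ τ * θ := by rw [sq]; gcongr
        have : 0 ≤ B ^ 5 := by positivity
        nlinarith
      have h4 : B * θ * τ ≤ B ^ 5 * (τ * θ) := by
        calc B * θ * τ = B * (τ * θ) := by ring
          _ ≤ _ := by gcongr
      norm_num at h1
      have : (2 * B ^ 5) * (τ * θ) ≤ B ^ 6 * (τ * θ) := by gcongr; nlinarith [pow_nonneg hB0 5]
      linarith)
    have pp : ∀ x ∈ Icc a b, |- (τ ^ 2 / 2 * phi4 a b α ε E₀ ω₀ x)| ≤ B ^ 3 * (τ * θ) := by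
      intro x hx
      rw [abs_neg, abs_mul, abs_of_nonneg (by positivity), hX.phi4_eq hT hX₀ (fun _ _ => rfl) hg hx]
      have n1 : ‖pd a b T X 0 1 x 0 * starRingEnd ℂ (pd a b T X 2 0 x 0)
          + X x 0 * starRingEnd ℂ (pd a b T X 2 1 x 0)‖ ≤ B * B + B * B := by
        refine (norm_add_le _ _).trans (add_le_add ?_ ?_)
        · rw [norm_mul, RCLike.norm_conj]
          exact mul_le_mul (c0 1 le_rfl x hx 0 h00) (c2 0 (by norm_num) x hx 0 h00)
            (norm_nonneg _) hB0
        · rw [norm_mul, RCLike.norm_conj]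
          have := c0 0 (by norm_num) x hx 0 h00
          rw [pd_zero_zero] at this
          exact mul_le_mul this (c2 1 le_rfl x hx 0 h00) (norm_nonneg _) hB0
      have n2 := (Complex.abs_im_le_norm _).trans n1
      rw [abs_mul, abs_of_pos (by norm_num : (0 : ℝ) < 2)]
      have n3 : τ ^ 2 ≤ τ * θ := by rw [sq]; gcongr
      have n4 := pB 2
      norm_num at n4
      calc _ ≤ τ ^ 2 / 2 * (2 * (B * B + B * B)) := by gcongr
        _ = 2 * B ^ 2 * τ ^ 2 := by ring
        _ ≤ B ^ 3 * (τ * θ) := by gcongr; nlinarith [pow_nonneg hB0 2]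
    have bX1 : ∀ j ≤ M, ‖grid a b M τ X 1 j‖ ≤ B ^ 8 := fun j hj => by
      have := (o0.bd _ (level_mem hτ hN h1N)).1 _ (node_mem hab hM hj)
      exact this.trans (pow_le_pow_right₀ (by linarith) (by norm_num))
    have hA8 : B ^ 6 * (τ * θ) ≤ B ^ 8 := by
      have h1 := pB 6; have h2 := pB 7
      norm_num at h1 h2
      have h3 : τ * θ ≤ 1 * 4 := by gcongr
      have h4 : 0 ≤ B ^ 6 := by positivity
      nlinarith
    have h6 := hδ2 7 (by norm_num)
    refine first_level_le (B := B) (δ := δ) (C := B ^ 3 * (τ * θ)) (D := B ^ 8) (Y₁ := fun _ => 0)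
      (p₁ := firstF a b α ε E₀ ω₀ M τ) (X₁ := grid a b M τ X 1)
      (u₁ := firstE a b α β ε E₀ ω₀ ω₁ M τ) hab hM hτ hε hL he pp bX1 hA8 (fun j hj => ?_)
      (fun j hj => by simp [firstF]) ?_ ?_ ?_
    · have hx := node_mem (M := M) hab hM hj
      simp only [grid, firstE, Nat.cast_one, one_mul, ← hX₀ _ hx,
        hX.phi2_eq hT hX₀ (fun _ _ => rfl) hg hx, Complex.real_smul]
      ring
    · calc _ = B ^ 7 * (τ * θ) := by ring
        _ ≤ δ := h6
    · calc _ = B ^ 4 * (τ * θ) := by ring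
        _ ≤ δ := hδ2 4 (by norm_num)
    · calc _ = (B ^ 4 + 3 * B ^ 15) * (ε * θ) := by field_simp
        _ ≤ B ^ 16 * (ε * θ) := by
          gcongr
          have h1 := pB 15
          have h2 : B ^ 4 ≤ B ^ 15 := pow_le_pow_right₀ (by linarith) (by norm_num)
          norm_num at h1
          linarith
        _ ≤ δ := hδ3 16 (by norm_num)
  have e0 : grid a b M τ (fun _ _ => (0 : ℝ)) = fun _ _ => 0 := rfl
  have oz : Osc a b T τ B θ 1 (pd a b T (fun _ _ => (0 : ℝ)) 0 1) :=
    (Osc.zero hB hθ).congr fun x _ t _ => pd_zero_fun 0 1 x t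
  have main := hX.consistent (N := N) (M := M) (δ := δ) (ε := ε) (η₁ := fun _ _ => 0)
    (η₂ := densityResidual a b M N τ ε X) (u₁ := firstE a b α β ε E₀ ω₀ ω₁ M τ)
    (p₁ := firstF a b α ε E₀ ω₀ M τ) hab hT hτ hM hN o0 o1 o2 (Osc.zero hB hθ) oz og b4
    (by
      have h1 := hδ1 2 (by norm_num)
      refine le_trans ?_ h1
      gcongr
      nlinarith) (hδ2 8 (by norm_num)) ?_ (fun l _ j _ => ?_) (fun k hk j hj => ?_)
    (fun l hl j hj => ?_) (fun j hj => by
      rw [grid, Nat.cast_zero, zero_mul, hX₀ _ (node_mem hab hM hj)]) (fun _ _ => rfl)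
    (fun h => (hfirst h).1)
    (fun h => (hfirst h).2.1) (fun h => (hfirst h).2.2)
  · exact ⟨_, _, _, _, main⟩
  · intro l hl j hj
    have h2 : 2 ≤ N := by omega
    simp only [densityResidual, if_pos h2, e0]
    have h3 : max (l + 1) 1 = l + 1 := by omega
    rw [h3]
    have h4 : (grid a b M τ fun x t => ‖X x t‖ ^ 2) = fun k i => ‖grid a b M τ X k i‖ ^ 2 := rfl
    rw [h4]
    simp [dt2, dx2, avg]
  · rw [abs_zero]
    exact mul_nonneg hε.le hδ0
  · rw [densityResidual]
    split_ifs with h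
    · rw [abs_neg]
      obtain ⟨l, hl⟩ : ∃ l, max k 1 = l + 1 := ⟨max k 1 - 1, by omega⟩
      rw [hl]
      exact hη l (by omega) j hj
    · rw [abs_zero]
      exact hδ0
  · have h2 : 2 ≤ N := by omega
    simp only [densityResidual, if_pos h2]
    rcases l with _ | l
    · simp only [max_eq_right zero_le_one, zero_add, max_self, sub_self, abs_zero]
      exact mul_nonneg hτ.le hδ0
    · have m1 : max (l + 1 + 1) 1 = l + 1 + 1 := by omega
      have m2 : max (l + 1) 1 = l + 1 := by omega
      have i1 := level_inner hτ hN (l := l) (by omega)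
      have i2 := level_inner hτ hN hl
      have et : ((l + 1 + 1 : ℕ) : ℝ) * τ = ((l + 1 : ℕ) : ℝ) * τ + τ := by push_cast; ring
      rw [et] at i2
      have := norm_third_difference_le hτ.le i1.1 i2.2 (dρ 0 (by norm_num) _ (mj hj))
        (dρ 1 (by norm_num) _ (mj hj)) (dρ 2 (by norm_num) _ (mj hj)) (ρ3 _ (mj hj))
      rw [m1, m2, dt2_grid, dt2_grid, et]
      rw [add_sub_cancel_right]
      have e5 : ∀ p q : ℝ, |-(ε ^ 2 * ((τ ^ 2)⁻¹ • p)) - -(ε ^ 2 * ((τ ^ 2)⁻¹ • q))|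
          = ε ^ 2 * (τ ^ 2)⁻¹ * ‖p - q‖ := fun p q => by
        have : -(ε ^ 2 * ((τ ^ 2)⁻¹ • p)) - -(ε ^ 2 * ((τ ^ 2)⁻¹ • q))
          = -((ε ^ 2 * (τ ^ 2)⁻¹) * (p - q)) := by simp only [smul_eq_mul]; ring
        rw [this, abs_neg, abs_mul, abs_of_nonneg (by positivity), Real.norm_eq_abs]
      rw [e5]
      have e6 : ε ^ 2 * A ≤ B * (ε * θ) := by nlinarith
      have e7 : ε ^ 2 ≤ ε * θ := by rw [sq]; gcongr
      calc _ ≤ ε ^ 2 * (τ ^ 2)⁻¹ * (2 * (8 * (B * (B + A)) * τ) * τ ^ 2) := by gcongr; exact this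
        _ = τ * (16 * B * (B * ε ^ 2 + ε ^ 2 * A)) := by field_simp; norm_num
        _ ≤ τ * (16 * B * (B * (ε * θ) + B * (ε * θ))) := by gcongr
        _ = τ * (32 * B ^ 2 * (ε * θ)) := by ring
        _ ≤ τ * (B ^ 5 * (ε * θ)) := by
          have h2 := pB 2
          have h3 := pB 3
          have h4 := pB 4
          norm_num at h2 h3 h4
          gcongr
          linarith [pow_nonneg hB0 2]
        _ ≤ τ * δ := by gcongr; exact hδ3 5 (by norm_num)

end NLS

section WaveEquation

variable {a b T α β ε B τ : ℝ} {M N : ℕ} {g F : ℝ → ℝ → ℝ} {X : ℝ → ℝ → ℂ} {E₀ : ℝ → ℂ}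
  {ω₀ ω₁ : ℝ → ℝ}

lemma IsSchrodinger.phi3_eq_pd (hX : IsSchrodinger a b T g F X) (hab : a < b) (hT : 0 < T)
    (hX₀ : ∀ x ∈ Icc a b, X x 0 = E₀ x) (hY₀ : ∀ x ∈ Icc a b, F x 0 = 0)
    (hY₁ : ∀ x ∈ Icc a b, pd a b T F 0 1 x 0 = 0)
    (hg : ∀ x ∈ Icc a b, g x 0 = ε ^ α * ω₀ x)
    (hg₁ : ∀ x ∈ Icc a b, HasDerivWithinAt (g x) (ε ^ β * ω₁ x) (Icc 0 T) 0) {x : ℝ}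
    (hx : x ∈ Icc a b) : phi3 a b α β ε E₀ ω₀ ω₁ x = pd a b T X 0 2 x 0 := by
  have h0 : (0 : ℝ) ∈ Icc 0 T := left_mem_Icc.2 hT.le
  have e : ∀ t ∈ Icc 0 T, pd a b T X 0 1 x t = Complex.I * (pd a b T X 2 0 x t
      + ((density a b T X 0 x t - F x t - g x t : ℝ) : ℂ) * X x t) := fun t ht => by
    have h := hX.eqn x hx t ht
    rw [density]
    linear_combination (-Complex.I) * h + pd a b T X 0 1 x t * Complex.I_mul_I
  have dF := hX.smoothY.hasDerivWithinAt_t hab hT (by norm_num) hx h0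
  have dX := hX.smooth.hasDerivWithinAt_t hab hT (by norm_num) hx h0
  have d := (((hX.smooth.hasDerivWithinAt_pd_t hab hT (m := 2) (n := 0) (by norm_num) hx h0).add
    (((((hX.hasDerivWithinAt_density hab hT (n := 0) (by norm_num) hx h0).sub dF).sub
      (hg₁ x hx)).ofReal_comp).mul dX)).const_mul Complex.I).congr e (e 0 h0)
  have := (uniqueDiffOn_Icc hT 0 h0).eq_deriv _
    (hX.smooth.hasDerivWithinAt_pd_t hab hT (m := 0) (n := 1) (by norm_num) hx h0) d
  rw [this, hX.phi3_eq hT hX₀ hY₀ hg hx, hY₁ x hx, Pi.sub_apply, Pi.sub_apply, hY₀ x hx]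
  simp [density, flux, pd_zero_zero, mul_comm]
  ring

lemma pd_normSq_two (hX : IsSchrodinger a b T g F X) (hab : a < b) (hT : 0 < T) {x t : ℝ}
    (hx : x ∈ Icc a b) (ht : t ∈ Icc 0 T) :
    pd a b T (fun y s => ‖X y s‖ ^ 2) 0 2 x t = density a b T X 2 x t := by
  have h1 : ∀ s ∈ Icc 0 T, pd a b T (fun y s => ‖X y s‖ ^ 2) 0 1 x s = density a b T X 1 x s := by
    intro s hs
    rw [pd_zero_succ]
    simp only [pd_zero_zero]
    exact (hX.hasDerivWithinAt_density hab hT (n := 0) (by norm_num) hx hs).derivWithin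
      (uniqueDiffOn_Icc hT s hs)
  rw [pd_zero_succ, derivWithin_congr h1 (h1 t ht)]
  exact (hX.hasDerivWithinAt_density hab hT (n := 1) (by norm_num) hx ht).derivWithin
      (uniqueDiffOn_Icc hT t ht)

lemma IsSchrodinger.continuousOn_density_two (hX : IsSchrodinger a b T g F X) (hab : a < b)
    (hT : 0 < T) : ContinuousOn (fun p : ℝ × ℝ => density a b T X 2 p.1 p.2) (rect a b T) := by
  have h : ∀ {m n}, m + n ≤ 2 →
      ContinuousOn (fun p : ℝ × ℝ => flux a b T X m n p.1 p.2) (rect a b T) := fun {m n} hmn =>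
    (Complex.continuous_conj.comp_continuousOn (hX.smooth.continuousOn_pd hab hT (by omega))).mul
      (hX.smooth.continuousOn_pd hab hT (by omega))
  simp only [density]
  exact continuousOn_const.mul (Complex.continuous_im.comp_continuousOn
    (continuousOn_finsetSum _ fun i hi => continuousOn_const.mul (h (by
      have := Finset.mem_range.1 hi; omega))))

/-- The wave equation holds up to the boundary. -/
lemma IsSchrodinger.wave_eq (hX : IsSchrodinger a b T g F X) (hab : a < b) (hT : 0 < T)
    (h : ∀ x ∈ Ioo a b, ∀ t ∈ Ioc 0 T, ε ^ 2 * pd a b T F 0 2 x t - pd a b T F 2 0 x t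
      - ε ^ 2 * pd a b T (fun y s => ‖X y s‖ ^ 2) 0 2 x t = 0) {x t : ℝ} (hx : x ∈ Icc a b)
    (ht : t ∈ Icc 0 T) : ε ^ 2 * pd a b T F 0 2 x t
      = pd a b T F 2 0 x t + ε ^ 2 * density a b T X 2 x t := by
  refine eqOn_rect (f := fun x t => ε ^ 2 * pd a b T F 0 2 x t)
    (g := fun x t => pd a b T F 2 0 x t + ε ^ 2 * density a b T X 2 x t) hab hT
    (continuousOn_const.mul (hX.smoothY.continuousOn_pd hab hT (by norm_num)))
    ((hX.smoothY.continuousOn_pd hab hT (by norm_num)).add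
      (continuousOn_const.mul (hX.continuousOn_density_two hab hT))) (fun x hx t ht => ?_) hx ht
  have := h x hx t ht
  rw [pd_normSq_two hX hab hT (Ioo_subset_Icc_self hx) (Ioc_subset_Icc_self ht)] at this
  linarith

/-- The residual of the discrete wave equation. -/
noncomputable def waveResidual (a b : ℝ) (M : ℕ) (τ ε : ℝ) (F : ℝ → ℝ → ℝ) (X : ℝ → ℝ → ℂ)
    (k j : ℕ) : ℝ :=
  ε ^ 2 * dt2 τ (grid a b M τ F) k j - dx2 (mesh a b M) (avg (grid a b M τ F) k) j
    - ε ^ 2 * dt2 τ (fun k i => ‖grid a b M τ X k i‖ ^ 2) k j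

set_option maxHeartbeats 1000000 in
lemma IsSchrodinger.waveResidual_le (hX : IsSchrodinger a b T g F X) (hab : a < b) (hT : 0 < T)
    (hτ : 0 < τ) (hM : 1 ≤ M) (hN : N * τ ≤ T) (hε : 0 < ε) (hε1 : ε ≤ 1) (hB : 4 ≤ B)
    (hw : ∀ x ∈ Icc a b, ∀ t ∈ Icc 0 T, ε ^ 2 * pd a b T F 0 2 x t
      = pd a b T F 2 0 x t + ε ^ 2 * density a b T X 2 x t)
    (hE : ∀ i ≤ 3, ∀ x ∈ Icc a b, ∀ t ∈ Icc 0 T,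
      ‖pd a b T X 0 i x t‖ ≤ B / ε ^ (i - 1) ∧ ‖pd a b T X 2 i x t‖ ≤ B / ε ^ (i - 1))
    (hF : ∀ x ∈ Icc a b, ∀ t ∈ Icc 0 T, ‖pd a b T F 0 4 x t‖ ≤ B / ε ^ 2 ∧
      ‖pd a b T F 4 0 x t‖ ≤ B * ε ^ 2 ∧ ‖pd a b T F 2 2 x t‖ ≤ B) {l : ℕ} (hl : l + 2 ≤ N) {j : ℕ}
    (hj : j ∈ Finset.Ico 1 M) :
    |waveResidual a b M τ ε F X (l + 1) j| ≤ B ^ 5 * (ε ^ 2 * mesh a b M ^ 2 + τ ^ 2) := by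
  obtain ⟨i1, i2⟩ := level_inner hτ hN hl
  have hB0 : 0 ≤ B := by linarith
  have hx := node_mem (a := a) (b := b) (M := M) hab hM (Finset.mem_Ico.1 hj).2.le
  rw [waveResidual, dt2_grid]
  set t := ((l + 1 : ℕ) : ℝ) * τ with ht
  have ht' : t ∈ Icc 0 T := ⟨by linarith, by linarith⟩
  have hsub : Icc (t - τ) (t + τ) ⊆ Icc 0 T := Icc_subset_Icc i1 i2
  have dF : ∀ m n, m + n + 1 ≤ 6 → ∀ s ∈ Icc 0 T, HasDerivWithinAt
      (fun s => pd a b T F m n (node a b M j) s) (pd a b T F m (n + 1) (node a b M j) s)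
      (Icc 0 T) s := fun m n h s hs => hX.smoothY.hasDerivWithinAt_pd_t hab hT h hx hs
  have e00 : ∀ y s, pd a b T F 0 0 y s = F y s := pd_zero_zero
  have t1 := norm_second_difference_sub_le hτ.le i1 i2 (dF 0 0 (by norm_num)) (dF 0 1 (by norm_num))
    (dF 0 2 (by norm_num)) (dF 0 3 (by norm_num)) (fun s hs => (hF _ hx s hs).1)
  simp only [e00] at t1
  have t2 := norm_dx2_sub_le hab hM (f := fun i x => tavg τ t (pd a b T F i 0 x)) (B := B * ε ^ 2)
    (fun i hi x hx => tavg_hasDerivWithinAt (fun s hs =>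
      hX.smoothY.hasDerivWithinAt_pd_x hab hT (by omega) hx hs) hτ i1 i2) (fun x hx => by
      rw [tavg, norm_smul, Real.norm_of_nonneg (by norm_num)]
      have q1 := (hF x hx (t + τ) ⟨by linarith, i2⟩).2.1
      have q2 := (hF x hx (t - τ) ⟨i1, by linarith⟩).2.1
      have := norm_add_le (pd a b T F 4 0 x (t + τ)) (pd a b T F 4 0 x (t - τ))
      linarith) hj
  have e01 : (fun i => tavg τ t (pd a b T F 0 0 (node a b M i)))
      = avg (grid a b M τ F) (l + 1) := funext fun i => by
    rw [avg_grid, funext (e00 (node a b M i))]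
  simp only [e01] at t2
  have t3 := norm_second_difference_le hτ.le i1 i2 (dF 2 0 (by norm_num)) (dF 2 1 (by norm_num))
    (fun s hs => (hF _ hx s hs).2.2)
  have t4 := norm_second_difference_sub_le hτ.le i1 i2
    (fun s hs => hX.hasDerivWithinAt_density hab hT (n := 0) (by norm_num) hx hs)
    (fun s hs => hX.hasDerivWithinAt_density hab hT (n := 1) (by norm_num) hx hs)
    (fun s hs => hX.hasDerivWithinAt_density hab hT (n := 2) (by norm_num) hx hs)
    (fun s hs => hX.hasDerivWithinAt_density hab hT (n := 3) (by norm_num) hx hs)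
    (B := 16 * (B ^ 2 / ε ^ 2)) (fun s hs => by
      refine (abs_density_le (n := 3) (c := fun i => B / ε ^ (i - 1)) (B := B ^ 2 / ε ^ 2)
        (fun i hi => (hE i hi _ hx s hs).1) (fun i hi => (hE i hi _ hx s hs).2)
        (fun i hi => ?_)).trans_eq (by norm_num)
      have h1 : ∀ m ≤ 2, B * B / ε ^ m ≤ B ^ 2 / ε ^ 2 := fun m hm => by
        rw [sq B]
        have : ε ^ 2 ≤ ε ^ m := pow_le_pow_of_le_one hε.le hε1 hm
        gcongr
      rw [div_mul_div_comm, ← pow_add]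
      refine h1 _ ?_
      omega)
  have hdd := dt2_grid (a := a) (b := b) (M := M) (τ := τ) (fun x t => ‖X x t‖ ^ 2) l j
  have e4 : (fun k i => ‖grid a b M τ X k i‖ ^ 2) = grid a b M τ fun x t => ‖X x t‖ ^ 2 := rfl
  rw [e4, hdd, ← ht]
  simp only [density, smul_eq_mul, tavg, Real.norm_eq_abs] at t1 t2 t3 t4 ⊢
  have hwt := hw _ hx t ht'
  set D := dx2 (mesh a b M) (avg (grid a b M τ F) (l + 1)) j
  set f2 := pd a b T F 2 0 (node a b M j) t
  set fp := pd a b T F 2 0 (node a b M j) (t + τ)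
  set fm := pd a b T F 2 0 (node a b M j) (t - τ)
  set P := F (node a b M j) (t + τ) - 2 * F (node a b M j) t + F (node a b M j) (t - τ)
  set R := ‖X (node a b M j) (t + τ)‖ ^ 2 - 2 * ‖X (node a b M j) t‖ ^ 2
    + ‖X (node a b M j) (t - τ)‖ ^ 2
  have hd2 : density a b T X 2 (node a b M j) t
      = -2 * (∑ i ∈ Finset.range (1 + 1), ((1 : ℕ).choose i : ℂ) * flux a b T X i (1 - i) (node a b M j) t).im := rfl
  rw [← hd2] at t4
  set r2 := density a b T X 2 (node a b M j) t
  set F2 := pd a b T F 0 2 (node a b M j) t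
  have hτ2 : 0 < τ ^ 2 := by positivity
  have split : ε ^ 2 * ((τ ^ 2)⁻¹ * P) - D - ε ^ 2 * ((τ ^ 2)⁻¹ * R)
      = ε ^ 2 * (τ ^ 2)⁻¹ * (P - τ ^ 2 * F2) - (D - 2⁻¹ * (fp + fm)) - 2⁻¹ * (fp - 2 * f2 + fm)
        - ε ^ 2 * (τ ^ 2)⁻¹ * (R - τ ^ 2 * r2) := by
    have : ε ^ 2 * (τ ^ 2)⁻¹ * (τ ^ 2 * F2) = ε ^ 2 * F2 := by field_simp
    have h2 : ε ^ 2 * (τ ^ 2)⁻¹ * (τ ^ 2 * r2) = ε ^ 2 * r2 := by field_simp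
    linear_combination this - h2 + hwt
  have s1 : |ε ^ 2 * (τ ^ 2)⁻¹ * (P - τ ^ 2 * F2)| ≤ 2 * B * τ ^ 2 := by
    rw [abs_mul, abs_of_nonneg (by positivity)]
    calc _ ≤ ε ^ 2 * (τ ^ 2)⁻¹ * (2 * (B / ε ^ 2) * τ ^ 4) := by gcongr
      _ = _ := by field_simp
  have s4 : |ε ^ 2 * (τ ^ 2)⁻¹ * (R - τ ^ 2 * r2)| ≤ 32 * B ^ 2 * τ ^ 2 := by
    rw [abs_mul, abs_of_nonneg (by positivity)]
    calc _ ≤ ε ^ 2 * (τ ^ 2)⁻¹ * (2 * (16 * (B ^ 2 / ε ^ 2)) * τ ^ 4) := by gcongr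
      _ = _ := by field_simp; norm_num
  rw [split]
  have s2 := abs_sub (ε ^ 2 * (τ ^ 2)⁻¹ * (P - τ ^ 2 * F2)) (D - 2⁻¹ * (fp + fm))
  have s3 : |2⁻¹ * (fp - 2 * f2 + fm)| ≤ B * τ ^ 2 := by
    rw [abs_mul, abs_of_pos (by norm_num : (0 : ℝ) < 2⁻¹)]; linarith
  have u1 := abs_sub (ε ^ 2 * (τ ^ 2)⁻¹ * (P - τ ^ 2 * F2) - (D - 2⁻¹ * (fp + fm)))
    (2⁻¹ * (fp - 2 * f2 + fm))
  have u2 := abs_sub (ε ^ 2 * (τ ^ 2)⁻¹ * (P - τ ^ 2 * F2) - (D - 2⁻¹ * (fp + fm))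
    - 2⁻¹ * (fp - 2 * f2 + fm)) (ε ^ 2 * (τ ^ 2)⁻¹ * (R - τ ^ 2 * r2))
  have v1 : B * 256 ≤ B ^ 5 := by
    have : (4 : ℝ) ^ 4 ≤ B ^ 4 := by gcongr
    calc B * 256 = B * 4 ^ 4 := by norm_num
      _ ≤ B * B ^ 4 := by gcongr
      _ = B ^ 5 := by ring
  have v2 : B ^ 2 * 64 ≤ B ^ 5 := by
    have : (4 : ℝ) ^ 3 ≤ B ^ 3 := by gcongr
    calc B ^ 2 * 64 = B ^ 2 * 4 ^ 3 := by norm_num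
      _ ≤ B ^ 2 * B ^ 3 := by gcongr
      _ = B ^ 5 := by ring
  have v3 : 2 * (B * ε ^ 2) * mesh a b M ^ 2 ≤ B ^ 5 * (ε ^ 2 * mesh a b M ^ 2) := by
    calc _ = (2 * B) * (ε ^ 2 * mesh a b M ^ 2) := by ring
      _ ≤ _ := by gcongr; linarith
  have v4 : (3 * B + 32 * B ^ 2) * τ ^ 2 ≤ B ^ 5 * τ ^ 2 := by gcongr; linarith
  linarith

set_option maxHeartbeats 1000000 in
lemma IsSchrodinger.consistent_wave (hX : IsSchrodinger a b T g F X) (hab : a < b) (hT : 0 < T)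
    (hτ : 0 < τ) (hM : 1 ≤ M) (hN : N * τ ≤ T) (hε : 0 < ε) (hε1 : ε ≤ 1) (hτε : τ ≤ ε)
    (o0 : Osc a b T τ B (2 * (τ / ε)) 1 X) (o1 : Osc a b T τ B (2 * (τ / ε)) 1 (pd a b T X 0 1))
    (o2 : Osc a b T τ B (2 * (τ / ε)) 1 (pd a b T X 2 1)) (oF : Osc a b T τ B (2 * (τ / ε)) 1 F)
    (oF1 : Osc a b T τ B (2 * (τ / ε)) 1 (pd a b T F 0 1)) (og : Osc a b T τ B (2 * (τ / ε)) 1 g)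
    (b4 : ∀ t ∈ Icc 0 T, BL a b B (fun x => pd a b T X 4 0 x t))
    (hw : ∀ x ∈ Icc a b, ∀ t ∈ Icc 0 T, ε ^ 2 * pd a b T F 0 2 x t
      = pd a b T F 2 0 x t + ε ^ 2 * density a b T X 2 x t)
    (hE : ∀ i ≤ 3, ∀ x ∈ Icc a b, ∀ t ∈ Icc 0 T,
      ‖pd a b T X 0 i x t‖ ≤ B / ε ^ (i - 1) ∧ ‖pd a b T X 2 i x t‖ ≤ B / ε ^ (i - 1))
    (hF : ∀ x ∈ Icc a b, ∀ t ∈ Icc 0 T, ‖pd a b T F 0 4 x t‖ ≤ B / ε ^ 2 ∧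
      ‖pd a b T F 4 0 x t‖ ≤ B * ε ^ 2 ∧ ‖pd a b T F 2 2 x t‖ ≤ B)
    (bE3 : ∀ t ∈ Icc 0 T, BL a b (B / ε ^ 2) (fun x => pd a b T X 0 3 x t))
    (bF3 : ∀ t ∈ Icc 0 T, BL a b (B / ε) (fun x => pd a b T F 0 3 x t))
    (hX₀ : ∀ x ∈ Icc a b, X x 0 = E₀ x) (hF₀ : ∀ x ∈ Icc a b, F x 0 = 0)
    (hF₁ : ∀ x ∈ Icc a b, pd a b T F 0 1 x 0 = 0) (hg : ∀ x ∈ Icc a b, g x 0 = ε ^ α * ω₀ x)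
    (hg₁ : ∀ x ∈ Icc a b, HasDerivWithinAt (g x) (ε ^ β * ω₁ x) (Icc 0 T) 0)
    (hL : √(b - a) ≤ B) :
    SchemeConsistent a b α β ε E₀ ω₀ ω₁ g τ B (B ^ 17 * (mesh a b M ^ 2 + τ ^ 2 / ε)) M N
      (grid a b M τ X) (grid a b M τ F) := by
  have hB := o0.four_le
  have hB0 : 0 ≤ B := by linarith
  have h00 : (0 : ℝ) ∈ Icc 0 T := left_mem_Icc.2 hT.le
  set δ := B ^ 17 * (mesh a b M ^ 2 + τ ^ 2 / ε) with hδ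
  have hδ1 : ∀ n ≤ 17, B ^ n * (mesh a b M ^ 2 + τ ^ 2 / ε) ≤ δ := fun n hn => by
    rw [hδ]
    have : B ^ n ≤ B ^ 17 := pow_le_pow_right₀ (by linarith) hn
    gcongr
  have hδ2 : ∀ n ≤ 17, B ^ n * (τ ^ 2 / ε) ≤ δ := fun n hn => by
    refine le_trans ?_ (hδ1 n hn)
    gcongr
    have : 0 ≤ mesh a b M ^ 2 := by positivity
    linarith
  have hδ0 : 0 ≤ δ := le_trans (by positivity) (hδ2 0 (by norm_num))
  have pB : ∀ n, 4 * B ^ n ≤ B ^ (n + 1) := fun n => by rw [pow_succ]; nlinarith [pow_nonneg hB0 n]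
  have hfirst : 1 ≤ N → _ := fun h1N => by
    have hτT : τ ≤ T := by
      have := (level_mem hτ hN h1N).2
      simpa using this
    have hsub : Icc 0 τ ⊆ Icc 0 T := Icc_subset_Icc le_rfl hτT
    have dX := fun n hn x hx s hs => (hX.smooth.hasDerivWithinAt_pd_t hab hT (m := 0) (n := n)
      hn (x := x) hx (hsub (a := s) hs)).mono hsub
    have dY := fun n hn x hx s hs => (hX.smoothY.hasDerivWithinAt_pd_t hab hT (m := 0) (n := n)
      hn (x := x) hx (hsub (a := s) hs)).mono hsub
    have he := BL.taylor_two (f := pd a b T X 0 0) (f₁ := pd a b T X 0 1) (f₂ := pd a b T X 0 2)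
      (f₃ := pd a b T X 0 3) (A := B / ε ^ 2) hτ.le
      (dX 0 (by norm_num)) (dX 1 (by norm_num)) (dX 2 (by norm_num))
      (fun s hs => bE3 s (hsub hs)) (by positivity)
    have hp := BL.taylor_two (f := pd a b T F 0 0) (f₁ := pd a b T F 0 1) (f₂ := pd a b T F 0 2)
      (f₃ := pd a b T F 0 3) (A := B / ε) hτ.le
      (dY 0 (by norm_num)) (dY 1 (by norm_num)) (dY 2 (by norm_num))
      (fun s hs => bF3 s (hsub hs)) (by positivity)
    simp only [pd_zero_zero] at he hp
    have q1 : B / ε ^ 2 * τ ^ 3 ≤ B * (τ ^ 2 / ε) := by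
      have : B / ε ^ 2 * τ ^ 3 = B * (τ ^ 2 / ε) * (τ / ε) := by field_simp
      rw [this]
      exact mul_le_of_le_one_right (by positivity) ((div_le_one hε).2 hτε)
    have q2 : B / ε * τ ^ 3 ≤ B * (τ ^ 2 / ε) := by
      have : B / ε * τ ^ 3 = B * (τ ^ 2 / ε) * τ := by field_simp
      rw [this]
      exact mul_le_of_le_one_right (by positivity) (hτε.trans hε1)
    have q3 : τ ^ 2 / ε ≤ 1 := by
      rw [div_le_one hε]; nlinarith
    have bX1 : ∀ j ≤ M, ‖grid a b M τ X 1 j‖ ≤ B := fun j hj => by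
      have := (o0.bd _ (level_mem hτ hN h1N)).1 _ (node_mem hab hM hj)
      rw [pow_one] at this
      exact this
    refine first_level_le (B := B) (δ := δ) (A := B / ε ^ 2 * τ ^ 3) (C := B / ε * τ ^ 3) (D := B)
      (Y₁ := grid a b M τ F 1)
      (p₁ := firstF a b α ε E₀ ω₀ M τ) (X₁ := grid a b M τ X 1)
      (u₁ := firstE a b α β ε E₀ ω₀ ω₁ M τ) hab hM hτ hε hL he hp.1 bX1
      (q1.trans (mul_le_of_le_one_right hB0 q3)) (fun j hj => ?_)
      (fun j hj => ?_) ?_ ?_ ?_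
    · have hx := node_mem (a := a) (b := b) (M := M) hab hM hj
      simp only [grid, firstE, Nat.cast_one, one_mul, ← hX₀ _ hx,
        hX.phi2_eq hT hX₀ hF₀ hg hx, hX.phi3_eq_pd hab hT hX₀ hF₀ hF₁ hg hg₁ hx, Complex.real_smul]
      ring
    · have hx := node_mem (a := a) (b := b) (M := M) hab hM hj
      have e2 : pd a b T F 0 2 (node a b M j) 0 = phi4 a b α ε E₀ ω₀ (node a b M j) := by
        have h1 := hw _ hx 0 h00
        have h2 : pd a b T F 2 0 (node a b M j) 0 = 0 := by
          refine Eq.trans ?_ (pd_zero_fun (a := a) (b := b) (T := T) 2 0 (node a b M j) 0)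
          simp only [pd, iteratedDerivWithin_zero]
          exact iteratedDerivWithin_congr hF₀ hx
        rw [h2, zero_add] at h1
        rw [mul_left_cancel₀ (by positivity) h1, hX.phi4_eq hT hX₀ hF₀ hg hx]
        simp [density, flux, Finset.sum_range_succ, pd_zero_zero]
        ring
      simp only [grid, firstF, Nat.cast_one, one_mul, hF₀ _ hx, hF₁ _ hx, e2, smul_eq_mul]
      ring
    · calc _ ≤ B * (B * (τ ^ 2 / ε)) := by gcongr
        _ = B ^ 2 * (τ ^ 2 / ε) := by ring
        _ ≤ δ := hδ2 2 (by norm_num)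
    · calc _ ≤ B * (B * (τ ^ 2 / ε)) := by gcongr
        _ = B ^ 2 * (τ ^ 2 / ε) := by ring
        _ ≤ δ := hδ2 2 (by norm_num)
    · calc _ = B ^ 2 * (τ ^ 2) + 3 * B ^ 3 * (τ ^ 2 / ε) := by field_simp
        _ ≤ B ^ 2 * (τ ^ 2 / ε) + 3 * B ^ 3 * (τ ^ 2 / ε) := by
          gcongr
          exact le_div_self (by positivity) hε hε1
        _ = (B ^ 2 + 3 * B ^ 3) * (τ ^ 2 / ε) := by ring
        _ ≤ B ^ 4 * (τ ^ 2 / ε) := by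
          have h2 := pB 2
          have h3 := pB 3
          norm_num at h2 h3
          gcongr
          linarith [pow_nonneg hB0 2]
        _ ≤ δ := hδ2 4 (by norm_num)
  refine ⟨_, _, waveResidual a b M τ ε F X, fun _ _ => 0, hX.consistent hab hT hτ hM hN o0 o1 o2 oF oF1 og b4 ?_ ?_
    (fun l hl j hj => ?_) (fun l hl j hj => ?_) (fun k hk j hj => ?_)
    (fun l hl j hj => ?_) (fun j hj => by
      rw [grid, Nat.cast_zero, zero_mul, hX₀ _ (node_mem hab hM hj)]) (fun j hj => by
      rw [grid, Nat.cast_zero, zero_mul, hF₀ _ (node_mem hab hM hj)])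
    (fun h => (hfirst h).1) (fun h => (hfirst h).2.1)
    (fun h => (hfirst h).2.2)⟩
  · refine le_trans ?_ (hδ1 2 (by norm_num))
    have h1 : 0 ≤ τ ^ 2 / ε := by positivity
    have h2 : 2 * B ≤ B ^ 2 := by nlinarith
    have h3 : 0 ≤ B ^ 2 * (τ ^ 2 / ε) := by positivity
    have h4 : 2 * B * mesh a b M ^ 2 ≤ B ^ 2 * mesh a b M ^ 2 := by gcongr
    linarith
  · refine le_trans ?_ (hδ2 9 (by norm_num))
    have h1 := pB 8
    norm_num at h1
    calc _ = (2 * B ^ 8) * (τ ^ 2 / ε) := by field_simp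
      _ ≤ _ := by gcongr; linarith [pow_nonneg hB0 8]
  · rw [waveResidual]; ring
  · refine (hX.waveResidual_le hab hT hτ hM hN hε hε1 hB hw hE hF hl hj).trans ?_
    calc _ ≤ B ^ 5 * (ε * mesh a b M ^ 2 + τ ^ 2) := by gcongr; nlinarith
      _ = ε * (B ^ 5 * (mesh a b M ^ 2 + τ ^ 2 / ε)) := by field_simp
      _ ≤ _ := by gcongr; exact hδ1 5 (by norm_num)
  · rw [abs_zero]; exact hδ0
  · simp only [sub_self, abs_zero]; exact mul_nonneg hτ.le hδ0

end WaveEquation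

section Setting

/-- The hypotheses on the continuous problems. -/
structure Setting (a b T α β K ε : ℝ) (E₀ : ℝ → ℂ) (ω₀ ω₁ : ℝ → ℝ) (G₁ G₂ : ℝ → ℝ → ℝ)
    (E : ℝ → ℝ → ℂ) (F : ℝ → ℝ → ℝ) (E' : ℝ → ℝ → ℂ) : Prop where
  hab : a < b
  hT : 0 < T
  hα : 0 ≤ α
  hβ : 0 ≤ β
  hε : 0 < ε
  hε1 : ε ≤ 1
  wave₁ : IsWaveSolution a b ω₀ (fun _ => 0) G₁
  wave₂ : IsWaveSolution a b (fun _ => 0) ω₁ G₂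
  zs : IsZSSolution a b T ε (oscG α β ε G₁ G₂) E₀ E F
  nls : IsNLSEOPSolution a b T ε (oscG α β ε G₁ G₂) E₀ E'
  bdA : AssumptionA a b T α ε K E F E'
  bdB : AssumptionB a b K E₀ ω₀ ω₁
  bdC : AssumptionC a b T ε K E E'

/-- A bound for the norms of the data, in terms of which the constants are expressed. -/
noncomputable def baseConst (a b K : ℝ) : ℝ := 4 + 8 * |K| * (2 + (b - a)) + (b - a) + (b - a)⁻¹

/-- A bound for the solutions and their time derivatives. -/
noncomputable def bigConst (a b K : ℝ) : ℝ := baseConst a b K ^ 12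

variable {a b T α β K ε τ : ℝ} {E₀ : ℝ → ℂ} {ω₀ ω₁ : ℝ → ℝ} {G₁ G₂ : ℝ → ℝ → ℝ}
    {E : ℝ → ℝ → ℂ} {F : ℝ → ℝ → ℝ} {E' : ℝ → ℝ → ℂ} {M N : ℕ}

lemma baseConst_bounds (hab : a < b) : 4 ≤ baseConst a b K ∧ 8 * |K| ≤ baseConst a b K ∧
    4 * |K| * (1 + (b - a)) ≤ baseConst a b K ∧ b - a ≤ baseConst a b K ∧
    1 ≤ baseConst a b K * (b - a) ∧ √(b - a) ≤ baseConst a b K := by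
  have hL : 0 < b - a := by linarith
  have hK := abs_nonneg K
  have hLi : 0 < (b - a)⁻¹ := by positivity
  have hKL : 0 ≤ |K| * (b - a) := by positivity
  have e : baseConst a b K = 4 + 16 * |K| + 8 * (|K| * (b - a)) + (b - a) + (b - a)⁻¹ := by
    rw [baseConst]; ring
  have h5 : (b - a)⁻¹ ≤ baseConst a b K := by rw [e]; linarith
  refine ⟨by rw [e]; linarith, by rw [e]; linarith, by rw [e]; linarith, by rw [e]; linarith, ?_, ?_⟩
  · calc (1 : ℝ) = (b - a)⁻¹ * (b - a) := by field_simp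
      _ ≤ _ := by gcongr
  · rw [Real.sqrt_le_left (by rw [e]; positivity)]
    have : 4 + (b - a) ≤ baseConst a b K := by rw [e]; linarith
    nlinarith

lemma bigConst_bounds (hab : a < b) : 4 ≤ bigConst a b K ∧ baseConst a b K ≤ bigConst a b K ∧
    8 * |K| ≤ bigConst a b K ∧ b - a ≤ bigConst a b K ∧
    1 ≤ bigConst a b K * (b - a) ∧ √(b - a) ≤ bigConst a b K := by
  obtain ⟨h1, h2, h3, h4, h5, h6⟩ := baseConst_bounds (K := K) hab
  have h : baseConst a b K ≤ bigConst a b K := le_self_pow₀ (by linarith) (by norm_num)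
  have hL : 0 < b - a := by linarith
  exact ⟨h1.trans h, h, h2.trans h, h4.trans h, h5.trans (by gcongr), h6.trans h⟩

variable (D : Setting a b T α β K ε E₀ ω₀ ω₁ G₁ G₂ E F E')

include D

lemma Setting.K_nonneg : 0 ≤ K :=
  (norm_nonneg _).trans (D.bdA.E_bound 0 (left_mem_Icc.2 D.hT.le) a (left_mem_Icc.2 D.hab.le) 0
    (by norm_num))

lemma Setting.K_le : K ≤ baseConst a b K := by
  have := (baseConst_bounds (K := K) D.hab).2.1
  have := le_abs_self K
  have := abs_nonneg K
  linarith

lemma Setting.potentialBounds : PotentialBounds a b T (baseConst a b K) (ε ^ min α 1) ε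
    (potential a b T α β ε G₁ G₂) := by
  have h := Zakharov.potentialBounds D.hab D.hT D.hα D.hβ D.hε D.hε1 D.wave₁ D.wave₂ D.bdB.ω₀_bound
    D.bdB.ω₁_bound
  have hc : 4 * K * (1 + (b - a)) ≤ baseConst a b K := by
    have := (baseConst_bounds (K := K) D.hab).2.2.1
    rwa [abs_of_nonneg D.K_nonneg] at this
  have hκ : 0 < ε ^ min α 1 := Real.rpow_pos_of_pos D.hε _
  have hε := D.hε
  exact ⟨h.deriv, fun m hm t ht => (h.bd m hm t ht).mono (by gcongr), fun s hs t ht =>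
    (h.osc s hs t ht).mono (by gcongr), h.cont⟩

lemma Setting.schE : IsSchrodinger a b T (potential a b T α β ε G₁ G₂ 0) F E :=
  D.zs.isSchrodinger (γ := potential a b T α β ε G₁ G₂) D.hab D.hT potential_zero
    (D.potentialBounds.cont 0 (by norm_num))

lemma Setting.schE' : IsSchrodinger a b T (potential a b T α β ε G₁ G₂ 0) (fun _ _ => 0) E' :=
  D.nls.isSchrodinger (γ := potential a b T α β ε G₁ G₂) D.hab D.hT potential_zero
    (D.potentialBounds.cont 0 (by norm_num))

lemma Setting.bl_potential {m : ℕ} (hm : m ≤ 2) {t : ℝ} (ht : t ∈ Icc 0 T) :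
    BL a b (baseConst a b K) (fun x => potential a b T α β ε G₁ G₂ m x t) :=
  (D.potentialBounds.bd m hm t ht).mono (mul_le_of_le_one_right
    (by linarith [(baseConst_bounds (K := K) D.hab).1])
    (rpow_amplitude D.hε D.hε1 D.hα D.hβ).2.2.2)

/-- Bounds of the time derivatives without any smallness of their oscillation. -/
lemma Setting.osc_weak {X : ℝ → ℝ → ℂ} {Y : ℝ → ℝ → ℝ} (τ : ℝ)
    (hX : IsSchrodinger a b T (potential a b T α β ε G₁ G₂ 0) Y X) (hK : WNormLE a b T 5 0 X K)
    (hY : ∀ j ≤ 2, ∀ t ∈ Icc 0 T, BL a b (baseConst a b K) (fun x => pd a b T Y j 0 x t)) :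
    Osc a b T τ (baseConst a b K) 2 12 (pd a b T X 0 1) ∧
      Osc a b T τ (baseConst a b K) 2 12 (pd a b T X 2 1) := by
  have h4 := (baseConst_bounds (K := K) D.hab).1
  refine hX.osc_time (γ := potential a b T α β ε G₁ G₂) D.hab D.hT (fun j hj => ?_) (fun j hj => ?_)
    D.potentialBounds.deriv (fun j hj => ?_)
  · refine Osc.of_bl h4 (fun x hx => hX.smooth.continuousOn_pd_t D.hab D.hT (by omega) hx)
      fun t ht => ?_
    rw [pow_one]
    exact (hK.bl hX.smooth D.hab D.hT (by omega) (by omega) ht).mono D.K_le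
  · refine Osc.of_bl h4 (fun x hx => hX.smoothY.continuousOn_pd_t D.hab D.hT (by omega) hx)
      fun t ht => ?_
    rw [pow_one]
    exact hY j hj t ht
  · refine Osc.of_bl h4 (fun x hx => D.potentialBounds.cont_t hj hx) fun t ht => ?_
    rw [pow_one]
    exact D.bl_potential hj ht

lemma Setting.osc_weak_nls (τ : ℝ) :
    Osc a b T τ (bigConst a b K) 2 1 (pd a b T E' 0 1) ∧
      Osc a b T τ (bigConst a b K) 2 1 (pd a b T E' 2 1) := by
  have h4 := (baseConst_bounds (K := K) D.hab).1
  obtain ⟨h1, h2⟩ := D.osc_weak τ D.schE' D.bdA.E'_bound fun j _ t ht =>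
    BL.congr (by simpa using (Osc.zero (V := ℝ) (a := a) (b := b) (τ := τ) h4 le_rfl).bd t ht)
      fun x _ => pd_zero_fun (V := ℝ) j 0 x t
  have hb := (bigConst_bounds (K := K) D.hab).1
  exact ⟨h1.rebase le_rfl hb, h2.rebase le_rfl hb⟩

lemma Setting.bl_F {j n : ℕ} (hn : n ≤ 1) (hj : j ≤ 3) {t : ℝ} (ht : t ∈ Icc 0 T) :
    BL a b K (fun x => pd a b T F j n x t) := by
  have hK := D.K_nonneg
  have hε := D.hε
  interval_cases n
  · exact (D.bdA.F_bound.bl D.zs.smooth_F D.hab D.hT (by omega) (by omega) ht).mono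
      (mul_le_of_le_one_right hK (pow_le_one₀ hε.le D.hε1))
  · exact (D.bdA.Ft_bound.bl D.zs.smooth_F D.hab D.hT (by omega) (by omega) ht).mono
      (mul_le_of_le_one_right hK D.hε1)

lemma Setting.osc_weak_zs (τ : ℝ) :
    Osc a b T τ (bigConst a b K) 2 1 (pd a b T E 0 1) ∧
      Osc a b T τ (bigConst a b K) 2 1 (pd a b T E 2 1) := by
  obtain ⟨h1, h2⟩ := D.osc_weak τ D.schE D.bdA.E_bound fun j hj t ht =>
    (D.bl_F (by norm_num) (by omega) ht).mono D.K_le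
  have hb := (bigConst_bounds (K := K) D.hab).1
  exact ⟨h1.rebase le_rfl hb, h2.rebase le_rfl hb⟩

lemma Setting.osc_potential {θ : ℝ} (hθ : 0 ≤ θ) (h : 2 * ε ^ min α 1 ≤ θ) :
    Osc a b T τ (bigConst a b K) θ 1 (potential a b T α β ε G₁ G₂ 0) := by
  obtain ⟨h4, hb, -⟩ := bigConst_bounds (K := K) D.hab
  have h0 : 0 ≤ baseConst a b K := by linarith [(baseConst_bounds (K := K) D.hab).1]
  refine ⟨h4, hθ, fun x hx => D.potentialBounds.cont_t (by norm_num) hx, fun t ht => ?_,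
    fun s hs t ht _ => ?_⟩
  · rw [pow_one]; exact (D.bl_potential (by norm_num) ht).mono hb
  · refine ((D.potentialBounds.bd 0 (by norm_num) s hs).sub
      (D.potentialBounds.bd 0 (by norm_num) t ht)).mono ?_
    rw [pow_one, ← mul_add]
    have := Real.rpow_pos_of_pos D.hε (min α 1)
    gcongr
    linarith

lemma Setting.osc_potential_zs (hτ : 0 < τ) :
    Osc a b T τ (bigConst a b K) (2 * (τ / ε)) 1 (potential a b T α β ε G₁ G₂ 0) := by
  obtain ⟨h4, hb, -⟩ := bigConst_bounds (K := K) D.hab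
  have h0 : 0 ≤ baseConst a b K := by linarith [(baseConst_bounds (K := K) D.hab).1]
  have hε := D.hε
  refine ⟨h4, by positivity, fun x hx => D.potentialBounds.cont_t (by norm_num) hx, fun t ht => ?_,
    fun s hs t ht hst => ?_⟩
  · rw [pow_one]; exact (D.bl_potential (by norm_num) ht).mono hb
  · refine (D.potentialBounds.osc s hs t ht).mono ?_
    have h1 : |s - t| / ε ≤ 2 * (τ / ε) := by rw [← mul_div_assoc]; gcongr
    rw [pow_one]
    gcongr

lemma Setting.bl_ω₁ : BL a b (bigConst a b K) (fun x => ε ^ β * ω₁ x) := by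
  have hc : ContinuousOn ω₁ (Icc a b) :=
    ((D.wave₂.isSmoothOn 1).continuousOn_pd_x D.hab one_pos (m := 0) (n := 1) (by norm_num)
      (left_mem_Icc.2 zero_le_one)).congr fun x hx =>
        (D.wave₂.pd_zero_one_init one_pos hx).symm
  have h := D.bdB.ω₁_bound.bl (m := 0) (by norm_num) D.hab (by simpa using hc) (j := 0) le_rfl
  simp only [iteratedDerivWithin_zero] at h
  refine (h.const_smul (ε ^ β)).mono ?_
  rw [abs_of_pos (Real.rpow_pos_of_pos D.hε _)]
  exact (mul_le_of_le_one_left D.K_nonneg (Real.rpow_le_one D.hε.le D.hε1 D.hβ)).trans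
    (D.K_le.trans (bigConst_bounds D.hab).2.1)

lemma Setting.osc_nls_of_time {θ : ℝ} (hθ : 2 * τ ≤ θ) (hτ : 0 < τ)
    : Osc a b T τ (bigConst a b K) θ 1 E' := by
  obtain ⟨h4, hb, -⟩ := bigConst_bounds (K := K) D.hab
  refine Osc.of_hasDerivWithinAt (A := bigConst a b K) (f' := pd a b T E' 0 1) h4 (by linarith)
    (by rw [pow_one]; gcongr) (by linarith)
    (fun x hx s hs => D.schE'.smooth.hasDerivWithinAt_t D.hab D.hT (by norm_num) hx hs)
    (fun t ht => ?_) (fun t ht => by simpa using (D.osc_weak_nls τ).1.bd t ht)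
  have := (D.bdA.E'_bound.bl D.schE'.smooth D.hab D.hT (j := 0) (by omega) (by omega) ht).mono D.K_le
  simp only [pd_zero_zero] at this
  rw [pow_one]
  exact this.mono hb

lemma Setting.osc_strong (hτ : 0 < τ) (hS : 0 < α → α < 1 → SmoothEnough a b T K E') :
    Osc a b T τ (bigConst a b K) (2 * (τ + ε ^ min α 1)) 1 (pd a b T E' 0 1) ∧
      Osc a b T τ (bigConst a b K) (2 * (τ + ε ^ min α 1)) 1 (pd a b T E' 2 1) := by
  obtain ⟨w1, w2⟩ := D.osc_weak_nls τ
  have h4 := (bigConst_bounds (K := K) D.hab).1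
  have hKB := D.K_le.trans (bigConst_bounds (K := K) D.hab).2.1
  have hK := D.K_nonneg
  have hκ : 0 < ε ^ min α 1 := Real.rpow_pos_of_pos D.hε _
  have hθ : K * (2 * τ) ≤ bigConst a b K ^ 1 * (2 * (τ + ε ^ min α 1)) := by
    rw [pow_one]; gcongr; linarith
  rcases lt_or_ge α 1 with h1 | h1
  · rcases D.hα.eq_or_lt with h0 | h0
    · have e : ε ^ min α 1 = 1 := by rw [← h0]; simp
      rw [e]
      exact ⟨w1.mono_osc (by linarith), w2.mono_osc (by linarith)⟩
    · have hS := hS h0 h1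
      have hX := D.schE'
      have h4' := (baseConst_bounds (K := K) D.hab).1
      have q1 : 0 < 2 * (τ + ε ^ min α 1) := by positivity
      obtain ⟨o1, o2⟩ := hX.osc_time (γ := potential a b T α β ε G₁ G₂) (τ := τ)
        (B := baseConst a b K) (θ := 2 * (τ + ε ^ min α 1)) D.hab D.hT
        (fun j hj => by
          refine Osc.of_hasDerivWithinAt (A := K) (f' := pd a b T E' j 1) h4' q1.le ?_ hK
            (fun x hx s hs => hX.smooth.hasDerivWithinAt_pd_t D.hab D.hT (by omega) hx hs)
            (fun t ht => ?_) fun t ht => hS.bl hX.smooth D.hab D.hT (by omega) (by omega) ht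
          · rw [pow_one]
            have := D.K_le
            gcongr
            linarith
          · rw [pow_one]
            exact (D.bdA.E'_bound.bl hX.smooth D.hab D.hT (by omega) (by omega) ht).mono D.K_le)
        (fun j hj => (Osc.zero h4' q1.le).congr fun x _ t _ => pd_zero_fun _ _ _ _)
        D.potentialBounds.deriv (fun j hj => by
          refine ⟨h4', q1.le, fun x hx => D.potentialBounds.cont_t hj hx, fun t ht => ?_,
            fun s hs t ht _ => ?_⟩
          · rw [pow_one]; exact D.bl_potential hj ht
          · refine ((D.potentialBounds.bd j hj s hs).sub (D.potentialBounds.bd j hj t ht)).mono ?_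
            rw [pow_one, ← mul_add]
            gcongr
            linarith)
      exact ⟨o1.rebase le_rfl h4, o2.rebase le_rfl h4⟩
  · have e : ε ^ (1 - min α 1) = 1 := by rw [min_eq_right h1]; simp
    have key : ∀ j ≤ 2, Osc a b T τ (bigConst a b K) 2 1 (pd a b T E' j 1) →
        Osc a b T τ (bigConst a b K) (2 * (τ + ε ^ min α 1)) 1 (pd a b T E' j 1) := by
      intro j hj hw
      refine Osc.of_hasDerivWithinAt (A := K) (f' := pd a b T E' j 2) h4 (by positivity) hθ hK
        (fun x hx s hs => D.schE'.smooth.hasDerivWithinAt_pd_t D.hab D.hT (by omega) hx hs) hw.bd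
        fun t ht => ?_
      have := D.bdA.E'tt_bound.bl D.schE'.smooth D.hab D.hT (j := j) (by omega) (by omega) ht
      rwa [e, div_one] at this
    exact ⟨key 0 (by norm_num) w1, key 2 (by norm_num) w2⟩

/-- The solution of the NLSE-OP satisfies the scheme approximately. -/
lemma Setting.consistent_nls {θ : ℝ} (hτ : 0 < τ) (hτ1 : τ ≤ 1) (hM : 1 ≤ M) (hN : N * τ ≤ T)
    (hθ1 : 2 * (τ + ε ^ min α 1) ≤ θ) (hθ2 : θ ≤ 4)
    (o1 : Osc a b T τ (bigConst a b K) θ 1 (pd a b T E' 0 1))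
    (o2 : Osc a b T τ (bigConst a b K) θ 1 (pd a b T E' 2 1)) :
    SchemeConsistent a b α β ε E₀ ω₀ ω₁ (potential a b T α β ε G₁ G₂ 0) τ (bigConst a b K)
      (bigConst a b K ^ 17 * (mesh a b M ^ 2 + (τ + ε) * θ)) M N (grid a b M τ E') (fun _ _ => 0) := by
  obtain ⟨h4, hb, -, -, -, hL⟩ := bigConst_bounds (K := K) D.hab
  have hKB := D.K_le.trans (bigConst_bounds (K := K) D.hab).2.1
  have hK := D.K_nonneg
  have hε := D.hε
  have hκ : 0 < ε ^ min α 1 := Real.rpow_pos_of_pos D.hε _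
  have hεκ := (rpow_amplitude D.hε D.hε1 D.hα D.hβ).2.2.1
  have hX := D.schE'
  refine hX.consistent_zero (A := K / ε ^ (1 - min α 1)) (E₀ := E₀) (ω₀ := ω₀)
    (ω₁ := ω₁) (α := α) (β := β) D.hab D.hT hτ hM hN D.hε (D.osc_nls_of_time (by linarith) hτ) o1 o2
    (D.osc_potential (by linarith) (by linarith)) (fun t ht => ?_) (fun t ht => ?_)
    (fun x hx t ht => D.bdA.E'tt_bound t ht x hx 0 (by norm_num))
    (fun x hx t ht => D.bdA.E'tt_bound t ht x hx 2 (by norm_num)) ?_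
    D.nls.init (fun x hx => potential_init D.wave₁ D.wave₂ hx) D.bl_ω₁ hL
    (by linarith) (by linarith) hτ1 hθ2
  · exact (D.bdA.E'_bound.bl hX.smooth D.hab D.hT (by omega) (by omega) ht).mono hKB
  · exact (D.bdA.E'_bound.bl hX.smooth D.hab D.hT (by omega) (by omega) ht).mono hKB
  · have e : ε * (K / ε ^ (1 - min α 1)) = K * ε ^ min α 1 := by
      rw [Real.rpow_sub hε, Real.rpow_one]; field_simp
    rw [e]
    gcongr
    linarith

lemma Setting.consistent_zs (hτ : 0 < τ) (hτε : τ ≤ ε) (hM : 1 ≤ M) (hN : N * τ ≤ T) :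
    SchemeConsistent a b α β ε E₀ ω₀ ω₁ (potential a b T α β ε G₁ G₂ 0) τ (bigConst a b K)
      (bigConst a b K ^ 17 * (mesh a b M ^ 2 + τ ^ 2 / ε)) M N (grid a b M τ E) (grid a b M τ F) := by
  obtain ⟨h4, hb, -, -, -, hL⟩ := bigConst_bounds (K := K) D.hab
  set B := bigConst a b K with hB
  have hKB : K ≤ B := D.K_le.trans hb
  have hK := D.K_nonneg
  have hε := D.hε
  have hε1 := D.hε1
  have hX := D.schE
  have hE6 := hX.smooth
  have hF6 := hX.smoothY
  obtain ⟨w1, w2⟩ := D.osc_weak_zs τ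
  have hdiv : K ≤ K / ε := le_div_self hK hε hε1
  have bE : ∀ j ≤ 4, ∀ t ∈ Icc 0 T, BL a b B (fun x => pd a b T E j 0 x t) := fun j hj t ht =>
    (D.bdA.E_bound.bl hE6 D.hab D.hT (by omega) (by omega) ht).mono hKB
  have bEtt : ∀ j ≤ 2, ∀ t ∈ Icc 0 T, BL a b (K / ε) (fun x => pd a b T E j 2 x t) :=
    fun j hj t ht => D.bdA.Ett_bound.bl hE6 D.hab D.hT (by omega) (by omega) ht
  have hθ0 : 0 ≤ 2 * (τ / ε) := by positivity
  have hθ1 : K / ε * (2 * τ) ≤ B ^ 1 * (2 * (τ / ε)) := by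
    rw [pow_one]
    calc _ = K * (2 * (τ / ε)) := by field_simp
      _ ≤ _ := by gcongr
  have hθ2 : B * (2 * τ) ≤ B ^ 1 * (2 * (τ / ε)) := by
    rw [pow_one]; gcongr; exact le_div_self hτ.le hε hε1
  have hθ3 : K * (2 * τ) ≤ B ^ 1 * (2 * (τ / ε)) := by
    refine le_trans ?_ hθ2; gcongr
  have hB0 : 0 ≤ B := by linarith
  refine hX.consistent_wave (E₀ := E₀) (ω₀ := ω₀) (ω₁ := ω₁) (α := α) (β := β) D.hab
    D.hT hτ hM hN hε hε1 hτε ?_ ?_ ?_ ?_ ?_ (D.osc_potential_zs hτ) (fun t ht => ?_)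
    (fun x hx t ht => hX.wave_eq D.hab D.hT D.zs.eqn_F hx ht) (fun i hi x hx t ht => ?_)
    (fun x hx t ht => ⟨?_, ?_, ?_⟩) (fun t ht => ?_) (fun t ht => ?_) D.zs.init_E D.zs.init_F
    D.zs.init_Ft (fun x hx => potential_init D.wave₁ D.wave₂ hx)
    (fun x hx => potential_init_deriv D.hab D.hT hε D.wave₁ D.wave₂ hx) hL
  · refine Osc.of_hasDerivWithinAt (A := B) (f' := pd a b T E 0 1) h4 hθ0 hθ2 hB0
      (fun x hx s hs => hE6.hasDerivWithinAt_t D.hab D.hT (by norm_num) hx hs)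
      (fun t ht => ?_) fun t ht => by simpa using w1.bd t ht
    have := bE 0 (by norm_num) t ht
    simp only [pd_zero_zero] at this
    rwa [pow_one]
  · exact Osc.of_hasDerivWithinAt (A := K / ε) (f' := pd a b T E 0 2) h4 hθ0 hθ1 (by positivity)
      (fun x hx s hs => hE6.hasDerivWithinAt_pd_t D.hab D.hT (by norm_num) hx hs) w1.bd
      (bEtt 0 (by norm_num))
  · exact Osc.of_hasDerivWithinAt (A := K / ε) (f' := pd a b T E 2 2) h4 hθ0 hθ1 (by positivity)
      (fun x hx s hs => hE6.hasDerivWithinAt_pd_t D.hab D.hT (by norm_num) hx hs) w2.bd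
      (bEtt 2 (by norm_num))
  · refine Osc.of_hasDerivWithinAt (A := K) (f' := pd a b T F 0 1) h4 hθ0 hθ3 hK
      (fun x hx s hs => hF6.hasDerivWithinAt_t D.hab D.hT (by norm_num) hx hs)
      (fun t ht => ?_) fun t ht => D.bl_F (by norm_num) (by norm_num) ht
    have := (D.bl_F (j := 0) (n := 0) (by norm_num) (by norm_num) ht).mono hKB
    simp only [pd_zero_zero] at this
    rwa [pow_one]
  · refine Osc.of_hasDerivWithinAt (A := K) (f' := pd a b T F 0 2) h4 hθ0 hθ3 hK
      (fun x hx s hs => hF6.hasDerivWithinAt_pd_t D.hab D.hT (by norm_num) hx hs)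
      (fun t ht => ?_) fun t ht => D.bdA.Ftt_bound.bl hF6 D.hab D.hT (by omega) (by omega) ht
    rw [pow_one]
    exact (D.bl_F (by norm_num) (by norm_num) ht).mono hKB
  · exact bE 4 le_rfl t ht
  · interval_cases i
    · simp only [zero_tsub, pow_zero, div_one]
      exact ⟨(bE 0 (by norm_num) t ht).1 x hx, (bE 2 (by norm_num) t ht).1 x hx⟩
    · simp only [tsub_self, pow_zero, div_one]
      exact ⟨by simpa using (w1.bd t ht).1 x hx, by simpa using (w2.bd t ht).1 x hx⟩
    · simp only [Nat.add_one_sub_one, pow_one]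
      have : K / ε ≤ B / ε := by gcongr
      exact ⟨((bEtt 0 (by norm_num) t ht).1 x hx).trans this,
        ((bEtt 2 (by norm_num) t ht).1 x hx).trans this⟩
    · simp only [Nat.add_one_sub_one]
      have : K / ε ^ 2 ≤ B / ε ^ 2 := by gcongr
      exact ⟨(D.bdA.Ettt_bound t ht x hx 0 (by norm_num)).trans this,
        (D.bdA.Ettt_bound t ht x hx 2 (by norm_num)).trans this⟩
  · exact (D.bdA.Ftttt_bound t ht x hx 0 (by norm_num)).trans (by gcongr)
  · exact (D.bdA.F_bound t ht x hx 4 le_rfl).trans (by gcongr)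
  · exact (D.bdA.Ftt_bound t ht x hx 2 le_rfl).trans hKB
  · exact (D.bdA.Ettt_bound.bl hE6 D.hab D.hT (by omega) (by omega) ht).mono (by gcongr)
  · exact (D.bdA.Fttt_bound.bl hF6 D.hab D.hT (by omega) (by omega) ht).mono (by gcongr)

end Setting

section Sampling

variable {V : Type*} [NormedAddCommGroup V] [NormedSpace ℝ V] [CompleteSpace V] {a b : ℝ} {M : ℕ}

lemma sq_norm_sub_le_integral {c d : ℝ} (hcd : c < d) {f f' : ℝ → V}
    (hd : ∀ x ∈ Icc c d, HasDerivWithinAt f (f' x) (Icc c d) x) (hc : ContinuousOn f' (Icc c d)) :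
    ‖f d - f c‖ ^ 2 ≤ (d - c) * ∫ x in c..d, ‖f' x‖ ^ 2 := by
  have hu : uIcc c d = Icc c d := uIcc_of_le hcd.le
  have hI : ∫ x in c..d, f' x = f d - f c :=
    intervalIntegral.integral_eq_sub_of_hasDerivAt_of_le hcd.le
      (fun s hs => (hd s hs).continuousWithinAt)
      (fun s hs => (hd s (Ioo_subset_Icc_self hs)).hasDerivAt (Icc_mem_nhds hs.1 hs.2))
      (ContinuousOn.intervalIntegrable (by rwa [hu]))
  have i1 : IntervalIntegrable (fun x => ‖f' x‖) volume c d :=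
    ContinuousOn.intervalIntegrable (by rw [hu]; exact hc.norm)
  have i2 : IntervalIntegrable (fun x => ‖f' x‖ ^ 2) volume c d :=
    ContinuousOn.intervalIntegrable (by rw [hu]; exact hc.norm.pow 2)
  have h1 : ‖f d - f c‖ ≤ ∫ x in c..d, ‖f' x‖ := by
    rw [← hI]; exact intervalIntegral.norm_integral_le_integral_norm hcd.le
  set J := ∫ x in c..d, ‖f' x‖ with hJ
  have hL : 0 < d - c := by linarith
  have h2 : 0 ≤ ∫ x in c..d, (‖f' x‖ - J / (d - c)) ^ 2 :=
    intervalIntegral.integral_nonneg hcd.le fun _ _ => by positivity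
  have h3 : ∫ x in c..d, (‖f' x‖ - J / (d - c)) ^ 2
      = (∫ x in c..d, ‖f' x‖ ^ 2) - 2 * (J / (d - c)) * J + (d - c) * (J / (d - c)) ^ 2 := by
    have e : ∀ x, (‖f' x‖ - J / (d - c)) ^ 2
        = ‖f' x‖ ^ 2 - 2 * (J / (d - c)) * ‖f' x‖ + (J / (d - c)) ^ 2 := fun x => by ring
    simp only [e]
    rw [intervalIntegral.integral_add (i2.sub (i1.const_mul _)) (by simp),
      intervalIntegral.integral_sub i2 (i1.const_mul _), intervalIntegral.integral_const_mul,
      intervalIntegral.integral_const, ← hJ, smul_eq_mul]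
  rw [h3] at h2
  have h4 : ‖f d - f c‖ ^ 2 ≤ J ^ 2 := by gcongr
  have h5 : (d - c) * ((∫ x in c..d, ‖f' x‖ ^ 2) - 2 * (J / (d - c)) * J
      + (d - c) * (J / (d - c)) ^ 2) = (d - c) * (∫ x in c..d, ‖f' x‖ ^ 2) - J ^ 2 := by
    field_simp; ring
  have := mul_nonneg hL.le h2
  linarith

/-- The discrete `H¹` seminorm of the grid values is at most the continuous one. -/
lemma l2dx_node_le (hab : a < b) (hM : 1 ≤ M) {f f' : ℝ → V}
    (hd : ∀ x ∈ Icc a b, HasDerivWithinAt f (f' x) (Icc a b) x) (hc : ContinuousOn f' (Icc a b)) :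
    l2dx (mesh a b M) M (fun j => f (node a b M j)) ≤ √(∫ x in a..b, ‖f' x‖ ^ 2) := by
  have hh := mesh_pos hab hM
  refine Real.sqrt_le_sqrt ?_
  have hsub : ∀ {j}, j < M → Icc (node a b M j) (node a b M (j + 1)) ⊆ Icc a b := fun {j} hj =>
    Icc_subset_Icc (node_mem hab hM hj.le).1 (node_mem hab hM hj).2
  have hlt : ∀ j, node a b M j < node a b M (j + 1) := fun j => by rw [node_succ]; linarith
  have hsum := intervalIntegral.sum_integral_adjacent_intervals (a := node a b M) (n := M)
    (f := fun x => ‖f' x‖ ^ 2) (μ := volume) (fun j hj => ContinuousOn.intervalIntegrable (by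
      rw [uIcc_of_le (hlt j).le]; exact (hc.mono (hsub hj)).norm.pow 2))
  rw [node_zero, node_last hM] at hsum
  rw [← hsum, Finset.mul_sum]
  refine Finset.sum_le_sum fun j hj => ?_
  have hj := Finset.mem_range.1 hj
  have := sq_norm_sub_le_integral (hlt j) (fun x hx => (hd x (hsub hj hx)).mono (hsub hj))
    (hc.mono (hsub hj))
  rw [dxp, norm_smul, Real.norm_of_nonneg (by positivity), mul_pow, inv_pow]
  have e : node a b M (j + 1) - node a b M j = mesh a b M := by rw [node_succ]; ring
  rw [e] at this
  calc _ ≤ mesh a b M * ((mesh a b M ^ 2)⁻¹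
        * (mesh a b M * ∫ x in (node a b M j)..(node a b M (j + 1)), ‖f' x‖ ^ 2)) := by gcongr
    _ = _ := by field_simp

end Sampling

section Scheme

variable {a b T α β K ε τ : ℝ} {E₀ : ℝ → ℂ} {ω₀ ω₁ : ℝ → ℝ} {G₁ G₂ : ℝ → ℝ → ℝ}
    {E : ℝ → ℝ → ℂ} {F : ℝ → ℝ → ℝ} {E' : ℝ → ℝ → ℂ} {M N : ℕ} {U : ℕ → ℕ → ℂ} {P : ℕ → ℕ → ℝ}

lemma avgPotential_eq (k j : ℕ) : avgPotential a b ε (oscG α β ε G₁ G₂) M τ k j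
    = tmean τ (k * τ) (potential a b T α β ε G₁ G₂ 0 (node a b M j)) := by
  have e1 : ((k : ℝ) - 1) * τ = k * τ - τ := by ring
  have e2 : ((k : ℝ) + 1) * τ = k * τ + τ := by ring
  rw [avgPotential, tmean, smul_eq_mul, e1, e2]
  simp only [potential_zero]

lemma half_dx2_sum (h : ℝ) (P : ℕ → ℕ → ℝ) (k j : ℕ) :
    1 / 2 * dx2 h (fun i => P (k + 1) i + P (k - 1) i) j = dx2 h (avg P k) j := by
  simp only [dx2, avg, smul_eq_mul]; ring

lemma IsSchemeSolution.gridScheme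
    (hS : IsSchemeSolution a b T α β ε E₀ ω₀ ω₁ (oscG α β ε G₁ G₂) M τ U P) (hτ : 0 < τ)
    (hN : N * τ ≤ T) : GridScheme (mesh a b M) τ ε M N U P
      (fun k j => tmean τ (k * τ) (potential a b T α β ε G₁ G₂ 0 (node a b M j))) where
  bdry_U k _ := ⟨(hS.bdry k).1, (hS.bdry k).2.1⟩
  bdry_P k _ := (hS.bdry k).2.2
  eq_U l hl j hj := by
    have h := hS.step_E (l + 1) (by omega) (by
      have := (level_inner hτ hN hl).2; push_cast at this ⊢; linarith) j hj
    rw [avgPotential_eq (T := T)] at h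
    exact h
  eq_P l hl j hj := by
    have h := hS.step_F (l + 1) (by omega) (by
      have := (level_inner hτ hN hl).2; push_cast at this ⊢; linarith) j hj
    rw [half_dx2_sum] at h
    exact h

/-- The constant in the error estimates. -/
noncomputable def stab (a b T K : ℝ) : ℝ := stabilityConst T (25 * (2 * bigConst a b K ^ 2) ^ 8)

/-- A restriction on the mesh size. -/
noncomputable def meshBound (a b T K : ℝ) : ℝ := (4 * stab a b T K * bigConst a b K ^ 17)⁻¹

/-- A restriction on the time step. -/
noncomputable def stepBound (a b T K : ℝ) : ℝ :=
  min (32 * stab a b T K * bigConst a b K ^ 17)⁻¹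
    (4 * (312 * (25 * (2 * bigConst a b K ^ 2) ^ 8) ^ 9))⁻¹

lemma one_le_stab (hab : a < b) (hT : 0 < T) : 1 ≤ stab a b T K := by
  have h4 := (bigConst_bounds (K := K) hab).1
  refine one_le_stabilityConst hT.le ?_
  have h1 : (1 : ℝ) ≤ bigConst a b K ^ 2 := one_le_pow₀ (by linarith)
  have h2 : (1 : ℝ) ≤ (2 * bigConst a b K ^ 2) ^ 8 := one_le_pow₀ (by linarith)
  linarith

lemma bounds_pos (hab : a < b) (hT : 0 < T) : 0 < meshBound a b T K ∧ 0 < stepBound a b T K := by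
  have h4 : 0 < bigConst a b K := by linarith [(bigConst_bounds (K := K) hab).1]
  have h1 : 0 < stab a b T K := by linarith [one_le_stab (K := K) hab hT]
  exact ⟨by rw [meshBound]; positivity, lt_min (by positivity) (by positivity)⟩

lemma smallness {h : ℝ} (hab : a < b) (hT : 0 < T) (hh : 0 < h) (h1 : h ≤ meshBound a b T K)
    (hτ : 0 < τ) (h2 : τ ≤ stepBound a b T K) : τ ≤ 1 ∧
    4 * (312 * (25 * (2 * bigConst a b K ^ 2) ^ 8) ^ 9) * τ ≤ 1 ∧
    2 * stab a b T K * (bigConst a b K ^ 17 * (h ^ 2 + 8 * τ)) ≤ 1 := by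
  have h4 := (bigConst_bounds (K := K) hab).1
  have hS := one_le_stab (K := K) hab hT
  have hB17 : 1 ≤ bigConst a b K ^ 17 := one_le_pow₀ (by linarith)
  set Q := stab a b T K * bigConst a b K ^ 17 with hQ
  have hQ1 : 1 ≤ Q := one_le_mul_of_one_le_of_one_le hS hB17
  have k1 : h * (4 * Q) ≤ 1 := by
    rw [← le_div_iff₀ (by positivity), one_div]
    exact h1.trans_eq (by rw [meshBound, hQ, mul_assoc])
  have k2 : τ * (32 * Q) ≤ 1 := by
    rw [← le_div_iff₀ (by positivity), one_div]
    exact (h2.trans (min_le_left _ _)).trans_eq (by rw [hQ, mul_assoc])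
  have k3 : h ≤ 1 := by nlinarith
  refine ⟨by nlinarith, ?_, ?_⟩
  · rw [mul_comm, ← le_div_iff₀ (by positivity), one_div]
    exact h2.trans (min_le_right _ _)
  · have e : 2 * stab a b T K * (bigConst a b K ^ 17 * (h ^ 2 + 8 * τ))
        = 2 * (h ^ 2 * Q) + 16 * (τ * Q) := by rw [hQ]; ring
    have : h ^ 2 * Q ≤ h * Q := by gcongr; nlinarith
    rw [e]; nlinarith

variable (D : Setting a b T α β K ε E₀ ω₀ ω₁ G₁ G₂ E F E')

include D

lemma Setting.first_bdry (hM : 1 ≤ M) :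
    (firstE a b α β ε E₀ ω₀ ω₁ M τ 0 = 0 ∧ firstE a b α β ε E₀ ω₀ ω₁ M τ M = 0) ∧
      (firstF a b α ε E₀ ω₀ M τ 0 = 0 ∧ firstF a b α ε E₀ ω₀ M τ M = 0) :=
  D.schE.first_bdry D.hab D.hT D.zs.init_E D.zs.init_F
    (fun _ hx => potential_init D.wave₁ D.wave₂ hx) hM

lemma Setting.init_bdry (hM : 1 ≤ M) : E₀ (node a b M 0) = 0 ∧ E₀ (node a b M M) = 0 := by
  rw [node_zero, node_last hM, ← D.zs.init_E a (left_mem_Icc.2 D.hab.le),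
    ← D.zs.init_E b (right_mem_Icc.2 D.hab.le)]
  exact D.zs.bdry_E 0 (left_mem_Icc.2 D.hT.le)

lemma Setting.levels (hM : 1 ≤ M)
    (hS : IsSchemeSolution a b T α β ε E₀ ω₀ ω₁ (oscG α β ε G₁ G₂) M τ U P) :
    (∀ j ≤ M, U 0 j = E₀ (node a b M j) ∧ P 0 j = 0) ∧
      ∀ j ≤ M, U 1 j = firstE a b α β ε E₀ ω₀ ω₁ M τ j ∧ P 1 j = firstF a b α ε E₀ ω₀ M τ j := by
  refine ⟨hS.init, fun j hj => ?_⟩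
  obtain ⟨⟨f1, f2⟩, f3, f4⟩ := D.first_bdry (τ := τ) hM
  obtain ⟨b1, b2, b3, b4⟩ := hS.bdry 1
  rcases Nat.eq_zero_or_pos j with rfl | h0
  · rw [f1, f3, b1, b3]; exact ⟨rfl, rfl⟩
  rcases hj.lt_or_eq with h1 | rfl
  · have hj' : j ∈ Finset.Ico 1 M := Finset.mem_Ico.2 ⟨h0, h1⟩
    exact ⟨hS.first_E j hj', hS.first_F j hj'⟩
  · rw [f2, f4, b2, b4]; exact ⟨rfl, rfl⟩

lemma Setting.consistent_weak (hτ : 0 < τ) (hτ1 : τ ≤ 1) (hM : 1 ≤ M) (hN : N * τ ≤ T) :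
    SchemeConsistent a b α β ε E₀ ω₀ ω₁ (potential a b T α β ε G₁ G₂ 0) τ (bigConst a b K)
      (bigConst a b K ^ 17 * (mesh a b M ^ 2 + (τ + ε) * 4)) M N (grid a b M τ E') (fun _ _ => 0) := by
  obtain ⟨w1, w2⟩ := D.osc_weak_nls τ
  have h1 := (rpow_amplitude D.hε D.hε1 D.hα D.hβ).2.2.2
  exact D.consistent_nls hτ hτ1 hM hN (by linarith) le_rfl (w1.mono_osc (by norm_num))
    (w2.mono_osc (by norm_num))

lemma Setting.exists_consistent (hτ : 0 < τ) (hτ1 : τ ≤ 1) (hM : 1 ≤ M) (hN : N * τ ≤ T) :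
    ∃ δ X Y, 0 ≤ δ ∧ δ ≤ bigConst a b K ^ 17 * (mesh a b M ^ 2 + 8 * τ) ∧
      SchemeConsistent a b α β ε E₀ ω₀ ω₁ (potential a b T α β ε G₁ G₂ 0) τ (bigConst a b K) δ M N X Y := by
  have hB : 0 ≤ bigConst a b K := by linarith [(bigConst_bounds (K := K) D.hab).1]
  have hε := D.hε
  rcases le_total τ ε with h | h
  · refine ⟨_, _, _, by positivity, ?_, D.consistent_zs hτ h hM hN⟩
    have : τ ^ 2 / ε ≤ 8 * τ := by rw [div_le_iff₀ hε]; nlinarith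
    gcongr
  · refine ⟨_, _, _, by positivity, ?_, D.consistent_weak hτ hτ1 hM hN⟩
    have : (τ + ε) * 4 ≤ 8 * τ := by linarith
    gcongr

lemma Setting.totalError_le (hM : 1 ≤ M) (hτ : 0 < τ)
    (hS : IsSchemeSolution a b T α β ε E₀ ω₀ ω₁ (oscG α β ε G₁ G₂) M τ U P) {k : ℕ} {p q : ℝ}
    (hk : (k : ℝ) * τ ≤ T)
    (he : l2dx (mesh a b M) M (fun j => E (node a b M j) (k * τ) - U k j) ≤ p)
    (hf : l2 (mesh a b M) M (fun j => F (node a b M j) (k * τ) - P k j) ≤ q) :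
    totalError a b M τ E F U P k ≤ (1 + (b - a)) * p + q := by
  have ht : (k : ℝ) * τ ∈ Icc 0 T := ⟨by positivity, hk⟩
  have := l2_le_l2dx (mesh_pos D.hab hM) (mesh_mul hM)
    (fun j => E (node a b M j) (k * τ) - U k j) (by
      simp only [node_zero, (D.zs.bdry_E _ ht).1, (hS.bdry k).1, sub_zero])
  have hL : 0 < b - a := by linarith [D.hab]
  have h2 : (b - a) * l2dx (mesh a b M) M (fun j => E (node a b M j) (k * τ) - U k j)
      ≤ (b - a) * p := by gcongr
  rw [totalError]
  linarith

variable (hM : 1 ≤ M) (hh : mesh a b M ≤ meshBound a b T K) (hτ : 0 < τ)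
  (hτ0 : τ ≤ stepBound a b T K)

include hM hh hτ hτ0

lemma Setting.exists_solution : ∃ U P,
    IsSchemeSolution a b T α β ε E₀ ω₀ ω₁ (oscG α β ε G₁ G₂) M τ U P := by
  obtain ⟨hτ1, s1, s2⟩ := smallness D.hab D.hT (mesh_pos D.hab hM) hh hτ hτ0
  obtain ⟨h4, -, -, hL, hL', -⟩ := bigConst_bounds (K := K) D.hab
  have hT := D.hT
  set N := ⌊T / τ⌋₊ with hNdef
  have hN : N * τ ≤ T := by
    rw [← le_div_iff₀ hτ]; exact Nat.floor_le (by positivity)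
  obtain ⟨δ, X, Y, hδ0, hδ, r, s, η₁, η₂, hC⟩ := D.exists_consistent hτ hτ1 hM hN
  have hS := one_le_stab (K := K) D.hab D.hT
  obtain ⟨fE, fF⟩ := D.first_bdry (τ := τ) hM
  obtain ⟨U, P, hG, hu0, hp0, hu1, hp1, hb⟩ := hC.exists_gridScheme (mesh_pos D.hab hM) hτ D.hε hM
    (mesh_mul hM) (by linarith) hL hL' hδ0 hN (le_trans (by
      change 2 * stab a b T K * δ ≤ _
      gcongr) s2) s1 (D.init_bdry hM) fE ⟨rfl, rfl⟩ fF
  have level : ∀ k : ℕ, 1 ≤ k → ((k : ℝ) + 1) * τ ≤ T → ∃ l, k = l + 1 ∧ l + 2 ≤ N := by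
    intro k hk hkT
    refine ⟨k - 1, by omega, ?_⟩
    have : k + 1 ≤ N := Nat.le_floor (by rw [le_div_iff₀ hτ]; push_cast; exact hkT)
    omega
  refine ⟨U, P, ⟨fun k hk hkT j hj => ?_, fun k hk hkT j hj => ?_,
    fun k => ⟨(hb k).1.1, (hb k).1.2, (hb k).2.1, (hb k).2.2⟩, fun j _ => ?_, fun j _ => ?_,
    fun j _ => ?_⟩⟩
  · obtain ⟨l, rfl, hl⟩ := level k hk hkT
    rw [avgPotential_eq (T := T)]
    exact hG.eq_U l hl j hj
  · obtain ⟨l, rfl, hl⟩ := level k hk hkT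
    rw [half_dx2_sum]
    exact hG.eq_P l hl j hj
  · rw [hu0, hp0]; exact ⟨rfl, rfl⟩
  · rw [hu1]; rfl
  · rw [hp1]; rfl

variable (hS : IsSchemeSolution a b T α β ε E₀ ω₀ ω₁ (oscG α β ε G₁ G₂) M τ U P)

include hS

lemma Setting.error_of_consistent {N k : ℕ} (hN : N * τ ≤ T) (hk : k ≤ N) {δ : ℝ} (hδ : 0 ≤ δ)
    {X : ℕ → ℕ → ℂ} {Y : ℕ → ℕ → ℝ}
    (hC : SchemeConsistent a b α β ε E₀ ω₀ ω₁ (potential a b T α β ε G₁ G₂ 0) τ (bigConst a b K) δ M N X Y) :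
    l2dx (mesh a b M) M (fun j => X k j - U k j) ≤ stab a b T K * δ ∧
    l2 (mesh a b M) M (fun j => Y k j - P k j) ≤ 2 * stab a b T K * δ := by
  obtain ⟨r, s, η₁, η₂, hC⟩ := hC
  obtain ⟨hτ1, s1, s2⟩ := smallness D.hab D.hT (mesh_pos D.hab hM) hh hτ hτ0
  obtain ⟨h4, -, -, hL, hL', -⟩ := bigConst_bounds (K := K) D.hab
  have hst := one_le_stab (K := K) D.hab D.hT
  have hG := hS.gridScheme (N := N) hτ hN
  obtain ⟨l0, l1⟩ := D.levels hM hS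
  obtain ⟨δ', X', Y', hδ0', hδ', r', s', η₁', η₂', hC'⟩ := D.exists_consistent hτ hτ1 hM hN
  have hb := hC'.bounds hG le_rfl l0 (fun _ => l1) (mesh_pos D.hab hM) hτ D.hε hM
    (mesh_mul hM) (by linarith) hL hL' hδ0' hN (le_trans (by
      change 2 * stab a b T K * δ' ≤ _
      gcongr) s2) s1
  exact hC.error_le hG l0 (fun _ => l1) (fun k hk => (hb k hk).1) (mesh_pos D.hab hM) hτ D.hε hM
    (mesh_mul hM) (by linarith) hL hL' hδ hN s1 hk

lemma Setting.error_zs (hτε : τ ≤ ε) {k : ℕ} (hk : (k : ℝ) * τ ≤ T) :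
    totalError a b M τ E F U P k ≤ (3 + (b - a)) * (stab a b T K * bigConst a b K ^ 17)
      * (mesh a b M ^ 2 + τ ^ 2 / ε) := by
  have hC := D.consistent_zs (N := k) hτ hτε hM hk
  have hB : 0 ≤ bigConst a b K := by linarith [(bigConst_bounds (K := K) D.hab).1]
  have hε := D.hε
  obtain ⟨h1, h2⟩ := D.error_of_consistent hM hh hτ hτ0 hS hk le_rfl (by positivity) hC
  exact (D.totalError_le hM hτ hS hk h1 h2).trans_eq (by ring)

lemma Setting.error_nls {θ : ℝ} (hθ : 0 ≤ θ) {k : ℕ} (hk : (k : ℝ) * τ ≤ T)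
    (hC : SchemeConsistent a b α β ε E₀ ω₀ ω₁ (potential a b T α β ε G₁ G₂ 0) τ (bigConst a b K)
      (bigConst a b K ^ 17 * (mesh a b M ^ 2 + (τ + ε) * θ)) M k (grid a b M τ E') (fun _ _ => 0)) :
    totalError a b M τ E F U P k ≤ (3 + (b - a)) * (stab a b T K * bigConst a b K ^ 17)
      * (mesh a b M ^ 2 + (τ + ε) * θ + ε ^ 2) := by
  obtain ⟨h4, hb, h8, hL, -, hsL⟩ := bigConst_bounds (K := K) D.hab
  have hB : 0 ≤ bigConst a b K := by linarith
  have hε := D.hε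
  have hS1 := one_le_stab (K := K) D.hab D.hT
  have hab := D.hab
  have hh0 := mesh_pos D.hab hM
  have hL0 : 0 < b - a := by linarith
  have ht : (k : ℝ) * τ ∈ Icc 0 T := ⟨by positivity, hk⟩
  obtain ⟨h1, h2⟩ := D.error_of_consistent hM hh hτ hτ0 hS hk le_rfl (by positivity) hC
  have hsm : IsSmoothOn a b T 6 (fun y s => E y s - E' y s) := D.schE.smooth.sub D.schE'.smooth
  have k1 : l2dx (mesh a b M) M (fun j => E (node a b M j) (k * τ) - E' (node a b M j) (k * τ))
      ≤ K * ε ^ 2 := by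
    have hd := fun x hx => hsm.hasDerivWithinAt_pd_x D.hab D.hT (m := 0) (n := 0) (by norm_num)
      (x := x) hx ht
    simp only [pd_zero_zero] at hd
    refine (l2dx_node_le D.hab hM hd (hsm.continuousOn_pd_x D.hab D.hT (by norm_num) ht)).trans
      (le_trans (Real.sqrt_le_sqrt ?_) (D.bdC _ ht))
    have : 0 ≤ ∫ x in a..b, ‖E x (k * τ) - E' x (k * τ)‖ ^ 2 :=
      intervalIntegral.integral_nonneg D.hab.le fun _ _ => by positivity
    rw [zero_add]
    linarith
  have k2 : l2 (mesh a b M) M (fun j => F (node a b M j) (k * τ)) ≤ √(b - a) * (K * ε ^ 2) :=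
    l2_le_of_forall hh0 (mesh_mul hM) (mul_nonneg D.K_nonneg (by positivity)) fun j hj => by
      have := D.bdA.F_bound _ ht _ (node_mem D.hab hM (Finset.mem_Ico.1 hj).2.le) 0 (by norm_num)
      rwa [pd_zero_zero] at this
  have e1 := l2dx_add_le hh0 M
    (fun j => E (node a b M j) (k * τ) - E' (node a b M j) (k * τ))
    (fun j => grid a b M τ E' k j - U k j)
  have e2 := l2_add_le hh0 M (fun j => F (node a b M j) (k * τ)) (fun j => (0 : ℝ) - P k j)
  simp only [grid, sub_add_sub_cancel, zero_sub, ← sub_eq_add_neg] at e1 e2 h1 h2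
  set δ := bigConst a b K ^ 17 * (mesh a b M ^ 2 + (τ + ε) * θ) with hδ
  refine (D.totalError_le hM hτ hS hk (e1.trans (add_le_add k1 h1))
    (e2.trans (add_le_add k2 h2))).trans ?_
  have hKB : K ≤ bigConst a b K := D.K_le.trans hb
  have hB17 : bigConst a b K ^ 2 ≤ bigConst a b K ^ 17 :=
    pow_le_pow_right₀ (by linarith) (by norm_num)
  have hKB17 : K ≤ bigConst a b K ^ 17 := by nlinarith
  have q1 : √(b - a) * (K * ε ^ 2) ≤ bigConst a b K ^ 17 * ε ^ 2 := by
    rw [← mul_assoc]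
    gcongr
    calc _ ≤ bigConst a b K * bigConst a b K := by gcongr; exact D.K_nonneg
      _ = bigConst a b K ^ 2 := by ring
      _ ≤ _ := hB17
  have q2 : (1 + (b - a)) * (K * ε ^ 2) ≤ (1 + (b - a)) * (bigConst a b K ^ 17 * ε ^ 2) := by gcongr
  have q3 : bigConst a b K ^ 17 * ε ^ 2 ≤ stab a b T K * (bigConst a b K ^ 17 * ε ^ 2) :=
    le_mul_of_one_le_left (by positivity) hS1
  have q4 : (1 + (b - a)) * (bigConst a b K ^ 17 * ε ^ 2)
      ≤ (1 + (b - a)) * (stab a b T K * (bigConst a b K ^ 17 * ε ^ 2)) := by gcongr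
  have e3 : (3 + (b - a)) * (stab a b T K * bigConst a b K ^ 17)
      * (mesh a b M ^ 2 + (τ + ε) * θ + ε ^ 2)
      = (3 + (b - a)) * (stab a b T K * δ)
        + (3 + (b - a)) * (stab a b T K * (bigConst a b K ^ 17 * ε ^ 2)) := by rw [hδ]; ring
  have q5 : 0 ≤ stab a b T K * (bigConst a b K ^ 17 * ε ^ 2) := by positivity
  rw [e3]
  linarith

end Scheme

section Exponents

variable {τ ε c h Z : ℝ}

/-- Balancing the two error bounds. -/
lemma min_bound_le (hτ : 0 < τ) (hτ1 : τ ≤ 1) (hε : 0 < ε) (hc : 0 ≤ c) (hZ : 0 ≤ Z)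
    {e : ℝ} (h1 : e ≤ Z * (h ^ 2 + τ ^ 2 / ε))
    (h2 : e ≤ Z * (h ^ 2 + τ ^ 2 + τ * ε ^ c + ε ^ (1 + c))) :
    e ≤ 3 * Z * (h ^ 2 + τ ^ (1 + c / (2 + c))) := by
  have hc2 : 0 < 2 + c := by linarith
  set w := τ ^ (1 + c / (2 + c)) with hw
  have hw0 : 0 < w := Real.rpow_pos_of_pos hτ _
  have mono : ∀ x y : ℝ, y ≤ x → τ ^ x ≤ τ ^ y := fun x y hxy =>
    Real.rpow_le_rpow_of_exponent_ge hτ hτ1 hxy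
  have hh : 0 ≤ h ^ 2 := by positivity
  rcases le_total ε (τ ^ (2 / (2 + c))) with hle | hle
  · have a1 : τ ^ 2 ≤ w := by
      rw [← Real.rpow_natCast τ 2]
      refine mono _ _ ?_
      have : c / (2 + c) ≤ 1 := by rw [div_le_one hc2]; linarith
      push_cast; linarith
    have a2 : τ * ε ^ c ≤ w := by
      have : ε ^ c ≤ τ ^ (2 / (2 + c) * c) := by
        rw [Real.rpow_mul hτ.le]; exact Real.rpow_le_rpow hε.le hle hc
      calc τ * ε ^ c ≤ τ * τ ^ (2 / (2 + c) * c) := by gcongr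
        _ = τ ^ (1 + 2 / (2 + c) * c) := by rw [Real.rpow_add hτ, Real.rpow_one]
        _ ≤ w := mono _ _ (by
          have : c / (2 + c) ≤ 2 / (2 + c) * c := by
            rw [div_mul_eq_mul_div]; gcongr; linarith
          linarith)
    have a3 : ε ^ (1 + c) ≤ w := by
      calc ε ^ (1 + c) ≤ (τ ^ (2 / (2 + c))) ^ (1 + c) :=
            Real.rpow_le_rpow hε.le hle (by linarith)
        _ = w := by
          rw [← Real.rpow_mul hτ.le, hw]; congr 1; field_simp; ring
    refine h2.trans ?_
    calc _ ≤ Z * (3 * h ^ 2 + 3 * w) := mul_le_mul_of_nonneg_left (by linarith) hZ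
      _ = _ := by ring
  · have a1 : τ ^ 2 / ε ≤ w := by
      calc τ ^ 2 / ε ≤ τ ^ 2 / τ ^ (2 / (2 + c)) := by
            have := Real.rpow_pos_of_pos hτ (2 / (2 + c))
            gcongr
        _ = w := by
          rw [← Real.rpow_natCast τ 2, ← Real.rpow_sub hτ, hw]; congr 1
          push_cast; field_simp; ring
    refine h1.trans ?_
    calc _ ≤ Z * (3 * h ^ 2 + 3 * w) := mul_le_mul_of_nonneg_left (by linarith) hZ
      _ = _ := by ring

end Exponents

end Zakharov

theorem theorem2p1 (a b T α β K : ℝ) (hab : a < b) (hT : 0 < T) (hα : 0 ≤ α) (hβ : 0 ≤ β) :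
    ∃ h₀ > 0, ∃ τ₀ > 0, ∃ C : ℝ,
      ∀ (E₀ : ℝ → ℂ) (ω₀ ω₁ : ℝ → ℝ) (G₁ G₂ : ℝ → ℝ → ℝ) (ε : ℝ)
        (E : ℝ → ℝ → ℂ) (F : ℝ → ℝ → ℝ) (E' : ℝ → ℝ → ℂ),
        0 < ε → ε ≤ 1 →
        Zakharov.IsWaveSolution a b ω₀ (fun _ => 0) G₁ →
        Zakharov.IsWaveSolution a b (fun _ => 0) ω₁ G₂ →
        Zakharov.IsZSSolution a b T ε (Zakharov.oscG α β ε G₁ G₂) E₀ E F →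
        Zakharov.IsNLSEOPSolution a b T ε (Zakharov.oscG α β ε G₁ G₂) E₀ E' →
        Zakharov.AssumptionA a b T α ε K E F E' →
        Zakharov.AssumptionB a b K E₀ ω₀ ω₁ →
        Zakharov.AssumptionC a b T ε K E E' →
        ∀ (M : ℕ) (τ : ℝ), 1 ≤ M → Zakharov.mesh a b M ≤ h₀ → 0 < τ → τ ≤ τ₀ →
          (∃ (U : ℕ → ℕ → ℂ) (P : ℕ → ℕ → ℝ),
            Zakharov.IsSchemeSolution a b T α β ε E₀ ω₀ ω₁ (Zakharov.oscG α β ε G₁ G₂) M τ U P) ∧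
          ∀ (U : ℕ → ℕ → ℂ) (P : ℕ → ℕ → ℝ),
            Zakharov.IsSchemeSolution a b T α β ε E₀ ω₀ ω₁ (Zakharov.oscG α β ε G₁ G₂) M τ U P →
            ∀ k : ℕ, (k : ℝ) * τ ≤ T →
              Zakharov.totalError a b M τ E F U P k
                  ≤ C * (Zakharov.mesh a b M ^ 2 + τ ^ 2 / ε) ∧
              ((0 < α → α < 1 → Zakharov.SmoothEnough a b T K E') →
                Zakharov.totalError a b M τ E F U P k
                  ≤ C * (Zakharov.mesh a b M ^ 2 + τ ^ 2 + τ * ε ^ min α 1 + ε ^ (1 + min α 1)) ∧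
                (1 ≤ α → Zakharov.totalError a b M τ E F U P k
                  ≤ C * (Zakharov.mesh a b M ^ 2 + τ ^ (4 / 3 : ℝ))) ∧
                (α < 1 → Zakharov.totalError a b M τ E F U P k
                  ≤ C * (Zakharov.mesh a b M ^ 2 + τ ^ (1 + α / (2 + α))))) := by

  obtain ⟨p1, p2⟩ := Zakharov.bounds_pos (K := K) hab hT
  have h4 := (Zakharov.bigConst_bounds (K := K) hab).1
  have hst := Zakharov.one_le_stab (K := K) hab hT
  have hL : 0 < b - a := sub_pos.2 hab
  obtain ⟨Z, hZdef⟩ : ∃ Z, Z = (3 + (b - a))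
    * (Zakharov.stab a b T K * Zakharov.bigConst a b K ^ 17) := ⟨_, rfl⟩
  have hZ : 0 ≤ Z := by rw [hZdef]; positivity
  refine ⟨_, p1, _, p2, 27 * Z, ?_⟩
  intro E₀ ω₀ ω₁ G₁ G₂ ε E F E' hε hε1 hG₁ hG₂ hzs hnls hA hB hC M τ hM hh hτ hτ0
  have D : Zakharov.Setting a b T α β K ε E₀ ω₀ ω₁ G₁ G₂ E F E' :=
    ⟨hab, hT, hα, hβ, hε, hε1, hG₁, hG₂, hzs, hnls, hA, hB, hC⟩
  refine ⟨D.exists_solution hM hh hτ hτ0, fun U P hS k hk => ?_⟩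
  have hτ1 := (Zakharov.smallness hab hT (Zakharov.mesh_pos hab hM) hh hτ hτ0).1
  set κ := ε ^ min α 1 with hκ
  have hκ0 : 0 < κ := Real.rpow_pos_of_pos hε _
  have hm : 0 ≤ min α 1 := le_min hα zero_le_one
  have hκ1 : κ ≤ 1 := Real.rpow_le_one hε.le hε1 hm
  have hεκ : ε ≤ κ := by
    simpa using Real.rpow_le_rpow_of_exponent_ge hε hε1 (min_le_right α 1)
  have hκε : ε ^ (1 + min α 1) = ε * κ := by rw [Real.rpow_add hε, Real.rpow_one]
  have hh2 : 0 ≤ Zakharov.mesh a b M ^ 2 := by positivity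
  have h1 : Zakharov.totalError a b M τ E F U P k
      ≤ 9 * Z * (Zakharov.mesh a b M ^ 2 + τ ^ 2 / ε) := by
    have hq : 0 ≤ τ ^ 2 / ε := by positivity
    rcases le_total τ ε with h | h
    · refine (D.error_zs hM hh hτ hτ0 hS h hk).trans ?_
      rw [← hZdef, mul_comm 9 Z, mul_assoc Z 9]
      exact mul_le_mul_of_nonneg_left (by linarith) hZ
    · refine (D.error_nls hM hh hτ hτ0 hS (by norm_num) hk (D.consistent_weak hτ hτ1 hM hk)).trans
        ?_
      rw [← hZdef, mul_comm 9 Z, mul_assoc Z 9]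
      have : τ ≤ τ ^ 2 / ε := by rw [le_div_iff₀ hε]; nlinarith
      have : ε ^ 2 ≤ ε := by nlinarith
      exact mul_le_mul_of_nonneg_left (by linarith) hZ
  have weaken : ∀ {s : ℝ}, 0 ≤ s → 9 * Z * s ≤ 27 * Z * s := fun {s} hs => by
    linarith [mul_nonneg hZ hs]
  refine ⟨h1.trans (weaken (by positivity)), fun hSm => ?_⟩
  have h2 : Zakharov.totalError a b M τ E F U P k
      ≤ 9 * Z * (Zakharov.mesh a b M ^ 2 + τ ^ 2 + τ * κ + ε ^ (1 + min α 1)) := by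
    obtain ⟨o1, o2⟩ := D.osc_strong hτ hSm
    refine (D.error_nls hM hh hτ hτ0 hS (by positivity) hk
      (D.consistent_nls hτ hτ1 hM hk le_rfl (by linarith) o1 o2)).trans ?_
    rw [← hZdef, hκε, mul_comm 9 Z, mul_assoc Z 9]
    refine mul_le_mul_of_nonneg_left ?_ hZ
    have a1 : ε * ε ≤ ε * κ := by gcongr
    have a2 : ε * τ ≤ κ * τ := by gcongr
    have a3 : 0 < τ * κ := by positivity
    have a4 : 0 < ε * κ := by positivity
    nlinarith [sq_nonneg τ]
  have h3 := Zakharov.min_bound_le hτ hτ1 hε hm (by positivity) h1 h2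
  rw [show 3 * (9 * Z) = 27 * Z by ring] at h3
  refine ⟨h2.trans (weaken (by positivity)), fun h => ?_, fun h => ?_⟩
  · rw [min_eq_right h] at h3
    norm_num at h3 ⊢
    exact h3
  · rwa [min_eq_left h.le] at h3
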